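/- **Notation.** All operads and modules are indexed by arities $n\ge 1$. $\Sigma_n$ is the symmetric group, and operads $\mathcal P$ have right $\Sigma_n$-actions on $\mathcal P(n)$. A right module over an operad $\mathcal P$ is a collection $M=\{M(n)\}_{n\ge1}$ with right $\Sigma_n$-actions and structure maps $\nu: M(l)\times \mathcal P(m_1)\times\cdots\times \mathcal P(m_l)\to M(m_1+\cdots+m_l)$ satisfying May's operad axioms (associativity, unit, equivariance) with the first occurrence of $\mathcal P$ replaced by $M$; write $x\circ_i p=\nu(x;1,\dots,1,p,1,\dots,1)$ ($p$ in place $i$). For $\sigma\in\Sigma_l$, $\tau_i\in\Sigma_{m_i}$ let $\sigma(\tau_1,\dots,\tau_l)\in\Sigma_{m_1+\cdots+m_l}$ permute the blocks of sizes $m_1,\dots,m_l$ by $\sigma$, after permuting the $i$-th block by $\tau_i$. $\mathcal B(n)$ is the set of meaningful bracketings of the string $1\cdots n$ (brackets enclose at least two letters and not the whole string; two brackets are nested or disjoint). $\mathcal{BC}(n)$ is the set of cyclic bracketings: the letters $1,\dots,n$ stand on a circle in this cyclic order, brackets enclose arcs of at least two letters, a bracket around all $n$ letters is allowed and remembers the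 letter before which it opens, and brackets are pairwise nested or disjoint. Both are posets: $b'\preceq b''$ if $b''$ arises from $b'$ by removing brackets. With $c(I)=3^{\#I}$, $K_n\subset\mathbb R^{n-1}$ is the polytope given by $\sum_{k=1}^{n-1} t_k=3^{n-1}$ and $\sum_{k\in I}t_k\ge c(I)$ for all nonempty proper subintervals $I$ of $\{1,\dots,n-1\}$ ($K_1$ is a point), and $W_n\subset\mathbb R^{n}$ is the polytope given by $\sum_{k=1}^n t_k=3^{n}$ and $\sum_{k\in I}t_k\ge c(I)$ for all nonempty proper cyclic subintervals $I$ of $\{1,\dots,n\}$. A bracket around the letters $a,a+1,\dots,b$ (cyclically) corresponds to the interval $I=\{a,\dots,b-1\}$, and a bracketing indexes the closed set of points at which $\sum_{k\in I}t_k= c(I)$ for all its brackets. Put $\overline K_n=\Sigma_n\times K_n$ and $\overline{\mathcal B}(n)=\Sigma_n\times\mathcal B(n)$ (bracketings of strings of the letters in any order, the letter $i$ in position $\sigma(i)$). Put $\overline W_n=\Sigma_{n-1}\times W_n$ and $\overline{\mathcal{BC}}(n)=\Sigma_{n-1}\times\mathcal{BC}(n)$ (cyclic bracketings of the letters put on a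 circle in any cyclic order), where $\Sigma_{n-1}\subset\Sigma_n$ is the subgroup fixing $1$, which represents the cosets $\mathbb Z_n\backslash\Sigma_n$. $\overline{\mathcal B}$ is an operad and $\overline{\mathcal{BC}}$ a right $\overline{\mathcal B}$-module by insertion of bracketed strings in place of letters, where every inserted string of at least two letters is itself put in brackets (in $\overline{\mathcal B}$ a bracket around the whole string is dropped); $\Sigma_n$ acts by relabelling. Over a field $\mathbf k$, $Ass(n)=\mathbf k[\Sigma_n]$ is the operad with $\gamma(\sigma;\tau_1,\dots,\tau_l)=\sigma(\tau_1,\dots,\tau_l)$ and right multiplication as action, and $Cycl(n)=\mathbf k[\Sigma_{n-1}]=\mathbf k[\mathbb Z_n\backslash\Sigma_n]$ is the right $Ass$-module with $\nu(\pi(\sigma);\tau_1,\dots,\tau_l)=\pi(\sigma(\tau_1,\dots,\tau_l))$, where $\pi$ is the projection on cosets. A *cellular operad structure* on $\overline K$ is a topological operad structure with action $(\sigma,x)\tau=(\sigma\tau,x)$ such that the structure maps send each product of closed cells homeomorphically onto the closed cell indexed by the composite in $\overline{\mathcal B}$. **Theorem.** 1. For every $n\ge1$, $\overline K_n$ and $\overline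 W_n$, with the cells above, are regular cell complexes with face posets $\overline{\mathcal B}(n)$ and $\overline{\mathcal{BC}}(n)$; a bracketing with $r$ brackets indexes a cell of dimension $n-2-r$ in $\overline K_n$ ($n\ge 2$; $\overline K_1$ is a point), and of dimension $n-1-r$ in $\overline W_n$. 2. The collection $\overline K$ has a cellular operad structure. For every such structure, the collection $\overline W=\{\overline W_n\}_{n\ge1}$ carries a structure of a topological right $\overline K$-module that is cellular and induces on face posets the $\overline{\mathcal B}$-module structure of $\overline{\mathcal{BC}}$: the structure maps send each product of closed cells homeomorphically onto the closed cell indexed by the composite in $\overline{\mathcal{BC}}$, and the action of $\tau\in\Sigma_n$ sends each closed cell homeomorphically onto the one indexed by its image under $\tau$. For $n\ge2$ and $1\le i\le m$, $\circ_i$ identifies $W_m\times K_n$ (in the components of the identities) with the codimension-one face of $W_{m+n-1}$ indexed by the single bracket around $i,\dots,i+n-1$. 3. For every field $\mathbf k$, the homology of $\overline K_n$ and $\overline W_n$ with coefficients in $\mathbf k$ vanishes in nonzero degrees, and the maps that send the class of a point to the index of its component are an isomorphism of operads $H_*(\overline K)\cong Ass$ and, over it, an isomorphism of right modules $H_*(\overline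 W)\cong Cycl$. -/

import Mathlib

open Set Topology

universe u

namespace CycloMod

/-! ### Blocks and block permutations

Arities are positive, hence are elements of `ℕ+`; positions are counted from `0`. -/

/-- The decomposition of `n = m₀ + ⋯ + m_{l-1}` positions into `l` consecutive blocks. -/
def blockEquiv {l : ℕ} {n : ℕ+} (m : Fin l → ℕ+) (h : ∑ i, (m i : ℕ) = n) :
    (Σ i, Fin (m i)) ≃ Fin n :=
  finSigmaFinEquiv.trans (finCongr h)

theorem sum_symm {l : ℕ} {n : ℕ+} {m : Fin l → ℕ+} (h : ∑ i, (m i : ℕ) = n)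
    (σ : Equiv.Perm (Fin l)) : ∑ i, (m (σ.symm i) : ℕ) = n := by
  rw [← h]
  exact Equiv.sum_comp σ.symm (fun i => (m i : ℕ))

/-- The permutation `σ(τ₀, …, τ_{l-1}) = σ(m₀, …, m_{l-1}) · (τ₀ ⊕ ⋯ ⊕ τ_{l-1})`: the `a`-th
element of the `i`-th block is sent to the `τ i a`-th element of the block in position `σ i`. -/
def blockPerm {l : ℕ} {n : ℕ+} (m : Fin l → ℕ+) (h : ∑ i, (m i : ℕ) = n)
    (σ : Equiv.Perm (Fin l)) (τ : ∀ i, Equiv.Perm (Fin (m i))) : Equiv.Perm (Fin n) :=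
  ((blockEquiv m h).symm.trans
    (Equiv.sigmaCongr (β₂ := fun p => Fin (m (σ.symm p))) σ
      (fun i => (τ i).trans (finCongr (by rw [Equiv.symm_apply_apply]))))).trans
    (blockEquiv (fun p => m (σ.symm p)) (sum_symm h σ))

/-! ### Operads and right modules in topological spaces -/

/-- A symmetric operad in topological spaces, in the sense of May, without arity zero. The right
action of the symmetric group is `act`: `act σ x` is `x · σ`. -/
structure TopOperad (P : ℕ+ → Type) [∀ n, TopologicalSpace (P n)] where
  one : P 1
  act : ∀ {n : ℕ+}, Equiv.Perm (Fin n) → C(P n, P n)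
  comp : ∀ {l n : ℕ+} (m : Fin l → ℕ+) (_ : ∑ i, (m i : ℕ) = n), C(P l × (∀ i, P (m i)), P n)
  act_one : ∀ {n : ℕ+} (x : P n), act 1 x = x
  act_mul : ∀ {n : ℕ+} (σ τ : Equiv.Perm (Fin n)) (x : P n), act (σ * τ) x = act τ (act σ x)
  one_comp : ∀ {n : ℕ+} (h : ∑ _i : Fin (1 : ℕ+), (n : ℕ) = n) (x : P n),
    comp (fun _ => n) h (one, fun _ => x) = x
  comp_one : ∀ {l : ℕ+} (h : ∑ _i : Fin l, ((1 : ℕ+) : ℕ) = l) (x : P l),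
    comp (fun _ => 1) h (x, fun _ => one) = x
  assoc : ∀ {l n N : ℕ+} (m : Fin l → ℕ+) (h : ∑ i, (m i : ℕ) = n)
    (k : ∀ i, Fin (m i) → ℕ+) (q : Fin l → ℕ+) (hq : ∀ i, ∑ j, (k i j : ℕ) = q i)
    (hN : ∑ i, (q i : ℕ) = N)
    (hN' : ∑ s, (k ((blockEquiv m h).symm s).1 ((blockEquiv m h).symm s).2 : ℕ) = N)
    (x : P l) (y : ∀ i, P (m i)) (z : ∀ i j, P (k i j)),
    comp (fun s => k ((blockEquiv m h).symm s).1 ((blockEquiv m h).symm s).2) hN'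
        (comp m h (x, y), fun s => z ((blockEquiv m h).symm s).1 ((blockEquiv m h).symm s).2) =
      comp q hN (x, fun i => comp (k i) (hq i) (y i, z i))
  act_comp : ∀ {l n : ℕ+} (m : Fin l → ℕ+) (h : ∑ i, (m i : ℕ) = n)
    (σ : Equiv.Perm (Fin l)) (x : P l) (y : ∀ i, P (m i)),
    comp m h (act σ x, y) =
      act (blockPerm m h σ (fun _ => 1))
        (comp (fun p => m (σ.symm p)) (sum_symm h σ) (x, fun p => y (σ.symm p)))
  comp_act : ∀ {l n : ℕ+} (m : Fin l → ℕ+) (h : ∑ i, (m i : ℕ) = n)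
    (τ : ∀ i, Equiv.Perm (Fin (m i))) (x : P l) (y : ∀ i, P (m i)),
    comp m h (x, fun i => act (τ i) (y i)) = act (blockPerm m h 1 τ) (comp m h (x, y))

/-- A right module over a topological operad: the axioms are those of an operad with the first
occurrence of `P` replaced by `M`. -/
structure TopModule {P : ℕ+ → Type} [∀ n, TopologicalSpace (P n)] (O : TopOperad P)
    (M : ℕ+ → Type) [∀ n, TopologicalSpace (M n)] where
  act : ∀ {n : ℕ+}, Equiv.Perm (Fin n) → C(M n, M n)
  comp : ∀ {l n : ℕ+} (m : Fin l → ℕ+) (_ : ∑ i, (m i : ℕ) = n), C(M l × (∀ i, P (m i)), M n)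
  act_one : ∀ {n : ℕ+} (x : M n), act 1 x = x
  act_mul : ∀ {n : ℕ+} (σ τ : Equiv.Perm (Fin n)) (x : M n), act (σ * τ) x = act τ (act σ x)
  comp_one : ∀ {l : ℕ+} (h : ∑ _i : Fin l, ((1 : ℕ+) : ℕ) = l) (x : M l),
    comp (fun _ => 1) h (x, fun _ => O.one) = x
  assoc : ∀ {l n N : ℕ+} (m : Fin l → ℕ+) (h : ∑ i, (m i : ℕ) = n)
    (k : ∀ i, Fin (m i) → ℕ+) (q : Fin l → ℕ+) (hq : ∀ i, ∑ j, (k i j : ℕ) = q i)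
    (hN : ∑ i, (q i : ℕ) = N)
    (hN' : ∑ s, (k ((blockEquiv m h).symm s).1 ((blockEquiv m h).symm s).2 : ℕ) = N)
    (x : M l) (y : ∀ i, P (m i)) (z : ∀ i j, P (k i j)),
    comp (fun s => k ((blockEquiv m h).symm s).1 ((blockEquiv m h).symm s).2) hN'
        (comp m h (x, y), fun s => z ((blockEquiv m h).symm s).1 ((blockEquiv m h).symm s).2) =
      comp q hN (x, fun i => O.comp (k i) (hq i) (y i, z i))
  act_comp : ∀ {l n : ℕ+} (m : Fin l → ℕ+) (h : ∑ i, (m i : ℕ) = n)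
    (σ : Equiv.Perm (Fin l)) (x : M l) (y : ∀ i, P (m i)),
    comp m h (act σ x, y) =
      act (blockPerm m h σ (fun _ => 1))
        (comp (fun p => m (σ.symm p)) (sum_symm h σ) (x, fun p => y (σ.symm p)))
  comp_act : ∀ {l n : ℕ+} (m : Fin l → ℕ+) (h : ∑ i, (m i : ℕ) = n)
    (τ : ∀ i, Equiv.Perm (Fin (m i))) (x : M l) (y : ∀ i, P (m i)),
    comp m h (x, fun i => O.act (τ i) (y i)) = act (blockPerm m h 1 τ) (comp m h (x, y))

/-! ### Brackets

A pair `(a, b)` of positions stands for a pair of brackets, opened before `a` and closed after `b`.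
On the circle of `n` positions it encloses `a, a + 1, …, b`, read cyclically. Gap `g` is the place
between the positions `g` and `g + 1` (modulo `n`). -/

/-- The positions `a, a + 1, …, b` (modulo `n`) enclosed by the bracket `(a, b)`. -/
def elts {n : ℕ+} (p : Fin n × Fin n) : Finset (Fin n) :=
  Finset.univ.filter fun x => x - p.1 ≤ p.2 - p.1

/-- The gaps `a, a + 1, …, b - 1` (modulo `n`) interior to the bracket `(a, b)`. -/
def gaps {n : ℕ+} (p : Fin n × Fin n) : Finset (Fin n) :=
  Finset.univ.filter fun x => x - p.1 < p.2 - p.1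

/-- Two brackets may occur together: one is inside the other, or they enclose disjoint sets. -/
def Compatible {n : ℕ+} (p q : Fin n × Fin n) : Prop :=
  gaps p ⊆ gaps q ∨ gaps q ⊆ gaps p ∨ Disjoint (elts p) (elts q)

/-- `𝓑(n)`: meaningful bracketings of a string of `n` letters. Brackets enclose at least two
letters, and not the whole string. -/
def Bracketing (n : ℕ+) : Type :=
  {β : Finset (Fin n × Fin n) //
    (∀ p ∈ β, p.1 < p.2 ∧ (p.2 : ℕ) - p.1 + 1 < n) ∧ ∀ p ∈ β, ∀ q ∈ β, Compatible p q}

/-- `𝓑𝓒(n)`: cyclic bracketings of `n` letters on a circle, in their natural cyclic order. Brackets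
enclose at least two letters. A bracket around all letters is allowed, and it remembers the letter
before which it is opened. -/
def CycBracketing (n : ℕ+) : Type :=
  {β : Finset (Fin n × Fin n) //
    (∀ p ∈ β, p.1 ≠ p.2) ∧ ∀ p ∈ β, ∀ q ∈ β, Compatible p q}

/-- `b' ≤ b''` if `b''` is obtained from `b'` by removing brackets. -/
instance (n : ℕ+) : PartialOrder (Bracketing n) where
  le b c := c.1 ⊆ b.1
  le_refl b := Finset.Subset.refl b.1
  le_trans _ _ _ h h' := Finset.Subset.trans h' h
  le_antisymm _ _ h h' := Subtype.ext (Finset.Subset.antisymm h' h)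

/-- `b' ≤ b''` if `b''` is obtained from `b'` by removing brackets. -/
instance (n : ℕ+) : PartialOrder (CycBracketing n) where
  le b c := c.1 ⊆ b.1
  le_refl b := Finset.Subset.refl b.1
  le_trans _ _ _ h h' := Finset.Subset.trans h' h
  le_antisymm _ _ h h' := Subtype.ext (Finset.Subset.antisymm h' h)

/-! ### The convex polytopes -/

/-- The polytope `K_n ⊆ ℝ^{n-1}`. A proper subinterval of the `n - 1` gaps is `{a, …, b - 1}` for
a bracket `(a, b)`. For `n = 1` it is the single point of `ℝ⁰`. -/
def polyK (n : ℕ+) : Set (Fin ((n : ℕ) - 1) → ℝ) :=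
  {t | (1 < n → ∑ k, t k = 3 ^ ((n : ℕ) - 1)) ∧
    ∀ p : Fin n × Fin n, p.1 < p.2 → (p.2 : ℕ) - p.1 + 1 < n →
      3 ^ ((p.2 : ℕ) - p.1) ≤
        ∑ k ∈ Finset.univ.filter (fun k : Fin ((n : ℕ) - 1) => (p.1 : ℕ) ≤ k ∧ (k : ℕ) < p.2), t k}

/-- The polytope `W_n ⊆ ℝⁿ`. The proper cyclic subintervals of the `n` gaps are the sets `gaps p`
for brackets `p`. -/
def polyW (n : ℕ+) : Set (Fin n → ℝ) :=
  {t | ∑ k, t k = 3 ^ (n : ℕ) ∧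
    ∀ p : Fin n × Fin n, p.1 ≠ p.2 → 3 ^ (gaps p).card ≤ ∑ k ∈ gaps p, t k}

/-- The face of `K_n` indexed by a bracketing. -/
def faceK {n : ℕ+} (b : Bracketing n) : Set (polyK n) :=
  {t | ∀ p ∈ b.1,
    ∑ k ∈ Finset.univ.filter (fun k : Fin ((n : ℕ) - 1) => (p.1 : ℕ) ≤ k ∧ (k : ℕ) < p.2), t.1 k =
      3 ^ ((p.2 : ℕ) - p.1)}

/-- The face of `W_n` indexed by a cyclic bracketing. -/
def faceW {n : ℕ+} (b : CycBracketing n) : Set (polyW n) :=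
  {t | ∀ p ∈ b.1, ∑ k ∈ gaps p, t.1 k = 3 ^ (gaps p).card}

/-! ### Symmetrizations -/

/-- `Σ_{n-1}`, as the permutations in `Σ_n` that leave the first letter fixed. -/
abbrev PermFix (n : ℕ+) : Type := {σ : Equiv.Perm (Fin n) // σ 0 = 0}

/-- The symmetrized associahedron, the disjoint union of `n!` copies of `K_n`. The copy of index `σ`
belongs to the string in which the letter `i` is in position `σ i`. -/
abbrev KBar (n : ℕ+) : Type := Σ _σ : Equiv.Perm (Fin n), polyK n

/-- The symmetrized cyclohedron, the disjoint union of `(n-1)!` copies of `W_n`. -/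
abbrev WBar (n : ℕ+) : Type := Σ _σ : PermFix n, polyW n

/-- Bracketings of strings that consist of `n` letters in any order. (The order of a sigma type is
that of a disjoint union.) -/
abbrev BBar (n : ℕ+) : Type := Σ _σ : Equiv.Perm (Fin n), Bracketing n

/-- Bracketings of `n` letters put on a circle in any cyclic order. -/
abbrev BCBar (n : ℕ+) : Type := Σ _σ : PermFix n, CycBracketing n

def cellK {n : ℕ+} (b : BBar n) : Set (KBar n) := {x | ∃ t ∈ faceK b.2, x = ⟨b.1, t⟩}

def cellW {n : ℕ+} (b : BCBar n) : Set (WBar n) := {x | ∃ t ∈ faceW b.2, x = ⟨b.1, t⟩}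

def dimK {n : ℕ+} (b : BBar n) : ℕ := (n : ℕ) - 2 - b.2.1.card

def dimW {n : ℕ+} (b : BCBar n) : ℕ := (n : ℕ) - 1 - b.2.1.card

/-- `X` is a regular CW complex whose closed cells are the sets `cell p`, `p : P`, of dimension
`dim p`, and its poset of closed cells is `P`. -/
structure IsRegularCellComplex {X P : Type} [TopologicalSpace X] [PartialOrder P]
    (dim : P → ℕ) (cell : P → Set X) : Prop where
  exists_cw : ∃ (cw : CWComplex (univ : Set X)) (e : ∀ d, cw.cell d ≃ {p : P // dim p = d}),
    ∀ d c, cw.map d c '' Metric.closedBall 0 1 = cell (e d c).1 ∧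
      InjOn (cw.map d c) (Metric.closedBall 0 1)
  le_iff : ∀ p q : P, p ≤ q ↔ cell p ⊆ cell q

/-! ### Composition of bracketings -/

theorem fin_sub_val {n : ℕ} (a b : Fin n) :
    ((a - b : Fin n) : ℕ) = if b ≤ a then (a : ℕ) - b else n + a - b := by
  have ha := a.2
  have hb := b.2
  rw [Fin.sub_def]
  simp only [Fin.le_def]
  split_ifs with h
  · rw [show n - (b : ℕ) + a = (a - b) + n by omega, Nat.add_mod_right, Nat.mod_eq_of_lt (by omega)]
  · rw [Nat.mod_eq_of_lt (by omega)]
    omega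

theorem mem_elts_iff {n : ℕ+} {p : Fin n × Fin n} {x : Fin n} :
    x ∈ elts p ↔ (p.1 ≤ p.2 ∧ p.1 ≤ x ∧ x ≤ p.2) ∨ (p.2 < p.1 ∧ (p.1 ≤ x ∨ x ≤ p.2)) := by
  have h1 := p.1.2
  have h2 := p.2.2
  have h3 := x.2
  simp only [elts, Finset.mem_filter, Finset.mem_univ, true_and]
  rw [Fin.le_def, fin_sub_val, fin_sub_val]
  simp only [Fin.le_def, Fin.lt_def]
  split_ifs <;> omega

theorem mem_gaps_iff {n : ℕ+} {p : Fin n × Fin n} {x : Fin n} :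
    x ∈ gaps p ↔ (p.1 ≤ p.2 ∧ p.1 ≤ x ∧ x < p.2) ∨ (p.2 < p.1 ∧ (p.1 ≤ x ∨ x < p.2)) := by
  have h1 := p.1.2
  have h2 := p.2.2
  have h3 := x.2
  simp only [gaps, Finset.mem_filter, Finset.mem_univ, true_and]
  rw [Fin.lt_def, fin_sub_val, fin_sub_val]
  simp only [Fin.le_def, Fin.lt_def]
  split_ifs <;> omega

theorem Compatible.symm {n : ℕ+} {p q : Fin n × Fin n} (h : Compatible p q) : Compatible q p := by
  rcases h with h | h | h
  · exact Or.inr (Or.inl h)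
  · exact Or.inl h
  · exact Or.inr (Or.inr h.symm)

section

variable {l n : ℕ+} (m : Fin l → ℕ+) (h : ∑ i, (m i : ℕ) = n)

theorem blockEquiv_lt_of_lt {x y : Σ i, Fin (m i)} (hxy : x.1 < y.1) :
    blockEquiv m h x < blockEquiv m h y := by
  have key : ∑ k : Fin x.1, (m (Fin.castLE x.1.2.le k) : ℕ) + m x.1 ≤
      ∑ k : Fin y.1, (m (Fin.castLE y.1.2.le k) : ℕ) := by
    have e : ∀ j : Fin l, ∑ k : Fin j, (m (Fin.castLE j.2.le k) : ℕ) =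
        ∑ k ∈ Finset.univ.filter (fun k : Fin l => k < j), (m k : ℕ) := by
      intro j
      refine Finset.sum_bij (fun k _ => Fin.castLE j.2.le k) ?_ ?_ ?_ ?_
      · intro k _
        exact Finset.mem_filter.2 ⟨Finset.mem_univ _, k.2⟩
      · intro a _ b _ hab
        simpa [Fin.ext_iff] using hab
      · intro b hb
        simp only [Finset.mem_filter, Finset.mem_univ, true_and] at hb
        exact ⟨⟨b, hb⟩, Finset.mem_univ _, by ext; simp⟩
      · intro k _
        rfl
    rw [e, e]
    have hnot : x.1 ∉ Finset.univ.filter (fun k : Fin l => k < x.1) := by simp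
    rw [add_comm, ← Finset.sum_insert (f := fun k => (m k : ℕ)) hnot]
    refine Finset.sum_le_sum_of_subset ?_
    intro k hk
    simp only [Finset.mem_insert, Finset.mem_filter, Finset.mem_univ, true_and] at hk ⊢
    rcases hk with rfl | hk
    · exact hxy
    · exact hk.trans hxy
  have hx := x.2.2
  simp only [blockEquiv, Equiv.trans_apply, finCongr_apply, Fin.lt_def, Fin.val_cast,
    finSigmaFinEquiv_apply]
  omega

theorem blockEquiv_lt_iff_snd {i : Fin l} {a b : Fin (m i)} :
    blockEquiv m h ⟨i, a⟩ < blockEquiv m h ⟨i, b⟩ ↔ a < b := by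
  simp only [blockEquiv, Equiv.trans_apply, finCongr_apply, Fin.lt_def, Fin.val_cast,
    finSigmaFinEquiv_apply]
  omega

/-- The first position of a block. -/
def blockFirst (i : Fin l) : Fin n := blockEquiv m h ⟨i, 0⟩

/-- The last position of a block. -/
def blockLast (i : Fin l) : Fin n := blockEquiv m h ⟨i, ⊤⟩

/-- The brackets of a string of `n` letters, together with the bracket around the whole string if
it has at least two letters. -/
def Bracketing.withOuter {n : ℕ+} (b : Bracketing n) : Finset (Fin n × Fin n) :=
  if 1 < n then insert (0, ⊤) b.1 else b.1

/-- Insertion of strings with bracketings `c i` in place of the letters of a string or a circle with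
the set of brackets `β`; each inserted string of at least two letters is put in brackets. -/
def insertBrackets (β : Finset (Fin l × Fin l)) (c : ∀ i, Bracketing (m i)) :
    Finset (Fin n × Fin n) :=
  β.image (fun p => (blockFirst m h p.1, blockLast m h p.2)) ∪
    Finset.univ.biUnion fun i => (c i).withOuter.image
      fun p => (blockEquiv m h ⟨i, p.1⟩, blockEquiv m h ⟨i, p.2⟩)

theorem withOuter_lt {n : ℕ+} (b : Bracketing n) {p : Fin n × Fin n} (hp : p ∈ b.withOuter) :
    p.1 < p.2 := by
  unfold Bracketing.withOuter at hp
  split_ifs at hp with h1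
  · rcases Finset.mem_insert.1 hp with rfl | hp
    · have : (1 : ℕ) < n := h1
      simp only [Fin.lt_def, Fin.val_zero, Fin.val_top]
      omega
    · exact (b.2.1 p hp).1
  · exact (b.2.1 p hp).1

theorem gaps_subset_outer {n : ℕ+} {p : Fin n × Fin n} (hp : p.1 < p.2) :
    gaps p ⊆ gaps (0, ⊤) := by
  intro x hx
  rw [mem_gaps_iff] at hx ⊢
  have h2 := p.2.2
  simp only [Fin.lt_def, Fin.le_def, Fin.val_zero, Fin.val_top] at *
  omega

theorem withOuter_compatible {n : ℕ+} (b : Bracketing n) {p q : Fin n × Fin n}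
    (hp : p ∈ b.withOuter) (hq : q ∈ b.withOuter) : Compatible p q := by
  have hp' := withOuter_lt b hp
  have hq' := withOuter_lt b hq
  unfold Bracketing.withOuter at hp hq
  split_ifs at hp hq with h1
  · rcases Finset.mem_insert.1 hp with rfl | hp
    · exact Or.inr (Or.inl (gaps_subset_outer hq'))
    rcases Finset.mem_insert.1 hq with rfl | hq
    · exact Or.inl (gaps_subset_outer hp')
    exact b.2.2 p hp q hq
  · exact b.2.2 p hp q hq

theorem le_blockEquiv_iff (x y : Σ i, Fin (m i)) :
    blockEquiv m h x ≤ blockEquiv m h y ↔ x.1 < y.1 ∨ ∃ e : x.1 = y.1, e ▸ x.2 ≤ y.2 := by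
  obtain ⟨i, a⟩ := x
  obtain ⟨j, b⟩ := y
  rcases lt_trichotomy i j with hij | rfl | hij
  · exact iff_of_true (blockEquiv_lt_of_lt m h (x := ⟨i, a⟩) (y := ⟨j, b⟩) hij).le (Or.inl hij)
  · simp only [lt_self_iff_false, exists_const, false_or]
    rw [← not_lt, ← not_lt, blockEquiv_lt_iff_snd]
  · refine iff_of_false (not_le.2 (blockEquiv_lt_of_lt m h (x := ⟨j, b⟩) (y := ⟨i, a⟩) hij)) ?_
    rintro (h' | ⟨h', -⟩)
    · exact lt_asymm hij h'
    · exact hij.ne' h'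

theorem blockFirst_le_iff {i : Fin l} {x : Σ i, Fin (m i)} :
    blockFirst m h i ≤ blockEquiv m h x ↔ i ≤ x.1 := by
  rw [blockFirst, le_blockEquiv_iff]
  obtain ⟨j, b⟩ := x
  constructor
  · rintro (h' | ⟨h', -⟩)
    · exact h'.le
    · exact h'.le
  · intro h'
    rcases h'.lt_or_eq with h' | h'
    · exact Or.inl h'
    · dsimp only at h'
      subst h'
      exact Or.inr ⟨rfl, Fin.zero_le _⟩

theorem le_blockLast_iff {i : Fin l} {x : Σ i, Fin (m i)} :
    blockEquiv m h x ≤ blockLast m h i ↔ x.1 ≤ i := by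
  rw [blockLast, le_blockEquiv_iff]
  obtain ⟨j, b⟩ := x
  constructor
  · rintro (h' | ⟨h', -⟩)
    · exact h'.le
    · exact h'.le
  · intro h'
    rcases h'.lt_or_eq with h' | h'
    · exact Or.inl h'
    · dsimp only at h'
      subst h'
      exact Or.inr ⟨rfl, le_top⟩

theorem blockFirst_lt_of {a b : Fin l} (hab : b < a) : blockLast m h b < blockFirst m h a :=
  blockEquiv_lt_of_lt m h (x := ⟨b, ⊤⟩) (y := ⟨a, 0⟩) hab

theorem blockFirst_le_blockLast {a b : Fin l} :
    blockFirst m h a ≤ blockLast m h b ↔ a ≤ b :=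
  blockFirst_le_iff m h (x := ⟨b, ⊤⟩)

theorem mem_elts_outer {p : Fin l × Fin l} {x : Σ i, Fin (m i)} :
    blockEquiv m h x ∈ elts (blockFirst m h p.1, blockLast m h p.2) ↔ x.1 ∈ elts p := by
  rw [mem_elts_iff, mem_elts_iff]
  simp only [blockFirst_le_blockLast, blockFirst_le_iff, le_blockLast_iff]
  rw [← not_le, blockFirst_le_blockLast, not_le]

theorem mem_gaps_iff_elts {n : ℕ+} {p : Fin n × Fin n} {x : Fin n} :
    x ∈ gaps p ↔ x ∈ elts p ∧ (p.1 = p.2 ∨ x ≠ p.2 ) ∧ p.1 ≠ p.2 := by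
  rw [mem_gaps_iff, mem_elts_iff]
  simp only [Fin.lt_def, Fin.le_def, Fin.ext_iff, ne_eq]
  omega

theorem elts_subset_of_gaps_subset {n : ℕ+} {p q : Fin n × Fin n} (hp : p.1 ≠ p.2)
    (hpq : gaps p ⊆ gaps q) : elts p ⊆ elts q := by
  intro x hx
  by_cases hx2 : x = p.2
  · subst hx2
    have h1 := p.1.2
    have h2 := p.2.2
    have hlast : ∃ g ∈ gaps p, ((g : ℕ) + 1 = p.2 ∨ ((p.2 : ℕ) = 0 ∧ (g : ℕ) + 1 = n)) := by
      by_cases h0 : (p.2 : ℕ) = 0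
      · refine ⟨⟨n - 1, by omega⟩, ?_, Or.inr ⟨h0, by simp only; omega⟩⟩
        rw [mem_gaps_iff]
        simp only [Fin.lt_def, Fin.le_def, ne_eq, Fin.ext_iff] at hp ⊢
        omega
      · refine ⟨⟨p.2 - 1, by omega⟩, ?_, Or.inl (by simp only; omega)⟩
        rw [mem_gaps_iff]
        simp only [Fin.lt_def, Fin.le_def, ne_eq, Fin.ext_iff] at hp ⊢
        omega
    obtain ⟨g, hg, hg'⟩ := hlast
    have := hpq hg
    rw [mem_gaps_iff] at this
    rw [mem_elts_iff]
    have h3 := q.1.2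
    have h4 := q.2.2
    simp only [Fin.lt_def, Fin.le_def] at this ⊢
    omega
  · exact (mem_gaps_iff_elts.1 (hpq (mem_gaps_iff_elts.2 ⟨hx, Or.inr hx2, hp⟩))).1

theorem mem_elts_local {i : Fin l} {p : Fin (m i) × Fin (m i)} (hp : p.1 < p.2) {z : Fin n} :
    z ∈ elts (blockEquiv m h ⟨i, p.1⟩, blockEquiv m h ⟨i, p.2⟩) ↔
      ∃ w ∈ elts p, z = blockEquiv m h ⟨i, w⟩ := by
  obtain ⟨⟨j, w⟩, rfl⟩ := (blockEquiv m h).surjective z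
  have hlt := (blockEquiv_lt_iff_snd m h).2 hp
  rw [mem_elts_iff]
  simp only [hlt.le, true_and, hlt.not_gt, false_and, or_false]
  constructor
  · rintro ⟨h1, h2⟩
    have e : i = j := by
      rw [le_blockEquiv_iff] at h1 h2
      have h1' : i ≤ j := by
        rcases h1 with h1 | ⟨h1, -⟩
        exacts [h1.le, h1.le]
      have h2' : j ≤ i := by
        rcases h2 with h2 | ⟨h2, -⟩
        exacts [h2.le, h2.le]
      exact le_antisymm h1' h2'
    subst e
    refine ⟨w, ?_, rfl⟩
    rw [mem_elts_iff]
    rw [← not_lt, blockEquiv_lt_iff_snd, not_lt] at h1 h2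
    exact Or.inl ⟨hp.le, h1, h2⟩
  · rintro ⟨w', hw', he⟩
    rw [he]
    rw [mem_elts_iff] at hw'
    rw [← not_lt, blockEquiv_lt_iff_snd, ← not_lt, blockEquiv_lt_iff_snd, not_lt, not_lt]
    rcases hw' with hw' | hw'
    · exact hw'.2
    · exact absurd hw'.1 hp.not_gt

theorem mem_gaps_local {i : Fin l} {p : Fin (m i) × Fin (m i)} (hp : p.1 < p.2) {z : Fin n} :
    z ∈ gaps (blockEquiv m h ⟨i, p.1⟩, blockEquiv m h ⟨i, p.2⟩) ↔
      ∃ w ∈ gaps p, z = blockEquiv m h ⟨i, w⟩ := by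
  have hne := ((blockEquiv_lt_iff_snd m h).2 hp).ne
  rw [mem_gaps_iff_elts, mem_elts_local m h hp]
  simp only [hne, false_or, ne_eq, not_false_eq_true, and_true]
  constructor
  · rintro ⟨⟨w, hw, rfl⟩, hz⟩
    refine ⟨w, mem_gaps_iff_elts.2 ⟨hw, Or.inr ?_, hp.ne⟩, rfl⟩
    rintro rfl
    exact hz rfl
  · rintro ⟨w, hw, rfl⟩
    rw [mem_gaps_iff_elts] at hw
    refine ⟨⟨w, hw.1, rfl⟩, ?_⟩
    intro he
    have := (blockEquiv m h).injective he
    simp only [Sigma.mk.injEq, heq_eq_eq, true_and] at this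
    rcases hw.2.1 with h1 | h1
    · exact hp.ne h1
    · exact h1 this

theorem compatible_local {i j : Fin l} {p : Fin (m i) × Fin (m i)} {q : Fin (m j) × Fin (m j)}
    (hp : p.1 < p.2) (hq : q.1 < q.2) (hpq : ∀ e : i = j, Compatible (e ▸ p) q) :
    Compatible (blockEquiv m h ⟨i, p.1⟩, blockEquiv m h ⟨i, p.2⟩)
      (blockEquiv m h ⟨j, q.1⟩, blockEquiv m h ⟨j, q.2⟩) := by
  by_cases e : i = j
  · subst e
    rcases hpq rfl with h' | h' | h'
    · refine Or.inl fun z hz => ?_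
      obtain ⟨w, hw, rfl⟩ := (mem_gaps_local m h hp).1 hz
      exact (mem_gaps_local m h hq).2 ⟨w, h' hw, rfl⟩
    · refine Or.inr (Or.inl fun z hz => ?_)
      obtain ⟨w, hw, rfl⟩ := (mem_gaps_local m h hq).1 hz
      exact (mem_gaps_local m h hp).2 ⟨w, h' hw, rfl⟩
    · refine Or.inr (Or.inr (Finset.disjoint_left.2 fun z hz hz' => ?_))
      obtain ⟨w, hw, rfl⟩ := (mem_elts_local m h hp).1 hz
      obtain ⟨w', hw', he⟩ := (mem_elts_local m h hq).1 hz'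
      have := (blockEquiv m h).injective he
      simp only [Sigma.mk.injEq, heq_eq_eq, true_and] at this
      subst this
      exact Finset.disjoint_left.1 h' hw hw'
  · refine Or.inr (Or.inr (Finset.disjoint_left.2 fun z hz hz' => ?_))
    obtain ⟨w, hw, rfl⟩ := (mem_elts_local m h hp).1 hz
    obtain ⟨w', hw', he⟩ := (mem_elts_local m h hq).1 hz'
    exact e (congrArg Sigma.fst ((blockEquiv m h).injective he))

theorem blockFirst_ne_blockLast {a b : Fin l} (hab : a ≠ b) :
    blockFirst m h a ≠ blockLast m h b := fun he =>
  hab (congrArg Sigma.fst ((blockEquiv m h).injective he))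

theorem gaps_outer_subset {p q : Fin l × Fin l} (hp : p.1 ≠ p.2) (hq : q.1 ≠ q.2)
    (hpq : gaps p ⊆ gaps q) :
    gaps (blockFirst m h p.1, blockLast m h p.2) ⊆ gaps (blockFirst m h q.1, blockLast m h q.2) := by
  intro z hz
  obtain ⟨x, rfl⟩ := (blockEquiv m h).surjective z
  rw [mem_gaps_iff_elts, mem_elts_outer] at hz ⊢
  obtain ⟨h1, h2, h3⟩ := hz
  have hne := blockFirst_ne_blockLast m h hq
  refine ⟨elts_subset_of_gaps_subset hp hpq h1, Or.inr ?_, hne⟩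
  intro he
  dsimp only at he
  have hx : x = ⟨q.2, ⊤⟩ := (blockEquiv m h).injective he
  subst hx
  rcases h2 with h2 | h2
  · exact h3 h2
  · have hne2 : q.2 ≠ p.2 := by
      intro e
      apply h2
      change blockLast m h q.2 = blockLast m h p.2
      rw [e]
    have := hpq (mem_gaps_iff_elts.2 ⟨h1, Or.inr hne2, hp⟩)
    rcases (mem_gaps_iff_elts.1 this).2.1 with h4 | h4
    · exact hq h4
    · exact h4 rfl

theorem compatible_outer {p q : Fin l × Fin l} (hp : p.1 ≠ p.2) (hq : q.1 ≠ q.2)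
    (hpq : Compatible p q) :
    Compatible (blockFirst m h p.1, blockLast m h p.2)
      (blockFirst m h q.1, blockLast m h q.2) := by
  rcases hpq with h' | h' | h'
  · exact Or.inl (gaps_outer_subset m h hp hq h')
  · exact Or.inr (Or.inl (gaps_outer_subset m h hq hp h'))
  · refine Or.inr (Or.inr (Finset.disjoint_left.2 fun z hz hz' => ?_))
    obtain ⟨x, rfl⟩ := (blockEquiv m h).surjective z
    exact Finset.disjoint_left.1 h' ((mem_elts_outer m h).1 hz) ((mem_elts_outer m h).1 hz')

theorem compatible_local_outer {i : Fin l} {p : Fin (m i) × Fin (m i)} {q : Fin l × Fin l}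
    (hp : p.1 < p.2) (hq : q.1 ≠ q.2) :
    Compatible (blockEquiv m h ⟨i, p.1⟩, blockEquiv m h ⟨i, p.2⟩)
      (blockFirst m h q.1, blockLast m h q.2) := by
  by_cases hi : i ∈ elts q
  · refine Or.inl fun z hz => ?_
    have hlt := (blockEquiv_lt_iff_snd m h).2 hp
    have hz' : z < blockEquiv m h ⟨i, p.2⟩ := by
      rw [mem_gaps_iff] at hz
      rcases hz with hz | hz
      · exact hz.2.2
      · exact absurd hz.1 hlt.not_gt
    obtain ⟨w, hw, rfl⟩ := (mem_gaps_local m h hp).1 hz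
    rw [mem_gaps_iff_elts, mem_elts_outer]
    refine ⟨hi, Or.inr ?_, blockFirst_ne_blockLast m h hq⟩
    intro he
    have hx := (blockEquiv m h).injective he
    have hi' : i = q.2 := congrArg Sigma.fst hx
    subst hi'
    have hle : blockEquiv m h ⟨q.2, p.2⟩ ≤ blockLast m h q.2 :=
      (le_blockLast_iff m h).2 le_rfl
    dsimp only at he
    rw [he] at hz'
    exact absurd hz' hle.not_gt
  · refine Or.inr (Or.inr (Finset.disjoint_left.2 fun z hz hz' => ?_))
    obtain ⟨w, hw, rfl⟩ := (mem_elts_local m h hp).1 hz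
    exact hi ((mem_elts_outer m h).1 hz')

variable {m h}

theorem insertBrackets_ne {β : Finset (Fin l × Fin l)} {c : ∀ i, Bracketing (m i)}
    (hβ : ∀ p ∈ β, p.1 ≠ p.2) : ∀ p ∈ insertBrackets m h β c, p.1 ≠ p.2 := by
  intro p hp
  simp only [insertBrackets, Finset.mem_union, Finset.mem_image, Finset.mem_biUnion,
    Finset.mem_univ, true_and] at hp
  rcases hp with ⟨q, hq, rfl⟩ | ⟨i, q, hq, rfl⟩
  · exact blockFirst_ne_blockLast m h (hβ q hq)
  · exact ((blockEquiv_lt_iff_snd m h).2 (withOuter_lt _ hq)).ne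

theorem insertBrackets_compatible {β : Finset (Fin l × Fin l)} {c : ∀ i, Bracketing (m i)}
    (hβ : ∀ p ∈ β, p.1 ≠ p.2) (hβ' : ∀ p ∈ β, ∀ q ∈ β, Compatible p q) :
    ∀ p ∈ insertBrackets m h β c, ∀ q ∈ insertBrackets m h β c, Compatible p q := by
  intro p hp q hq
  simp only [insertBrackets, Finset.mem_union, Finset.mem_image, Finset.mem_biUnion,
    Finset.mem_univ, true_and] at hp hq
  rcases hp with ⟨p, hp, rfl⟩ | ⟨i, p, hp, rfl⟩ <;> rcases hq with ⟨q, hq, rfl⟩ | ⟨j, q, hq, rfl⟩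
  · exact compatible_outer m h (hβ p hp) (hβ q hq) (hβ' p hp q hq)
  · exact (compatible_local_outer m h (withOuter_lt _ hq) (hβ p hp)).symm
  · exact compatible_local_outer m h (withOuter_lt _ hp) (hβ q hq)
  · refine compatible_local m h (withOuter_lt _ hp) (withOuter_lt _ hq) fun e => ?_
    subst e
    exact withOuter_compatible _ hp hq

theorem insertBrackets_lt {β : Finset (Fin l × Fin l)} {c : ∀ i, Bracketing (m i)}
    (hβ : ∀ p ∈ β, p.1 < p.2) : ∀ p ∈ insertBrackets m h β c, p.1 < p.2 := by
  intro p hp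
  simp only [insertBrackets, Finset.mem_union, Finset.mem_image, Finset.mem_biUnion,
    Finset.mem_univ, true_and] at hp
  rcases hp with ⟨q, hq, rfl⟩ | ⟨i, q, hq, rfl⟩
  · exact blockEquiv_lt_of_lt m h (x := ⟨q.1, 0⟩) (y := ⟨q.2, ⊤⟩) (hβ q hq)
  · exact (blockEquiv_lt_iff_snd m h).2 (withOuter_lt _ hq)

end

section

variable {l n : ℕ+} (m : Fin l → ℕ+) (h : ∑ i, (m i : ℕ) = n)

/-- The composition `b(c₀, …, c_{l-1})` of bracketings of strings. A bracket around the whole string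
is not recorded. -/
def Bracketing.comp (b : Bracketing l) (c : ∀ i, Bracketing (m i)) : Bracketing n :=
  ⟨(insertBrackets m h b.1 c).filter fun p => (p.2 : ℕ) - p.1 + 1 < n,
    fun p hp => ⟨insertBrackets_lt (fun q hq => (b.2.1 q hq).1) p (Finset.mem_filter.1 hp).1,
      (Finset.mem_filter.1 hp).2⟩,
    fun p hp q hq => insertBrackets_compatible (fun r hr => (b.2.1 r hr).1.ne) b.2.2
      p (Finset.mem_filter.1 hp).1 q (Finset.mem_filter.1 hq).1⟩

/-- The cyclic bracketing `b(c₀, …, c_{l-1})` obtained by insertion of bracketed strings in place of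
the letters of a circle. -/
def CycBracketing.comp (b : CycBracketing l) (c : ∀ i, Bracketing (m i)) : CycBracketing n :=
  ⟨insertBrackets m h b.1 c, insertBrackets_ne b.2.1, insertBrackets_compatible b.2.1 b.2.2⟩

end

/-- Rotation of the circle that takes the position `r` to the position `0`. -/
def CycBracketing.rotate {n : ℕ+} (r : Fin n) (b : CycBracketing n) : CycBracketing n :=
  ⟨b.1.image fun p => (p.1 - r, p.2 - r), by
    constructor
    · simp only [Finset.mem_image, forall_exists_index, and_imp]
      rintro _ p hp rfl
      simpa using b.2.1 p hp
    · simp only [Finset.mem_image, forall_exists_index, and_imp]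
      rintro _ p hp rfl _ q hq rfl
      have hg : ∀ (p : Fin n × Fin n) x, x ∈ gaps (p.1 - r, p.2 - r) ↔ x + r ∈ gaps p := by
        intro p x
        simp only [gaps, Finset.mem_filter, Finset.mem_univ, true_and, sub_sub_sub_cancel_right]
        rw [sub_sub_eq_add_sub]
      have he : ∀ (p : Fin n × Fin n) x, x ∈ elts (p.1 - r, p.2 - r) ↔ x + r ∈ elts p := by
        intro p x
        simp only [elts, Finset.mem_filter, Finset.mem_univ, true_and, sub_sub_sub_cancel_right]
        rw [sub_sub_eq_add_sub]
      rcases b.2.2 p hp q hq with h' | h' | h'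
      · exact Or.inl fun x hx => (hg q x).2 (h' ((hg p x).1 hx))
      · exact Or.inr (Or.inl fun x hx => (hg p x).2 (h' ((hg q x).1 hx)))
      · exact Or.inr (Or.inr (Finset.disjoint_left.2 fun x hx hx' =>
          Finset.disjoint_left.1 h' ((he p x).1 hx) ((he q x).1 hx')))⟩

/-- The representative, in the class of `σ` modulo cyclic permutations `ℤ/n` (acting from the left),
that leaves the first letter fixed. -/
def toFix {n : ℕ+} (σ : Equiv.Perm (Fin n)) : PermFix n :=
  ⟨σ.trans (Equiv.subRight (σ 0)), by simp⟩

/-- The element of `BCBar n` represented by a cyclic bracketing `b` of the circle in which the letter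
`i` is in position `σ i`: the circle is rotated so that the first letter comes to position `0`. -/
def BCBar.mk {n : ℕ+} (σ : Equiv.Perm (Fin n)) (b : CycBracketing n) : BCBar n :=
  ⟨toFix σ, b.rotate (σ 0)⟩

/-- The composition of the operad of bracketings. The string that is inserted for the letter `i`
comes to the position `σ i`. -/
def BBar.comp {l n : ℕ+} (m : Fin l → ℕ+) (h : ∑ i, (m i : ℕ) = n) (b : BBar l)
    (c : ∀ i, BBar (m i)) : BBar n :=
  ⟨blockPerm m h b.1 fun i => (c i).1,
    b.2.comp (fun p => m (b.1.symm p)) (sum_symm h b.1) fun p => (c (b.1.symm p)).2⟩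

/-- The right action of the symmetric group on cyclic bracketings. -/
def BCBar.act {n : ℕ+} (τ : Equiv.Perm (Fin n)) (b : BCBar n) : BCBar n :=
  BCBar.mk (b.1.1 * τ) b.2

/-- The composition of the right module of cyclic bracketings over the operad of bracketings. -/
def BCBar.comp {l n : ℕ+} (m : Fin l → ℕ+) (h : ∑ i, (m i : ℕ) = n) (b : BCBar l)
    (c : ∀ i, BBar (m i)) : BCBar n :=
  BCBar.mk (blockPerm m h b.1.1 fun i => (c i).1)
    (b.2.comp (fun p => m (b.1.1.symm p)) (sum_symm h b.1.1) fun p => (c (b.1.1.symm p)).2)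

/-! ### Cellular structures -/

/-- An operad structure on the symmetrized associahedra in the category of cellular complexes, which
induces the composition of bracketings on the posets of faces. The symmetric group permutes the
copies of `K_n`; the structure map is a homeomorphism of each product of closed cells onto the closed
cell indexed by the composite bracketing. -/
structure IsCellularOperad (O : TopOperad KBar) : Prop where
  act_eq : ∀ {n : ℕ+} (σ τ : Equiv.Perm (Fin n)) (x : polyK n), O.act τ ⟨σ, x⟩ = ⟨σ * τ, x⟩
  comp_cell : ∀ {l n : ℕ+} (m : Fin l → ℕ+) (h : ∑ i, (m i : ℕ) = n) (b : BBar l)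
    (c : ∀ i, BBar (m i)),
    BijOn (O.comp m h) (cellK b ×ˢ univ.pi fun i => cellK (c i)) (cellK (b.comp m h c))

/-- A module structure on the symmetrized cyclohedra in the category of cellular complexes, which
induces the module of cyclic bracketings on the posets of faces. The structure map is a homeomorphism
of each product of closed cells onto the closed cell indexed by the composite bracketing. -/
structure IsCellularModule {O : TopOperad KBar} (M : TopModule O WBar) : Prop where
  act_cell : ∀ {n : ℕ+} (τ : Equiv.Perm (Fin n)) (b : BCBar n),
    BijOn (M.act τ) (cellW b) (cellW (b.act τ))
  comp_cell : ∀ {l n : ℕ+} (m : Fin l → ℕ+) (h : ∑ i, (m i : ℕ) = n) (b : BCBar l)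
    (c : ∀ i, BBar (m i)),
    BijOn (M.comp m h) (cellW b ×ˢ univ.pi fun i => cellK (c i)) (cellW (b.comp m h c))

/-- The arities `1, …, 1, n, 1, …, 1` with `n` at the place `i`. -/
def circArity {m : ℕ+} (i : Fin m) (n : ℕ+) : Fin m → ℕ+ := fun j => if j = i then n else 1

theorem sum_circArity {m n N : ℕ+} (i : Fin m) (hN : (N : ℕ) + 1 = m + n) :
    ∑ j, (circArity i n j : ℕ) = N := by
  have hm := m.pos
  have e : ∀ j, (circArity i n j : ℕ) = (if j = i then (n : ℕ) - 1 else 0) + 1 := by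
    intro j
    have := n.pos
    unfold circArity
    split_ifs
    · omega
    · rfl
  simp only [e, Finset.sum_add_distrib, Finset.sum_ite_eq', Finset.mem_univ, if_true,
    Finset.sum_const, Finset.card_univ, Fintype.card_fin, smul_eq_mul, mul_one]
  have := n.pos
  omega

/-- The sequence `1, …, 1, p, 1, …, 1` with `p` at the place `i`. -/
def circArgs {P : ℕ+ → Type} (e : P 1) {m n : ℕ+} (i : Fin m) (p : P n) :
    ∀ j, P (circArity i n j) := fun j =>
  if hj : j = i then cast (by rw [circArity, if_pos hj]) p
  else cast (by rw [circArity, if_neg hj]) e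

/-- The operation `x ∘ᵢ p = ν(x; 1, …, 1, p, 1, …, 1)` of a module. -/
def TopModule.circ {P : ℕ+ → Type} [∀ n, TopologicalSpace (P n)] {O : TopOperad P}
    {M : ℕ+ → Type} [∀ n, TopologicalSpace (M n)] (A : TopModule O M) {m n N : ℕ+} (i : Fin m)
    (hN : (N : ℕ) + 1 = m + n) (x : M m) (p : P n) : M N :=
  A.comp (circArity i n) (sum_circArity i hN) (x, circArgs O.one i p)

/-- The cyclic bracketing with a single bracket. -/
def CycBracketing.single {n : ℕ+} (p : Fin n × Fin n) (hp : p.1 ≠ p.2) : CycBracketing n :=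
  ⟨{p}, by
    constructor
    · intro q hq
      rw [Finset.mem_singleton.1 hq]
      exact hp
    · intro q hq r hr
      rw [Finset.mem_singleton.1 hq, Finset.mem_singleton.1 hr]
      exact Or.inl (Finset.Subset.refl _)⟩

/-- For `n ≥ 2`, the operation `∘ᵢ` identifies `W_m × K_n` with the codimension-one face of
`W_{m+n-1}` indexed by the single bracket around the letters `i, …, i + n - 1`. -/
def CircIsFacet {O : TopOperad KBar} (M : TopModule O WBar) : Prop :=
  ∀ (m n N : ℕ+) (i : Fin m) (hN : (N : ℕ) + 1 = m + n) (a b : Fin N) (hab : a ≠ b),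
    (a : ℕ) = i → (b : ℕ) = i + n - 1 →
    BijOn (fun x : polyW m × polyK n =>
        M.circ i hN (⟨⟨1, rfl⟩, x.1⟩ : WBar m) (⟨1, x.2⟩ : KBar n)) univ
      (cellW (⟨⟨1, rfl⟩, CycBracketing.single (a, b) hab⟩ : BCBar N)) ∧
    dimW (⟨⟨1, rfl⟩, CycBracketing.single (a, b) hab⟩ : BCBar N) + 1 = (N : ℕ) - 1

/-! ### The operad `Ass` and its module `Cycl` -/

section

variable (k : Type u) [Field k]

/-- `Ass(n) = k[Σ_n]`. -/
abbrev Ass (n : ℕ+) : Type u := Equiv.Perm (Fin n) →₀ k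

/-- `Cycl(n) = k[Σ_{n-1}]`, where `Σ_{n-1}` represents the cosets of `Σ_n` modulo `ℤ/n`. -/
abbrev Cycl (n : ℕ+) : Type u := PermFix n →₀ k

/-- The right action on `Ass(n)`, by multiplication from the right. -/
noncomputable def Ass.act {n : ℕ+} (τ : Equiv.Perm (Fin n)) : Ass k n →ₗ[k] Ass k n :=
  Finsupp.lmapDomain k k fun σ => σ * τ

/-- The right action on `Cycl(n)`, induced by the projection of `Σ_n` on the cosets. -/
noncomputable def Cycl.act {n : ℕ+} (τ : Equiv.Perm (Fin n)) : Cycl k n →ₗ[k] Cycl k n :=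
  Finsupp.lmapDomain k k fun σ => toFix (σ.1 * τ)

/-- The multilinear map on `Ass(m₀) × ⋯ × Ass(m_{l-1})` with values `f τ` on the basis. -/
noncomputable def multilinearOfBasis {l : ℕ} (m : Fin l → ℕ+) {V : Type u} [AddCommGroup V]
    [Module k V] (f : (∀ i, Equiv.Perm (Fin (m i))) → V) :
    MultilinearMap k (fun i => Ass k (m i)) V :=
  ∑ τ : ∀ i, Equiv.Perm (Fin (m i)),
    ((MultilinearMap.mkPiAlgebra k (Fin l) k).compLinearMap
      fun i => Finsupp.lapply (τ i)).smulRight (f τ)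

/-- The composition of `Ass`: the multilinear extension of `(σ; τ₀, …) ↦ σ(τ₀, …)`. -/
noncomputable def Ass.comp {l n : ℕ+} (m : Fin l → ℕ+) (h : ∑ i, (m i : ℕ) = n) :
    Ass k l →ₗ[k] MultilinearMap k (fun i => Ass k (m i)) (Ass k n) :=
  Finsupp.lift _ k _ fun σ =>
    multilinearOfBasis k m fun τ => Finsupp.single (blockPerm m h σ τ) 1

/-- The structure map of `Cycl`: the multilinear extension of `(π(σ); τ₀, …) ↦ π(σ(τ₀, …))`, where
`π` is the projection of permutations on cosets. -/
noncomputable def Cycl.comp {l n : ℕ+} (m : Fin l → ℕ+) (h : ∑ i, (m i : ℕ) = n) :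
    Cycl k l →ₗ[k] MultilinearMap k (fun i => Ass k (m i)) (Cycl k n) :=
  Finsupp.lift _ k _ fun σ =>
    multilinearOfBasis k m fun τ => Finsupp.single (toFix (blockPerm m h σ.1 τ)) 1

/-! ### Homology -/

open CategoryTheory in
/-- Singular homology with coefficients in `k`. -/
noncomputable abbrev Homology (i : ℕ) (X : Type) [TopologicalSpace X] : ModuleCat.{u} k :=
  ((AlgebraicTopology.singularHomologyFunctor (ModuleCat.{u} k) i).obj (ModuleCat.of k k)).obj
    (TopCat.of X)

open CategoryTheory in
noncomputable def Homology.map (i : ℕ) {X Y : Type} [TopologicalSpace X] [TopologicalSpace Y]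
    (f : C(X, Y)) : Homology k i X →ₗ[k] Homology k i Y :=
  (((AlgebraicTopology.singularHomologyFunctor (ModuleCat.{u} k) i).obj (ModuleCat.of k k)).map
    (TopCat.ofHom f)).hom

open CategoryTheory in
/-- The class in `H_0(X)` of a point of `X`: the image of the element of `H_0(pt)` with
augmentation `1`. -/
noncomputable def ptClass {X : Type} [TopologicalSpace X] (x : X) : Homology k 0 X :=
  Homology.map k 0 (ContinuousMap.const Unit x)
    ((inv (TopCat.singularHomology₀ε (TopCat.of Unit) (ModuleCat.of k k))).hom (1 : k))

/-- `E` is the exterior product `H_0(X) ⊗ ⨂ᵢ H_0(Yᵢ) → H_0(X × ∏ᵢ Yᵢ)`. (The classes of points span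
`H_0`.) -/
def IsExteriorProduct {l : ℕ} {X : Type} [TopologicalSpace X] {Y : Fin l → Type}
    [∀ i, TopologicalSpace (Y i)]
    (E : Homology k 0 X →ₗ[k]
      MultilinearMap k (fun i => Homology k 0 (Y i)) (Homology k 0 (X × ∀ i, Y i))) : Prop :=
  ∀ (x : X) (y : ∀ i, Y i), E (ptClass k x) (fun i => ptClass k (y i)) = ptClass k (x, y)

/-- The homology of `K̄` and of `W̄` is concentrated in degree zero, where it is isomorphic to the
operad `Ass` and to its right module `Cycl`; the isomorphisms take the class of a point to the
permutation that indexes its component. -/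
def HomologyIsCycl (O : TopOperad KBar) (M : TopModule O WBar) : Prop :=
  (∀ (n : ℕ+) (i : ℕ), i ≠ 0 →
    Subsingleton (Homology k i (KBar n)) ∧ Subsingleton (Homology k i (WBar n))) ∧
  ∃ (φ : ∀ n : ℕ+, Homology k 0 (KBar n) ≃ₗ[k] Ass k n)
    (ψ : ∀ n : ℕ+, Homology k 0 (WBar n) ≃ₗ[k] Cycl k n),
    (∀ (n : ℕ+) (x : KBar n), φ n (ptClass k x) = Finsupp.single x.1 1) ∧
    (∀ (n : ℕ+) (x : WBar n), ψ n (ptClass k x) = Finsupp.single x.1 1) ∧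
    φ 1 (ptClass k O.one) = Finsupp.single 1 1 ∧
    (∀ (n : ℕ+) (τ : Equiv.Perm (Fin n)) (a : Homology k 0 (KBar n)),
      φ n (Homology.map k 0 (O.act τ) a) = Ass.act k τ (φ n a)) ∧
    (∀ (n : ℕ+) (τ : Equiv.Perm (Fin n)) (a : Homology k 0 (WBar n)),
      ψ n (Homology.map k 0 (M.act τ) a) = Cycl.act k τ (ψ n a)) ∧
    (∀ (l n : ℕ+) (m : Fin l → ℕ+) (h : ∑ i, (m i : ℕ) = n),
      ∃ E, IsExteriorProduct k (X := KBar l) (Y := fun i => KBar (m i)) E ∧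
        ∀ a c, φ n (Homology.map k 0 (O.comp m h) (E a c)) =
          Ass.comp k m h (φ l a) (fun i => φ (m i) (c i))) ∧
    (∀ (l n : ℕ+) (m : Fin l → ℕ+) (h : ∑ i, (m i : ℕ) = n),
      ∃ E, IsExteriorProduct k (X := WBar l) (Y := fun i => KBar (m i)) E ∧
        ∀ a c, ψ n (Homology.map k 0 (M.comp m h) (E a c)) =
          Cycl.comp k m h (ψ l a) (fun i => φ (m i) (c i)))

end

end CycloMod

open CycloMod

/-! The function `3 ^ card` makes both polytopes simple with the expected combinatorics. If two
brackets cannot occur together, the union of their gap sets has size at least one more than each, so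
two tight sums add up to at most 2/3 of what the union requires. Hence the inequalities that are
tight at a point always form a bracketing (`compatible_of_tight`). Conversely, for a given
bracketing, mass spread evenly over the gaps of each bracket that lie in no smaller bracket gives a
point that is tight at exactly these brackets (`CycBracketing.lt_center`), and the same construction
shows that the tight functionals are independent. So each face is a convex body of the right
dimension, hence a ball, and the faces form a regular cell complex
(`isRegularCellComplex_of_carrier`). `K_n` is the face of `W_n` at the bracket around all letters
opened before the first (`embedK`), so its properties are inherited from `W_n`.

The maps between these spaces come from the face posets. By barycentric subdivision a point is a
unique convex combination of centers of a chain of faces, and such a combination is the same thing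
as a monotone step function from the unit interval to the poset, up to null sets (`chartW`,
`chartK`). An order embedding of posets whose image is closed downwards therefore induces a cellular
embedding of spaces, by applying it to the values of step functions (`Chart.compose`). Insertion of
bracketed strings and rotation are such embeddings, and every identity between them, such as
associativity, units and compatibility with rotations, passes from bracketings to points. This gives
a planar operad of associahedra and a planar module of cyclohedra. Copies indexed by permutations
give the symmetric structures, where the symmetrized cyclohedron is treated as the quotient by
rotations of `n!` copies of `W_n`.

The module has to exist over every cellular operad, not only over the standard one. Any two planar
operads are isomorphic by maps that preserve faces (`PlanarOperad.exists_isComparison`). This is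
proved by induction on the arity: a boundary point has a unique coarsest decomposition
(`eq_of_top_comp_eq`), so maps in lower arities determine the map on the boundary sphere, which is
then extended radially over the ball. The standard module is pulled back along such an isomorphism.

Finally the components are convex, so homology lives in degree zero and is free on the set of
components. Cellularity says to which component a composite belongs, and this is the composition law
of `Ass` and `Cycl` (`IsCellularModule.homologyIsCycl`). -/

namespace CycloMod

/-! ### Combinatorics of brackets -/

section Gaps

variable {n : ℕ+} {p q r : Fin n × Fin n}

/-- `x` is the place before `y` on the circle. -/
def IsPred (x y : Fin n) : Prop := (x : ℕ) + 1 = y ∨ ((y : ℕ) = 0 ∧ (x : ℕ) + 1 = n)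

theorem exists_isPred (y : Fin n) : ∃ x, IsPred x y := by
  by_cases h : (y : ℕ) = 0
  · exact ⟨⟨n - 1, by omega⟩, Or.inr ⟨h, by simp only; omega⟩⟩
  · exact ⟨⟨y - 1, by omega⟩, Or.inl (by simp only; omega)⟩

theorem mem_gaps_iff' {x : Fin n} :
    x ∈ gaps p ↔ ((p.1 : ℕ) ≤ p.2 ∧ (p.1 : ℕ) ≤ x ∧ (x : ℕ) < p.2) ∨
      ((p.2 : ℕ) < p.1 ∧ ((p.1 : ℕ) ≤ x ∨ (x : ℕ) < p.2)) :=
  mem_gaps_iff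

theorem mem_elts_iff' {x : Fin n} :
    x ∈ elts p ↔ ((p.1 : ℕ) ≤ p.2 ∧ (p.1 : ℕ) ≤ x ∧ (x : ℕ) ≤ p.2) ∨
      ((p.2 : ℕ) < p.1 ∧ ((p.1 : ℕ) ≤ x ∨ (x : ℕ) ≤ p.2)) :=
  mem_elts_iff

theorem val_ne (hp : p.1 ≠ p.2) : (p.1 : ℕ) ≠ p.2 := fun h => hp (Fin.ext h)

theorem fst_mem_gaps (hp : p.1 ≠ p.2) : p.1 ∈ gaps p := by
  have := val_ne hp
  rw [mem_gaps_iff']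
  omega

theorem snd_notMem_gaps : p.2 ∉ gaps p := by
  rw [mem_gaps_iff']
  omega

theorem gaps_nonempty (hp : p.1 ≠ p.2) : (gaps p).Nonempty := ⟨_, fst_mem_gaps hp⟩

theorem gaps_ne_univ : gaps p ≠ Finset.univ := fun h =>
  snd_notMem_gaps (p := p) (h ▸ Finset.mem_univ _)

theorem card_gaps_lt : (gaps p).card < n := by
  have := Finset.card_lt_univ_of_notMem (snd_notMem_gaps (p := p))
  simpa using this

theorem eq_fst_of_mem {x y : Fin n} (hxy : IsPred x y) (hy : y ∈ gaps p) (hx : x ∉ gaps p) :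
    y = p.1 := by
  rw [mem_gaps_iff'] at hx hy
  ext
  unfold IsPred at hxy
  omega

theorem eq_snd_of_mem {x y : Fin n} (hxy : IsPred x y) (hx : x ∈ gaps p) (hy : y ∉ gaps p) :
    y = p.2 := by
  rw [mem_gaps_iff'] at hx hy
  ext
  unfold IsPred at hxy
  omega

theorem isPred_fst_notMem {x : Fin n} (hx : IsPred x p.1) : x ∉ gaps p := by
  rw [mem_gaps_iff']
  unfold IsPred at hx
  omega

theorem isPred_snd_mem {x : Fin n} (hp : p.1 ≠ p.2) (hx : IsPred x p.2) : x ∈ gaps p := by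
  have := val_ne hp
  rw [mem_gaps_iff']
  unfold IsPred at hx
  omega

/-- The opening letter numbers the only gap of the set whose predecessor is outside, the closing
letter the only place outside whose predecessor belongs to the set. This covers brackets around all
letters too: they omit exactly one gap, and so remember where they open. -/
theorem gaps_injective (hp : p.1 ≠ p.2) (h : gaps p = gaps q) : p = q := by
  obtain ⟨x, hx⟩ := exists_isPred p.1
  obtain ⟨y, hy⟩ := exists_isPred p.2
  refine Prod.ext (eq_fst_of_mem hx (h ▸ fst_mem_gaps hp) (h ▸ isPred_fst_notMem hx))
    (eq_snd_of_mem hy (h ▸ isPred_snd_mem hp hy) (h ▸ snd_notMem_gaps))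

theorem gaps_subset_elts : gaps p ⊆ elts p := fun x hx => by
  rw [mem_gaps_iff'] at hx
  rw [mem_elts_iff']
  omega

theorem Compatible.nested_or_disjoint (h : Compatible p q) :
    gaps p ⊆ gaps q ∨ gaps q ⊆ gaps p ∨ Disjoint (gaps p) (gaps q) :=
  h.imp_right (Or.imp_right fun h => h.mono gaps_subset_elts gaps_subset_elts)

/-- If two brackets cannot occur together, then their union is a cyclic interval. -/
theorem exists_union_of_not_compatible (hp : p.1 ≠ p.2) (hq : q.1 ≠ q.2) (h : ¬ Compatible p q) :
    gaps p ∪ gaps q = Finset.univ ∨ ∃ r : Fin n × Fin n, r.1 ≠ r.2 ∧ gaps r = gaps p ∪ gaps q := by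
  have hp' := val_ne hp
  have hq' := val_ne hq
  obtain ⟨h1, h2, h3⟩ : ¬ gaps p ⊆ gaps q ∧ ¬ gaps q ⊆ gaps p ∧ ¬ Disjoint (elts p) (elts q) := by
    unfold Compatible at h
    tauto
  obtain ⟨x, hx, hx'⟩ := Finset.not_subset.1 h1
  obtain ⟨y, hy, hy'⟩ := Finset.not_subset.1 h2
  obtain ⟨z, hz, hz'⟩ := Finset.not_disjoint_iff.1 h3
  rw [mem_gaps_iff'] at hx hx' hy hy'
  rw [mem_elts_iff'] at hz hz'
  by_cases hu : gaps p ∪ gaps q = Finset.univ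
  · exact Or.inl hu
  right
  obtain ⟨w, hw⟩ : ∃ w, w ∉ gaps p ∪ gaps q := by
    by_contra hcon
    push Not at hcon
    exact hu (Finset.eq_univ_iff_forall.2 hcon)
  simp only [Finset.mem_union, mem_gaps_iff', not_or] at hw
  -- The brackets overlap without nesting and do not cover the circle, so one of them opens inside
  -- the other. The union opens with the other one and closes with the one that opens inside.
  by_cases hc : q.1 ∈ elts p
  · refine ⟨(p.1, q.2), ?_, ?_⟩
    · intro e
      have := congrArg Fin.val e
      simp only at this
      rw [mem_elts_iff'] at hc
      omega
    · ext g
      have := g.2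
      simp only [Finset.mem_union, mem_gaps_iff']
      rw [mem_elts_iff'] at hc
      omega
  · refine ⟨(q.1, p.2), ?_, ?_⟩
    · intro e
      have := congrArg Fin.val e
      simp only at this
      rw [mem_elts_iff'] at hc
      omega
    · have hc2 : p.1 ∈ elts q := by
        rw [mem_elts_iff'] at hc ⊢
        omega
      ext g
      have := g.2
      simp only [Finset.mem_union, mem_gaps_iff']
      rw [mem_elts_iff'] at hc hc2
      clear hy hy' hz hz' h1 h2 h3 h hu
      omega

/-- A place next to a bracket. -/
theorem exists_adjacent {c : Fin n × Fin n} (hc : c.1 ≠ c.2) {S : Finset (Fin n)}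
    (hS : S = Finset.univ ∨ ∃ q : Fin n × Fin n, S = gaps q) {g : Fin n} (hg : g ∈ S)
    (hgc : g ∈ gaps c) (hsub : ¬ S ⊆ gaps c) :
    ∃ x ∈ S, x ∉ gaps c ∧ ∀ c' : Fin n × Fin n, x ∈ gaps c' → ¬ Disjoint (elts c) (elts c') := by
  have hc' := val_ne hc
  -- An interval that meets `gaps c` without being contained in it contains the gap just after the
  -- last letter of `c` or the gap just before its first letter. A bracket across this gap encloses
  -- that end letter, so it is not disjoint from `c`.
  have key : c.2 ∈ S ∨ ∃ x ∈ S, IsPred x c.1 := by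
    rcases hS with rfl | ⟨q, rfl⟩
    · exact Or.inl (Finset.mem_univ _)
    · obtain ⟨y, hy, hy'⟩ := Finset.not_subset.1 hsub
      obtain ⟨x, hx⟩ := exists_isPred c.1
      by_cases h2 : c.2 ∈ gaps q
      · exact Or.inl h2
      refine Or.inr ⟨x, ?_, hx⟩
      rw [mem_gaps_iff'] at *
      unfold IsPred at hx
      omega
  rcases key with h | ⟨x, hx, hxc⟩
  · refine ⟨c.2, h, snd_notMem_gaps, fun c' hx' hd => ?_⟩
    refine Finset.disjoint_left.1 hd ?_ (gaps_subset_elts hx')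
    rw [mem_elts_iff']
    omega
  · refine ⟨x, hx, isPred_fst_notMem hxc, fun c' hx' hd => ?_⟩
    refine absurd (Finset.disjoint_left.1 hd (show c.1 ∈ elts c from ?_)) (not_not.2 ?_)
    · rw [mem_elts_iff']
      omega
    · rw [mem_gaps_iff'] at hx'
      rw [mem_elts_iff']
      unfold IsPred at hxc
      omega

/-- An interval of gaps that is not interior to one of a set of compatible brackets has a gap that
is exterior to all of them. -/
theorem exists_free {C : Finset (Fin n × Fin n)} (hC : ∀ c ∈ C, c.1 ≠ c.2)
    (hcomp : ∀ c ∈ C, ∀ d ∈ C, Compatible c d) {S : Finset (Fin n)} (hne : S.Nonempty)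
    (hS : S = Finset.univ ∨ ∃ q : Fin n × Fin n, S = gaps q) (hsub : ∀ c ∈ C, ¬ S ⊆ gaps c) :
    ∃ g ∈ S, ∀ c ∈ C, g ∉ gaps c := by
  by_contra! hcon
  obtain ⟨g₀, hg₀⟩ := hne
  obtain ⟨c₀, hc₀, hgc₀⟩ := hcon g₀ hg₀
  -- Take a largest bracket that meets `S`. A bracket `d` across the adjacent gap `x` can neither
  -- lie inside `c` nor be disjoint from it, so it is strictly larger, a contradiction.
  obtain ⟨c, hc, hmax⟩ := Finset.exists_max_image (C.filter fun c => ∃ g ∈ S, g ∈ gaps c)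
    (fun c => (gaps c).card) ⟨c₀, Finset.mem_filter.2 ⟨hc₀, g₀, hg₀, hgc₀⟩⟩
  obtain ⟨hcC, g, hg, hgc⟩ := Finset.mem_filter.1 hc
  obtain ⟨x, hx, hxc, hx'⟩ := exists_adjacent (hC c hcC) hS hg hgc (hsub c hcC)
  obtain ⟨d, hd, hxd⟩ := hcon x hx
  have hlt : (gaps c).card < (gaps d).card := by
    rcases hcomp c hcC d hd with h | h | h
    · exact Finset.card_lt_card ⟨h, fun h' => hxc (h' hxd)⟩
    · exact absurd (h hxd) hxc
    · exact absurd h (hx' d hxd)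
  exact absurd (hmax d (Finset.mem_filter.2 ⟨hd, x, hx, hxd⟩)) (not_le.2 hlt)

end Gaps

/-! ### Laminar families -/

namespace Laminar

variable {α : Type*} [DecidableEq α] (F : Finset (Finset α)) (a : Finset α → ℝ)

/-- The elements of `S` in no smaller member of the family. -/
def free (S : Finset α) : Finset α := S.filter fun g => ∀ T ∈ F, T ⊂ S → g ∉ T

/-- The total mass of the free elements of `S`, if each member `T` of the family has mass `a T`. -/
noncomputable def weight (S : Finset α) : ℝ :=
  a S - ∑ T ∈ (F.filter (· ⊂ S)).attach, weight T.1
termination_by S.card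
decreasing_by exact Finset.card_lt_card (Finset.mem_filter.1 T.2).2

theorem weight_eq (S : Finset α) : weight F a S = a S - ∑ T ∈ F.filter (· ⊂ S), weight F a T := by
  rw [weight, Finset.sum_attach (F.filter (· ⊂ S)) (fun T => weight F a T)]

/-- The mass distribution that is constant on the free elements of each member. -/
noncomputable def solve (g : α) : ℝ :=
  ∑ S ∈ F, if g ∈ free F S then weight F a S / (free F S).card else 0

variable {F} in
theorem mem_free {S : Finset α} {g : α} : g ∈ free F S ↔ g ∈ S ∧ ∀ T ∈ F, T ⊂ S → g ∉ T :=
  Finset.mem_filter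

theorem free_subset (S : Finset α) : free F S ⊆ S := Finset.filter_subset _ _

theorem sum_solve_eq (Q : Finset α) :
    ∑ g ∈ Q, solve F a g =
      ∑ S ∈ F, (Q ∩ free F S).card * (weight F a S / (free F S).card) := by
  unfold solve
  rw [Finset.sum_comm]
  refine Finset.sum_congr rfl fun S _ => ?_
  rw [← Finset.sum_filter, Finset.sum_const, nsmul_eq_mul, Finset.filter_mem_eq_inter]

variable {F} (hF : ∀ S ∈ F, ∀ T ∈ F, S ⊆ T ∨ T ⊆ S ∨ Disjoint S T)
  (hfree : ∀ S ∈ F, (free F S).Nonempty)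

include hF hfree

/-- By laminarity the free part of a member `T` lies in `S` if `T ⊆ S` and misses `S` otherwise. So
the mass of `S` is the total weight of the members inside `S`, which is `a S` by the recursion that
defines `weight`. The values `a` are arbitrary, which later gives independence of the functionals.
-/
theorem sum_solve {S : Finset α} (hS : S ∈ F) : ∑ g ∈ S, solve F a g = a S := by
  have h0 : ∀ T ∈ F, (S ∩ free F T).card * (weight F a T / (free F T).card) =
      if T ⊆ S then weight F a T else 0 := by
    intro T hT
    have hpos : ((free F T).card : ℝ) ≠ 0 := by
      exact_mod_cast (Finset.card_pos.2 (hfree T hT)).ne'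
    split_ifs with h
    · rw [Finset.inter_eq_right.2 ((free_subset F T).trans h), mul_div_cancel₀ _ hpos]
    · have : S ∩ free F T = ∅ := by
        rw [← Finset.disjoint_iff_inter_eq_empty]
        rcases hF S hS T hT with h' | h' | h'
        · refine Finset.disjoint_left.2 fun g hg hg' => ?_
          exact (Finset.mem_filter.1 hg').2 S hS ⟨h', h⟩ hg
        · exact absurd h' h
        · exact h'.mono_right (free_subset F T)
      rw [this]
      simp
  rw [sum_solve_eq, Finset.sum_congr rfl h0, ← Finset.sum_filter]
  have : F.filter (· ⊆ S) = insert S (F.filter (· ⊂ S)) := by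
    ext T
    simp only [Finset.mem_filter, Finset.mem_insert]
    constructor
    · rintro ⟨h1, h2⟩
      rcases h2.eq_or_ssubset with h3 | h3
      · exact Or.inl h3
      · exact Or.inr ⟨h1, h3⟩
    · rintro (rfl | ⟨h1, h2⟩)
      · exact ⟨hS, Finset.Subset.refl _⟩
      · exact ⟨h1, h2.1⟩
  rw [this, Finset.sum_insert (by simp), weight_eq]
  ring

theorem sum_solve_free {S : Finset α} (hS : S ∈ F) :
    ∑ g ∈ free F S, solve F a g = weight F a S := by
  have hpos : ((free F S).card : ℝ) ≠ 0 := by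
    exact_mod_cast (Finset.card_pos.2 (hfree S hS)).ne'
  rw [sum_solve_eq, Finset.sum_eq_single_of_mem S hS, Finset.inter_self, mul_div_cancel₀ _ hpos]
  intro T hT hne
  have : free F S ∩ free F T = ∅ := by
    rw [← Finset.disjoint_iff_inter_eq_empty]
    refine Finset.disjoint_left.2 fun g hg hg' => ?_
    rcases hF S hS T hT with h | h | h
    · exact (Finset.mem_filter.1 hg').2 S hS (h.ssubset_of_ne hne.symm) (free_subset F S hg)
    · exact (Finset.mem_filter.1 hg).2 T hT (h.ssubset_of_ne hne) (free_subset F T hg')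
    · exact Finset.disjoint_left.1 h (free_subset F S hg) (free_subset F T hg')
  rw [this]
  simp

/-- The maximal members of `G` are disjoint, a member of size `x` has mass `3 ^ x`, and `3 ^ x + 3 ^
y ≤ 3 ^ (x + y)` for `x, y ≥ 1`. The induction splits off a largest member together with all members
inside it. -/
theorem sum_solve_biUnion_le (ha : ∀ S ∈ F, a S = 3 ^ S.card) (G : Finset (Finset α)) (hG : G ⊆ F) :
    ∑ g ∈ G.biUnion id, solve F a g ≤ 3 ^ (G.biUnion id).card := by
  induction G using Finset.strongInduction with
  | H G ih =>
    rcases G.eq_empty_or_nonempty with rfl | hne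
    · simp
    obtain ⟨S, hS, hmax⟩ := Finset.exists_max_image G Finset.card hne
    set G' := G.filter (Disjoint S) with hG'
    have hSne : S.Nonempty := (hfree S (hG hS)).mono (free_subset F S)
    have hSG' : S ∉ G' := by
      simp only [hG', Finset.mem_filter, not_and, disjoint_self, Finset.bot_eq_empty]
      exact fun _ => hSne.ne_empty
    have hlt : G' ⊂ G := ⟨Finset.filter_subset _ _, fun h => hSG' (h hS)⟩
    have hdisj : Disjoint S (G'.biUnion id) := by
      rw [Finset.disjoint_biUnion_right]
      exact fun T hT => (Finset.mem_filter.1 hT).2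
    have hun : G.biUnion id = S ∪ G'.biUnion id := by
      ext g
      simp only [Finset.mem_biUnion, id, Finset.mem_union]
      constructor
      · rintro ⟨T, hT, hg⟩
        rcases hF S (hG hS) T (hG hT) with h | h | h
        · rw [Finset.eq_of_subset_of_card_le h (hmax T hT)]
          exact Or.inl hg
        · exact Or.inl (h hg)
        · exact Or.inr ⟨T, Finset.mem_filter.2 ⟨hT, h⟩, hg⟩
      · rintro (h | ⟨T, hT, hg⟩)
        · exact ⟨S, hS, h⟩
        · exact ⟨T, (Finset.mem_filter.1 hT).1, hg⟩
    have ih' := ih G' hlt ((Finset.filter_subset _ _).trans hG)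
    rw [hun, Finset.sum_union hdisj, Finset.card_union_of_disjoint hdisj,
      sum_solve a hF hfree (hG hS), ha S (hG hS)]
    rcases (G'.biUnion id).eq_empty_or_nonempty with h | h
    · rw [h]
      simp
    · have h1 : (3 : ℝ) ≤ 3 ^ S.card := by
        simpa using pow_le_pow_right₀ (by norm_num : (1 : ℝ) ≤ 3) (Finset.card_pos.2 hSne)
      have h2 : (3 : ℝ) ≤ 3 ^ (G'.biUnion id).card := by
        simpa using pow_le_pow_right₀ (by norm_num : (1 : ℝ) ≤ 3) (Finset.card_pos.2 h)
      rw [pow_add]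
      nlinarith

/-- The elements of `S` that are not free form the union of the smaller members, whose mass is
bounded by `sum_solve_biUnion_le`; the rest of the mass `3 ^ S.card` is the weight. -/
theorem le_weight (ha : ∀ S ∈ F, a S = 3 ^ S.card) {S : Finset α} (hS : S ∈ F) :
    3 ^ S.card - 3 ^ (S.card - (free F S).card) ≤ weight F a S := by
  have hU : (F.filter (· ⊂ S)).biUnion id = S \ free F S := by
    ext g
    simp only [Finset.mem_biUnion, Finset.mem_filter, id, Finset.mem_sdiff, free, not_and, not_forall,
      not_not]
    constructor
    · rintro ⟨T, ⟨hT, hTS⟩, hg⟩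
      exact ⟨hTS.1 hg, fun _ => ⟨T, hT, hTS, hg⟩⟩
    · rintro ⟨hg, h⟩
      obtain ⟨T, hT, hTS, hgT⟩ := h hg
      exact ⟨T, ⟨hT, hTS⟩, hgT⟩
  have h1 := sum_solve_biUnion_le a hF hfree ha (F.filter (· ⊂ S)) (Finset.filter_subset _ _)
  rw [hU, Finset.card_sdiff_of_subset (free_subset F S)] at h1
  have h2 := Finset.sum_sdiff (f := solve F a) (free_subset F S)
  rw [sum_solve_free a hF hfree hS, sum_solve a hF hfree hS, ha S hS] at h2
  linarith

theorem weight_nonneg (ha : ∀ S ∈ F, a S = 3 ^ S.card) {S : Finset α} (hS : S ∈ F) :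
    0 ≤ weight F a S := by
  refine le_trans ?_ (le_weight a hF hfree ha hS)
  have : (3 : ℝ) ^ (S.card - (free F S).card) ≤ 3 ^ S.card :=
    pow_le_pow_right₀ (by norm_num) (Nat.sub_le _ _)
  linarith

-- The estimate behind `lt_sum_solve`: `N` is the size of a member, `f` the number of its free
-- elements, `k` the size of a proper subset and `j` the number of free elements in the subset. The
-- subset receives at least `j / f` of the weight, and this must exceed `3 ^ k`.
omit [DecidableEq α] hF hfree in
theorem numeric_bound {N f j k : ℕ} (hj : 1 ≤ j) (hjf : j ≤ f) (hf : f ≤ N) (hk : k < N)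
    (hk' : k + f ≤ N + j) : (f : ℝ) * 3 ^ k < j * (3 ^ N - 3 ^ (N - f)) := by
  obtain ⟨d, rfl⟩ := Nat.exists_eq_add_of_le hf
  rw [Nat.add_sub_cancel_left, pow_add]
  have hd : (0 : ℝ) < 3 ^ d := by positivity
  -- Division by `3 ^ d`, where `d = N - f`: the two bounds on `k` together say `k ≤ d + min (f - 1)
  -- j`.
  suffices h : (f : ℝ) * 3 ^ (min (f - 1) j) < j * (3 ^ f - 1) by
    have h2 : (3 : ℝ) ^ k ≤ 3 ^ (min (f - 1) j) * 3 ^ d := by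
      rw [← pow_add]
      exact pow_le_pow_right₀ (by norm_num) (by omega)
    calc (f : ℝ) * 3 ^ k ≤ f * (3 ^ (min (f - 1) j) * 3 ^ d) := by gcongr
      _ = (f * 3 ^ (min (f - 1) j)) * 3 ^ d := by ring
      _ < (j * (3 ^ f - 1)) * 3 ^ d := by gcongr
      _ = _ := by ring
  rcases hjf.eq_or_lt with rfl | hlt
  · obtain ⟨i, rfl⟩ := Nat.exists_eq_add_of_le hj
    rw [min_eq_left (by omega), show 1 + i - 1 = i by omega, pow_add]
    have : (1 : ℝ) ≤ 3 ^ i := one_le_pow₀ (by norm_num)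
    have h3 : (0 : ℝ) < ((1 + i : ℕ) : ℝ) := by positivity
    nlinarith
  · obtain ⟨e, rfl⟩ := Nat.exists_eq_add_of_lt hlt
    rw [min_eq_right (by omega), add_assoc, pow_add]
    -- Bernoulli's inequality for the exponent `x = f - j ≥ 1`. With it the claim reduces to `j < (2
    -- * j - 1) * 3 ^ j * x`.
    have h1 : (1 : ℝ) + 2 * ((e + 1 : ℕ) : ℝ) ≤ 3 ^ (e + 1) := by
      have := one_add_mul_le_pow (a := (2 : ℝ)) (by norm_num) (e + 1)
      norm_num at this ⊢
      linarith
    have h2 : (3 : ℝ) ≤ 3 ^ j := by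
      simpa using pow_le_pow_right₀ (by norm_num : (1 : ℝ) ≤ 3) hj
    have hj' : (1 : ℝ) ≤ j := by exact_mod_cast hj
    have he : (1 : ℝ) ≤ ((e + 1 : ℕ) : ℝ) := by
      push_cast
      have : (0 : ℝ) ≤ e := by positivity
      linarith
    push_cast at *
    set x : ℝ := (e : ℝ) + 1
    set y : ℝ := 3 ^ j
    have a1 : y * (1 + 2 * x) ≤ y * 3 ^ (e + 1) := by gcongr
    have a2 : (j : ℝ) * (y * (1 + 2 * x)) ≤ j * (y * 3 ^ (e + 1)) := by gcongr
    have a3 : (j : ℝ) * 1 < j * y * x := by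
      have : (1 : ℝ) < y * x := by nlinarith
      nlinarith
    have a4 : (j : ℝ) * y * x ≤ (2 * j - 1) * (y * x) := by
      have : 0 ≤ y * x := by positivity
      nlinarith
    nlinarith

/-- A set that has free elements of `S` and is large compared with their number has mass more than
its size requires. -/
theorem lt_sum_solve (ha : ∀ S ∈ F, a S = 3 ^ S.card) {S Q : Finset α} (hS : S ∈ F) (hQS : Q ⊂ S)
    (hQ : (Q ∩ free F S).Nonempty) : 3 ^ Q.card < ∑ g ∈ Q, solve F a g := by
  set f := (free F S).card with hf
  set j := (Q ∩ free F S).card with hj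
  have hjpos : 1 ≤ j := Finset.card_pos.2 hQ
  have hjf : j ≤ f := Finset.card_le_card Finset.inter_subset_right
  have hfN : f ≤ S.card := Finset.card_le_card (free_subset F S)
  have hk : Q.card + f ≤ S.card + j := by
    have h1 := Finset.card_union_add_card_inter Q (free F S)
    have h2 := Finset.card_le_card (Finset.union_subset hQS.1 (free_subset F S))
    omega
  have hfpos : (0 : ℝ) < f := by exact_mod_cast hjpos.trans hjf
  have h1 := numeric_bound hjpos hjf hfN (Finset.card_lt_card hQS) hk
  -- All members contribute nonnegatively, and `S` spreads its weight evenly over `f` elements, `j`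
  -- of which lie in `Q`.
  have h2 : (j : ℝ) * (weight F a S / f) ≤ ∑ g ∈ Q, solve F a g := by
    rw [sum_solve_eq]
    refine Finset.single_le_sum (f := fun S => ((Q ∩ free F S).card : ℝ) *
      (weight F a S / (free F S).card)) (fun T hT => ?_) hS
    have := weight_nonneg a hF hfree ha hT
    positivity
  refine lt_of_lt_of_le ?_ h2
  rw [mul_div_assoc', lt_div_iff₀ hfpos, mul_comm]
  refine h1.trans_le ?_
  gcongr
  exact le_weight a hF hfree ha hS

end Laminar

/-! ### Points of the cyclohedron in general position on a face -/

section Rotation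

variable {n : ℕ+}

/-- The rotation of the circle of gaps that takes the position `r` to the position `0`. -/
def rotFun (r : Fin n) (t : Fin n → ℝ) : Fin n → ℝ := fun g => t (g + r)

theorem mem_gaps_rotate {p : Fin n × Fin n} {r x : Fin n} :
    x ∈ gaps (p.1 - r, p.2 - r) ↔ x + r ∈ gaps p := by
  simp only [gaps, Finset.mem_filter, Finset.mem_univ, true_and, sub_sub_sub_cancel_right]
  rw [sub_sub_eq_add_sub]

theorem gaps_rotate (p : Fin n × Fin n) (r : Fin n) :
    gaps p = (gaps (p.1 - r, p.2 - r)).map (Equiv.addRight r).toEmbedding := by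
  ext x
  simp only [Finset.mem_map_equiv, Equiv.addRight_symm, Equiv.coe_addRight, mem_gaps_rotate,
    neg_add_cancel_right]

theorem card_gaps_rotate (p : Fin n × Fin n) (r : Fin n) :
    (gaps (p.1 - r, p.2 - r)).card = (gaps p).card := by
  rw [gaps_rotate p r, Finset.card_map]

theorem sum_gaps_rotate (p : Fin n × Fin n) (r : Fin n) (t : Fin n → ℝ) :
    ∑ k ∈ gaps (p.1 - r, p.2 - r), rotFun r t k = ∑ k ∈ gaps p, t k := by
  rw [gaps_rotate p r, Finset.sum_map]
  rfl

theorem sum_rotFun (r : Fin n) (t : Fin n → ℝ) : ∑ k, rotFun r t k = ∑ k, t k :=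
  Equiv.sum_comp (Equiv.addRight r) t

theorem rotFun_rotFun (r s : Fin n) (t : Fin n → ℝ) : rotFun r (rotFun s t) = rotFun (r + s) t := by
  funext g
  simp only [rotFun, add_assoc]

theorem rotFun_zero (t : Fin n → ℝ) : rotFun 0 t = t := by
  funext g
  simp only [rotFun, add_zero]

theorem CycBracketing.mem_rotate {b : CycBracketing n} {r : Fin n} {p : Fin n × Fin n} :
    p ∈ (b.rotate r).1 ↔ (p.1 + r, p.2 + r) ∈ b.1 := by
  constructor
  · intro h
    obtain ⟨q, hq, rfl⟩ := Finset.mem_image.1 h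
    simpa using hq
  · intro h
    exact Finset.mem_image.2 ⟨_, h, by simp⟩

theorem CycBracketing.ext {b c : CycBracketing n} (h : ∀ p, p ∈ b.1 ↔ p ∈ c.1) : b = c :=
  Subtype.ext (Finset.ext h)

theorem CycBracketing.rotate_rotate (b : CycBracketing n) (r s : Fin n) :
    (b.rotate r).rotate s = b.rotate (s + r) := by
  refine CycBracketing.ext fun p => ?_
  simp only [CycBracketing.mem_rotate, add_assoc]

theorem CycBracketing.rotate_zero (b : CycBracketing n) : b.rotate 0 = b := by
  refine CycBracketing.ext fun p => ?_
  simp only [CycBracketing.mem_rotate, add_zero]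

end Rotation

/-! ### Points in the relative interior of the faces, and dimensions of faces -/

section Center

variable {n : ℕ+} (b : CycBracketing n)

/-- The sets of gaps that belong to the brackets, and the set of all gaps. -/
def CycBracketing.family : Finset (Finset (Fin n)) := insert Finset.univ (b.1.image gaps)

theorem CycBracketing.univ_mem_family : Finset.univ ∈ b.family := Finset.mem_insert_self _ _

theorem CycBracketing.gaps_mem_family {p : Fin n × Fin n} (hp : p ∈ b.1) : gaps p ∈ b.family :=
  Finset.mem_insert_of_mem (Finset.mem_image_of_mem _ hp)

theorem CycBracketing.family_laminar :
    ∀ S ∈ b.family, ∀ T ∈ b.family, S ⊆ T ∨ T ⊆ S ∨ Disjoint S T := by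
  intro S hS T hT
  rcases Finset.mem_insert.1 hS with rfl | hS
  · exact Or.inr (Or.inl (Finset.subset_univ _))
  rcases Finset.mem_insert.1 hT with rfl | hT
  · exact Or.inl (Finset.subset_univ _)
  obtain ⟨p, hp, rfl⟩ := Finset.mem_image.1 hS
  obtain ⟨q, hq, rfl⟩ := Finset.mem_image.1 hT
  exact (b.2.2 p hp q hq).nested_or_disjoint

/-- This is `exists_free` for the brackets strictly inside `S`; minimality of `S` among the members
that contain `Q` says that `Q` is inside none of them. -/
theorem CycBracketing.inter_free_nonempty {S Q : Finset (Fin n)} (hQ : Q.Nonempty)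
    (hQ' : Q = Finset.univ ∨ ∃ q : Fin n × Fin n, Q = gaps q) (hQS : Q ⊆ S)
    (hmin : ∀ T ∈ b.family, T ⊂ S → ¬ Q ⊆ T) : (Q ∩ Laminar.free b.family S).Nonempty := by
  obtain ⟨g, hg, hg'⟩ := exists_free (C := b.1.filter fun c => gaps c ⊂ S)
    (fun c hc => b.2.1 c (Finset.mem_filter.1 hc).1)
    (fun c hc d hd => b.2.2 c (Finset.mem_filter.1 hc).1 d (Finset.mem_filter.1 hd).1) hQ hQ'
    (fun c hc => hmin _ (b.gaps_mem_family (Finset.mem_filter.1 hc).1) (Finset.mem_filter.1 hc).2)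
  refine ⟨g, Finset.mem_inter.2 ⟨hg, Laminar.mem_free.2 ⟨hQS hg, fun T hT hTS => ?_⟩⟩⟩
  rcases Finset.mem_insert.1 hT with rfl | hT
  · exact absurd (Finset.subset_univ _) hTS.2
  · obtain ⟨c, hc, rfl⟩ := Finset.mem_image.1 hT
    exact hg' c (Finset.mem_filter.2 ⟨hc, hTS⟩)

theorem CycBracketing.family_free_nonempty :
    ∀ S ∈ b.family, (Laminar.free b.family S).Nonempty := by
  intro S hS
  have h : S.Nonempty ∧ (S = Finset.univ ∨ ∃ q : Fin n × Fin n, S = gaps q) := by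
    rcases Finset.mem_insert.1 hS with rfl | hS
    · exact ⟨Finset.univ_nonempty, Or.inl rfl⟩
    · obtain ⟨c, hc, rfl⟩ := Finset.mem_image.1 hS
      exact ⟨gaps_nonempty (b.2.1 c hc), Or.inr ⟨c, rfl⟩⟩
  exact (b.inter_free_nonempty h.1 h.2 (Finset.Subset.refl _) fun T _ hTS => hTS.2).mono
    Finset.inter_subset_right

/-- A point in the interior of a face. -/
noncomputable def CycBracketing.center₀ : Fin n → ℝ :=
  Laminar.solve b.family fun S => 3 ^ S.card

theorem CycBracketing.sum_center₀ : ∑ k, b.center₀ k = 3 ^ (n : ℕ) := by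
  have := Laminar.sum_solve (fun S => 3 ^ S.card) b.family_laminar b.family_free_nonempty
    b.univ_mem_family
  rwa [Finset.card_univ, Fintype.card_fin] at this

theorem CycBracketing.center₀_eq {p : Fin n × Fin n} (hp : p ∈ b.1) :
    ∑ k ∈ gaps p, b.center₀ k = 3 ^ (gaps p).card :=
  Laminar.sum_solve (fun S => 3 ^ S.card) b.family_laminar b.family_free_nonempty
    (b.gaps_mem_family hp)

/-- Let `S` be a smallest member that contains `gaps p`. The inclusion is proper because `p` is not
a bracket of `b`, and by minimality `gaps p` contains a free gap of `S`, so `lt_sum_solve` applies.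
-/
theorem CycBracketing.lt_center₀ {p : Fin n × Fin n} (hp : p.1 ≠ p.2) (hpb : p ∉ b.1) :
    3 ^ (gaps p).card < ∑ k ∈ gaps p, b.center₀ k := by
  obtain ⟨S, hS, hmin⟩ := Finset.exists_min_image (b.family.filter (gaps p ⊆ ·)) Finset.card
    ⟨_, Finset.mem_filter.2 ⟨b.univ_mem_family, Finset.subset_univ _⟩⟩
  obtain ⟨hS, hpS⟩ := Finset.mem_filter.1 hS
  refine Laminar.lt_sum_solve _ b.family_laminar b.family_free_nonempty (fun _ _ => rfl) hS
    (hpS.ssubset_of_ne ?_) (b.inter_free_nonempty (gaps_nonempty hp) (Or.inr ⟨p, rfl⟩) hpS ?_)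
  · rintro rfl
    rcases Finset.mem_insert.1 hS with h | h
    · exact gaps_ne_univ h
    · obtain ⟨q, hq, hqp⟩ := Finset.mem_image.1 h
      exact hpb (gaps_injective hp hqp.symm ▸ hq)
  · intro T hT hTS hpT
    exact absurd (hmin T (Finset.mem_filter.2 ⟨hT, hpT⟩)) (not_le.2 (Finset.card_lt_card hTS))

/-- A point in the interior of a face, defined as an average over rotations. -/
noncomputable def CycBracketing.center : Fin n → ℝ :=
  ((n : ℕ) : ℝ)⁻¹ • ∑ r, rotFun (-r) (b.rotate r).center₀

theorem CycBracketing.sum_rotFun_center₀ (p : Fin n × Fin n) (r : Fin n) :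
    ∑ k ∈ gaps p, rotFun (-r) (b.rotate r).center₀ k =
      ∑ k ∈ gaps (p.1 - r, p.2 - r), (b.rotate r).center₀ k := by
  rw [← sum_gaps_rotate p r, rotFun_rotFun, add_neg_cancel, rotFun_zero]

theorem CycBracketing.mem_rotate_sub {p : Fin n × Fin n} {r : Fin n} :
    (p.1 - r, p.2 - r) ∈ (b.rotate r).1 ↔ p ∈ b.1 := by
  simp [CycBracketing.mem_rotate]

theorem CycBracketing.sum_center_gaps (p : Fin n × Fin n) :
    ∑ k ∈ gaps p, b.center k = ((n : ℕ) : ℝ)⁻¹ *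
      ∑ r, ∑ k ∈ gaps (p.1 - r, p.2 - r), (b.rotate r).center₀ k := by
  simp only [CycBracketing.center, Pi.smul_apply, Finset.sum_apply, smul_eq_mul]
  rw [← Finset.mul_sum, Finset.sum_comm]
  simp only [sum_rotFun_center₀]

theorem CycBracketing.sum_center : ∑ k, b.center k = 3 ^ (n : ℕ) := by
  have hn : ((n : ℕ) : ℝ) ≠ 0 := by exact_mod_cast n.pos.ne'
  simp only [CycBracketing.center, Pi.smul_apply, Finset.sum_apply, smul_eq_mul]
  rw [← Finset.mul_sum, Finset.sum_comm]
  simp only [sum_rotFun, CycBracketing.sum_center₀]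
  simp [hn]

theorem CycBracketing.center_eq {p : Fin n × Fin n} (hp : p ∈ b.1) :
    ∑ k ∈ gaps p, b.center k = 3 ^ (gaps p).card := by
  have hn : ((n : ℕ) : ℝ) ≠ 0 := by exact_mod_cast n.pos.ne'
  rw [b.sum_center_gaps]
  simp only [(b.rotate _).center₀_eq (b.mem_rotate_sub.2 hp), card_gaps_rotate]
  simp [hn]

/-- Each term of the average satisfies the strict inequality for the rotated bracket. Later
arguments use only that the center is tight at the brackets of `b` and strict at all others. -/
theorem CycBracketing.lt_center {p : Fin n × Fin n} (hp : p.1 ≠ p.2) (hpb : p ∉ b.1) :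
    3 ^ (gaps p).card < ∑ k ∈ gaps p, b.center k := by
  have hn : (0 : ℝ) < ((n : ℕ) : ℝ) := by exact_mod_cast n.pos
  rw [b.sum_center_gaps, inv_mul_eq_div, lt_div_iff₀ hn]
  have h : ∀ r : Fin n, (3 : ℝ) ^ (gaps p).card <
      ∑ k ∈ gaps (p.1 - r, p.2 - r), (b.rotate r).center₀ k := by
    intro r
    rw [← card_gaps_rotate p r]
    exact (b.rotate r).lt_center₀ (by simpa using hp) (by rwa [b.mem_rotate_sub])
  have h2 := Finset.sum_lt_sum_of_nonempty (Finset.univ_nonempty (α := Fin n)) fun r _ => h r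
  rw [Finset.sum_const, Finset.card_univ, Fintype.card_fin, nsmul_eq_mul] at h2
  linarith

theorem CycBracketing.center_eq_iff {p : Fin n × Fin n} (hp : p.1 ≠ p.2) :
    ∑ k ∈ gaps p, b.center k = 3 ^ (gaps p).card ↔ p ∈ b.1 :=
  ⟨fun h => by_contra fun h' => (b.lt_center hp h').ne' h, b.center_eq⟩

theorem CycBracketing.center_mem : b.center ∈ polyW n := by
  refine ⟨b.sum_center, fun p hp => ?_⟩
  by_cases h : p ∈ b.1
  · exact (b.center_eq h).ge
  · exact (b.lt_center hp h).le

theorem CycBracketing.card_family : b.family.card = b.1.card + 1 := by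
  rw [CycBracketing.family, Finset.card_insert_of_notMem, Finset.card_image_of_injOn]
  · intro p hp q _ h
    exact gaps_injective (b.2.1 p hp) h
  · intro h
    obtain ⟨p, _, hp⟩ := Finset.mem_image.1 h
    exact gaps_ne_univ hp

/-- The values of the functionals that are constant on a face. -/
noncomputable def CycBracketing.constraints : (Fin n → ℝ) →ₗ[ℝ] (b.family → ℝ) where
  toFun t S := ∑ k ∈ S.1, t k
  map_add' _ _ := funext fun _ => Finset.sum_add_distrib
  map_smul' _ _ := funext fun _ => (Finset.mul_sum _ _ _).symm

/-- Since `Laminar.solve` realizes arbitrary values on the members of the family, the functionals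
that are constant on a face are linearly independent. This gives the dimension of the face. -/
theorem CycBracketing.constraints_surjective : Function.Surjective b.constraints := by
  intro a
  refine ⟨Laminar.solve b.family fun S => if h : S ∈ b.family then a ⟨S, h⟩ else 0,
    funext fun S => ?_⟩
  have := Laminar.sum_solve (fun S => if h : S ∈ b.family then a ⟨S, h⟩ else 0)
    b.family_laminar b.family_free_nonempty S.2
  rwa [dif_pos S.2] at this

theorem CycBracketing.finrank_ker :
    Module.finrank ℝ (LinearMap.ker b.constraints) + (b.1.card + 1) = n := by
  have h := b.constraints.finrank_range_add_finrank_ker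
  rw [LinearMap.range_eq_top.2 b.constraints_surjective, finrank_top] at h
  simp only [Module.finrank_fintype_fun_eq_card, Fintype.card_coe, Fintype.card_fin,
    b.card_family] at h
  omega

/-- Guarantees that the subtraction `n - 1 - b.1.card` in the dimension of a cell is not truncated.
-/
theorem CycBracketing.card_lt : b.1.card < n := by
  have := b.finrank_ker
  omega

end Center

/-! ### The smallest face that contains a point, and faces as balls -/

section Carrier

variable {n : ℕ+}

/-- A single gap is a proper cyclic interval if `n ≥ 2`, which gives `t g ≥ 3`; for `n = 1` the only
coordinate is the total sum. -/
theorem polyW_sum_pos {t : Fin n → ℝ} (ht : t ∈ polyW n) (g : Fin n) : 0 < t g := by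
  by_cases hn : (n : ℕ) = 1
  · have h1 := ht.1
    have hg : ∀ k : Fin n, k = g := fun k => Fin.ext (by have := k.2; have := g.2; omega)
    rw [Fintype.sum_eq_single g fun k hk => absurd (hg k) hk] at h1
    rw [h1]
    positivity
  · have hn' := n.pos
    have h1 := ht.2 (g, g + 1) (by
      intro h
      have h' : (1 : Fin n) = 0 := by simpa using h
      have := congrArg Fin.val h'
      rw [Fin.val_one', Fin.val_zero, Nat.mod_eq_of_lt (by omega)] at this
      omega)
    have h2 : gaps (g, g + 1) = {g} := by
      ext x
      simp only [gaps, add_sub_cancel_left, Finset.mem_filter, Finset.mem_univ, true_and,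
        Finset.mem_singleton]
      rw [← sub_eq_zero (a := x), Fin.lt_def, Fin.ext_iff, Fin.val_one', Fin.val_zero,
        Nat.mod_eq_of_lt (by omega)]
      omega
    rw [h2] at h1
    simp only [Finset.card_singleton, pow_one, Finset.sum_singleton] at h1
    linarith

/-- If the brackets were incompatible, the union of their gaps would be an interval or everything,
and larger than each of the two sets. Its sum is then at least `3 ^ card` of the union, but by
positivity at most the sum of two powers, each at most a third of that. -/
theorem compatible_of_tight {t : Fin n → ℝ} (ht : t ∈ polyW n) {p q : Fin n × Fin n}
    (hp : p.1 ≠ p.2) (hq : q.1 ≠ q.2) (hp' : ∑ k ∈ gaps p, t k = 3 ^ (gaps p).card)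
    (hq' : ∑ k ∈ gaps q, t k = 3 ^ (gaps q).card) : Compatible p q := by
  by_contra h
  have h1 : ¬ gaps p ⊆ gaps q := fun h' => h (Or.inl h')
  have h2 : ¬ gaps q ⊆ gaps p := fun h' => h (Or.inr (Or.inl h'))
  have hun : (3 : ℝ) ^ (gaps p ∪ gaps q).card ≤ ∑ k ∈ gaps p ∪ gaps q, t k := by
    rcases exists_union_of_not_compatible hp hq h with h' | ⟨r, hr, h'⟩
    · rw [h', ht.1]
      simp
    · rw [← h']
      exact ht.2 r hr
  have hle : ∑ k ∈ gaps p ∪ gaps q, t k ≤ ∑ k ∈ gaps p, t k + ∑ k ∈ gaps q, t k := by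
    rw [← Finset.sum_union_inter]
    exact le_add_of_nonneg_right (Finset.sum_nonneg fun k _ => (polyW_sum_pos ht k).le)
  have c1 : (gaps p).card + 1 ≤ (gaps p ∪ gaps q).card :=
    Finset.card_lt_card ⟨Finset.subset_union_left, fun h' =>
      h2 (Finset.subset_union_right.trans h')⟩
  have c2 : (gaps q).card + 1 ≤ (gaps p ∪ gaps q).card :=
    Finset.card_lt_card ⟨Finset.subset_union_right, fun h' =>
      h1 (Finset.subset_union_left.trans h')⟩
  have e1 := pow_le_pow_right₀ (by norm_num : (1 : ℝ) ≤ 3) c1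
  have e2 := pow_le_pow_right₀ (by norm_num : (1 : ℝ) ≤ 3) c2
  rw [pow_succ] at e1 e2
  have e3 : (0 : ℝ) < 3 ^ (gaps p ∪ gaps q).card := by positivity
  rw [hp', hq'] at hle
  linarith

open Classical in
/-- The brackets whose inequalities are equalities at a point. -/
noncomputable def carrierW (t : polyW n) : CycBracketing n :=
  ⟨Finset.univ.filter fun p => p.1 ≠ p.2 ∧ ∑ k ∈ gaps p, t.1 k = 3 ^ (gaps p).card,
    fun _ hp => (Finset.mem_filter.1 hp).2.1, fun _ hp _ hq =>
      compatible_of_tight t.2 (Finset.mem_filter.1 hp).2.1 (Finset.mem_filter.1 hq).2.1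
        (Finset.mem_filter.1 hp).2.2 (Finset.mem_filter.1 hq).2.2⟩

theorem mem_carrierW {t : polyW n} {p : Fin n × Fin n} :
    p ∈ (carrierW t).1 ↔ p.1 ≠ p.2 ∧ ∑ k ∈ gaps p, t.1 k = 3 ^ (gaps p).card := by
  simp [carrierW]

/-- Closed cells are preimages of principal lower sets under the carrier; later arguments use faces
in this form. -/
theorem mem_faceW_iff {t : polyW n} {b : CycBracketing n} : t ∈ faceW b ↔ carrierW t ≤ b :=
  ⟨fun h p hp => mem_carrierW.2 ⟨b.2.1 p hp, h p hp⟩, fun h _ hp => (mem_carrierW.1 (h hp)).2⟩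

/-- The chosen point in the interior of a face. -/
noncomputable def centerW (b : CycBracketing n) : polyW n := ⟨b.center, b.center_mem⟩

theorem carrierW_centerW (b : CycBracketing n) : carrierW (centerW b) = b := by
  refine CycBracketing.ext fun p => ?_
  rw [mem_carrierW]
  constructor
  · rintro ⟨h1, h2⟩
    exact (b.center_eq_iff h1).1 h2
  · intro h
    exact ⟨b.2.1 p h, b.center_eq h⟩

theorem convex_polyW : Convex ℝ (polyW n) := by
  intro x hx y hy a c ha hc hac
  constructor
  · simp only [Pi.add_apply, Pi.smul_apply, smul_eq_mul, Finset.sum_add_distrib, ← Finset.mul_sum,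
      hx.1, hy.1]
    rw [← add_mul, hac, one_mul]
  · intro p hp
    simp only [Pi.add_apply, Pi.smul_apply, smul_eq_mul, Finset.sum_add_distrib, ← Finset.mul_sum]
    have h1 := mul_le_mul_of_nonneg_left (hx.2 p hp) ha
    have h2 := mul_le_mul_of_nonneg_left (hy.2 p hp) hc
    have h3 : (3 : ℝ) ^ (gaps p).card = a * 3 ^ (gaps p).card + c * 3 ^ (gaps p).card := by
      rw [← add_mul, hac, one_mul]
    linarith

theorem polyW_le {t : Fin n → ℝ} (ht : t ∈ polyW n) (g : Fin n) : t g ≤ 3 ^ (n : ℕ) := by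
  rw [← ht.1]
  exact Finset.single_le_sum (fun k _ => (polyW_sum_pos ht k).le) (Finset.mem_univ g)

theorem isCompact_polyW : IsCompact (polyW n) := by
  refine Metric.isCompact_of_isClosed_isBounded ?_ ?_
  · simp only [polyW, ne_eq, Set.ofPred_and, Set.ofPred_forall]
    refine IsClosed.inter (isClosed_eq (by fun_prop) continuous_const) ?_
    exact isClosed_iInter fun p => isClosed_iInter fun _ =>
      isClosed_le continuous_const (by fun_prop)
  · refine (Metric.isBounded_Icc (0 : Fin n → ℝ) (fun _ => 3 ^ (n : ℕ))).subset fun t ht => ?_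
    exact ⟨fun g => (polyW_sum_pos ht g).le, fun g => polyW_le ht g⟩

theorem isClosed_faceW (b : CycBracketing n) : IsClosed (faceW b) := by
  simp only [faceW, Set.ofPred_forall]
  exact isClosed_iInter fun p => isClosed_iInter fun _ =>
    isClosed_eq (by fun_prop) continuous_const

/-- Each face is a ball, with the points of smaller faces as its boundary. -/
theorem exists_ball_faceW (b : CycBracketing n) {d : ℕ} (hd : d = (n : ℕ) - 1 - b.1.card) :
    ∃ χ : (Fin d → ℝ) → (Fin n → ℝ), Continuous χ ∧ Function.Injective χ ∧
      χ '' Metric.closedBall 0 1 = Subtype.val '' faceW b ∧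
      χ '' Metric.ball 0 1 = Subtype.val '' {t | carrierW t = b} := by
  have hfr : Module.finrank ℝ (Fin d → ℝ) = Module.finrank ℝ (LinearMap.ker b.constraints) := by
    have := b.finrank_ker
    rw [Module.finrank_fin_fun]
    omega
  let e := LinearEquiv.ofFinrankEq _ _ hfr
  -- An affine parametrization of the affine hull of the face, with the center of the face at the
  -- origin.
  let A : (Fin d → ℝ) → (Fin n → ℝ) := fun v => b.center + (e v : Fin n → ℝ)
  have hAc : Continuous A := continuous_const.add
    (continuous_subtype_val.comp (LinearMap.continuous_of_finiteDimensional e.toLinearMap))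
  have hAi : Function.Injective A := fun v w h =>
    e.injective (Subtype.ext (add_left_cancel h))
  have hker : ∀ v S, S ∈ b.family → ∑ k ∈ S, (e v : Fin n → ℝ) k = 0 := fun v S hS =>
    congrFun (LinearMap.mem_ker.1 (e v).2) ⟨S, hS⟩
  have hAr : ∀ t : Fin n → ℝ, ∑ k, t k = 3 ^ (n : ℕ) →
      (∀ p ∈ b.1, ∑ k ∈ gaps p, t k = 3 ^ (gaps p).card) → ∃ v, A v = t := by
    intro t h1 h2
    have hmem : t - b.center ∈ LinearMap.ker b.constraints := by
      rw [LinearMap.mem_ker]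
      funext ⟨S, hS⟩
      change ∑ k ∈ S, (t k - b.center k) = 0
      rw [Finset.sum_sub_distrib]
      rcases Finset.mem_insert.1 hS with rfl | hS
      · rw [h1, b.sum_center, sub_self]
      · obtain ⟨p, hp, rfl⟩ := Finset.mem_image.1 hS
        rw [h2 p hp, b.center_eq hp, sub_self]
    exact ⟨e.symm ⟨_, hmem⟩, by simp [A]⟩
  have hA1 : ∀ v, ∑ k, A v k = 3 ^ (n : ℕ) := by
    intro v
    simp only [A, Pi.add_apply, Finset.sum_add_distrib]
    rw [hker v _ b.univ_mem_family, b.sum_center, add_zero]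
  have hA2 : ∀ v, ∀ p ∈ b.1, ∑ k ∈ gaps p, A v k = 3 ^ (gaps p).card := by
    intro v p hp
    simp only [A, Pi.add_apply, Finset.sum_add_distrib]
    rw [hker v _ (b.gaps_mem_family hp), b.center_eq hp, add_zero]
  set s : Set (Fin d → ℝ) := A ⁻¹' polyW n with hs
  set o : Set (Fin d → ℝ) := {v | ∀ p : Fin n × Fin n, p.1 ≠ p.2 → p ∉ b.1 →
    3 ^ (gaps p).card < ∑ k ∈ gaps p, A v k} with ho
  have hso : o ⊆ s := by
    intro v hv
    refine ⟨hA1 v, fun p hp => ?_⟩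
    by_cases h : p ∈ b.1
    · exact (hA2 v p h).ge
    · exact (hv p hp h).le
  have hoo : IsOpen o := by
    simp only [ho, Set.ofPred_forall]
    refine isOpen_iInter_of_finite fun p => isOpen_iInter_of_finite fun _ =>
      isOpen_iInter_of_finite fun _ => isOpen_lt continuous_const ?_
    exact continuous_finsetSum _ fun k _ => (continuous_apply k).comp hAc
  have hsc : IsClosed s := isCompact_polyW.isClosed.preimage hAc
  have hconv : Convex ℝ s := by
    let A' : (Fin d → ℝ) →ᵃ[ℝ] (Fin n → ℝ) := AffineMap.const ℝ (Fin d → ℝ) b.center +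
      ((LinearMap.ker b.constraints).subtype.comp e.toLinearMap).toAffineMap
    exact Convex.affine_preimage A' convex_polyW
  have h0 : (0 : Fin d → ℝ) ∈ o := by
    intro p hp hpb
    simpa [A] using b.lt_center hp hpb
  have hint : interior s = o := by
    refine Set.Subset.antisymm (fun v hv p hp hpb => ?_) (interior_maximal hso hoo)
    -- For an interior point `v`, some `c • v` with `c > 1` still belongs to `s`. Since the
    -- inequality is strict at the origin and weak at `c • v`, it is strict at `v`.
    have hcont : Filter.Tendsto (fun c : ℝ => c • v) (𝓝[>] 1) (𝓝 v) := by
      have : Filter.Tendsto (fun c : ℝ => c • v) (𝓝 1) (𝓝 ((1 : ℝ) • v)) :=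
        (continuous_id.smul continuous_const).continuousAt
      rw [one_smul] at this
      exact this.mono_left nhdsWithin_le_nhds
    obtain ⟨c, hc, hc1⟩ := ((hcont.eventually (mem_interior_iff_mem_nhds.1 hv)).and
      self_mem_nhdsWithin).exists
    have hc' := hc.2 p hp
    have hc1' : (1 : ℝ) < c := hc1
    have h0' := b.lt_center hp hpb
    simp only [A, Pi.add_apply, Finset.sum_add_distrib, map_smul, SetLike.val_smul, Pi.smul_apply,
      smul_eq_mul, ← Finset.mul_sum] at hc' ⊢
    nlinarith
  have hbd : Bornology.IsBounded s := by
    let B : (LinearMap.ker b.constraints) →ₗ[ℝ] (Fin d → ℝ) := e.symm.toLinearMap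
    have h1 : s ⊆ B '' (Subtype.val ⁻¹' ((fun t => t - b.center) '' polyW n)) := by
      intro v hv
      exact ⟨e v, ⟨A v, hv, by simp [A]⟩, by simp [B]⟩
    refine IsCompact.isBounded (IsCompact.image ?_ (LinearMap.continuous_of_finiteDimensional B)) |>.subset h1
    refine Topology.IsClosedEmbedding.isCompact_preimage
      (Submodule.closed_of_finiteDimensional
      (LinearMap.ker b.constraints : Submodule ℝ (Fin n → ℝ))).isClosedEmbedding_subtypeVal ?_
    exact isCompact_polyW.image (continuous_id.sub continuous_const)
  -- A bounded convex set with interior points is carried to the unit ball by a homeomorphism of the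
  -- ambient space; here the norm is the sup norm.
  obtain ⟨H, hH1, hH2, -⟩ := exists_homeomorph_image_interior_closure_frontier_eq_unitBall hconv
    (hint ▸ ⟨0, h0⟩) hbd
  have hHs : ∀ u : Set (Fin d → ℝ), H.symm '' (H '' u) = u := H.toEquiv.symm_image_image
  rw [hsc.closure_eq] at hH2
  rw [hint] at hH1
  refine ⟨A ∘ H.symm, hAc.comp H.symm.continuous, hAi.comp H.symm.injective, ?_, ?_⟩
  · rw [Set.image_comp, ← hH2, hHs]
    ext t
    constructor
    · rintro ⟨v, hv, rfl⟩
      exact ⟨⟨A v, hv⟩, hA2 v, rfl⟩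
    · rintro ⟨t, ht, rfl⟩
      obtain ⟨v, hv⟩ := hAr t.1 t.2.1 ht
      exact ⟨v, (congrArg (· ∈ polyW n) hv).mpr t.2, hv⟩
  · rw [Set.image_comp, ← hH1, hHs]
    ext t
    constructor
    · rintro ⟨v, hv, rfl⟩
      refine ⟨⟨A v, hso hv⟩, CycBracketing.ext fun p => ?_, rfl⟩
      rw [mem_carrierW]
      refine ⟨fun h => by_contra fun h' => (hv p h.1 h').ne' h.2, fun h => ⟨b.2.1 p h, hA2 v p h⟩⟩
    · rintro ⟨t, ht, rfl⟩
      obtain ⟨v, hv⟩ := hAr t.1 t.2.1 (mem_faceW_iff.2 (le_of_eq ht))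
      refine ⟨v, fun p hp hpb => ?_, hv⟩
      rw [hv]
      refine lt_of_le_of_ne (t.2.2 p hp) fun h => hpb ?_
      rw [← show carrierW t = b from ht]
      exact mem_carrierW.2 ⟨hp, h.symm⟩

end Carrier

/-! ### Step functions with values in a partially ordered set -/

section Profiles

open MeasureTheory

/-- The length of the part of a set that is in the unit interval. -/
noncomputable abbrev unitMeasure : Measure ℝ := volume.restrict (Ioc 0 1)

theorem unitMeasure_Ioc {s : ℝ} (hs : s ∈ Ioc (0 : ℝ) 1) : unitMeasure.real (Ioc 0 s) = s := by
  rw [measureReal_restrict_apply measurableSet_Ioc, inter_eq_left.2 (Ioc_subset_Ioc_right hs.2),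
    Real.volume_real_Ioc_of_le hs.1.le, sub_zero]

theorem le_unitMeasure_of_mem {S : Set ℝ} (hS : IsLowerSet S) {s : ℝ} (hs : s ∈ Ioc (0 : ℝ) 1)
    (h : s ∈ S) : s ≤ unitMeasure.real S := by
  rw [← unitMeasure_Ioc hs]
  refine (unitMeasure_Ioc hs).le.trans ?_
  conv_lhs => rw [← unitMeasure_Ioc hs]
  exact measureReal_mono fun u hu => hS hu.2 h

theorem unitMeasure_le_of_notMem {S : Set ℝ} (hS : IsLowerSet S) {s : ℝ} (hs : s ∈ Ioc (0 : ℝ) 1)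
    (h : s ∉ S) : unitMeasure.real S ≤ s := by
  conv_rhs => rw [← unitMeasure_Ioc hs]
  have hmeas : unitMeasure.real S = unitMeasure.real (S ∩ Ioc 0 1) := by
    rw [measureReal_restrict_apply' measurableSet_Ioc, measureReal_restrict_apply' measurableSet_Ioc,
      inter_assoc, inter_self]
  rw [hmeas]
  refine measureReal_mono fun u hu => ⟨hu.2.1, ?_⟩
  by_contra hlt
  exact h (hS (not_le.1 hlt).le hu.1)

variable {P : Type}

theorem measurableSet_fiber [PartialOrder P] (φ : ℝ →o P) (p : P) : MeasurableSet {s | φ s = p} := by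
  refine Set.OrdConnected.measurableSet ⟨fun x hx y hy z hz => ?_⟩
  exact le_antisymm ((φ.monotone hz.2).trans hy.le) (hx.ge.trans (φ.monotone hz.1))

/-- The length of the part of the unit interval where a step function has a given value. -/
noncomputable def mass (φ : ℝ → P) (p : P) : ℝ := unitMeasure.real {s | φ s = p}

theorem mass_nonneg (φ : ℝ → P) (p : P) : 0 ≤ mass φ p := measureReal_nonneg

theorem mass_congr {φ ψ : ℝ → P} (h : φ =ᵐ[unitMeasure] ψ) (p : P) : mass φ p = mass ψ p := by
  refine measureReal_congr (Filter.eventuallyEq_set.2 ?_)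
  filter_upwards [h] with s hs
  rw [hs]

theorem mass_ne_zero_imp {φ : ℝ → P} {p : P} (h : mass φ p ≠ 0) :
    ∃ s ∈ Ioc (0 : ℝ) 1, φ s = p := by
  by_contra! hcon
  refine h ?_
  rw [mass, measureReal_restrict_apply' measurableSet_Ioc]
  have : {s | φ s = p} ∩ Ioc 0 1 = ∅ := by
    ext s
    simp only [mem_inter_iff, mem_ofPred_eq, mem_empty_iff_false, iff_false, not_and]
    exact fun h1 h2 => hcon s h2 h1
  rw [this, measureReal_empty]

variable [PartialOrder P]

section

variable [Fintype P]

theorem measure_preimage_eq_sum (φ : ℝ →o P) (Q : P → Prop) [DecidablePred Q] :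
    unitMeasure.real {s | Q (φ s)} = ∑ p with Q p, mass φ p := by
  have h : {s | Q (φ s)} = ⋃ p ∈ Finset.univ.filter Q, {s | φ s = p} := by
    ext s
    simp
  rw [h, measureReal_biUnion_finset]
  · rfl
  · intro p _ q _ hpq
    refine Set.disjoint_left.2 fun s hs hs' => hpq ?_
    exact hs.symm.trans hs'
  · exact fun p _ => measurableSet_fiber φ p

theorem sum_mass (φ : ℝ →o P) : ∑ p, mass φ p = 1 := by
  have h := measure_preimage_eq_sum φ (fun _ => True)
  simp only [Finset.filter_true] at h
  rw [← h, show {_s : ℝ | True} = univ from rfl, measureReal_restrict_apply' measurableSet_Ioc,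
    univ_inter, Real.volume_real_Ioc_of_le zero_le_one, sub_zero]

open Classical in
/-- The part of the mass below a value. -/
noncomputable def massLE (l : P → ℝ) (p : P) : ℝ := ∑ q with q ≤ p, l q

open Classical in
/-- The part of the mass strictly below a value. -/
noncomputable def massLT (l : P → ℝ) (p : P) : ℝ := ∑ q with q < p, l q

theorem massLE_eq (φ : ℝ →o P) (p : P) : massLE (mass φ) p = unitMeasure.real {s | φ s ≤ p} := by
  classical
  rw [measure_preimage_eq_sum φ (· ≤ p)]
  unfold massLE
  congr!

theorem massLT_eq (φ : ℝ →o P) (p : P) : massLT (mass φ) p = unitMeasure.real {s | φ s < p} := by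
  classical
  rw [measure_preimage_eq_sum φ (· < p)]
  unfold massLT
  congr!

/-- The sets where `φ < p` and where `φ ≤ p` are initial segments, whose lengths in the unit
interval are `massLT` and `massLE`. A parameter strictly between these lengths is in the second set
and not in the first. -/
theorem eq_of_massLT_lt (φ : ℝ →o P) {s : ℝ} (hs : s ∈ Ioc (0 : ℝ) 1) {p : P}
    (h1 : massLT (mass φ) p < s) (h2 : s < massLE (mass φ) p) : φ s = p := by
  rw [massLT_eq] at h1
  rw [massLE_eq] at h2
  have l1 : IsLowerSet {s | φ s < p} := fun x y hxy hx => (φ.monotone hxy).trans_lt hx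
  have l2 : IsLowerSet {s | φ s ≤ p} := fun x y hxy hx => (φ.monotone hxy).trans hx
  have h3 : φ s ≤ p := by
    by_contra h
    exact absurd (unitMeasure_le_of_notMem l2 hs h) (not_le.2 h2)
  have h4 : ¬ φ s < p := fun h => absurd (le_unitMeasure_of_mem l1 hs h) (not_le.2 h1)
  exact h3.eq_of_not_lt h4

/-- Monotonicity gives the weak inequalities everywhere; they can be equalities only at the finitely
many values of `massLT` and `massLE`. -/
theorem ae_between (φ : ℝ →o P) : ∀ᵐ s ∂unitMeasure, s ∈ Ioc (0 : ℝ) 1 ∧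
    massLT (mass φ) (φ s) < s ∧ s < massLE (mass φ) (φ s) := by
  have h0 : ∀ c : ℝ, ∀ᵐ s ∂unitMeasure, s ≠ c := fun c =>
    ae_restrict_of_ae (measure_eq_zero_iff_ae_notMem.1 (measure_singleton c))
  filter_upwards [ae_restrict_mem measurableSet_Ioc,
    ae_all_iff.2 fun p => h0 (massLT (mass φ) p), ae_all_iff.2 fun p => h0 (massLE (mass φ) p)]
    with s hs h1 h2
  refine ⟨hs, lt_of_le_of_ne ?_ (h1 _).symm, lt_of_le_of_ne ?_ (h2 _)⟩
  · rw [massLT_eq]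
    exact unitMeasure_le_of_notMem (fun x y hxy hx => (φ.monotone hxy).trans_lt hx) hs
      (lt_irrefl (φ s))
  · rw [massLE_eq]
    exact le_unitMeasure_of_mem (fun x y hxy hx => (φ.monotone hxy).trans hx) hs (le_refl (φ s))

/-- A monotone step function is determined, almost everywhere, by the lengths of its steps. -/
theorem ae_eq_of_mass_eq {φ ψ : ℝ →o P} (h : mass φ = mass ψ) : φ =ᵐ[unitMeasure] ψ := by
  filter_upwards [ae_between φ] with s hs
  rw [h] at hs
  exact (eq_of_massLT_lt ψ hs.1 hs.2.1 hs.2.2).symm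

/-- If the lengths of the steps depend continuously on a parameter, then almost everywhere the values
are locally constant. -/
theorem ae_eventually_eq {X : Type} [TopologicalSpace X] {φ : X → ℝ →o P}
    (h : ∀ p, Continuous fun x => mass (φ x) p) (x : X) :
    ∀ᵐ s ∂unitMeasure, ∀ᶠ y in 𝓝 x, φ y s = φ x s := by
  filter_upwards [ae_between (φ x)] with s hs
  have c1 : Continuous fun y => massLT (mass (φ y)) (φ x s) :=
    continuous_finsetSum _ fun q _ => h q
  have c2 : Continuous fun y => massLE (mass (φ y)) (φ x s) :=
    continuous_finsetSum _ fun q _ => h q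
  filter_upwards [c1.continuousAt.eventually_lt continuousAt_const hs.2.1,
    continuousAt_const.eventually_lt c2.continuousAt hs.2.2] with y h1 h2
  exact eq_of_massLT_lt (φ y) hs.1 h1 h2

end

/-- If almost everywhere the values are locally constant, then the lengths of the steps depend
continuously on a parameter. -/
theorem continuous_mass {X : Type} [TopologicalSpace X] [FirstCountableTopology X] {φ : X → ℝ →o P}
    (h : ∀ x, ∀ᵐ s ∂unitMeasure, ∀ᶠ y in 𝓝 x, φ y s = φ x s) (p : P) :
    Continuous fun x => mass (φ x) p := by
  have h1 : ∀ x, mass (φ x) p = ∫ s, ({s | φ x s = p}.indicator (fun _ => (1 : ℝ))) s ∂unitMeasure := by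
    intro x
    rw [integral_indicator (measurableSet_fiber (φ x) p)]
    simp [mass, measureReal_def]
  simp only [h1]
  rw [continuous_iff_continuousAt]
  intro x
  -- Dominated convergence for the indicator of the set where the value is `p`: for almost every `s`
  -- it is constant near `x`.
  refine continuousAt_of_dominated (bound := fun _ => 1) ?_ ?_ (integrable_const _) ?_
  · exact Filter.Eventually.of_forall fun y =>
      (measurable_const.indicator (measurableSet_fiber (φ y) p)).aestronglyMeasurable
  · refine Filter.Eventually.of_forall fun y => Filter.Eventually.of_forall fun s => ?_
    by_cases hs : φ y s = p <;> simp [Set.indicator, hs]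
  · filter_upwards [h x] with s hs
    refine (continuousAt_const (y := ({s | φ x s = p}.indicator (fun _ => (1 : ℝ))) s)).congr ?_
    filter_upwards [hs] with y hy
    by_cases hp : φ x s = p
    · rw [indicator_of_mem (show s ∈ {s | φ x s = p} from hp),
        indicator_of_mem (show s ∈ {s | φ y s = p} from hy.trans hp)]
    · rw [indicator_of_notMem (show s ∉ {s | φ x s = p} from hp),
        indicator_of_notMem (show s ∉ {s | φ y s = p} from fun h' => hp (hy.symm.trans h'))]

end Profiles

open MeasureTheory

/-- A description of the points of a space by monotone step functions with values in a partially
ordered set, as in the barycentric subdivision of a regular cell complex. -/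
structure Chart (X P : Type) [TopologicalSpace X] [PartialOrder P] [Fintype P] where
  profile : X → ℝ →o P
  pt : (ℝ →o P) → X
  carrier : X → P
  pt_profile : ∀ x, pt (profile x) = x
  profile_pt : ∀ φ, profile (pt φ) =ᵐ[unitMeasure] φ
  pt_congr : ∀ φ ψ : ℝ →o P, φ =ᵐ[unitMeasure] ψ → pt φ = pt ψ
  profile_le : ∀ x s, profile x s ≤ carrier x
  carrier_le : ∀ x p, (∀ᵐ s ∂unitMeasure, profile x s ≤ p) → carrier x ≤ p
  continuous_mass_profile : ∀ p, Continuous fun x => mass (profile x) p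
  continuous_pt : ∀ {Y : Type} [TopologicalSpace Y] (φ : Y → ℝ →o P),
    (∀ p, Continuous fun y => mass (φ y) p) → Continuous fun y => pt (φ y)

/-! ### Barycentric coordinates with respect to chains of faces: uniqueness -/

section ChainSimplex

variable {n : ℕ+}

instance (n : ℕ+) : Finite (CycBracketing n) :=
  inferInstanceAs (Finite {β : Finset (Fin n × Fin n) //
    (∀ p ∈ β, p.1 ≠ p.2) ∧ ∀ p ∈ β, ∀ q ∈ β, Compatible p q})

noncomputable instance (n : ℕ+) : Fintype (CycBracketing n) := Fintype.ofFinite _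

/-- The point of the cone over the cyclohedron with given coordinates with respect to the centers of
the faces. -/
noncomputable def combo (l : CycBracketing n → ℝ) : Fin n → ℝ := ∑ b, l b • b.center

theorem sum_combo (S : Finset (Fin n)) (l : CycBracketing n → ℝ) :
    ∑ k ∈ S, combo l k = ∑ b, l b * ∑ k ∈ S, b.center k := by
  simp only [combo, Finset.sum_apply, Pi.smul_apply, smul_eq_mul, Finset.mul_sum]
  exact Finset.sum_comm

theorem exists_top {l : CycBracketing n → ℝ} (h : l ≠ 0)
    (hchain : ∀ p q, l p ≠ 0 → l q ≠ 0 → p ≤ q ∨ q ≤ p) : ∃ b, l b ≠ 0 ∧ ∀ p, l p ≠ 0 → p ≤ b := by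
  classical
  obtain ⟨p, hp⟩ := Function.ne_iff.1 h
  obtain ⟨b, hb⟩ := (Finset.univ.filter fun p => l p ≠ 0).exists_maximal
    ⟨p, Finset.mem_filter.2 ⟨Finset.mem_univ _, hp⟩⟩
  have hb' := (Finset.mem_filter.1 hb.1).2
  refine ⟨b, hb', fun q hq => ?_⟩
  rcases hchain b q hb' hq with h | h
  · exact hb.2 (Finset.mem_filter.2 ⟨Finset.mem_univ _, hq⟩) h
  · exact h

/-- Every center satisfies the inequality of `q`, so equality for the combination forces equality at
each center that occurs, in particular at `b`. Conversely a bracket of `b` occurs in all smaller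
faces of the chain. Thus the largest face of the chain can be read off from the combination. -/
theorem mem_top_iff {l : CycBracketing n → ℝ} (hl : ∀ b, 0 ≤ l b) {b : CycBracketing n}
    (hb : l b ≠ 0) (htop : ∀ p, l p ≠ 0 → p ≤ b) {q : Fin n × Fin n} (hq : q.1 ≠ q.2) :
    q ∈ b.1 ↔ ∑ k ∈ gaps q, combo l k = (∑ p, l p) * 3 ^ (gaps q).card := by
  have hnn : ∀ p ∈ Finset.univ, 0 ≤ l p * (∑ k ∈ gaps q, p.center k - 3 ^ (gaps q).card) :=
    fun p _ => mul_nonneg (hl p) (sub_nonneg.2 (p.center_mem.2 q hq))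
  rw [sum_combo, Finset.sum_mul, ← sub_eq_zero, ← Finset.sum_sub_distrib]
  simp only [← mul_sub]
  rw [Finset.sum_eq_zero_iff_of_nonneg hnn]
  constructor
  · intro h p _
    by_cases hp : l p = 0
    · rw [hp, zero_mul]
    · rw [p.center_eq (htop p hp h), sub_self, mul_zero]
  · intro h
    have := (mul_eq_zero.1 (h b (Finset.mem_univ _))).resolve_left hb
    exact (b.center_eq_iff hq).1 (sub_eq_zero.1 this)

/-- The largest faces of both chains agree by `mem_top_iff`. Subtracting the smaller of their two
coefficients from both sides removes this face from one support, and induction on the total size of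
supports applies. Coefficients are only required to have equal sums, not sum one, so that the
subtraction is allowed. -/
theorem combo_injective (l l' : CycBracketing n → ℝ) (hl : ∀ b, 0 ≤ l b) (hl' : ∀ b, 0 ≤ l' b)
    (hchain : ∀ p q, l p ≠ 0 → l q ≠ 0 → p ≤ q ∨ q ≤ p)
    (hchain' : ∀ p q, l' p ≠ 0 → l' q ≠ 0 → p ≤ q ∨ q ≤ p)
    (hs : ∑ b, l b = ∑ b, l' b) (hc : combo l = combo l') : l = l' := by
  classical
  obtain ⟨N, hN⟩ : ∃ N, N = (Finset.univ.filter fun p => l p ≠ 0).card +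
    (Finset.univ.filter fun p => l' p ≠ 0).card := ⟨_, rfl⟩
  induction N using Nat.strong_induction_on generalizing l l' with
  | _ N ih =>
  by_cases h0 : l = 0
  · subst h0
    funext b
    simp only [Pi.zero_apply, Finset.sum_const_zero] at hs ⊢
    exact ((Finset.sum_eq_zero_iff_of_nonneg fun b _ => hl' b).1 hs.symm b (Finset.mem_univ _)).symm
  by_cases h0' : l' = 0
  · subst h0'
    funext b
    simp only [Pi.zero_apply, Finset.sum_const_zero] at hs ⊢
    exact (Finset.sum_eq_zero_iff_of_nonneg fun b _ => hl b).1 hs b (Finset.mem_univ _)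
  obtain ⟨b, hb, htop⟩ := exists_top h0 hchain
  obtain ⟨b', hb', htop'⟩ := exists_top h0' hchain'
  have hbb : b = b' := by
    refine CycBracketing.ext fun q => ?_
    by_cases hq : q.1 ≠ q.2
    · rw [mem_top_iff hl hb htop hq, mem_top_iff hl' hb' htop' hq, hc, hs]
    · exact iff_of_false (fun h => hq (b.2.1 q h)) fun h => hq (b'.2.1 q h)
  subst hbb
  -- The statement is symmetric in the two families, so the case where the top coefficient of the
  -- first is the smaller one suffices.
  have key : ∀ l l' : CycBracketing n → ℝ, (∀ b, 0 ≤ l b) → (∀ b, 0 ≤ l' b) →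
      (∀ p q, l p ≠ 0 → l q ≠ 0 → p ≤ q ∨ q ≤ p) → (∀ p q, l' p ≠ 0 → l' q ≠ 0 → p ≤ q ∨ q ≤ p) →
      ∑ b, l b = ∑ b, l' b → combo l = combo l' → N = (Finset.univ.filter fun p => l p ≠ 0).card +
      (Finset.univ.filter fun p => l' p ≠ 0).card → l b ≠ 0 → l' b ≠ 0 → l b ≤ l' b → l = l' := by
    intro l l' hl hl' hchain hchain' hs hc hN hb hb' hle
    have hsub : ∀ (f : CycBracketing n → ℝ) (c : ℝ) p, (f - Pi.single b c : CycBracketing n → ℝ) p ≠ 0 → f b ≠ 0 →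
        f p ≠ 0 := by
      intro f c p hp hfb
      by_cases h : p = b
      · rwa [h]
      · simpa [h] using hp
    have hcombo : ∀ (f : CycBracketing n → ℝ) (c : ℝ), combo (f - Pi.single b c) =
        combo f - combo (Pi.single b c) := by
      intro f c
      simp only [combo, Pi.sub_apply, sub_smul, Finset.sum_sub_distrib]
    have hnn : ∀ (f : CycBracketing n → ℝ) (c : ℝ), (∀ p, 0 ≤ f p) → c ≤ f b →
        ∀ p, 0 ≤ (f - Pi.single b c : CycBracketing n → ℝ) p := by
      intro f c hf hcf p
      by_cases h : p = b
      · subst h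
        simpa using hcf
      · simpa [h] using hf p
    have h := ih _ ?_ (l - Pi.single b (l b)) (l' - Pi.single b (l b)) (hnn l _ hl le_rfl)
      (hnn l' _ hl' hle) (fun p q hp hq => hchain p q (hsub _ _ _ hp hb) (hsub _ _ _ hq hb))
      (fun p q hp hq => hchain' p q (hsub _ _ _ hp hb') (hsub _ _ _ hq hb'))
      (by simp only [Pi.sub_apply, Finset.sum_sub_distrib, hs]) (by rw [hcombo, hcombo, hc]) rfl
    · exact sub_left_injective h
    · rw [hN]
      refine add_lt_add_of_lt_of_le (Finset.card_lt_card ?_) (Finset.card_le_card ?_)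
      · rw [Finset.ssubset_iff_of_subset]
        · refine ⟨b, Finset.mem_filter.2 ⟨Finset.mem_univ _, hb⟩, ?_⟩
          simp
        · intro p hp
          exact Finset.mem_filter.2 ⟨Finset.mem_univ _, hsub _ _ _ (Finset.mem_filter.1 hp).2 hb⟩
      · intro p hp
        exact Finset.mem_filter.2 ⟨Finset.mem_univ _, hsub _ _ _ (Finset.mem_filter.1 hp).2 hb'⟩
  rcases le_total (l b) (l' b) with hle | hle
  · exact key l l' hl hl' hchain hchain' hs hc hN hb hb' hle
  · exact (key l' l hl' hl hchain' hchain hs.symm hc.symm (by rw [hN, add_comm]) hb' hb hle).symm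

/-- The simplicial complex of chains in the poset of faces. -/
def chainSimplex (n : ℕ+) : Set (CycBracketing n → ℝ) :=
  {l | ((∀ b, 0 ≤ l b) ∧ ∑ b, l b = 1) ∧ ∀ p q, l p ≠ 0 → l q ≠ 0 → p ≤ q ∨ q ≤ p}

/-- The chain condition is closed because it says that `l p * l q = 0` for incomparable `p` and `q`.
-/
theorem isCompact_chainSimplex : IsCompact (chainSimplex n) := by
  have h : chainSimplex n = stdSimplex ℝ (CycBracketing n) ∩
      {l | ∀ p q, ¬ (p ≤ q ∨ q ≤ p) → l p * l q = 0} := by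
    ext l
    refine and_congr Iff.rfl ⟨fun h p q hpq => ?_, fun h p q hp hq => ?_⟩
    · by_contra h0
      exact hpq (h p q (left_ne_zero_of_mul h0) (right_ne_zero_of_mul h0))
    · by_contra hpq
      exact (mul_ne_zero hp hq) (h p q hpq)
  rw [h]
  refine (isCompact_stdSimplex ℝ _).inter_right ?_
  simp only [Set.ofPred_forall]
  exact isClosed_iInter fun p => isClosed_iInter fun q => isClosed_iInter fun _ =>
    isClosed_eq ((continuous_apply p).mul (continuous_apply q)) continuous_const

theorem combo_mem {l : CycBracketing n → ℝ} (hl : l ∈ chainSimplex n) : combo l ∈ polyW n :=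
  convex_polyW.sum_mem (fun b _ => hl.1.1 b) hl.1.2 fun b _ => b.center_mem

theorem continuous_combo : Continuous (combo (n := n)) :=
  continuous_finsetSum _ fun b _ => (continuous_apply b).smul continuous_const

theorem mass_mem_chainSimplex (φ : ℝ →o CycBracketing n) : mass φ ∈ chainSimplex n := by
  refine ⟨⟨mass_nonneg φ, sum_mass φ⟩, fun p q hp hq => ?_⟩
  obtain ⟨s, -, rfl⟩ := mass_ne_zero_imp hp
  obtain ⟨t, -, rfl⟩ := mass_ne_zero_imp hq
  exact (le_total s t).imp (fun h => φ.monotone h) fun h => φ.monotone h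

end ChainSimplex

/-! ### Barycentric coordinates with respect to chains of faces: existence -/

section Surjective

variable {n : ℕ+}

/-- A point that is not the center of its face is on the segment from the center to a point of a
smaller face. -/
theorem exists_radial (x : polyW n) (hx : x.1 ≠ (carrierW x).center) :
    ∃ (y : polyW n) (c : ℝ), 0 ≤ c ∧ c ≤ 1 ∧ carrierW y < carrierW x ∧
      x.1 = (1 - c) • (carrierW x).center + c • y.1 := by
  classical
  set b := carrierW x with hb
  let z : ℝ → Fin n → ℝ := fun u => b.center + u • (x.1 - b.center)
  have hz : ∀ u (S : Finset (Fin n)), ∑ k ∈ S, z u k =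
      ∑ k ∈ S, b.center k + u * (∑ k ∈ S, x.1 k - ∑ k ∈ S, b.center k) := by
    intro u S
    simp only [z, Pi.add_apply, Pi.smul_apply, Pi.sub_apply, smul_eq_mul, Finset.sum_add_distrib,
      ← Finset.mul_sum, Finset.sum_sub_distrib]
  have hz1 : ∀ u, ∑ k, z u k = 3 ^ (n : ℕ) := by
    intro u
    rw [hz, b.sum_center, x.2.1, sub_self, mul_zero, add_zero]
  have hzb : ∀ u, ∀ p ∈ b.1, ∑ k ∈ gaps p, z u k = 3 ^ (gaps p).card := by
    intro u p hp
    rw [hz, b.center_eq hp, (mem_carrierW.1 hp).2, sub_self, mul_zero, add_zero]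
  let D := Finset.univ.filter fun p : Fin n × Fin n => p.1 ≠ p.2 ∧ p ∉ b.1 ∧
    ∑ k ∈ gaps p, x.1 k < ∑ k ∈ gaps p, b.center k
  -- If no inequality became tighter along the ray from the center through `x`, the whole ray would
  -- lie in the bounded polytope.
  have hD : D.Nonempty := by
    by_contra hD
    have hall : ∀ u, 0 ≤ u → z u ∈ polyW n := by
      refine fun u hu => ⟨hz1 u, fun p hp => ?_⟩
      by_cases hpb : p ∈ b.1
      · exact (hzb u p hpb).ge
      · rw [hz]
        have h1 : ∑ k ∈ gaps p, b.center k ≤ ∑ k ∈ gaps p, x.1 k := by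
          by_contra hlt
          exact hD ⟨p, Finset.mem_filter.2 ⟨Finset.mem_univ _, hp, hpb, not_le.1 hlt⟩⟩
        have h2 := (b.lt_center hp hpb).le
        nlinarith
    obtain ⟨g, hg⟩ := Function.ne_iff.1 hx
    have hg' : 0 < |x.1 g - b.center g| := abs_pos.2 (sub_ne_zero.2 hg)
    -- At this parameter the coordinate `g` has moved by `3 ^ n + 1`, while coordinates in the
    -- polytope range in an interval of length `3 ^ n`.
    set u := (3 ^ (n : ℕ) + 1) / |x.1 g - b.center g| with hu
    have hu0 : 0 ≤ u := by positivity
    have h1 := polyW_le (hall u hu0) g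
    have h2 := (polyW_sum_pos (hall u hu0) g).le
    have h3 := polyW_le b.center_mem g
    have h4 := (polyW_sum_pos b.center_mem g).le
    have h5 : |z u g - b.center g| = 3 ^ (n : ℕ) + 1 := by
      simp only [z, Pi.add_apply, Pi.smul_apply, Pi.sub_apply, smul_eq_mul, add_sub_cancel_left]
      rw [abs_mul, abs_of_nonneg hu0, hu, div_mul_cancel₀ _ hg'.ne']
    have h6 : |z u g - b.center g| ≤ 3 ^ (n : ℕ) := abs_le.2 ⟨by linarith, by linarith⟩
    linarith
  -- `ρ p` is the parameter at which the inequality of `p` becomes an equality on the ray. At the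
  -- least of these the ray leaves the polytope, through a face with a new tight bracket.
  let ρ : Fin n × Fin n → ℝ := fun p => (∑ k ∈ gaps p, b.center k - 3 ^ (gaps p).card) /
    (∑ k ∈ gaps p, b.center k - ∑ k ∈ gaps p, x.1 k)
  obtain ⟨p₀, hp₀, hmin⟩ := Finset.exists_min_image D ρ hD
  obtain ⟨-, hp1, hp2, hp3⟩ := Finset.mem_filter.1 hp₀
  set u := ρ p₀ with hu
  have hu1 : 1 ≤ u := by
    rw [hu, one_le_div (by linarith)]
    have := x.2.2 p₀ hp1
    linarith
  have hmem : z u ∈ polyW n := by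
    refine ⟨hz1 u, fun p hp => ?_⟩
    by_cases hpb : p ∈ b.1
    · exact (hzb u p hpb).ge
    · rw [hz]
      have h2 := (b.lt_center hp hpb).le
      by_cases h1 : ∑ k ∈ gaps p, x.1 k < ∑ k ∈ gaps p, b.center k
      · have h3 := hmin p (Finset.mem_filter.2 ⟨Finset.mem_univ _, hp, hpb, h1⟩)
        have h4 : u * (∑ k ∈ gaps p, b.center k - ∑ k ∈ gaps p, x.1 k) ≤
            ∑ k ∈ gaps p, b.center k - 3 ^ (gaps p).card := by
          rwa [← le_div_iff₀ (by linarith)]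
        linarith
      · have h5 : 0 ≤ u * (∑ k ∈ gaps p, x.1 k - ∑ k ∈ gaps p, b.center k) :=
          mul_nonneg (by linarith) (by linarith)
        linarith
  refine ⟨⟨z u, hmem⟩, u⁻¹, by positivity, inv_le_one_of_one_le₀ hu1, lt_of_le_of_ne ?_ ?_, ?_⟩
  · intro p hp
    exact mem_carrierW.2 ⟨b.2.1 p hp, hzb u p hp⟩
  · intro heq
    refine hp2 (heq ▸ mem_carrierW.2 ⟨hp1, ?_⟩)
    change ∑ k ∈ gaps p₀, z u k = _
    rw [hz]
    have h4 : u * (∑ k ∈ gaps p₀, b.center k - ∑ k ∈ gaps p₀, x.1 k) =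
        ∑ k ∈ gaps p₀, b.center k - 3 ^ (gaps p₀).card := by
      rw [hu, div_mul_cancel₀]
      linarith
    linarith
  · have hu0 : u ≠ 0 := by positivity
    funext k
    simp only [z, Pi.add_apply, Pi.smul_apply, Pi.sub_apply, smul_eq_mul]
    field_simp
    ring

/-- Induction on the face that carries `x`. If `x` is not its center, it is a combination of the
center with weight `1 - c` and a point of a smaller face with weight `c`; the step function follows
the profile of that point on an initial segment of length `a * c` and is then constant. The length
`a` is arbitrary so that the induction hypothesis can be used with `a * c`. -/
theorem exists_profile (x : polyW n) {a : ℝ} (ha : 0 ≤ a) : ∃ φ : ℝ →o CycBracketing n,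
    (∀ s, φ s ≤ carrierW x) ∧
      combo (fun p => volume.real ({s | φ s = p} ∩ Ioc 0 a)) = a • x.1 := by
  classical
  obtain ⟨b, hb⟩ : ∃ b, b = carrierW x := ⟨_, rfl⟩
  induction b using WellFoundedLT.induction generalizing x a with
  | _ b ih =>
  have hstep : ∀ (c : ℝ), 0 ≤ c → c ≤ 1 → ∀ ψ : ℝ →o CycBracketing n, (∀ s, ψ s ≤ b) → ∀ v,
      combo (fun p => volume.real ({s | ψ s = p} ∩ Ioc 0 (a * c))) = v →
      ∃ φ : ℝ →o CycBracketing n, (∀ s, φ s ≤ b) ∧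
      combo (fun p => volume.real ({s | φ s = p} ∩ Ioc 0 a)) = v + (a - a * c) • b.center := by
    intro c hc hc1 ψ hψ v hv
    have hac : a * c ≤ a := mul_le_of_le_one_right ha hc1
    have hac0 : 0 ≤ a * c := mul_nonneg ha hc
    refine ⟨⟨fun s => if s ≤ a * c then ψ s else b, ?_⟩, ?_, ?_⟩
    · intro s t hst
      dsimp only
      split_ifs with h1 h2
      · exact ψ.monotone hst
      · exact hψ s
      · exact absurd (hst.trans ‹_›) h1
      · exact le_rfl
    · intro s
      change (if s ≤ a * c then ψ s else b) ≤ b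
      split_ifs
      · exact hψ s
      · exact le_rfl
    · rw [← hv]
      have hvol : ∀ p, volume.real ({s | (if s ≤ a * c then ψ s else b) = p} ∩ Ioc 0 a) =
          volume.real ({s | ψ s = p} ∩ Ioc 0 (a * c)) + if p = b then a - a * c else 0 := by
        intro p
        have hset : {s | (if s ≤ a * c then ψ s else b) = p} ∩ Ioc 0 a =
            ({s | ψ s = p} ∩ Ioc 0 (a * c)) ∪ (if p = b then Ioc (a * c) a else ∅) := by
          ext s
          simp only [mem_inter_iff, mem_union, mem_Ioc]
          constructor
          · rintro ⟨h1, h2, h3⟩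
            by_cases hs : s ≤ a * c
            · have h1' : (if s ≤ a * c then ψ s else b) = p := h1
              rw [if_pos hs] at h1'
              exact Or.inl ⟨h1', h2, hs⟩
            · have h1' : (if s ≤ a * c then ψ s else b) = p := h1
              rw [if_neg hs] at h1'
              rw [if_pos h1'.symm]
              exact Or.inr ⟨not_le.1 hs, h3⟩
          · rintro (⟨h1, h2, h3⟩ | h)
            · refine ⟨?_, h2, h3.trans hac⟩
              change (if s ≤ a * c then ψ s else b) = p
              rw [if_pos h3]
              exact h1
            · split_ifs at h with hp
              · refine ⟨?_, hac0.trans_lt h.1, h.2⟩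
                change (if s ≤ a * c then ψ s else b) = p
                rw [if_neg (not_le.2 h.1), hp]
              · exact absurd h (notMem_empty _)
        rw [hset, measureReal_union ?_ ?_ ?_ ?_]
        · congr 1
          split_ifs
          · exact Real.volume_real_Ioc_of_le hac
          · exact measureReal_empty
        · refine Set.disjoint_left.2 fun s hs hs' => ?_
          split_ifs at hs'
          · exact absurd hs.2.2 (not_le.2 hs'.1)
          · exact absurd hs' (notMem_empty _)
        · split_ifs
          · exact measurableSet_Ioc
          · exact MeasurableSet.empty
        · exact ((measure_mono inter_subset_right).trans_lt measure_Ioc_lt_top).ne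
        · split_ifs
          · exact measure_Ioc_lt_top.ne
          · simp
      change combo (fun p => volume.real ({s | (if s ≤ a * c then ψ s else b) = p} ∩ Ioc 0 a)) = _
      simp only [hvol]
      unfold combo
      simp only [add_smul, Finset.sum_add_distrib, ite_smul, zero_smul, Finset.sum_ite_eq',
        Finset.mem_univ, if_true]
  by_cases hx : x.1 = b.center
  · obtain ⟨φ, h1, h2⟩ := hstep 0 le_rfl zero_le_one ⟨fun _ => b, fun _ _ _ => le_rfl⟩
      (fun _ => le_rfl) 0 (by
        unfold combo
        simp)
    refine ⟨φ, hb ▸ h1, ?_⟩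
    rw [h2, hx]
    simp
  · obtain ⟨y, c, hc, hc1, hy, he⟩ := exists_radial x (hb ▸ hx)
    obtain ⟨ψ, h1, h2⟩ := ih (carrierW y) (hb ▸ hy) y (mul_nonneg ha hc) rfl
    obtain ⟨φ, h3, h4⟩ := hstep c hc hc1 ψ (fun s => (h1 s).trans (hb ▸ hy.le)) _ h2
    refine ⟨φ, hb ▸ h3, ?_⟩
    rw [h4, he, ← hb]
    simp only [smul_add, smul_smul, mul_sub, mul_one]
    rw [add_comm]

end Surjective

/-! ### Points of the cyclohedron as step functions -/

section ChartW

variable {n : ℕ+}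

theorem exists_profileW (x : polyW n) : ∃ φ : ℝ →o CycBracketing n,
    (∀ s, φ s ≤ carrierW x) ∧ combo (mass φ) = x.1 := by
  obtain ⟨φ, h1, h2⟩ := exists_profile x zero_le_one
  refine ⟨φ, h1, ?_⟩
  rw [one_smul] at h2
  rw [← h2]
  congr 1
  funext p
  exact measureReal_restrict_apply' measurableSet_Ioc

theorem mass_eq_of_combo_eq {φ ψ : ℝ →o CycBracketing n} (h : combo (mass φ) = combo (mass ψ)) :
    mass φ = mass ψ := by
  have h1 := mass_mem_chainSimplex φ
  have h2 := mass_mem_chainSimplex ψ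
  exact combo_injective _ _ h1.1.1 h2.1.1 h1.2 h2.2 (h1.1.2.trans h2.1.2.symm) h

/-- `combo` is a continuous bijection of the compact complex of chains onto the Hausdorff space
`polyW n`, hence a homeomorphism; `β` is its inverse. -/
theorem continuous_mass_of_combo : ∃ β : polyW n → CycBracketing n → ℝ, Continuous β ∧
    ∀ (x : polyW n) (φ : ℝ →o CycBracketing n), combo (mass φ) = x.1 → β x = mass φ := by
  have : CompactSpace (chainSimplex n) := isCompact_iff_compactSpace.1 isCompact_chainSimplex
  have hbij : Function.Bijective fun l : chainSimplex n => (⟨combo l.1, combo_mem l.2⟩ : polyW n) := by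
    constructor
    · intro l l' h
      exact Subtype.ext (combo_injective _ _ l.2.1.1 l'.2.1.1 l.2.2 l'.2.2
        (l.2.1.2.trans l'.2.1.2.symm) (congrArg Subtype.val h))
    · intro x
      obtain ⟨φ, -, h⟩ := exists_profileW x
      exact ⟨⟨mass φ, mass_mem_chainSimplex φ⟩, Subtype.ext h⟩
  have hcont : Continuous (Equiv.ofBijective _ hbij) :=
    (continuous_combo.comp continuous_subtype_val).subtype_mk _
  refine ⟨fun x => (hcont.homeoOfEquivCompactToT2.symm x).1,
    continuous_subtype_val.comp (Homeomorph.continuous _), fun x φ h => ?_⟩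
  have : hcont.homeoOfEquivCompactToT2 ⟨mass φ, mass_mem_chainSimplex φ⟩ = x := Subtype.ext h
  rw [← this]
  exact congrArg Subtype.val (Homeomorph.symm_apply_apply _ _)

/-- A bracket of `b` occurs in almost all values of `φ`, so it is tight at each center that has
nonzero mass. -/
theorem carrierW_le_of_combo {x : polyW n} {φ : ℝ →o CycBracketing n} (h : combo (mass φ) = x.1)
    {b : CycBracketing n} (hb : ∀ᵐ s ∂unitMeasure, φ s ≤ b) : carrierW x ≤ b := by
  intro p hp
  refine mem_carrierW.2 ⟨b.2.1 p hp, ?_⟩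
  rw [← h, sum_combo]
  have hz : ∀ c, mass φ c * ∑ k ∈ gaps p, c.center k = mass φ c * 3 ^ (gaps p).card := by
    intro c
    by_cases hc : c ≤ b
    · rw [c.center_eq (hc hp)]
    · have : mass φ c = 0 := by
        rw [mass, measureReal_def]
        have h0 : unitMeasure {s | φ s = c} = 0 := by
          rw [measure_eq_zero_iff_ae_notMem]
          filter_upwards [hb] with s hs hsc
          exact hc (hsc ▸ hs)
        rw [h0, ENNReal.toReal_zero]
      rw [this, zero_mul, zero_mul]
  simp only [hz]
  rw [← Finset.sum_mul, sum_mass, one_mul]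

/-- The description of the points of the cyclohedron by step functions. -/
noncomputable def chartW (n : ℕ+) : Chart (polyW n) (CycBracketing n) where
  profile x := (exists_profileW x).choose
  pt φ := ⟨combo (mass φ), combo_mem (mass_mem_chainSimplex φ)⟩
  carrier := carrierW
  pt_profile x := Subtype.ext (exists_profileW x).choose_spec.2
  profile_pt φ := ae_eq_of_mass_eq (mass_eq_of_combo_eq (exists_profileW _).choose_spec.2)
  pt_congr φ ψ h := Subtype.ext (congrArg combo (funext fun p => mass_congr h p))
  profile_le x := (exists_profileW x).choose_spec.1
  carrier_le x _ hp := carrierW_le_of_combo (exists_profileW x).choose_spec.2 hp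
  continuous_mass_profile p := by
    obtain ⟨β, hβ, h⟩ := continuous_mass_of_combo (n := n)
    simp only [← h _ _ (exists_profileW _).choose_spec.2]
    exact (continuous_apply p).comp hβ
  continuous_pt φ hφ := (continuous_combo.comp (continuous_pi hφ)).subtype_mk _

end ChartW

open MeasureTheory

/-! ### The associahedron as a face of the cyclohedron -/

section Embedding

variable {n : ℕ+}

instance (n : ℕ+) : OrderTop (Bracketing n) where
  top := ⟨∅, by simp⟩
  le_top b := Finset.empty_subset b.1

instance (n : ℕ+) : OrderTop (CycBracketing n) where
  top := ⟨∅, by simp⟩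
  le_top b := Finset.empty_subset b.1

instance (n : ℕ+) : Finite (Bracketing n) :=
  inferInstanceAs (Finite {β : Finset (Fin n × Fin n) //
    (∀ p ∈ β, p.1 < p.2 ∧ (p.2 : ℕ) - p.1 + 1 < n) ∧ ∀ p ∈ β, ∀ q ∈ β, Compatible p q})

noncomputable instance (n : ℕ+) : Fintype (Bracketing n) := Fintype.ofFinite _

theorem Bracketing.ext {b c : Bracketing n} (h : ∀ p, p ∈ b.1 ↔ p ∈ c.1) : b = c :=
  Subtype.ext (Finset.ext h)

/-- The string is closed to a circle, with a bracket around all letters. -/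
def Bracketing.close (b : Bracketing n) : CycBracketing n :=
  ⟨b.withOuter, fun _ hp => (withOuter_lt b hp).ne, fun _ hp _ hq => withOuter_compatible b hp hq⟩

/-- The circle is cut between the last and the first position. -/
def CycBracketing.cut (b : CycBracketing n) : Bracketing n :=
  ⟨b.1.filter fun p => p.1 < p.2 ∧ (p.2 : ℕ) - p.1 + 1 < n, fun _ hp => (Finset.mem_filter.1 hp).2,
    fun _ hp _ hq => b.2.2 _ (Finset.mem_filter.1 hp).1 _ (Finset.mem_filter.1 hq).1⟩

theorem Bracketing.mem_close {b : Bracketing n} {p : Fin n × Fin n} :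
    p ∈ b.close.1 ↔ (1 < n ∧ p = (0, ⊤)) ∨ p ∈ b.1 := by
  unfold Bracketing.close Bracketing.withOuter
  dsimp only
  split_ifs with h
  · simp [h]
  · simp [h]

theorem CycBracketing.mem_cut {b : CycBracketing n} {p : Fin n × Fin n} :
    p ∈ b.cut.1 ↔ p ∈ b.1 ∧ p.1 < p.2 ∧ (p.2 : ℕ) - p.1 + 1 < n :=
  Finset.mem_filter

theorem outer_not_proper : ¬ (((⊤ : Fin n) : ℕ) - ((0 : Fin n) : ℕ) + 1 < n) := by
  have := n.pos
  rw [Fin.val_top, Fin.val_zero]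
  omega

theorem Bracketing.cut_close (b : Bracketing n) : b.close.cut = b := by
  refine Bracketing.ext fun p => ?_
  rw [CycBracketing.mem_cut, Bracketing.mem_close]
  constructor
  · rintro ⟨⟨-, rfl⟩ | h, -, h2⟩
    · exact absurd h2 outer_not_proper
    · exact h
  · exact fun h => ⟨Or.inr h, b.2.1 p h⟩

/-- A bracket with `p.2 < p.1` contains the gap `⊤`, misses the gap `p.2` and encloses the letter
`p.2`, so it is neither nested with `(0, ⊤)` nor disjoint from it. Among the other brackets only
`(0, ⊤)` itself encloses all letters. -/
theorem proper_of_compatible_outer {p : Fin n × Fin n} (hp : p.1 ≠ p.2)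
    (h : Compatible (0, ⊤) p) (h0 : p ≠ (0, ⊤)) : p.1 < p.2 ∧ (p.2 : ℕ) - p.1 + 1 < n := by
  have hp' := val_ne hp
  have h1 := p.1.2
  have h2 := p.2.2
  have hpos := n.pos
  have hlt : p.1 < p.2 := by
    by_contra hlt
    have hge : (p.2 : ℕ) < p.1 := by
      have := not_lt.1 hlt
      rw [Fin.le_def] at this
      omega
    have htop : (⊤ : Fin n) ∈ gaps p := by
      rw [mem_gaps_iff', Fin.val_top]
      omega
    have hnot : (⊤ : Fin n) ∉ gaps ((0 : Fin n), (⊤ : Fin n)) := snd_notMem_gaps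
    have hp2 : p.2 ∉ gaps p := snd_notMem_gaps
    have hp2' : p.2 ∈ gaps ((0 : Fin n), (⊤ : Fin n)) := by
      rw [mem_gaps_iff', Fin.val_top, Fin.val_zero]
      omega
    rcases h with h | h | h
    · exact hp2 (h hp2')
    · exact hnot (h htop)
    · refine absurd (Finset.disjoint_left.1 h (gaps_subset_elts hp2')) (not_not.2 ?_)
      rw [mem_elts_iff']
      omega
  refine ⟨hlt, ?_⟩
  by_contra hcon
  refine h0 (Prod.ext (Fin.ext ?_) (Fin.ext ?_))
  · rw [Fin.lt_def] at hlt
    rw [Fin.val_zero]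
    omega
  · rw [Fin.lt_def] at hlt
    rw [Fin.val_top]
    omega

/-- Together with `Bracketing.cut_close` this identifies the poset of strings with the lower set of
cyclic bracketings that contain the outer bracket. For `n = 1` there is no outer bracket, and the
hypothesis is void. -/
theorem CycBracketing.close_cut {b : CycBracketing n} (hb : b ≤ (⊤ : Bracketing n).close) :
    b.cut.close = b := by
  refine CycBracketing.ext fun p => ?_
  rw [Bracketing.mem_close, CycBracketing.mem_cut]
  constructor
  · rintro (⟨h, rfl⟩ | h)
    · exact hb (Bracketing.mem_close.2 (Or.inl ⟨h, rfl⟩))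
    · exact h.1
  · intro h
    have h1 : 1 < n := by
      by_contra h1
      have h2 : ¬ 1 < (n : ℕ) := h1
      exact b.2.1 p h (Fin.ext (by omega))
    by_cases h0 : p = (0, ⊤)
    · exact Or.inl ⟨h1, h0⟩
    · exact Or.inr ⟨h, proper_of_compatible_outer (b.2.1 p h)
        (b.2.2 _ (hb (Bracketing.mem_close.2 (Or.inl ⟨h1, rfl⟩))) p h) h0⟩

theorem Bracketing.close_le_close {b c : Bracketing n} : b.close ≤ c.close ↔ b ≤ c := by
  constructor
  · intro h p hp
    rw [← b.cut_close]
    rw [← c.cut_close] at hp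
    rw [CycBracketing.mem_cut] at hp ⊢
    exact ⟨h hp.1, hp.2⟩
  · intro h p hp
    rw [Bracketing.mem_close] at hp ⊢
    exact hp.imp_right fun hp => h hp

theorem Bracketing.close_le (b : Bracketing n) : b.close ≤ (⊤ : Bracketing n).close :=
  Bracketing.close_le_close.2 le_top

/-- Closing of strings, as a monotone map. -/
def closeHom (n : ℕ+) : Bracketing n →o CycBracketing n :=
  ⟨Bracketing.close, fun _ _ h => Bracketing.close_le_close.2 h⟩

/-- Cutting of circles, as a monotone map. -/
def cutHom (n : ℕ+) : CycBracketing n →o Bracketing n :=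
  ⟨CycBracketing.cut, fun _ _ h _ hp =>
    CycBracketing.mem_cut.2 ⟨h (CycBracketing.mem_cut.1 hp).1, (CycBracketing.mem_cut.1 hp).2⟩⟩

/-- The coordinates of a point of the associahedron, extended by the coordinate of the gap between
the last and the first position. -/
noncomputable def extendFun (t : Fin ((n : ℕ) - 1) → ℝ) : Fin n → ℝ := fun g =>
  if h : (g : ℕ) < (n : ℕ) - 1 then t ⟨g, h⟩ else 3 ^ (n : ℕ) - ∑ k, t k

/-- The coordinates other than the last one. -/
def restrictFun (x : Fin n → ℝ) : Fin ((n : ℕ) - 1) → ℝ := fun k => x (k.castLE (Nat.sub_le _ _))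

theorem restrictFun_extendFun (t : Fin ((n : ℕ) - 1) → ℝ) : restrictFun (extendFun t) = t := by
  funext k
  simp [restrictFun, extendFun]

theorem sum_extendFun_gaps (x : Fin n → ℝ) {p : Fin n × Fin n} (hp : p.1 < p.2) :
    ∑ k ∈ gaps p, x k = ∑ k ∈ Finset.univ.filter
      (fun k : Fin ((n : ℕ) - 1) => (p.1 : ℕ) ≤ k ∧ (k : ℕ) < p.2), restrictFun x k := by
  have h2 := p.2.2
  symm
  refine Finset.sum_bij (fun k _ => k.castLE (Nat.sub_le _ _)) ?_ ?_ ?_ ?_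
  · intro k hk
    have := (Finset.mem_filter.1 hk).2
    rw [mem_gaps_iff']
    rw [Fin.lt_def] at hp
    simp only [Fin.val_castLE]
    omega
  · intro k _ k' _ h
    simpa [Fin.ext_iff] using h
  · intro g hg
    rw [mem_gaps_iff'] at hg
    rw [Fin.lt_def] at hp
    exact ⟨⟨g, by omega⟩, Finset.mem_filter.2 ⟨Finset.mem_univ _, by simp only; omega⟩, rfl⟩
  · intro k _
    rfl

theorem card_gaps_of_lt {p : Fin n × Fin n} (hp : p.1 < p.2) :
    (gaps p).card = (p.2 : ℕ) - p.1 := by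
  have h : gaps p = Finset.Ico p.1 p.2 := by
    ext x
    rw [mem_gaps_iff, Finset.mem_Ico]
    constructor
    · rintro (h | h)
      · exact h.2
      · exact absurd h.1 hp.not_gt
    · exact fun h => Or.inl ⟨hp.le, h⟩
  rw [h, Fin.card_Ico]

theorem polyK_nonneg {t : Fin ((n : ℕ) - 1) → ℝ} (ht : t ∈ polyK n) (k : Fin ((n : ℕ) - 1)) :
    0 ≤ t k := by
  have hk := k.2
  -- For `n = 2` the only gap is not a proper subinterval, but its coordinate is the total sum.
  by_cases h2 : (n : ℕ) = 2
  · have h1 := ht.1 (show 1 < (n : ℕ) by omega)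
    have hg : ∀ i, i = k := fun i => Fin.ext (by have := i.2; omega)
    rw [Fintype.sum_eq_single k fun i hi => absurd (hg i) hi] at h1
    rw [h1]
    positivity
  · have h1 := ht.2 (⟨k, by omega⟩, ⟨k + 1, by omega⟩) (by simp [Fin.lt_def])
      (by simp only; omega)
    have h3 : (Finset.univ.filter (fun i : Fin ((n : ℕ) - 1) => (k : ℕ) ≤ i ∧ (i : ℕ) < k + 1)) =
        {k} := by
      ext i
      simp only [Finset.mem_filter, Finset.mem_univ, true_and, Finset.mem_singleton, Fin.ext_iff]
      omega
    simp only [h3, Finset.sum_singleton] at h1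
    refine le_trans ?_ h1
    positivity

theorem univ_eq_filter : (Finset.univ : Finset (Fin ((n : ℕ) - 1))) = Finset.univ.filter
    (fun k : Fin ((n : ℕ) - 1) => (((0 : Fin n) : ℕ)) ≤ k ∧ (k : ℕ) < ((⊤ : Fin n) : ℕ)) := by
  ext k
  have := k.2
  refine iff_of_true (Finset.mem_univ _) (Finset.mem_filter.2 ⟨Finset.mem_univ _, ?_⟩)
  rw [Fin.val_zero, Fin.val_top]
  omega

theorem zero_lt_top (hn : 1 < n) : (0 : Fin n) < ⊤ := by
  have : 1 < (n : ℕ) := hn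
  rw [Fin.lt_def, Fin.val_zero, Fin.val_top]
  omega

theorem sum_eq_sum_restrictFun (x : Fin n → ℝ) :
    ∑ k, x k = ∑ k, restrictFun x k + x ⊤ := by
  have hn := n.pos
  have h : (Finset.univ : Finset (Fin n)) = insert ⊤ (gaps (0, ⊤)) := by
    ext g
    have := g.2
    simp only [Finset.mem_univ, Finset.mem_insert, mem_gaps_iff', Fin.ext_iff, Fin.val_top,
      Fin.val_zero, true_iff]
    omega
  have h1 : ∑ k ∈ gaps ((0 : Fin n), (⊤ : Fin n)), x k = ∑ k, restrictFun x k := by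
    by_cases h1 : 1 < n
    · rw [sum_extendFun_gaps x (zero_lt_top h1), ← univ_eq_filter]
    · have h2 : (n : ℕ) = 1 := by
        have : ¬ 1 < (n : ℕ) := h1
        omega
      have h3 : gaps ((0 : Fin n), (⊤ : Fin n)) = ∅ := by
        ext g
        simp only [mem_gaps_iff', Fin.val_top, Fin.val_zero, Finset.notMem_empty, iff_false]
        omega
      have h4 : IsEmpty (Fin ((n : ℕ) - 1)) := by
        rw [h2]
        exact Fin.isEmpty
      rw [h3]
      simp
  rw [h, Finset.sum_insert (snd_notMem_gaps (p := (0, ⊤))), h1, add_comm]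

theorem extendFun_top (t : Fin ((n : ℕ) - 1) → ℝ) :
    extendFun t ⊤ = 3 ^ (n : ℕ) - ∑ k, t k := by
  have : ¬ (((⊤ : Fin n) : ℕ) < (n : ℕ) - 1) := by
    rw [Fin.val_top]
    omega
  rw [extendFun, dif_neg this]

theorem sum_extendFun (t : Fin ((n : ℕ) - 1) → ℝ) : ∑ k, extendFun t k = 3 ^ (n : ℕ) := by
  rw [sum_eq_sum_restrictFun, restrictFun_extendFun, extendFun_top]
  ring

theorem extendFun_nonneg {t : Fin ((n : ℕ) - 1) → ℝ} (ht : t ∈ polyK n) (g : Fin n) :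
    0 ≤ extendFun t g := by
  unfold extendFun
  split_ifs with h
  · exact polyK_nonneg ht _
  · by_cases h1 : 1 < n
    · rw [ht.1 h1, sub_nonneg]
      exact pow_le_pow_right₀ (by norm_num) (Nat.sub_le _ _)
    · have h2 : (n : ℕ) = 1 := by
        have : ¬ 1 < (n : ℕ) := h1
        have := n.pos
        omega
      have h4 : IsEmpty (Fin ((n : ℕ) - 1)) := by
        rw [h2]
        exact Fin.isEmpty
      simp

/-- An interval that avoids the last gap is one of `K_n` or the full interval of `K_n`. An interval
through the last gap has at most `n - 1` gaps, and the last coordinate alone is `3 ^ n - 3 ^ (n - 1)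
= 2 * 3 ^ (n - 1)`. -/
theorem extendFun_mem {t : Fin ((n : ℕ) - 1) → ℝ} (ht : t ∈ polyK n) : extendFun t ∈ polyW n := by
  refine ⟨sum_extendFun t, fun p hp => ?_⟩
  have hp' := val_ne hp
  have h1 := p.1.2
  have h2 := p.2.2
  have hn : 1 < n := show 1 < (n : ℕ) by omega
  by_cases hlt : p.1 < p.2
  · rw [sum_extendFun_gaps _ hlt, restrictFun_extendFun, card_gaps_of_lt hlt]
    by_cases h0 : (p.2 : ℕ) - p.1 + 1 < n
    · exact ht.2 p hlt h0
    · have hp0 : p = (0, ⊤) := by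
        rw [Fin.lt_def] at hlt
        refine Prod.ext (Fin.ext ?_) (Fin.ext ?_)
        · rw [Fin.val_zero]
          omega
        · rw [Fin.val_top]
          omega
      rw [hp0, ← univ_eq_filter, ht.1 hn, Fin.val_top, Fin.val_zero, Nat.sub_zero]
  · have htop : (⊤ : Fin n) ∈ gaps p := by
      rw [Fin.lt_def] at hlt
      rw [mem_gaps_iff', Fin.val_top]
      omega
    refine le_trans ?_ (Finset.single_le_sum (fun g _ => extendFun_nonneg ht g) htop)
    rw [extendFun_top, ht.1 hn]
    have hc : (3 : ℝ) ^ (gaps p).card ≤ 3 ^ ((n : ℕ) - 1) :=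
      pow_le_pow_right₀ (by norm_num) (Nat.le_sub_one_of_lt card_gaps_lt)
    have h3 : (3 : ℝ) ^ (n : ℕ) = 3 * 3 ^ ((n : ℕ) - 1) := by
      rw [← pow_succ', Nat.sub_add_cancel n.pos]
    have h4 : (0 : ℝ) < 3 ^ ((n : ℕ) - 1) := by positivity
    linarith

/-- The associahedron as a face of the cyclohedron. -/
noncomputable def embedK (t : polyK n) : polyW n := ⟨extendFun t.1, extendFun_mem t.2⟩

theorem continuous_embedK : Continuous (embedK (n := n)) := by
  refine Continuous.subtype_mk (continuous_pi fun g => ?_) _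
  unfold extendFun
  split_ifs with h
  · exact (continuous_apply _).comp continuous_subtype_val
  · exact continuous_const.sub (continuous_finsetSum _ fun k _ =>
      (continuous_apply _).comp continuous_subtype_val)

theorem embedK_injective : Function.Injective (embedK (n := n)) := by
  intro t t' h
  have h' := congrArg (fun x : polyW n => restrictFun x.1) h
  simp only [embedK, restrictFun_extendFun] at h'
  exact Subtype.ext h'

/-- The outer bracket is tight at every embedded point, and for the other brackets the sums on both
sides are the same. -/
theorem mem_faceK_iff_embedK {t : polyK n} {b : Bracketing n} :
    t ∈ faceK b ↔ carrierW (embedK t) ≤ b.close := by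
  rw [← mem_faceW_iff]
  have key : ∀ p : Fin n × Fin n, p.1 < p.2 → (∑ k ∈ gaps p, (embedK t).1 k = 3 ^ (gaps p).card ↔
      ∑ k ∈ Finset.univ.filter (fun k : Fin ((n : ℕ) - 1) => (p.1 : ℕ) ≤ k ∧ (k : ℕ) < p.2), t.1 k =
      3 ^ ((p.2 : ℕ) - p.1)) := by
    intro p hp
    rw [sum_extendFun_gaps _ hp, card_gaps_of_lt hp, embedK, restrictFun_extendFun]
  constructor
  · intro h p hp
    rcases Bracketing.mem_close.1 hp with ⟨hn, rfl⟩ | hp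
    · rw [key _ (zero_lt_top hn), ← univ_eq_filter, t.2.1 hn, Fin.val_top, Fin.val_zero,
        Nat.sub_zero]
    · exact (key p (b.2.1 p hp).1).2 (h p hp)
  · intro h p hp
    exact (key p (b.2.1 p hp).1).1 (h p (Bracketing.mem_close.2 (Or.inr hp)))

theorem restrictFun_mem {x : polyW n} (hx : carrierW x ≤ (⊤ : Bracketing n).close) :
    restrictFun x.1 ∈ polyK n := by
  constructor
  · intro hn
    have h := (mem_carrierW.1 (hx (Bracketing.mem_close.2 (Or.inl ⟨hn, rfl⟩)))).2
    rw [sum_extendFun_gaps _ (zero_lt_top hn), ← univ_eq_filter, card_gaps_of_lt (zero_lt_top hn),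
      Fin.val_top, Fin.val_zero, Nat.sub_zero] at h
    exact h
  · intro p hp _
    rw [← sum_extendFun_gaps _ hp, ← card_gaps_of_lt hp]
    exact x.2.2 p hp.ne

theorem embedK_restrictFun {x : polyW n} (hx : carrierW x ≤ (⊤ : Bracketing n).close) :
    embedK ⟨restrictFun x.1, restrictFun_mem hx⟩ = x := by
  refine Subtype.ext (funext fun g => ?_)
  change extendFun (restrictFun x.1) g = x.1 g
  by_cases h : (g : ℕ) < (n : ℕ) - 1
  · rw [extendFun, dif_pos h]
    rfl
  · have hg : g = ⊤ := by
      have := g.2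
      ext
      rw [Fin.val_top]
      omega
    rw [hg, extendFun_top, ← x.2.1, sum_eq_sum_restrictFun]
    ring

theorem carrierW_embedK_le (t : polyK n) : carrierW (embedK t) ≤ (⊤ : Bracketing n).close :=
  mem_faceK_iff_embedK.1 fun p hp => absurd hp (Finset.notMem_empty p)

/-- The brackets whose inequalities are equalities at a point. -/
noncomputable def carrierK (t : polyK n) : Bracketing n := (carrierW (embedK t)).cut

theorem close_carrierK (t : polyK n) : (carrierK t).close = carrierW (embedK t) :=
  CycBracketing.close_cut (carrierW_embedK_le t)

theorem mem_faceK_iff {t : polyK n} {b : Bracketing n} : t ∈ faceK b ↔ carrierK t ≤ b := by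
  rw [mem_faceK_iff_embedK, ← close_carrierK, Bracketing.close_le_close]

theorem isClosed_faceK (b : Bracketing n) : IsClosed (faceK b) := by
  have : faceK b = embedK ⁻¹' faceW b.close := by
    ext t
    rw [mem_faceK_iff_embedK, mem_preimage, mem_faceW_iff]
  rw [this]
  exact (isClosed_faceW _).preimage continuous_embedK

end Embedding

/-! ### General properties of charts, and the chart of the associahedron -/

section Charts

theorem mass_comp {P Q : Type} [PartialOrder P] [PartialOrder Q] [Fintype P] [DecidableEq Q]
    (F : P → Q) (φ : ℝ →o P) (q : Q) :
    mass (fun s => F (φ s)) q = ∑ p with F p = q, mass φ p :=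
  measure_preimage_eq_sum φ fun p => F p = q

namespace Chart

variable {X P : Type} [TopologicalSpace X] [PartialOrder P] [Fintype P] (C : Chart X P)

theorem ae_profile_le_iff {x : X} {p : P} :
    (∀ᵐ s ∂unitMeasure, C.profile x s ≤ p) ↔ C.carrier x ≤ p :=
  ⟨C.carrier_le x p, fun h => Filter.Eventually.of_forall fun s => (C.profile_le x s).trans h⟩

theorem ae_of_forall_le {φ : ℝ →o P} {p : P} (h : ∀ s, φ s ≤ p) : C.carrier (C.pt φ) ≤ p := by
  refine C.carrier_le _ _ ?_
  filter_upwards [C.profile_pt φ] with s hs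
  exact hs.le.trans (h s)

/-- A constant step function represents a point in the interior of a face. This shows that every
face occurs as a carrier. -/
theorem carrier_pt_const (p : P) : C.carrier (C.pt ⟨fun _ => p, fun _ _ _ => le_rfl⟩) = p := by
  refine le_antisymm (C.ae_of_forall_le fun _ => le_rfl) ?_
  have hne : unitMeasure ≠ 0 := by
    intro h
    have := unitMeasure_Ioc (s := 1) ⟨one_pos, le_rfl⟩
    rw [h] at this
    simp at this
  have : (ae unitMeasure).NeBot := ae_neBot.2 hne
  obtain ⟨s, hs⟩ := (C.profile_pt ⟨fun _ => p, fun _ _ _ => le_rfl⟩).exists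
  exact hs.ge.trans (C.profile_le _ s)

theorem eq_of_profile_ae_eq {x y : X} (h : C.profile x =ᵐ[unitMeasure] C.profile y) : x = y := by
  rw [← C.pt_profile x, ← C.pt_profile y]
  exact C.pt_congr _ _ h

theorem ae_eventually_profile (x : X) :
    ∀ᵐ s ∂unitMeasure, ∀ᶠ y in 𝓝 x, C.profile y s = C.profile x s :=
  ae_eventually_eq C.continuous_mass_profile x

end Chart

/-- The description of the points of the associahedron by step functions. -/
noncomputable def chartK (n : ℕ+) : Chart (polyK n) (Bracketing n) where
  profile t := (cutHom n).comp ((chartW n).profile (embedK t))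
  pt φ := ⟨restrictFun ((chartW n).pt ((closeHom n).comp φ)).1, restrictFun_mem
    ((chartW n).ae_of_forall_le fun s => (φ s).close_le)⟩
  carrier := carrierK
  pt_profile t := by
    have h : (chartW n).pt ((closeHom n).comp ((cutHom n).comp ((chartW n).profile (embedK t)))) =
        embedK t := by
      conv_rhs => rw [← (chartW n).pt_profile (embedK t)]
      congr 1
      ext s : 2
      exact CycBracketing.close_cut
        (((chartW n).profile_le (embedK t) s).trans (carrierW_embedK_le t))
    refine Subtype.ext ?_
    change restrictFun ((chartW n).pt _).1 = t.1
    rw [h]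
    exact restrictFun_extendFun t.1
  profile_pt φ := by
    rw [embedK_restrictFun ((chartW n).ae_of_forall_le fun s => (φ s).close_le)]
    filter_upwards [(chartW n).profile_pt ((closeHom n).comp φ)] with s hs
    change ((chartW n).profile _ s).cut = φ s
    rw [hs]
    exact (φ s).cut_close
  pt_congr φ ψ h := by
    have : (chartW n).pt ((closeHom n).comp φ) = (chartW n).pt ((closeHom n).comp ψ) := by
      refine (chartW n).pt_congr _ _ ?_
      filter_upwards [h] with s hs
      exact congrArg Bracketing.close hs
    simp only [this]
  profile_le t s := (cutHom n).monotone ((chartW n).profile_le _ s)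
  carrier_le t b h := by
    rw [← Bracketing.close_le_close, close_carrierK]
    refine (chartW n).carrier_le _ _ ?_
    filter_upwards [h] with s hs
    rw [← Bracketing.close_le_close] at hs
    refine le_trans (le_of_eq ?_) hs
    exact (CycBracketing.close_cut
        (((chartW n).profile_le (embedK t) s).trans (carrierW_embedK_le t))).symm
  continuous_mass_profile p := by
    classical
    have h : ∀ t : polyK n, mass ((cutHom n).comp ((chartW n).profile (embedK t))) p =
        ∑ q with CycBracketing.cut q = p, mass ((chartW n).profile (embedK t)) q := fun t =>
      mass_comp CycBracketing.cut _ _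
    simp only [h]
    exact continuous_finsetSum _ fun q _ =>
      ((chartW n).continuous_mass_profile q).comp continuous_embedK
  continuous_pt φ hφ := by
    classical
    refine Continuous.subtype_mk (continuous_pi fun k => ?_) _
    refine (continuous_apply _).comp (continuous_subtype_val.comp
      ((chartW n).continuous_pt (fun y => (closeHom n).comp (φ y)) fun p => ?_))
    have h : ∀ y, mass ((closeHom n).comp (φ y)) p =
        ∑ q with Bracketing.close q = p, mass (φ y) q := fun y => mass_comp Bracketing.close _ _
    simp only [h]
    exact continuous_finsetSum _ fun q _ => hφ q

end Charts

/-! ### Parametrizations of closed cells by balls -/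

section Balls

/-- A parametrization of a closed cell by a ball. -/
structure IsCellMap {X : Type} [TopologicalSpace X] {d : ℕ} (χ : (Fin d → ℝ) → X)
    (closed opened : Set X) : Prop where
  continuousOn : ContinuousOn χ (Metric.closedBall 0 1)
  injOn : InjOn χ (Metric.closedBall 0 1)
  image_closedBall : χ '' Metric.closedBall 0 1 = closed
  image_ball : χ '' Metric.ball 0 1 = opened

variable {n : ℕ+}

theorem exists_cellMap_faceW (b : CycBracketing n) {d : ℕ} (hd : d = (n : ℕ) - 1 - b.1.card) :
    ∃ χ : (Fin d → ℝ) → polyW n, IsCellMap χ (faceW b) {t | carrierW t = b} := by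
  classical
  obtain ⟨χ, hc, hi, h1, h2⟩ := exists_ball_faceW b hd
  have hmem : ∀ v ∈ Metric.closedBall (0 : Fin d → ℝ) 1, χ v ∈ polyW n := by
    intro v hv
    obtain ⟨t, -, ht⟩ := h1 ▸ mem_image_of_mem χ hv
    exact ht ▸ t.2
  let χ' : (Fin d → ℝ) → polyW n := fun v => if h : χ v ∈ polyW n then ⟨χ v, h⟩ else centerW b
  have hχ' : ∀ v ∈ Metric.closedBall (0 : Fin d → ℝ) 1, (χ' v).1 = χ v := fun v hv => by
    simp only [χ', dif_pos (hmem v hv)]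
  have himage : ∀ (s : Set (Fin d → ℝ)) (u : Set (polyW n)), s ⊆ Metric.closedBall 0 1 →
      χ '' s = Subtype.val '' u → χ' '' s = u := by
    intro s u hs h
    apply Subtype.val_injective.image_injective
    rw [← h, ← image_comp]
    exact image_congr fun v hv => hχ' v (hs hv)
  refine ⟨χ', ?_, ?_, himage _ _ Subset.rfl h1, himage _ _ Metric.ball_subset_closedBall h2⟩
  · rw [IsInducing.subtypeVal.continuousOn_iff]
    exact hc.continuousOn.congr hχ'
  · intro v hv w hw h
    refine hi ?_
    rw [← hχ' v hv, ← hχ' w hw, h]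

theorem Bracketing.card_close (b : Bracketing n) :
    b.close.1.card = b.1.card + if 1 < n then 1 else 0 := by
  unfold Bracketing.close Bracketing.withOuter
  dsimp only
  split_ifs with h
  · rw [Finset.card_insert_of_notMem]
    intro h'
    exact outer_not_proper (b.2.1 _ h').2
  · rfl

/-- The face is carried over from the face of `W_n` at `b.close`. For `n ≥ 2` that bracketing has
one more bracket, so `n - 2 - #b` and `n - 1 - #b.close` agree; for `n = 1` both are zero. -/
theorem exists_cellMap_faceK (b : Bracketing n) {d : ℕ} (hd : d = (n : ℕ) - 2 - b.1.card) :
    ∃ χ : (Fin d → ℝ) → polyK n, IsCellMap χ (faceK b) {t | carrierK t = b} := by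
  classical
  have hd' : d = (n : ℕ) - 1 - b.close.1.card := by
    rw [b.card_close]
    split_ifs with h
    · omega
    · have : ¬ 1 < (n : ℕ) := h
      omega
  obtain ⟨χ, hc, hi, h1, h2⟩ := exists_cellMap_faceW b.close hd'
  have hle : ∀ v ∈ Metric.closedBall (0 : Fin d → ℝ) 1,
      carrierW (χ v) ≤ (⊤ : Bracketing n).close := by
    intro v hv
    exact (mem_faceW_iff.1 (h1 ▸ mem_image_of_mem χ hv)).trans b.close_le
  let χ' : (Fin d → ℝ) → polyK n := fun v =>
    if h : carrierW (χ v) ≤ (⊤ : Bracketing n).close then ⟨_, restrictFun_mem h⟩ else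
      (chartK n).pt ⟨fun _ => ⊤, fun _ _ _ => le_rfl⟩
  have hχ' : ∀ v ∈ Metric.closedBall (0 : Fin d → ℝ) 1, embedK (χ' v) = χ v := fun v hv => by
    simp only [χ', dif_pos (hle v hv)]
    exact embedK_restrictFun (hle v hv)
  have hχ'' : ∀ v ∈ Metric.closedBall (0 : Fin d → ℝ) 1, (χ' v).1 = restrictFun (χ v).1 :=
    fun v hv => by
    simp only [χ', dif_pos (hle v hv)]
  refine ⟨χ', ?_, ?_, ?_, ?_⟩
  · rw [IsInducing.subtypeVal.continuousOn_iff]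
    refine ContinuousOn.congr ?_ hχ''
    refine Continuous.comp_continuousOn (g := fun x : polyW n => restrictFun x.1) ?_ hc
    exact continuous_pi fun k => (continuous_apply _).comp continuous_subtype_val
  · intro v hv w hw h
    refine hi hv hw ?_
    rw [← hχ' v hv, ← hχ' w hw, h]
  · ext t
    rw [mem_faceK_iff_embedK, ← mem_faceW_iff, ← h1]
    constructor
    · rintro ⟨v, hv, rfl⟩
      exact ⟨v, hv, (hχ' v hv).symm⟩
    · rintro ⟨v, hv, h⟩
      exact ⟨v, hv, embedK_injective ((hχ' v hv).trans h)⟩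
  · ext t
    have ht : t ∈ {t | carrierK t = b} ↔ embedK t ∈ {x | carrierW x = b.close} := by
      change carrierK t = b ↔ carrierW (embedK t) = b.close
      rw [← close_carrierK]
      exact ⟨fun h => h ▸ rfl, fun h => by rw [← b.cut_close, ← h, Bracketing.cut_close]⟩
    rw [ht, ← h2]
    constructor
    · rintro ⟨v, hv, rfl⟩
      exact ⟨v, hv, (hχ' v (Metric.ball_subset_closedBall hv)).symm⟩
    · rintro ⟨v, hv, h⟩
      exact ⟨v, hv, embedK_injective ((hχ' v (Metric.ball_subset_closedBall hv)).trans h)⟩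

end Balls

/-! ### Regular cell complexes -/

section CW

/-- An injective continuous map of a compact ball to a Hausdorff space is a closed embedding. -/
theorem IsCellMap.continuousOn_inv {X : Type} [TopologicalSpace X] [T2Space X] {d : ℕ}
    {χ : (Fin d → ℝ) → X} {A B : Set X} (h : IsCellMap χ A B) {g : X → (Fin d → ℝ)}
    (hg : ∀ v ∈ Metric.closedBall (0 : Fin d → ℝ) 1, g (χ v) = v) : ContinuousOn g A := by
  have hcomp : CompactSpace (Metric.closedBall (0 : Fin d → ℝ) 1) :=
    isCompact_iff_compactSpace.1 (isCompact_closedBall 0 1)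
  have he : IsClosedEmbedding fun v : Metric.closedBall (0 : Fin d → ℝ) 1 => χ v :=
    Continuous.isClosedEmbedding (continuousOn_iff_continuous_domRestrict.1 h.continuousOn)
      fun v w hvw => Subtype.ext (h.injOn v.2 w.2 hvw)
  rw [continuousOn_iff_isClosed]
  intro t ht
  refine ⟨(fun v : Metric.closedBall (0 : Fin d → ℝ) 1 => χ v) '' (Subtype.val ⁻¹' t),
    he.isClosedMap _ (ht.preimage continuous_subtype_val), ?_⟩
  ext x
  constructor
  · rintro ⟨hx, hxA⟩
    obtain ⟨v, hv, rfl⟩ := h.image_closedBall.symm ▸ hxA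
    refine ⟨⟨⟨v, hv⟩, ?_, rfl⟩, hxA⟩
    have : g (χ v) ∈ t := hx
    rwa [hg v hv] at this
  · rintro ⟨⟨v, hv, rfl⟩, hxA⟩
    refine ⟨?_, hxA⟩
    change g (χ v) ∈ t
    rw [hg v v.2]
    exact hv

/-- Open cells are the fibers of `carr`, so they are disjoint and cover the space. A boundary point
of a cell has a strictly smaller carrier, hence lies in a cell of lower dimension by `hdim`;
closedness conditions are automatic for finitely many compact cells. -/
theorem isRegularCellComplex_of_carrier {X P : Type} [TopologicalSpace X] [T2Space X]
    [PartialOrder P] [Finite P] {dim : P → ℕ} {cell : P → Set X} (carr : X → P)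
    (hsurj : Function.Surjective carr) (hcell : ∀ p, cell p = {x | carr x ≤ p})
    (hχ : ∀ p, ∃ χ : (Fin (dim p) → ℝ) → X, IsCellMap χ (cell p) {x | carr x = p})
    (hdim : StrictMono dim) : IsRegularCellComplex dim cell := by
  classical
  have hχ' : ∀ d (c : {p : P // dim p = d}), ∃ χ : (Fin d → ℝ) → X,
      IsCellMap χ (cell c.1) {x | carr x = c.1} := by
    rintro d ⟨p, rfl⟩
    exact hχ p
  choose χ h using hχ'
  have hinj : ∀ d c, InjOn (χ d c) (Metric.ball 0 1) := fun d c =>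
    (h d c).injOn.mono Metric.ball_subset_closedBall
  have hclosed : ∀ p, IsClosed (cell p) := by
    intro p
    rw [← (h _ ⟨p, rfl⟩).image_closedBall]
    exact ((isCompact_closedBall _ _).image_of_continuousOn (h _ ⟨p, rfl⟩).continuousOn).isClosed
  refine ⟨⟨{
    cell := fun d => {p : P // dim p = d}
    map := fun d c => (hinj d c).toPartialEquiv _ _
    source_eq := fun d c => rfl
    continuousOn := fun d c => (h d c).continuousOn
    continuousOn_symm := fun d c => ?_
    pairwiseDisjoint' := ?_
    mapsTo' := fun d c => ?_
    closed' := fun A _ hA => ?_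
    union' := ?_ }, fun d => Equiv.refl _, fun d c => ⟨(h d c).image_closedBall, (h d c).injOn⟩⟩,
    fun p q => ?_⟩
  · have h1 : ContinuousOn (Function.invFunOn (χ d c) (Metric.closedBall 0 1)) (cell c.1) :=
      (h d c).continuousOn_inv fun v hv => (h d c).injOn.leftInvOn_invFunOn hv
    refine (h1.mono ?_).congr ?_
    · change χ d c '' Metric.ball 0 1 ⊆ _
      rw [← (h d c).image_closedBall]
      exact image_mono Metric.ball_subset_closedBall
    · rintro x ⟨v, hv, rfl⟩
      rw [(h d c).injOn.leftInvOn_invFunOn (Metric.ball_subset_closedBall hv)]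
      exact ((hinj d c).toPartialEquiv _ _).left_inv hv
  · rintro ⟨d, c⟩ - ⟨d', c'⟩ - hne
    change Disjoint (χ d c '' Metric.ball 0 1) (χ d' c' '' Metric.ball 0 1)
    rw [(h d c).image_ball, (h d' c').image_ball]
    refine Set.disjoint_left.2 fun x hx hx' => hne ?_
    obtain ⟨p, rfl⟩ := c
    obtain ⟨p', rfl⟩ := c'
    have hp : carr x = p := hx
    have hp' : carr x = p' := hx'
    subst hp
    subst hp'
    rfl
  · have : ∀ m, Fintype {p : P // dim p = m} := fun m => Fintype.ofFinite _
    refine ⟨fun m => Finset.univ, fun v hv => ?_⟩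
    have hv' : v ∈ Metric.closedBall (0 : Fin d → ℝ) 1 := Metric.sphere_subset_closedBall hv
    have h1 : carr (χ d c v) ≤ c.1 := by
      have := mem_image_of_mem (χ d c) hv'
      rw [(h d c).image_closedBall, hcell] at this
      exact this
    have h2 : carr (χ d c v) ≠ c.1 := by
      intro heq
      have h3 : χ d c v ∈ χ d c '' Metric.ball 0 1 := by
        rw [(h d c).image_ball]
        exact heq
      obtain ⟨w, hw, hwv⟩ := h3
      have := (h d c).injOn (Metric.ball_subset_closedBall hw) hv' hwv
      subst this
      have h4 := Metric.mem_ball.1 hw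
      rw [Metric.mem_sphere.1 hv] at h4
      exact lt_irrefl _ h4
    have h3 := hdim (lt_of_le_of_ne h1 h2)
    rw [c.2] at h3
    refine mem_iUnion.2 ⟨dim (carr (χ d c v)), mem_iUnion.2 ⟨h3, mem_iUnion.2
      ⟨⟨_, rfl⟩, mem_iUnion.2 ⟨Finset.mem_univ _, ?_⟩⟩⟩⟩
    change χ d c v ∈ χ _ _ '' _
    rw [(h _ _).image_closedBall, hcell]
    exact le_refl (carr (χ d c v))
  · have : A = ⋃ p, A ∩ cell p := by
      rw [← inter_iUnion]
      refine (inter_eq_left.2 fun x _ => mem_iUnion.2 ⟨carr x, ?_⟩).symm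
      rw [hcell]
      exact le_refl (carr x)
    rw [this]
    refine isClosed_iUnion_of_finite fun p => ?_
    have := hA (dim p) ⟨p, rfl⟩
    change IsClosed (A ∩ χ _ _ '' _) at this
    rwa [(h _ _).image_closedBall] at this
  · refine eq_univ_of_forall fun x => mem_iUnion.2 ⟨dim (carr x), mem_iUnion.2 ⟨⟨_, rfl⟩, ?_⟩⟩
    change x ∈ χ _ _ '' _
    rw [(h _ _).image_closedBall, hcell]
    exact le_refl (carr x)
  · rw [hcell, hcell]
    constructor
    · exact fun hpq x hx => le_trans (show carr x ≤ p from hx) hpq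
    · intro hpq
      obtain ⟨x, rfl⟩ := hsurj p
      exact hpq (le_refl (carr x))

theorem IsCellMap.sigma {ι X : Type} [TopologicalSpace X] {d : ℕ} {χ : (Fin d → ℝ) → X}
    {A B : Set X} (h : IsCellMap χ A B) (i : ι) :
    IsCellMap (fun v => (⟨i, χ v⟩ : Σ _i : ι, X)) (Sigma.mk i '' A) (Sigma.mk i '' B) where
  continuousOn := continuous_sigmaMk.comp_continuousOn h.continuousOn
  injOn := fun _ hv _ hw hvw => h.injOn hv hw (sigma_mk_injective hvw)
  image_closedBall := by rw [← h.image_closedBall, ← image_comp]; rfl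
  image_ball := by rw [← h.image_ball, ← image_comp]; rfl

theorem sigma_mk_le_iff {ι P : Type} [PartialOrder P] {i j : ι} {p q : P} :
    (⟨i, p⟩ : Σ _i : ι, P) ≤ ⟨j, q⟩ ↔ i = j ∧ p ≤ q := by
  rw [Sigma.le_def]
  constructor
  · rintro ⟨h, h'⟩
    dsimp only at h
    subst h
    exact ⟨rfl, h'⟩
  · rintro ⟨rfl, h⟩
    exact ⟨rfl, h⟩

theorem isRegularCellComplex_sigma {ι X P : Type} [Finite ι] [TopologicalSpace X] [T2Space X]
    [PartialOrder P] [Finite P] {dim : P → ℕ} {face : P → Set X} (carr : X → P)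
    (hsurj : Function.Surjective carr) (hface : ∀ p, face p = {x | carr x ≤ p})
    (hχ : ∀ p, ∃ χ : (Fin (dim p) → ℝ) → X, IsCellMap χ (face p) {x | carr x = p})
    (hdim : StrictMono dim) :
    IsRegularCellComplex (fun b : Σ _i : ι, P => dim b.2)
      (fun b : Σ _i : ι, P => {x : Σ _i : ι, X | ∃ t ∈ face b.2, x = ⟨b.1, t⟩}) := by
  refine isRegularCellComplex_of_carrier (fun x => ⟨x.1, carr x.2⟩) ?_ ?_ ?_ ?_
  · rintro ⟨i, p⟩
    obtain ⟨x, rfl⟩ := hsurj p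
    exact ⟨⟨i, x⟩, rfl⟩
  · rintro ⟨i, p⟩
    ext ⟨j, x⟩
    change (∃ t ∈ face p, (⟨j, x⟩ : Σ _i : ι, X) = ⟨i, t⟩) ↔
      (⟨j, carr x⟩ : Σ _i : ι, P) ≤ ⟨i, p⟩
    rw [sigma_mk_le_iff, hface]
    constructor
    · rintro ⟨t, ht, h⟩
      cases h
      exact ⟨rfl, ht⟩
    · rintro ⟨rfl, h⟩
      exact ⟨x, h, rfl⟩
  · rintro ⟨i, p⟩
    obtain ⟨χ, h⟩ := hχ p
    have h' := h.sigma i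
    refine ⟨fun v => ⟨i, χ v⟩, h'.continuousOn, h'.injOn, h'.image_closedBall.trans ?_, h'.image_ball.trans ?_⟩
    · ext
      exact ⟨fun ⟨t, ht, e⟩ => ⟨t, ht, e.symm⟩, fun ⟨t, ht, e⟩ => ⟨t, ht, e.symm⟩⟩
    · ext ⟨j, x⟩
      constructor
      · rintro ⟨t, ht, e⟩
        cases e
        have ht' : carr x = p := ht
        subst ht'
        rfl
      · intro e
        have e' : (⟨j, carr x⟩ : Σ _i : ι, P) = ⟨i, p⟩ := e
        cases e'
        exact ⟨x, rfl, rfl⟩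
  · rintro ⟨i, p⟩ ⟨j, q⟩ h
    have h1 := sigma_mk_le_iff.1 h.le
    obtain ⟨rfl, h2⟩ := h1
    refine hdim (lt_of_le_of_ne h2 ?_)
    rintro rfl
    exact lt_irrefl _ h

variable (n : ℕ+)

theorem isRegularCellComplex_WBar : IsRegularCellComplex (dimW (n := n)) (cellW (n := n)) := by
  refine isRegularCellComplex_sigma (dim := fun b : CycBracketing n => (n : ℕ) - 1 - b.1.card)
    (face := faceW) carrierW (fun b => ⟨_, carrierW_centerW b⟩) ?_
    (fun b => exists_cellMap_faceW b rfl) ?_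
  · intro b
    ext x
    exact mem_faceW_iff
  · intro b c h
    have h1 : c.1.card < b.1.card := Finset.card_lt_card ⟨h.le, fun h' => h.not_ge h'⟩
    have h2 := b.card_lt
    simp only
    omega

theorem isRegularCellComplex_KBar : IsRegularCellComplex (dimK (n := n)) (cellK (n := n)) := by
  refine isRegularCellComplex_sigma (dim := fun b : Bracketing n => (n : ℕ) - 2 - b.1.card)
    (face := faceK) carrierK (fun b => ⟨_, (chartK n).carrier_pt_const b⟩) ?_
    (fun b => exists_cellMap_faceK b rfl) ?_
  · intro b
    ext x
    exact mem_faceK_iff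
  · intro b c h
    have h1 : c.1.card < b.1.card := Finset.card_lt_card ⟨h.le, fun h' => h.not_ge h'⟩
    have h2 := b.close.card_lt
    rw [b.card_close] at h2
    simp only
    split_ifs at h2 with hn
    · omega
    · have : ¬ 1 < (n : ℕ) := hn
      omega

end CW

/-! ### Composition of bracketings -/

section Blocks

variable {l n : ℕ+} (m : Fin l → ℕ+) (h : ∑ i, (m i : ℕ) = n)

theorem strictMono_eq_self {N : ℕ} {f : Fin N → Fin N} (hf : StrictMono f) (x : Fin N) : f x = x :=
  le_antisymm hf.apply_le hf.le_apply

theorem blockEquiv_lt_cases {x y : Σ i, Fin (m i)} (hxy : blockEquiv m h x < blockEquiv m h y) :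
    x.1 < y.1 ∨ ∃ (i : Fin l) (a b : Fin (m i)), a < b ∧ x = ⟨i, a⟩ ∧ y = ⟨i, b⟩ := by
  obtain ⟨i, a⟩ := x
  obtain ⟨j, b⟩ := y
  rcases lt_trichotomy i j with hij | rfl | hij
  · exact Or.inl hij
  · exact Or.inr ⟨i, a, b, (blockEquiv_lt_iff_snd m h).1 hxy, rfl, rfl⟩
  · exact absurd (blockEquiv_lt_of_lt m h (x := ⟨j, b⟩) (y := ⟨i, a⟩) hij) hxy.not_gt

/-- A numbering of the elements of consecutive blocks that preserves the order is `blockEquiv`. -/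
theorem eq_blockEquiv {g : (Σ i, Fin (m i)) → Fin n}
    (h1 : ∀ x y : Σ i, Fin (m i), x.1 < y.1 → g x < g y)
    (h2 : ∀ i (a b : Fin (m i)), a < b → g ⟨i, a⟩ < g ⟨i, b⟩) (x : Σ i, Fin (m i)) :
    g x = blockEquiv m h x := by
  have hmono : StrictMono fun s => g ((blockEquiv m h).symm s) := by
    intro s t hst
    obtain ⟨x, rfl⟩ := (blockEquiv m h).surjective s
    obtain ⟨y, rfl⟩ := (blockEquiv m h).surjective t
    simp only [Equiv.symm_apply_apply]
    rcases blockEquiv_lt_cases m h hst with hxy | ⟨i, a, b, hab, rfl, rfl⟩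
    · exact h1 x y hxy
    · exact h2 i a b hab
  have := strictMono_eq_self hmono (blockEquiv m h x)
  simpa only [Equiv.symm_apply_apply] using this

theorem blockFirst_zero : blockFirst m h 0 = 0 := by
  refine le_antisymm ?_ (Fin.zero_le _)
  obtain ⟨x, hx⟩ := (blockEquiv m h).surjective 0
  rw [← hx]
  exact (blockFirst_le_iff m h).2 (Fin.zero_le _)

theorem blockLast_top : blockLast m h ⊤ = ⊤ := by
  refine le_antisymm le_top ?_
  obtain ⟨x, hx⟩ := (blockEquiv m h).surjective ⊤
  rw [← hx]
  exact (le_blockLast_iff m h).2 le_top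

variable {m h} in
theorem mem_insertBrackets {β : Finset (Fin l × Fin l)} {c : ∀ i, Bracketing (m i)}
    {p : Fin n × Fin n} : p ∈ insertBrackets m h β c ↔
      (∃ q ∈ β, p = (blockFirst m h q.1, blockLast m h q.2)) ∨
      ∃ i, ∃ q ∈ (c i).close.1, p = (blockEquiv m h ⟨i, q.1⟩, blockEquiv m h ⟨i, q.2⟩) := by
  simp only [insertBrackets, Finset.mem_union, Finset.mem_image, Finset.mem_biUnion,
    Finset.mem_univ, true_and, Bracketing.close, eq_comm (a := p)]

/-- Outer brackets begin and end in different blocks, local ones in the same block, so the two kinds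
of brackets of a composite cannot be confused and each comes from a unique bracket. -/
theorem outer_mem_insertBrackets {β : Finset (Fin l × Fin l)} {c : ∀ i, Bracketing (m i)}
    {q : Fin l × Fin l} (hq : q.1 ≠ q.2) :
    (blockFirst m h q.1, blockLast m h q.2) ∈ insertBrackets m h β c ↔ q ∈ β := by
  rw [mem_insertBrackets]
  constructor
  · rintro (⟨q', hq', e⟩ | ⟨i, q', hq', e⟩)
    · have e1 := congrArg Sigma.fst ((blockEquiv m h).injective (congrArg Prod.fst e))
      have e2 := congrArg Sigma.fst ((blockEquiv m h).injective (congrArg Prod.snd e))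
      rwa [show q = q' from Prod.ext e1 e2]
    · have e1 := congrArg Sigma.fst ((blockEquiv m h).injective (congrArg Prod.fst e))
      have e2 := congrArg Sigma.fst ((blockEquiv m h).injective (congrArg Prod.snd e))
      exact absurd (e1.trans e2.symm) hq
  · exact fun hq' => Or.inl ⟨q, hq', rfl⟩

theorem local_mem_insertBrackets {β : Finset (Fin l × Fin l)} {c : ∀ i, Bracketing (m i)}
    (hβ : ∀ q ∈ β, q.1 ≠ q.2) {i : Fin l} {q : Fin (m i) × Fin (m i)} :
    (blockEquiv m h ⟨i, q.1⟩, blockEquiv m h ⟨i, q.2⟩) ∈ insertBrackets m h β c ↔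
      q ∈ (c i).close.1 := by
  rw [mem_insertBrackets]
  constructor
  · rintro (⟨q', hq', e⟩ | ⟨j, q', hq', e⟩)
    · have e1 := congrArg Sigma.fst ((blockEquiv m h).injective (congrArg Prod.fst e))
      have e2 := congrArg Sigma.fst ((blockEquiv m h).injective (congrArg Prod.snd e))
      exact absurd (e1.symm.trans e2) (hβ q' hq')
    · have e1 := (blockEquiv m h).injective (congrArg Prod.fst e)
      have e2 := (blockEquiv m h).injective (congrArg Prod.snd e)
      obtain rfl : i = j := congrArg Sigma.fst e1
      simp only [Sigma.mk.injEq, heq_eq_eq, true_and] at e1 e2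
      rwa [show q = q' from Prod.ext e1 e2]
  · exact fun hq' => Or.inr ⟨i, q, hq', rfl⟩

/-- Composition is an embedding of partially ordered sets. -/
theorem CycBracketing.comp_le_comp {b b' : CycBracketing l} {c c' : ∀ i, Bracketing (m i)} :
    b.comp m h c ≤ b'.comp m h c' ↔ b ≤ b' ∧ ∀ i, c i ≤ c' i := by
  constructor
  · intro hle
    refine ⟨fun q hq => ?_, fun i => Bracketing.close_le_close.1 fun q hq => ?_⟩
    · have := hle ((outer_mem_insertBrackets m h (β := b'.1) (c := c') (b'.2.1 q hq)).2 hq)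
      exact (outer_mem_insertBrackets m h (b'.2.1 q hq)).1 this
    · have := hle ((local_mem_insertBrackets m h (β := b'.1) (c := c') b'.2.1).2 hq)
      exact (local_mem_insertBrackets m h b.2.1).1 this
  · rintro ⟨h1, h2⟩ p hp
    rcases mem_insertBrackets.1 hp with ⟨q, hq, rfl⟩ | ⟨i, q, hq, rfl⟩
    · exact mem_insertBrackets.2 (Or.inl ⟨q, h1 hq, rfl⟩)
    · exact mem_insertBrackets.2 (Or.inr ⟨i, q, Bracketing.close_le_close.2 (h2 i) hq, rfl⟩)

/-- The gap after the letter `x` becomes the gap after the last letter of the string that is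
inserted for `x`. -/
theorem mem_gaps_iff_blockLast {p : Fin l × Fin l} (hp : p.1 ≠ p.2) {x : Fin l} :
    x ∈ gaps p ↔ blockLast m h x ∈ gaps (blockFirst m h p.1, blockLast m h p.2) := by
  rw [mem_gaps_iff_elts, mem_gaps_iff_elts]
  have h1 : blockLast m h x ∈ elts (blockFirst m h p.1, blockLast m h p.2) ↔ x ∈ elts p :=
    mem_elts_outer m h (x := ⟨x, ⊤⟩)
  have h2 := blockFirst_ne_blockLast m h hp
  have h3 : blockLast m h x = blockLast m h p.2 ↔ x = p.2 :=
    ⟨fun e => congrArg Sigma.fst ((blockEquiv m h).injective e), fun e => by rw [e]⟩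
  simp only [h1, h2, h3, hp, ne_eq]

theorem compatible_of_outer {p q : Fin l × Fin l} (hp : p.1 ≠ p.2) (hq : q.1 ≠ q.2)
    (hpq : Compatible (blockFirst m h p.1, blockLast m h p.2)
      (blockFirst m h q.1, blockLast m h q.2)) : Compatible p q := by
  rcases hpq with h' | h' | h'
  · refine Or.inl fun x hx => ?_
    rw [mem_gaps_iff_blockLast m h hp] at hx
    exact (mem_gaps_iff_blockLast m h hq).2 (h' hx)
  · refine Or.inr (Or.inl fun x hx => ?_)
    rw [mem_gaps_iff_blockLast m h hq] at hx
    exact (mem_gaps_iff_blockLast m h hp).2 (h' hx)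
  · refine Or.inr (Or.inr (Finset.disjoint_left.2 fun x hx hx' => ?_))
    exact Finset.disjoint_left.1 h' ((mem_elts_outer m h (x := ⟨x, 0⟩)).2 hx)
      ((mem_elts_outer m h (x := ⟨x, 0⟩)).2 hx')

theorem compatible_of_local {i : Fin l} {p q : Fin (m i) × Fin (m i)} (hp : p.1 < p.2)
    (hq : q.1 < q.2) (hpq : Compatible (blockEquiv m h ⟨i, p.1⟩, blockEquiv m h ⟨i, p.2⟩)
      (blockEquiv m h ⟨i, q.1⟩, blockEquiv m h ⟨i, q.2⟩)) : Compatible p q := by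
  have key : ∀ {p q : Fin (m i) × Fin (m i)}, p.1 < p.2 → q.1 < q.2 →
      gaps (blockEquiv m h ⟨i, p.1⟩, blockEquiv m h ⟨i, p.2⟩) ⊆
      gaps (blockEquiv m h ⟨i, q.1⟩, blockEquiv m h ⟨i, q.2⟩) → gaps p ⊆ gaps q := by
    intro p q hp hq h' x hx
    obtain ⟨w, hw, e⟩ := (mem_gaps_local m h hq).1 (h' ((mem_gaps_local m h hp).2 ⟨x, hx, rfl⟩))
    have := (blockEquiv m h).injective e
    simp only [Sigma.mk.injEq, heq_eq_eq, true_and] at this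
    rwa [this]
  rcases hpq with h' | h' | h'
  · exact Or.inl (key hp hq h')
  · exact Or.inr (Or.inl (key hq hp h'))
  · refine Or.inr (Or.inr (Finset.disjoint_left.2 fun x hx hx' => ?_))
    exact Finset.disjoint_left.1 h' ((mem_elts_local m h hp).2 ⟨x, hx, rfl⟩)
      ((mem_elts_local m h hq).2 ⟨x, hx', rfl⟩)

theorem fst_mem_elts {n : ℕ+} (p : Fin n × Fin n) : p.1 ∈ elts p := by
  rw [mem_elts_iff']
  omega

theorem snd_mem_elts {n : ℕ+} (p : Fin n × Fin n) : p.2 ∈ elts p := by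
  rw [mem_elts_iff']
  omega

theorem mem_elts_block {i : Fin l} (hi : (0 : Fin (m i)) < ⊤) (a : Fin (m i)) :
    blockEquiv m h ⟨i, a⟩ ∈ elts (blockEquiv m h ⟨i, 0⟩, blockEquiv m h ⟨i, ⊤⟩) := by
  refine (mem_elts_local m h (p := (0, ⊤)) hi).2 ⟨a, ?_, rfl⟩
  rw [mem_elts_iff]
  exact Or.inl ⟨hi.le, Fin.zero_le _, le_top⟩

theorem mem_gaps_block {i : Fin l} (hi : (0 : Fin (m i)) < ⊤) {a : Fin (m i)} (ha : a < ⊤) :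
    blockEquiv m h ⟨i, a⟩ ∈ gaps (blockEquiv m h ⟨i, 0⟩, blockEquiv m h ⟨i, ⊤⟩) := by
  refine (mem_gaps_local m h (p := (0, ⊤)) hi).2 ⟨a, ?_, rfl⟩
  rw [mem_gaps_iff]
  exact Or.inl ⟨hi.le, Fin.zero_le _, ha⟩

/-- A bracket that is compatible with all blocks either encloses whole blocks or is inside a
block. -/
theorem outer_or_local {p : Fin n × Fin n} (hp : p.1 ≠ p.2)
    (hcomp : ∀ i, (0 : Fin (m i)) < ⊤ →
      Compatible (blockEquiv m h ⟨i, 0⟩, blockEquiv m h ⟨i, ⊤⟩) p) :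
    (∃ q : Fin l × Fin l, q.1 ≠ q.2 ∧ p = (blockFirst m h q.1, blockLast m h q.2)) ∨
      ∃ i, ∃ q : Fin (m i) × Fin (m i), q.1 < q.2 ∧
        p = (blockEquiv m h ⟨i, q.1⟩, blockEquiv m h ⟨i, q.2⟩) := by
  obtain ⟨u, v⟩ := p
  obtain ⟨⟨i, a⟩, rfl⟩ := (blockEquiv m h).surjective u
  obtain ⟨⟨j, b⟩, rfl⟩ := (blockEquiv m h).surjective v
  set p : Fin n × Fin n := (blockEquiv m h ⟨i, a⟩, blockEquiv m h ⟨j, b⟩) with hpdef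
  by_cases hij : i = j
  · subst hij
    -- Both ends are in one block. A bracket that opens after the place where it closes runs around
    -- the circle and would cross the bracket around this block.
    rcases lt_trichotomy a b with hab | rfl | hab
    · exact Or.inr ⟨i, (a, b), hab, rfl⟩
    · exact absurd rfl hp
    · have hi : (0 : Fin (m i)) < ⊤ := (Fin.zero_le b).trans_lt (hab.trans_le le_top)
      have hlt := (blockEquiv_lt_iff_snd m h).2 hab
      rcases hcomp i hi with h' | h' | h'
      · exact absurd (h' (mem_gaps_block m h hi (hab.trans_le le_top)))
          (snd_notMem_gaps (p := p))
      · have htop : (⊤ : Fin n) ∈ gaps p := by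
          rw [mem_gaps_iff]
          exact Or.inr ⟨hlt, Or.inl le_top⟩
        have h2 := h' htop
        rw [mem_gaps_iff] at h2
        rcases h2 with h2 | h2
        · exact absurd h2.2.2 (not_lt.2 le_top)
        · exact absurd h2.1 (not_lt.2 ((blockEquiv_lt_iff_snd m h).2 hi).le)
      · exact absurd (fst_mem_elts p) (Finset.disjoint_left.1 h' (mem_elts_block m h hi a))
  · have ha : a = 0 := by
      by_contra ha
      have ha' : 0 < a := Fin.pos_iff_ne_zero.2 ha
      have hi : (0 : Fin (m i)) < ⊤ := ha'.trans_le le_top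
      rcases hcomp i hi with h' | h' | h'
      · obtain ⟨x, hx⟩ := exists_isPred a
        have hxa : (x : ℕ) + 1 = a := by
          rw [Fin.lt_def, Fin.val_zero] at ha'
          unfold IsPred at hx
          omega
        have hx' : IsPred (blockEquiv m h ⟨i, x⟩) (blockEquiv m h ⟨i, a⟩) := by
          left
          simp only [blockEquiv, Equiv.trans_apply, finCongr_apply, Fin.val_cast,
            finSigmaFinEquiv_apply]
          omega
        have hxtop : x < ⊤ := lt_of_lt_of_le (show x < a from by rw [Fin.lt_def]; omega) le_top
        exact isPred_fst_notMem (p := p) hx' (h' (mem_gaps_block m h hi hxtop))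
      · have h2 := elts_subset_of_gaps_subset hp h' (snd_mem_elts p)
        obtain ⟨w, _, e⟩ := (mem_elts_local m h (p := (0, ⊤)) hi).1 h2
        exact hij (congrArg Sigma.fst ((blockEquiv m h).injective e)).symm
      · exact absurd (fst_mem_elts p) (Finset.disjoint_left.1 h' (mem_elts_block m h hi a))
    have hb : b = ⊤ := by
      by_contra hb
      have hb' : b < ⊤ := lt_top_iff_ne_top.2 hb
      have hj : (0 : Fin (m j)) < ⊤ := (Fin.zero_le b).trans_lt hb'
      rcases hcomp j hj with h' | h' | h'
      · exact snd_notMem_gaps (p := p) (h' (mem_gaps_block m h hj hb'))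
      · have h2 := gaps_subset_elts (h' (fst_mem_gaps hp))
        obtain ⟨w, _, e⟩ := (mem_elts_local m h (p := (0, ⊤)) hj).1 h2
        exact hij (congrArg Sigma.fst ((blockEquiv m h).injective e))
      · exact absurd (snd_mem_elts p) (Finset.disjoint_left.1 h' (mem_elts_block m h hj b))
    refine Or.inl ⟨(i, j), hij, ?_⟩
    rw [hpdef, ha, hb]
    rfl

theorem zero_lt_top_iff {n : ℕ+} : (0 : Fin n) < ⊤ ↔ 1 < n := by
  have := n.pos
  rw [Fin.lt_def, Fin.val_zero, Fin.val_top, ← PNat.coe_lt_coe, PNat.one_coe]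
  omega

theorem lt_of_mem_close {n : ℕ+} {b : Bracketing n} {p : Fin n × Fin n} (hp : p ∈ b.close.1) :
    p.1 < p.2 := withOuter_lt b hp

/-- The image of a composition map is closed downwards. -/
theorem CycBracketing.exists_eq_comp_of_le_top {β : CycBracketing n}
    (hβ : β ≤ (⊤ : CycBracketing l).comp m h fun _ => ⊤) :
    ∃ (b : CycBracketing l) (c : ∀ i, Bracketing (m i)), β = b.comp m h c := by
  classical
  have hblock : ∀ i, (0 : Fin (m i)) < ⊤ →
      (blockEquiv m h ⟨i, 0⟩, blockEquiv m h ⟨i, ⊤⟩) ∈ β.1 := fun i hi =>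
    hβ (mem_insertBrackets.2 (Or.inr ⟨i, (0, ⊤), Bracketing.mem_close.2
      (Or.inl ⟨zero_lt_top_iff.1 hi, rfl⟩), rfl⟩))
  let b : CycBracketing l := ⟨Finset.univ.filter fun q => q.1 ≠ q.2 ∧
      (blockFirst m h q.1, blockLast m h q.2) ∈ β.1, fun q hq => (Finset.mem_filter.1 hq).2.1,
    fun p hp q hq => compatible_of_outer m h (Finset.mem_filter.1 hp).2.1
      (Finset.mem_filter.1 hq).2.1 (β.2.2 _ (Finset.mem_filter.1 hp).2.2 _
      (Finset.mem_filter.1 hq).2.2)⟩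
  let c : ∀ i, Bracketing (m i) := fun i => ⟨Finset.univ.filter fun q => (q.1 < q.2 ∧
      (q.2 : ℕ) - q.1 + 1 < m i) ∧ (blockEquiv m h ⟨i, q.1⟩, blockEquiv m h ⟨i, q.2⟩) ∈ β.1,
    fun q hq => (Finset.mem_filter.1 hq).2.1,
    fun p hp q hq => compatible_of_local m h (Finset.mem_filter.1 hp).2.1.1
      (Finset.mem_filter.1 hq).2.1.1 (β.2.2 _ (Finset.mem_filter.1 hp).2.2 _
      (Finset.mem_filter.1 hq).2.2)⟩
  refine ⟨b, c, CycBracketing.ext fun p => ⟨fun hp => ?_, fun hp => ?_⟩⟩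
  · rcases outer_or_local m h (β.2.1 p hp) fun i hi => β.2.2 _ (hblock i hi) _ hp with
      ⟨q, hq, rfl⟩ | ⟨i, q, hq, rfl⟩
    · exact mem_insertBrackets.2 (Or.inl ⟨q, Finset.mem_filter.2 ⟨Finset.mem_univ _, hq, hp⟩, rfl⟩)
    · refine mem_insertBrackets.2 (Or.inr ⟨i, q, Bracketing.mem_close.2 ?_, rfl⟩)
      by_cases h0 : q = (0, ⊤)
      · refine Or.inl ⟨?_, h0⟩
        rw [h0] at hq
        exact zero_lt_top_iff.1 hq
      · have hi : 1 < m i := zero_lt_top_iff.1 ((Fin.zero_le q.1).trans_lt (hq.trans_le le_top))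
        refine Or.inr (Finset.mem_filter.2 ⟨Finset.mem_univ _,
          proper_of_compatible_outer hq.ne ?_ h0, hp⟩)
        refine Or.inr (Or.inl (gaps_subset_outer hq))
  · rcases mem_insertBrackets.1 hp with ⟨q, hq, rfl⟩ | ⟨i, q, hq, rfl⟩
    · exact (Finset.mem_filter.1 hq).2.2
    · rcases Bracketing.mem_close.1 hq with ⟨hi, rfl⟩ | hq
      · exact hblock i (zero_lt_top_iff.2 hi)
      · exact (Finset.mem_filter.1 hq).2.2

theorem CycBracketing.exists_eq_comp {β : CycBracketing n} {b : CycBracketing l}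
    {c : ∀ i, Bracketing (m i)} (hβ : β ≤ b.comp m h c) :
    ∃ (b' : CycBracketing l) (c' : ∀ i, Bracketing (m i)), β = b'.comp m h c' ∧ b' ≤ b ∧
      ∀ i, c' i ≤ c i := by
  obtain ⟨b', c', rfl⟩ := CycBracketing.exists_eq_comp_of_le_top m h
    (hβ.trans ((CycBracketing.comp_le_comp m h).2 ⟨le_top, fun i => le_top⟩))
  exact ⟨b', c', rfl, (CycBracketing.comp_le_comp m h).1 hβ⟩

/-- Composition of strings is a special case of the insertion of strings into circles. -/
theorem Bracketing.close_comp (b : Bracketing l) (c : ∀ i, Bracketing (m i)) :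
    (b.comp m h c).close = b.close.comp m h c := by
  have hmem : ∀ p, p ∈ (b.comp m h c).1 ↔ p ∈ insertBrackets m h b.1 c ∧
      (p.2 : ℕ) - p.1 + 1 < n := fun p => Finset.mem_filter
  refine CycBracketing.ext fun p => ?_
  rw [Bracketing.mem_close, hmem]
  change _ ↔ p ∈ insertBrackets m h b.close.1 c
  constructor
  · rintro (⟨hn, rfl⟩ | ⟨hp, -⟩)
    · by_cases hl : 1 < l
      · refine mem_insertBrackets.2 (Or.inl ⟨(0, ⊤), Bracketing.mem_close.2 (Or.inl ⟨hl, rfl⟩), ?_⟩)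
        rw [blockFirst_zero, blockLast_top]
      · have hl' : (⊤ : Fin l) = 0 := by
          have : ¬ (0 : Fin l) < ⊤ := fun h' => hl (zero_lt_top_iff.1 h')
          exact le_antisymm (not_lt.1 this) (Fin.zero_le _)
        have e1 : blockEquiv m h ⟨0, 0⟩ = 0 := blockFirst_zero m h
        have e2 : blockEquiv m h ⟨0, ⊤⟩ = ⊤ := by
          have := blockLast_top m h
          rwa [hl'] at this
        refine mem_insertBrackets.2 (Or.inr ⟨0, (0, ⊤), Bracketing.mem_close.2
          (Or.inl ⟨?_, rfl⟩), ?_⟩)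
        · rw [← zero_lt_top_iff, ← blockEquiv_lt_iff_snd m h, e1, e2]
          exact zero_lt_top_iff.2 hn
        · rw [e1, e2]
    · rcases mem_insertBrackets.1 hp with ⟨q, hq, rfl⟩ | h'
      · exact mem_insertBrackets.2 (Or.inl ⟨q, Bracketing.mem_close.2 (Or.inr hq), rfl⟩)
      · exact mem_insertBrackets.2 (Or.inr h')
  · intro hp
    have hlt : p.1 < p.2 := insertBrackets_lt (fun q hq => lt_of_mem_close hq) p hp
    by_cases h0 : p = (0, ⊤)
    · rw [h0] at hlt
      exact Or.inl ⟨zero_lt_top_iff.1 hlt, h0⟩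
    · have hproper := proper_of_compatible_outer hlt.ne (Or.inr (Or.inl (gaps_subset_outer hlt))) h0
      refine Or.inr ⟨?_, hproper.2⟩
      rcases mem_insertBrackets.1 hp with ⟨q, hq, rfl⟩ | h'
      · rcases Bracketing.mem_close.1 hq with ⟨_, rfl⟩ | hq
        · exfalso
          rw [blockFirst_zero, blockLast_top] at h0
          exact h0 rfl
        · exact mem_insertBrackets.2 (Or.inl ⟨q, hq, rfl⟩)
      · exact mem_insertBrackets.2 (Or.inr h')

theorem Bracketing.close_injective {n : ℕ+} : Function.Injective (Bracketing.close (n := n)) :=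
  fun b c e => by rw [← b.cut_close, e, c.cut_close]

theorem Bracketing.comp_le_comp {b b' : Bracketing l} {c c' : ∀ i, Bracketing (m i)} :
    b.comp m h c ≤ b'.comp m h c' ↔ b ≤ b' ∧ ∀ i, c i ≤ c' i := by
  rw [← Bracketing.close_le_close, Bracketing.close_comp, Bracketing.close_comp,
    CycBracketing.comp_le_comp, Bracketing.close_le_close]

theorem Bracketing.exists_eq_comp {β : Bracketing n} {b : Bracketing l}
    {c : ∀ i, Bracketing (m i)} (hβ : β ≤ b.comp m h c) :
    ∃ (b' : Bracketing l) (c' : ∀ i, Bracketing (m i)), β = b'.comp m h c' ∧ b' ≤ b ∧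
      ∀ i, c' i ≤ c i := by
  rw [← Bracketing.close_le_close, Bracketing.close_comp] at hβ
  obtain ⟨b', c', h1, h2, h3⟩ := CycBracketing.exists_eq_comp m h (b := b.close) hβ
  have h4 := CycBracketing.close_cut (h2.trans b.close_le)
  refine ⟨b'.cut, c', Bracketing.close_injective ?_, ?_, h3⟩
  · rw [h1, Bracketing.close_comp, h4]
  · rwa [← Bracketing.close_le_close, h4]

end Blocks

/-! ### Unit laws for bracketings -/

section Units

theorem eq_of_fin_one (a b : Fin (1 : ℕ+)) : a = b :=
  Subsingleton.elim (α := Fin 1) a b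

theorem blockEquiv_one {l : ℕ+} (h : ∑ _i : Fin l, ((1 : ℕ+) : ℕ) = l) (i : Fin l)
    (a : Fin (1 : ℕ+)) : blockEquiv (fun _ : Fin l => (1 : ℕ+)) h ⟨i, a⟩ = i := by
  refine (eq_blockEquiv (fun _ : Fin l => (1 : ℕ+)) h (g := fun x => x.1) (fun _ _ h => h) ?_
    ⟨i, a⟩).symm
  intro i a b hab
  rw [eq_of_fin_one a b] at hab
  exact absurd hab (lt_irrefl _)

theorem blockEquiv_single {n : ℕ+} (h : ∑ _i : Fin (1 : ℕ+), (n : ℕ) = n) (i : Fin (1 : ℕ+))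
    (a : Fin n) : blockEquiv (fun _ : Fin (1 : ℕ+) => n) h ⟨i, a⟩ = a := by
  refine (eq_blockEquiv (fun _ : Fin (1 : ℕ+) => n) h (g := fun x => x.2) ?_
    (fun _ _ _ h => h) ⟨i, a⟩).symm
  intro x y hxy
  rw [eq_of_fin_one x.1 y.1] at hxy
  exact absurd hxy (lt_irrefl _)

theorem close_one (b : Bracketing 1) (p : Fin (1 : ℕ+) × Fin (1 : ℕ+)) : p ∉ b.close.1 := by
  intro hp
  have := lt_of_mem_close hp
  rw [eq_of_fin_one p.1 p.2] at this
  exact lt_irrefl _ this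

theorem CycBracketing.comp_one {l : ℕ+} (h : ∑ _i : Fin l, ((1 : ℕ+) : ℕ) = l)
    (b : CycBracketing l) (c : Fin l → Bracketing 1) : b.comp (fun _ => 1) h c = b := by
  refine CycBracketing.ext fun p => mem_insertBrackets.trans ?_
  simp only [blockFirst, blockLast, blockEquiv_one]
  constructor
  · rintro (⟨q, hq, rfl⟩ | ⟨i, q, hq, -⟩)
    · exact hq
    · exact absurd hq (close_one _ _)
  · exact fun hp => Or.inl ⟨p, hp, rfl⟩

theorem Bracketing.comp_one {l : ℕ+} (h : ∑ _i : Fin l, ((1 : ℕ+) : ℕ) = l)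
    (b : Bracketing l) (c : Fin l → Bracketing 1) : b.comp (fun _ => 1) h c = b :=
  Bracketing.close_injective (by rw [Bracketing.close_comp, CycBracketing.comp_one])

theorem Bracketing.one_comp {n : ℕ+} (h : ∑ _i : Fin (1 : ℕ+), (n : ℕ) = n) (b : Bracketing 1)
    (c : Bracketing n) : b.comp (fun _ => n) h (fun _ => c) = c := by
  refine Bracketing.close_injective ?_
  rw [Bracketing.close_comp]
  refine CycBracketing.ext fun p => mem_insertBrackets.trans ?_
  simp only [blockEquiv_single]
  constructor
  · rintro (⟨q, hq, -⟩ | ⟨i, q, hq, rfl⟩)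
    · exact absurd hq (close_one _ _)
    · exact hq
  · exact fun hp => Or.inr ⟨0, p, hp, rfl⟩

end Units

/-! ### Associativity of insertion -/

section Assoc

variable {l n N : ℕ+} (m : Fin l → ℕ+) (h : ∑ i, (m i : ℕ) = n)
  (k : ∀ i, Fin (m i) → ℕ+) (q : Fin l → ℕ+) (hq : ∀ i, ∑ j, (k i j : ℕ) = q i)
  (hN : ∑ i, (q i : ℕ) = N)
  (hN' : ∑ s, (k ((blockEquiv m h).symm s).1 ((blockEquiv m h).symm s).2 : ℕ) = N)

theorem blockEquiv_blockEquiv_lt {x y : Σ i, Fin (m i)}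
    (hxy : blockEquiv m h x < blockEquiv m h y) (a : Fin (k x.1 x.2)) (b : Fin (k y.1 y.2)) :
    blockEquiv q hN ⟨x.1, blockEquiv (k x.1) (hq x.1) ⟨x.2, a⟩⟩ <
      blockEquiv q hN ⟨y.1, blockEquiv (k y.1) (hq y.1) ⟨y.2, b⟩⟩ := by
  rcases blockEquiv_lt_cases m h hxy with hxy' | ⟨i, c, d, hcd, rfl, rfl⟩
  · exact blockEquiv_lt_of_lt q hN hxy'
  · exact (blockEquiv_lt_iff_snd q hN).2 (blockEquiv_lt_of_lt (k i) (hq i) hcd)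

/-- Decomposition into blocks and then into blocks of blocks. -/
theorem blockEquiv_assoc (s : Fin n)
    (a : Fin (k ((blockEquiv m h).symm s).1 ((blockEquiv m h).symm s).2)) :
    blockEquiv (fun s => k ((blockEquiv m h).symm s).1 ((blockEquiv m h).symm s).2) hN' ⟨s, a⟩ =
      blockEquiv q hN ⟨((blockEquiv m h).symm s).1,
        blockEquiv (k ((blockEquiv m h).symm s).1) (hq _) ⟨((blockEquiv m h).symm s).2, a⟩⟩ := by
  symm
  refine eq_blockEquiv (fun s => k ((blockEquiv m h).symm s).1 ((blockEquiv m h).symm s).2) hN'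
    (g := fun x => blockEquiv q hN ⟨((blockEquiv m h).symm x.1).1,
      blockEquiv (k ((blockEquiv m h).symm x.1).1) (hq _) ⟨((blockEquiv m h).symm x.1).2, x.2⟩⟩)
    ?_ ?_ ⟨s, a⟩
  · rintro ⟨s, a⟩ ⟨t, b⟩ hst
    refine blockEquiv_blockEquiv_lt m h k q hq hN ?_ a b
    rwa [Equiv.apply_symm_apply, Equiv.apply_symm_apply]
  · intro s a b hab
    exact (blockEquiv_lt_iff_snd q hN).2 ((blockEquiv_lt_iff_snd _ (hq _)).2 hab)

theorem blockFirst_assoc (x : Σ i, Fin (m i)) :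
    blockFirst (fun s => k ((blockEquiv m h).symm s).1 ((blockEquiv m h).symm s).2) hN'
      (blockEquiv m h x) = blockEquiv q hN ⟨x.1, blockFirst (k x.1) (hq x.1) x.2⟩ := by
  obtain ⟨s, rfl⟩ := (blockEquiv m h).symm.surjective x
  rw [Equiv.apply_symm_apply]
  exact blockEquiv_assoc m h k q hq hN hN' s 0

theorem blockLast_assoc (x : Σ i, Fin (m i)) :
    blockLast (fun s => k ((blockEquiv m h).symm s).1 ((blockEquiv m h).symm s).2) hN'
      (blockEquiv m h x) = blockEquiv q hN ⟨x.1, blockLast (k x.1) (hq x.1) x.2⟩ := by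
  obtain ⟨s, rfl⟩ := (blockEquiv m h).symm.surjective x
  rw [Equiv.apply_symm_apply]
  exact blockEquiv_assoc m h k q hq hN hN' s ⊤

/-- On both sides there are three kinds of brackets: those of `b`, those of some `c i` closed by its
outer bracket, and those of some `d i j` likewise. Their positions agree by the uniqueness of
order-preserving numberings. -/
theorem CycBracketing.comp_assoc (b : CycBracketing l) (c : ∀ i, Bracketing (m i))
    (d : ∀ i j, Bracketing (k i j)) :
    (b.comp m h c).comp (fun s => k ((blockEquiv m h).symm s).1 ((blockEquiv m h).symm s).2) hN'
        (fun s => d ((blockEquiv m h).symm s).1 ((blockEquiv m h).symm s).2) =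
      b.comp q hN fun i => (c i).comp (k i) (hq i) (d i) := by
  refine CycBracketing.ext fun p => mem_insertBrackets.trans (Iff.trans ?_
    mem_insertBrackets.symm)
  have e1 : ∀ i, blockFirst (fun s => k ((blockEquiv m h).symm s).1 ((blockEquiv m h).symm s).2) hN'
      (blockFirst m h i) = blockFirst q hN i := fun i => by
    refine (blockFirst_assoc m h k q hq hN hN' ⟨i, 0⟩).trans ?_
    rw [blockFirst_zero]
    rfl
  have e2 : ∀ i, blockLast (fun s => k ((blockEquiv m h).symm s).1 ((blockEquiv m h).symm s).2) hN'
      (blockLast m h i) = blockLast q hN i := fun i => by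
    refine (blockLast_assoc m h k q hq hN hN' ⟨i, ⊤⟩).trans ?_
    rw [blockLast_top]
    rfl
  constructor
  · rintro (⟨r, hr, rfl⟩ | ⟨s, r, hr, rfl⟩)
    · rcases mem_insertBrackets.1 hr with ⟨t, ht, rfl⟩ | ⟨i, t, ht, rfl⟩
      · exact Or.inl ⟨t, ht, by rw [e1, e2]⟩
      · refine Or.inr ⟨i, (blockFirst (k i) (hq i) t.1, blockLast (k i) (hq i) t.2), ?_, ?_⟩
        · rw [Bracketing.close_comp]
          exact mem_insertBrackets.2 (Or.inl ⟨t, ht, rfl⟩)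
        · rw [blockFirst_assoc m h k q hq hN hN', blockLast_assoc m h k q hq hN hN']
    · refine Or.inr ⟨((blockEquiv m h).symm s).1, 
        (blockEquiv _ (hq _) ⟨((blockEquiv m h).symm s).2, r.1⟩,
        blockEquiv _ (hq _) ⟨((blockEquiv m h).symm s).2, r.2⟩), ?_, ?_⟩
      · rw [Bracketing.close_comp]
        exact mem_insertBrackets.2 (Or.inr ⟨_, r, hr, rfl⟩)
      · rw [blockEquiv_assoc m h k q hq hN hN', blockEquiv_assoc m h k q hq hN hN']
  · rintro (⟨r, hr, rfl⟩ | ⟨i, r, hr, rfl⟩)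
    · refine Or.inl ⟨(blockFirst m h r.1, blockLast m h r.2),
        mem_insertBrackets.2 (Or.inl ⟨r, hr, rfl⟩), by rw [e1, e2]⟩
    · rw [Bracketing.close_comp] at hr
      rcases mem_insertBrackets.1 hr with ⟨t, ht, rfl⟩ | ⟨j, t, ht, rfl⟩
      · refine Or.inl ⟨(blockEquiv m h ⟨i, t.1⟩, blockEquiv m h ⟨i, t.2⟩),
          mem_insertBrackets.2 (Or.inr ⟨i, t, ht, rfl⟩), ?_⟩
        rw [blockFirst_assoc m h k q hq hN hN', blockLast_assoc m h k q hq hN hN']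
      · obtain ⟨s, hs⟩ := (blockEquiv m h).symm.surjective ⟨i, j⟩
        obtain rfl : ((blockEquiv m h).symm s).1 = i := congrArg Sigma.fst hs
        obtain rfl : ((blockEquiv m h).symm s).2 = j := eq_of_heq (Sigma.mk.inj_iff.1 hs).2
        refine Or.inr ⟨s, t, ht, ?_⟩
        rw [blockEquiv_assoc m h k q hq hN hN', blockEquiv_assoc m h k q hq hN hN']

theorem Bracketing.comp_assoc (b : Bracketing l) (c : ∀ i, Bracketing (m i))
    (d : ∀ i j, Bracketing (k i j)) :
    (b.comp m h c).comp (fun s => k ((blockEquiv m h).symm s).1 ((blockEquiv m h).symm s).2) hN'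
        (fun s => d ((blockEquiv m h).symm s).1 ((blockEquiv m h).symm s).2) =
      b.comp q hN fun i => (c i).comp (k i) (hq i) (d i) := by
  refine Bracketing.close_injective ?_
  rw [Bracketing.close_comp, Bracketing.close_comp, Bracketing.close_comp,
    CycBracketing.comp_assoc m h k q hq hN hN']

end Assoc

/-! ### Compatibility of insertion with rotations -/

section Rotation

/-- After the circle is cut at `r`, the order of two places depends only on their order and on their
comparisons with `r`. Here `s, t, r` are blocks, and `u, v, f` are letters in the first two and the
beginning of the third. -/
theorem sub_lt_sub_of_cyclic {M N : ℕ} {s t r : Fin M} {u v f : Fin N} (hst : s - r < t - r)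
    (hu : f ≤ u ↔ r ≤ s) (hv : f ≤ v ↔ r ≤ t) (huv : s < t → u < v) : u - f < v - f := by
  rw [Fin.lt_def, fin_sub_val, fin_sub_val] at *
  simp only [hu, hv]
  have := u.2
  have := v.2
  have := s.2
  have := t.2
  simp only [Fin.le_def, Fin.lt_def] at *
  split_ifs at * <;> omega

variable {l n : ℕ+} (m : Fin l → ℕ+) (h : ∑ i, (m i : ℕ) = n) (r : Fin l)

include h in
theorem sum_add_right : ∑ i, (m (i + r) : ℕ) = n := by
  rw [← h]
  exact Equiv.sum_comp (Equiv.addRight r) fun i => (m i : ℕ)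

/-- The right-hand side numbers the rotated blocks in increasing order, beginning with the block
`r`; such a numbering is unique by `eq_blockEquiv`. -/
theorem blockEquiv_add_right (i : Fin l) (a : Fin (m (i + r))) :
    blockEquiv (fun i => m (i + r)) (sum_add_right m h r) ⟨i, a⟩ =
      blockEquiv m h ⟨i + r, a⟩ - blockFirst m h r := by
  symm
  refine eq_blockEquiv (fun i => m (i + r)) (sum_add_right m h r)
    (g := fun x => blockEquiv m h ⟨x.1 + r, x.2⟩ - blockFirst m h r) ?_ ?_ ⟨i, a⟩
  · rintro ⟨i, a⟩ ⟨j, b⟩ hij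
    refine sub_lt_sub_of_cyclic (s := i + r) (t := j + r) (r := r) ?_
      (blockFirst_le_iff m h (x := ⟨i + r, a⟩)) (blockFirst_le_iff m h (x := ⟨j + r, b⟩))
      fun e => blockEquiv_lt_of_lt m h (x := ⟨i + r, a⟩) (y := ⟨j + r, b⟩) e
    rwa [add_sub_cancel_right, add_sub_cancel_right]
  · intro i a b hab
    have hu : _ ≤ _ ↔ r ≤ i + r := blockFirst_le_iff m h (i := r) (x := ⟨i + r, a⟩)
    have hv : _ ≤ _ ↔ r ≤ i + r := blockFirst_le_iff m h (i := r) (x := ⟨i + r, b⟩)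
    have huv := (blockEquiv_lt_iff_snd m h (i := i + r) (a := a) (b := b)).2 hab
    rw [Fin.lt_def, fin_sub_val, fin_sub_val]
    simp only [hu, hv]
    have := (blockEquiv m h ⟨i + r, a⟩).2
    rw [Fin.le_def] at hu hv
    rw [Fin.lt_def] at huv
    by_cases hr : r ≤ i + r
    · simp only [if_pos hr]
      have := hu.2 hr
      omega
    · simp only [if_neg hr]
      omega

theorem CycBracketing.rotate_comp (b : CycBracketing l) (c : ∀ i, Bracketing (m i)) :
    (b.rotate r).comp (fun i => m (i + r)) (sum_add_right m h r) (fun i => c (i + r)) =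
      (b.comp m h c).rotate (blockFirst m h r) := by
  refine CycBracketing.ext fun p => ?_
  rw [CycBracketing.mem_rotate]
  refine mem_insertBrackets.trans (Iff.trans ?_ mem_insertBrackets.symm)
  have e : ∀ i (a : Fin (m (i + r))),
      blockEquiv (fun i => m (i + r)) (sum_add_right m h r) ⟨i, a⟩ + blockFirst m h r =
        blockEquiv m h ⟨i + r, a⟩ := fun i a => by
    rw [blockEquiv_add_right, sub_add_cancel]
  have e1 : ∀ i, blockFirst (fun i => m (i + r)) (sum_add_right m h r) i + blockFirst m h r =
      blockFirst m h (i + r) := fun i => e i 0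
  have e2 : ∀ i, blockLast (fun i => m (i + r)) (sum_add_right m h r) i + blockFirst m h r =
      blockLast m h (i + r) := fun i => e i ⊤
  constructor
  · rintro (⟨q, hq, rfl⟩ | ⟨i, q, hq, rfl⟩)
    · exact Or.inl ⟨_, CycBracketing.mem_rotate.1 hq, by rw [e1, e2]⟩
    · exact Or.inr ⟨i + r, q, hq, by rw [e, e]⟩
  · rintro (⟨q, hq, hp⟩ | ⟨i, q, hq, hp⟩)
    · refine Or.inl ⟨(q.1 - r, q.2 - r), CycBracketing.mem_rotate.2 ?_, ?_⟩
      · simpa using hq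
      · refine Prod.ext (add_right_cancel (b := blockFirst m h r) ?_)
          (add_right_cancel (b := blockFirst m h r) ?_)
        · rw [e1, sub_add_cancel]
          exact congrArg Prod.fst hp
        · rw [e2, sub_add_cancel]
          exact congrArg Prod.snd hp
    · obtain ⟨i, rfl⟩ : ∃ j, j + r = i := ⟨i - r, sub_add_cancel i r⟩
      refine Or.inr ⟨i, q, hq, ?_⟩
      refine Prod.ext (add_right_cancel (b := blockFirst m h r) ?_)
        (add_right_cancel (b := blockFirst m h r) ?_)
      · rw [e]
        exact congrArg Prod.fst hp
      · rw [e]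
        exact congrArg Prod.snd hp

end Rotation

open MeasureTheory

/-! ### Composition of points -/

/-- An embedding of a product of partially ordered sets, as a union of principal lower sets. -/
structure IsFaceEmbedding {P R ι : Type} {Q : ι → Type} [PartialOrder P] [PartialOrder R]
    [∀ i, PartialOrder (Q i)] (f : P → (∀ i, Q i) → R) : Prop where
  le_iff : ∀ {p p' q q'}, f p q ≤ f p' q' ↔ p ≤ p' ∧ ∀ i, q i ≤ q' i
  exists_eq : ∀ {r p q}, r ≤ f p q → ∃ p' q', r = f p' q'

/-! ### Maps of spaces induced by embeddings of face posets -/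

namespace Chart

variable {X P Z R ι : Type} {Y Q : ι → Type} [Fintype ι]
  [TopologicalSpace X] [∀ i, TopologicalSpace (Y i)] [TopologicalSpace Z]
  [PartialOrder P] [Fintype P] [PartialOrder R] [Fintype R] [∀ i, PartialOrder (Q i)]
  [∀ i, Fintype (Q i)] (A : Chart X P) (B : ∀ i, Chart (Y i) (Q i)) (C : Chart Z R)
  {f : P → (∀ i, Q i) → R} (hf : IsFaceEmbedding f)

/-- The map of spaces induced by an embedding of posets of faces. -/
def compose (x : X) (y : ∀ i, Y i) : Z :=
  C.pt ⟨fun s => f (A.profile x s) fun i => (B i).profile (y i) s, fun _ _ hst =>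
    hf.le_iff.2 ⟨(A.profile x).monotone hst, fun i => ((B i).profile (y i)).monotone hst⟩⟩

omit [Fintype ι] in
theorem profile_compose (x : X) (y : ∀ i, Y i) : ∀ᵐ s ∂unitMeasure,
    C.profile (compose A B C hf x y) s = f (A.profile x s) fun i => (B i).profile (y i) s :=
  C.profile_pt _

/-- For almost every parameter the profiles of all arguments are locally constant, hence so is the
value of `f` on them; `continuous_mass` turns this into continuity. -/
theorem continuous_compose [FirstCountableTopology X] [∀ i, FirstCountableTopology (Y i)] :
    Continuous fun p : X × ∀ i, Y i => compose A B C hf p.1 p.2 := by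
  refine C.continuous_pt _ (continuous_mass ?_)
  rintro ⟨x, y⟩
  have h2 : ∀ᵐ s ∂unitMeasure, ∀ i, ∀ᶠ y' in 𝓝 (y i), (B i).profile y' s = (B i).profile (y i) s :=
    ae_all_iff.2 fun i => (B i).ae_eventually_profile (y i)
  filter_upwards [A.ae_eventually_profile x, h2] with s h1 h2
  have h3 : ∀ᶠ p : X × ∀ i, Y i in 𝓝 (x, y), ∀ i, (B i).profile (p.2 i) s = (B i).profile (y i) s :=
    Filter.eventually_all.2 fun i => (((continuous_apply i).comp continuous_snd).tendsto (x, y)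
      |>.eventually (h2 i))
  filter_upwards [(continuous_fst.tendsto (x, y)).eventually h1, h3] with p h4 h5
  change f (A.profile p.1 s) (fun i => (B i).profile (p.2 i) s) =
    f (A.profile x s) fun i => (B i).profile (y i) s
  rw [h4]
  exact congrArg _ (funext h5)

theorem carrier_compose_le {x : X} {y : ∀ i, Y i} {p : P} {q : ∀ i, Q i} :
    C.carrier (compose A B C hf x y) ≤ f p q ↔
      A.carrier x ≤ p ∧ ∀ i, (B i).carrier (y i) ≤ q i := by
  simp only [← ae_profile_le_iff]
  rw [← ae_all_iff, ← Filter.eventually_and]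
  refine Filter.eventually_congr ?_
  filter_upwards [profile_compose A B C hf x y] with s hs
  rw [hs, hf.le_iff]

/-- Since `f` reflects the order, equality of profiles of the composites gives equality almost
everywhere of the profiles of the arguments. -/
theorem compose_injective {x x' : X} {y y' : ∀ i, Y i}
    (e : compose A B C hf x y = compose A B C hf x' y') : x = x' ∧ y = y' := by
  have key : ∀ᵐ s ∂unitMeasure, A.profile x s = A.profile x' s ∧
      ∀ i, (B i).profile (y i) s = (B i).profile (y' i) s := by
    filter_upwards [profile_compose A B C hf x y, profile_compose A B C hf x' y'] with s h1 h2
    rw [e, h2] at h1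
    have h3 := hf.le_iff.1 h1.le
    have h4 := hf.le_iff.1 h1.ge
    exact ⟨le_antisymm h4.1 h3.1, fun i => le_antisymm (h4.2 i) (h3.2 i)⟩
  rw [Filter.eventually_and, ae_all_iff] at key
  exact ⟨A.eq_of_profile_ae_eq key.1, funext fun i => (B i).eq_of_profile_ae_eq (key.2 i)⟩

/-- All values of the profile of `z` lie below `f p q`, hence in the image of `f`. The factors are
monotone because `f` reflects the order, so they are step functions of points. -/
theorem exists_compose_eq {z : Z} {p : P} {q : ∀ i, Q i} (hz : C.carrier z ≤ f p q) :
    ∃ x y, compose A B C hf x y = z := by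
  choose φ ψ h using fun s => hf.exists_eq ((C.profile_le z s).trans hz)
  have hmono : ∀ s t, s ≤ t → φ s ≤ φ t ∧ ∀ i, ψ s i ≤ ψ t i := fun s t hst =>
    hf.le_iff.1 (by rw [← h, ← h]; exact (C.profile z).monotone hst)
  let φ' : ℝ →o P := ⟨φ, fun s t hst => (hmono s t hst).1⟩
  let ψ' : ∀ i, ℝ →o Q i := fun i => ⟨fun s => ψ s i, fun s t hst => (hmono s t hst).2 i⟩
  refine ⟨A.pt φ', fun i => (B i).pt (ψ' i), C.eq_of_profile_ae_eq ?_⟩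
  have h2 : ∀ᵐ s ∂unitMeasure, ∀ i, (B i).profile ((B i).pt (ψ' i)) s = ψ s i :=
    ae_all_iff.2 fun i => (B i).profile_pt (ψ' i)
  filter_upwards [profile_compose A B C hf (A.pt φ') (fun i => (B i).pt (ψ' i)),
    A.profile_pt φ', h2] with s h3 h4 h5
  rw [h3, h4, h s]
  exact congrArg _ (funext h5)

theorem bijOn_compose (p : P) (q : ∀ i, Q i) :
    BijOn (fun x : X × ∀ i, Y i => compose A B C hf x.1 x.2)
      ({x | A.carrier x ≤ p} ×ˢ univ.pi fun i => {y | (B i).carrier y ≤ q i})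
      {z | C.carrier z ≤ f p q} := by
  refine ⟨fun x hx => ?_, fun x _ x' _ e => ?_, fun z hz => ?_⟩
  · exact (carrier_compose_le A B C hf).2 ⟨hx.1, fun i => hx.2 i (mem_univ i)⟩
  · exact Prod.ext (compose_injective A B C hf e).1 (compose_injective A B C hf e).2
  · obtain ⟨x, y, rfl⟩ := exists_compose_eq A B C hf hz
    have := (carrier_compose_le A B C hf).1 hz
    exact ⟨(x, y), ⟨this.1, fun i _ => this.2 i⟩, rfl⟩

/-- The empty family of charts. -/
def none : ∀ _ : Empty, Chart Unit Unit := fun i => i.elim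

variable {g : P → R} (hg : IsFaceEmbedding (Q := fun _ : Empty => Unit) fun p _ => g p)

/-- The map of spaces induced by an embedding of posets of faces, with a single argument. -/
def map (x : X) : Z := compose A none C hg x fun _ => ()

theorem profile_map (x : X) :
    ∀ᵐ s ∂unitMeasure, C.profile (map A C hg x) s = g (A.profile x s) :=
  profile_compose A none C hg x fun _ => ()

theorem continuous_map [FirstCountableTopology X] : Continuous (map A C hg) := by
  have h2 : Continuous fun x : X => ((x, fun _ => ()) : X × (Empty → Unit)) :=
    continuous_id.prodMk continuous_const
  exact (continuous_compose A none C hg).comp h2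

theorem bijOn_map (p : P) :
    BijOn (map A C hg) {x | A.carrier x ≤ p} {z | C.carrier z ≤ g p} := by
  have h := bijOn_compose A none C hg p fun _ => ()
  have hmem : ∀ x ∈ {x | A.carrier x ≤ p}, ((x, fun _ => ()) : X × (Empty → Unit)) ∈
      {x | A.carrier x ≤ p} ×ˢ univ.pi fun i => {y : Unit | (none i).carrier y ≤ ()} :=
    fun x hx => ⟨hx, fun i => i.elim⟩
  refine ⟨fun x hx => h.mapsTo (hmem x hx), ?_, ?_⟩
  · intro x hx y hy e
    exact congrArg Prod.fst (h.injOn (hmem x hx) (hmem y hy) e)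
  · intro z hz
    obtain ⟨⟨x, y⟩, hx, rfl⟩ := h.surjOn hz
    obtain rfl := Subsingleton.elim (fun _ => ()) y
    exact ⟨x, hx.1, rfl⟩

end Chart

/-! ### Composition and rotation of points of associahedra and cyclohedra -/

section

variable {l n N : ℕ+} (m : Fin l → ℕ+) (h : ∑ i, (m i : ℕ) = n)

theorem CycBracketing.isFaceEmbedding_comp : IsFaceEmbedding (CycBracketing.comp m h) where
  le_iff := CycBracketing.comp_le_comp m h
  exists_eq hr := by
    obtain ⟨b, c, e, -⟩ := CycBracketing.exists_eq_comp m h hr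
    exact ⟨b, c, e⟩

theorem Bracketing.isFaceEmbedding_comp : IsFaceEmbedding (Bracketing.comp m h) where
  le_iff := Bracketing.comp_le_comp m h
  exists_eq hr := by
    obtain ⟨b, c, e, -⟩ := Bracketing.exists_eq_comp m h hr
    exact ⟨b, c, e⟩

theorem CycBracketing.rotate_le_rotate {b c : CycBracketing n} {r : Fin n} :
    b.rotate r ≤ c.rotate r ↔ b ≤ c := by
  constructor
  · intro hle p hp
    have := CycBracketing.mem_rotate.1 (hle (c.mem_rotate_sub.2 hp))
    simpa using this
  · exact fun hle p hp => CycBracketing.mem_rotate.2 (hle (CycBracketing.mem_rotate.1 hp))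

theorem CycBracketing.isFaceEmbedding_rotate (r : Fin n) :
    IsFaceEmbedding (Q := fun _ : Empty => Unit) fun (b : CycBracketing n) _ => b.rotate r where
  le_iff := by
    intro p p' q q'
    rw [CycBracketing.rotate_le_rotate]
    exact ⟨fun h => ⟨h, fun i => i.elim⟩, And.left⟩
  exists_eq := by
    intro b _ _ _
    exact ⟨b.rotate (-r), fun i => i.elim, by
      rw [CycBracketing.rotate_rotate, add_neg_cancel, CycBracketing.rotate_zero]⟩

/-- The composition of points of associahedra. -/
noncomputable def compK (x : polyK l) (y : ∀ i, polyK (m i)) : polyK n :=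
  (chartK l).compose (fun i => chartK (m i)) (chartK n) (Bracketing.isFaceEmbedding_comp m h) x y

/-- The composition of a point of the cyclohedron with points of associahedra. -/
noncomputable def compW (x : polyW l) (y : ∀ i, polyK (m i)) : polyW n :=
  (chartW l).compose (fun i => chartK (m i)) (chartW n) (CycBracketing.isFaceEmbedding_comp m h) x y

/-- The rotation of the cyclohedron that takes the position `r` to the position `0`. -/
noncomputable def rotW (r : Fin n) (x : polyW n) : polyW n :=
  (chartW n).map (chartW n) (CycBracketing.isFaceEmbedding_rotate r) x

theorem setOf_carrierK_le (b : Bracketing n) : {t | (chartK n).carrier t ≤ b} = faceK b :=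
  Set.ext fun _ => mem_faceK_iff.symm

theorem setOf_carrierW_le (b : CycBracketing n) : {t | (chartW n).carrier t ≤ b} = faceW b :=
  Set.ext fun _ => mem_faceW_iff.symm

theorem bijOn_compK (b : Bracketing l) (c : ∀ i, Bracketing (m i)) :
    BijOn (fun x : polyK l × ∀ i, polyK (m i) => compK m h x.1 x.2)
      (faceK b ×ˢ univ.pi fun i => faceK (c i)) (faceK (b.comp m h c)) := by
  simp only [← setOf_carrierK_le]
  exact Chart.bijOn_compose _ _ _ _ _ _

theorem bijOn_compW (b : CycBracketing l) (c : ∀ i, Bracketing (m i)) :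
    BijOn (fun x : polyW l × ∀ i, polyK (m i) => compW m h x.1 x.2)
      (faceW b ×ˢ univ.pi fun i => faceK (c i)) (faceW (b.comp m h c)) := by
  simp only [← setOf_carrierK_le, ← setOf_carrierW_le]
  exact Chart.bijOn_compose _ _ _ _ _ _

theorem bijOn_rotW (r : Fin n) (b : CycBracketing n) :
    BijOn (rotW r) (faceW b) (faceW (b.rotate r)) := by
  have h := Chart.bijOn_map (chartW n) (chartW n) (CycBracketing.isFaceEmbedding_rotate r) b
  rwa [setOf_carrierW_le, setOf_carrierW_le] at h

theorem profile_compK (x : polyK l) (y : ∀ i, polyK (m i)) : ∀ᵐ s ∂unitMeasure,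
    (chartK n).profile (compK m h x y) s =
      ((chartK l).profile x s).comp m h fun i => (chartK (m i)).profile (y i) s :=
  Chart.profile_compose _ _ _ _ _ _

theorem profile_compW (x : polyW l) (y : ∀ i, polyK (m i)) : ∀ᵐ s ∂unitMeasure,
    (chartW n).profile (compW m h x y) s =
      ((chartW l).profile x s).comp m h fun i => (chartK (m i)).profile (y i) s :=
  Chart.profile_compose _ _ _ _ _ _

theorem profile_rotW (r : Fin n) (x : polyW n) : ∀ᵐ s ∂unitMeasure,
    (chartW n).profile (rotW r x) s = ((chartW n).profile x s).rotate r :=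
  (chartW n).profile_map (chartW n) (CycBracketing.isFaceEmbedding_rotate r) x

theorem continuous_compK :
    Continuous fun x : polyK l × ∀ i, polyK (m i) => compK m h x.1 x.2 :=
  Chart.continuous_compose _ _ _ _

theorem continuous_compW :
    Continuous fun x : polyW l × ∀ i, polyK (m i) => compW m h x.1 x.2 :=
  Chart.continuous_compose _ _ _ _

theorem continuous_rotW (r : Fin n) : Continuous (rotW r) :=
  Chart.continuous_map (chartW n) (chartW n) (CycBracketing.isFaceEmbedding_rotate r)

/-- A point is determined by its profile up to null sets, so an identity of bracketings, applied to
the values of profiles, becomes an identity of points. The identities below are all obtained in this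
way. -/
theorem rotW_rotW (r s : Fin n) (x : polyW n) : rotW r (rotW s x) = rotW (r + s) x := by
  refine (chartW n).eq_of_profile_ae_eq ?_
  filter_upwards [profile_rotW r (rotW s x), profile_rotW s x, profile_rotW (r + s) x]
    with t h1 h2 h3
  rw [h1, h2, h3, CycBracketing.rotate_rotate]

theorem rotW_zero (x : polyW n) : rotW 0 x = x := by
  refine (chartW n).eq_of_profile_ae_eq ?_
  filter_upwards [profile_rotW 0 x] with t h1
  rw [h1, CycBracketing.rotate_zero]

theorem rotW_compW (r : Fin l) (x : polyW l) (y : ∀ i, polyK (m i)) :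
    compW (fun i => m (i + r)) (sum_add_right m h r) (rotW r x) (fun i => y (i + r)) =
      rotW (blockFirst m h r) (compW m h x y) := by
  refine (chartW n).eq_of_profile_ae_eq ?_
  filter_upwards [profile_rotW r x, profile_compW m h x y,
    profile_rotW (blockFirst m h r) (compW m h x y),
    profile_compW (fun i => m (i + r)) (sum_add_right m h r) (rotW r x) (fun i => y (i + r))]
    with t h1 h2 h3 h4
  rw [h4, h1, h3, h2, ← CycBracketing.rotate_comp]

theorem compW_one (h : ∑ _i : Fin l, ((1 : ℕ+) : ℕ) = l) (x : polyW l) (y : Fin l → polyK 1) :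
    compW (fun _ => 1) h x y = x := by
  refine (chartW l).eq_of_profile_ae_eq ?_
  filter_upwards [profile_compW (fun _ => 1) h x y] with t h1
  rw [h1, CycBracketing.comp_one]

theorem compK_one (h : ∑ _i : Fin l, ((1 : ℕ+) : ℕ) = l) (x : polyK l) (y : Fin l → polyK 1) :
    compK (fun _ => 1) h x y = x := by
  refine (chartK l).eq_of_profile_ae_eq ?_
  filter_upwards [profile_compK (fun _ => 1) h x y] with t h1
  rw [h1, Bracketing.comp_one]

theorem compK_of_one (h : ∑ _i : Fin (1 : ℕ+), (n : ℕ) = n) (x : polyK 1) (y : polyK n) :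
    compK (fun _ => n) h x (fun _ => y) = y := by
  refine (chartK n).eq_of_profile_ae_eq ?_
  filter_upwards [profile_compK (fun _ => n) h x fun _ => y] with t h1
  rw [h1, Bracketing.one_comp]

variable (k : ∀ i, Fin (m i) → ℕ+) (q : Fin l → ℕ+) (hq : ∀ i, ∑ j, (k i j : ℕ) = q i)
  (hN : ∑ i, (q i : ℕ) = N)
  (hN' : ∑ s, (k ((blockEquiv m h).symm s).1 ((blockEquiv m h).symm s).2 : ℕ) = N)

theorem compW_assoc (x : polyW l) (y : ∀ i, polyK (m i)) (z : ∀ i j, polyK (k i j)) :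
    compW (fun s => k ((blockEquiv m h).symm s).1 ((blockEquiv m h).symm s).2) hN'
        (compW m h x y) (fun s => z ((blockEquiv m h).symm s).1 ((blockEquiv m h).symm s).2) =
      compW q hN x fun i => compK (k i) (hq i) (y i) (z i) := by
  refine (chartW N).eq_of_profile_ae_eq ?_
  filter_upwards [profile_compW (fun s => k ((blockEquiv m h).symm s).1
    ((blockEquiv m h).symm s).2) hN' (compW m h x y)
    (fun s => z ((blockEquiv m h).symm s).1 ((blockEquiv m h).symm s).2), profile_compW m h x y,
    profile_compW q hN x fun i => compK (k i) (hq i) (y i) (z i),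
    ae_all_iff.2 fun i => profile_compK (k i) (hq i) (y i) (z i)] with t h1 h2 h3 h4
  rw [h1, h2, h3]
  simp only [h4]
  exact CycBracketing.comp_assoc m h k q hq hN hN' _ _
    fun i j => (chartK (k i j)).profile (z i j) t

theorem compK_assoc (x : polyK l) (y : ∀ i, polyK (m i)) (z : ∀ i j, polyK (k i j)) :
    compK (fun s => k ((blockEquiv m h).symm s).1 ((blockEquiv m h).symm s).2) hN'
        (compK m h x y) (fun s => z ((blockEquiv m h).symm s).1 ((blockEquiv m h).symm s).2) =
      compK q hN x fun i => compK (k i) (hq i) (y i) (z i) := by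
  refine (chartK N).eq_of_profile_ae_eq ?_
  filter_upwards [profile_compK (fun s => k ((blockEquiv m h).symm s).1
    ((blockEquiv m h).symm s).2) hN' (compK m h x y)
    (fun s => z ((blockEquiv m h).symm s).1 ((blockEquiv m h).symm s).2), profile_compK m h x y,
    profile_compK q hN x fun i => compK (k i) (hq i) (y i) (z i),
    ae_all_iff.2 fun i => profile_compK (k i) (hq i) (y i) (z i)] with t h1 h2 h3 h4
  rw [h1, h2, h3]
  simp only [h4]
  exact Bracketing.comp_assoc m h k q hq hN hN' _ _
    fun i j => (chartK (k i j)).profile (z i j) t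

end

/-! ### Planar structures -/

/-- The part of a cellular operad structure on the symmetrized associahedra that concerns the
components of the identities. -/
structure PlanarOperad where
  comp : ∀ {l n : ℕ+} (m : Fin l → ℕ+) (_ : ∑ i, (m i : ℕ) = n),
    C(polyK l × (∀ i, polyK (m i)), polyK n)
  bijOn : ∀ {l n : ℕ+} (m : Fin l → ℕ+) (h : ∑ i, (m i : ℕ) = n) (b : Bracketing l)
    (c : ∀ i, Bracketing (m i)),
    BijOn (comp m h) (faceK b ×ˢ univ.pi fun i => faceK (c i)) (faceK (b.comp m h c))
  one_comp : ∀ {n : ℕ+} (h : ∑ _i : Fin (1 : ℕ+), (n : ℕ) = n) (x : polyK 1) (y : polyK n),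
    comp (fun _ => n) h (x, fun _ => y) = y
  comp_one : ∀ {l : ℕ+} (h : ∑ _i : Fin l, ((1 : ℕ+) : ℕ) = l) (x : polyK l) (y : Fin l → polyK 1),
    comp (fun _ => 1) h (x, y) = x
  assoc : ∀ {l n N : ℕ+} (m : Fin l → ℕ+) (h : ∑ i, (m i : ℕ) = n)
    (k : ∀ i, Fin (m i) → ℕ+) (q : Fin l → ℕ+) (hq : ∀ i, ∑ j, (k i j : ℕ) = q i)
    (hN : ∑ i, (q i : ℕ) = N)
    (hN' : ∑ s, (k ((blockEquiv m h).symm s).1 ((blockEquiv m h).symm s).2 : ℕ) = N)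
    (x : polyK l) (y : ∀ i, polyK (m i)) (z : ∀ i j, polyK (k i j)),
    comp (fun s => k ((blockEquiv m h).symm s).1 ((blockEquiv m h).symm s).2) hN'
        (comp m h (x, y), fun s => z ((blockEquiv m h).symm s).1 ((blockEquiv m h).symm s).2) =
      comp q hN (x, fun i => comp (k i) (hq i) (y i, z i))

/-- The structure on cyclohedra that gives rise to a cellular module. -/
structure PlanarModule (A : PlanarOperad) where
  comp : ∀ {l n : ℕ+} (m : Fin l → ℕ+) (_ : ∑ i, (m i : ℕ) = n),
    C(polyW l × (∀ i, polyK (m i)), polyW n)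
  bijOn : ∀ {l n : ℕ+} (m : Fin l → ℕ+) (h : ∑ i, (m i : ℕ) = n) (b : CycBracketing l)
    (c : ∀ i, Bracketing (m i)),
    BijOn (comp m h) (faceW b ×ˢ univ.pi fun i => faceK (c i)) (faceW (b.comp m h c))
  comp_one : ∀ {l : ℕ+} (h : ∑ _i : Fin l, ((1 : ℕ+) : ℕ) = l) (x : polyW l) (y : Fin l → polyK 1),
    comp (fun _ => 1) h (x, y) = x
  assoc : ∀ {l n N : ℕ+} (m : Fin l → ℕ+) (h : ∑ i, (m i : ℕ) = n)
    (k : ∀ i, Fin (m i) → ℕ+) (q : Fin l → ℕ+) (hq : ∀ i, ∑ j, (k i j : ℕ) = q i)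
    (hN : ∑ i, (q i : ℕ) = N)
    (hN' : ∑ s, (k ((blockEquiv m h).symm s).1 ((blockEquiv m h).symm s).2 : ℕ) = N)
    (x : polyW l) (y : ∀ i, polyK (m i)) (z : ∀ i j, polyK (k i j)),
    comp (fun s => k ((blockEquiv m h).symm s).1 ((blockEquiv m h).symm s).2) hN'
        (comp m h (x, y), fun s => z ((blockEquiv m h).symm s).1 ((blockEquiv m h).symm s).2) =
      comp q hN (x, fun i => A.comp (k i) (hq i) (y i, z i))
  rotate_comp : ∀ {l n : ℕ+} (m : Fin l → ℕ+) (h : ∑ i, (m i : ℕ) = n) (r : Fin l) (x : polyW l)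
    (y : ∀ i, polyK (m i)),
    comp (fun i => m (i + r)) (sum_add_right m h r) (rotW r x, fun i => y (i + r)) =
      rotW (blockFirst m h r) (comp m h (x, y))

/-- The operad structure defined by composition of step functions. -/
noncomputable def standardOperad : PlanarOperad where
  comp m h := ⟨_, continuous_compK m h⟩
  bijOn := bijOn_compK
  one_comp := compK_of_one
  comp_one := compK_one
  assoc := compK_assoc

/-! ### Symmetrization -/

section BlockPerm

variable {l n N : ℕ+} (m : Fin l → ℕ+) (h : ∑ i, (m i : ℕ) = n)
  (σ : Equiv.Perm (Fin l)) (τ : ∀ i, Equiv.Perm (Fin (m i)))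

/-- A permutation is determined by the order in which it arranges its arguments. By
`blockPerm_lt_iff` this order is lexicographic for block permutations, and their identities reduce
to comparisons of lexicographic orders. -/
theorem perm_ext_of_lt {N : ℕ} {P Q : Equiv.Perm (Fin N)} (h : ∀ u v, P u < P v → Q u < Q v) :
    P = Q := by
  have hmono : StrictMono fun s => Q (P.symm s) := fun s t hst =>
    h _ _ (by rwa [Equiv.apply_symm_apply, Equiv.apply_symm_apply])
  ext u
  have := strictMono_eq_self hmono (P u)
  rw [Equiv.symm_apply_apply] at this
  rw [this]

theorem blockPerm_apply (p : Fin l) (a : Fin (m (σ.symm p))) :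
    blockPerm m h σ τ (blockEquiv m h ⟨σ.symm p, a⟩) =
      blockEquiv (fun p => m (σ.symm p)) (sum_symm h σ) ⟨p, τ (σ.symm p) a⟩ := by
  simp only [blockPerm, Equiv.trans_apply, Equiv.symm_apply_apply]
  congr 1
  refine Sigma.ext (σ.apply_symm_apply p) ?_
  rw [Fin.heq_ext_iff]
  · rfl
  · exact congrArg (fun i => (m (σ.symm i) : ℕ)) (σ.apply_symm_apply p)

theorem blockPerm_symm_apply (p : Fin l) (a : Fin (m (σ.symm p))) :
    (blockPerm m h σ τ).symm (blockEquiv (fun p => m (σ.symm p)) (sum_symm h σ) ⟨p, a⟩) =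
      blockEquiv m h ⟨σ.symm p, (τ (σ.symm p)).symm a⟩ := by
  rw [Equiv.symm_apply_eq, blockPerm_apply, Equiv.apply_symm_apply]

variable {m h σ τ} in
theorem blockPerm_lt_iff {x y : Σ i, Fin (m i)} :
    blockPerm m h σ τ (blockEquiv m h x) < blockPerm m h σ τ (blockEquiv m h y) ↔
      σ x.1 < σ y.1 ∨ ∃ i a b, x = ⟨i, a⟩ ∧ y = ⟨i, b⟩ ∧ τ i a < τ i b := by
  obtain ⟨i, a⟩ := x
  obtain ⟨j, b⟩ := y
  obtain ⟨p, rfl⟩ := σ.symm.surjective i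
  obtain ⟨q, rfl⟩ := σ.symm.surjective j
  rw [blockPerm_apply, blockPerm_apply]
  dsimp only
  rw [Equiv.apply_symm_apply, Equiv.apply_symm_apply]
  constructor
  · intro hlt
    rcases lt_trichotomy p q with hpq | rfl | hpq
    · exact Or.inl hpq
    · exact Or.inr ⟨σ.symm p, a, b, rfl, rfl,
        (blockEquiv_lt_iff_snd (fun p => m (σ.symm p)) (sum_symm h σ) (i := p)).1 hlt⟩
    · exact absurd (blockEquiv_lt_of_lt (fun p => m (σ.symm p)) (sum_symm h σ)
        (x := ⟨q, τ (σ.symm q) b⟩) (y := ⟨p, τ (σ.symm p) a⟩) hpq) hlt.not_gt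
  · rintro (hpq | ⟨i, c, d, hx, hy, hlt⟩)
    · exact blockEquiv_lt_of_lt (fun p => m (σ.symm p)) (sum_symm h σ)
        (x := ⟨p, τ (σ.symm p) a⟩) (y := ⟨q, τ (σ.symm q) b⟩) hpq
    · obtain rfl : σ.symm p = i := congrArg Sigma.fst hx
      obtain rfl : q = p := σ.symm.injective (congrArg Sigma.fst hy)
      simp only [Sigma.mk.injEq, heq_eq_eq, true_and] at hx hy
      subst hx hy
      exact (blockEquiv_lt_iff_snd _ _).2 hlt

theorem blockPerm_mul_left (ρ : Equiv.Perm (Fin l)) :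
    blockPerm m h (ρ * σ) τ = blockPerm (fun p => m (σ.symm p)) (sum_symm h σ) ρ
      (fun p => τ (σ.symm p)) * blockPerm m h σ fun _ => 1 := by
  refine perm_ext_of_lt fun u v huv => ?_
  obtain ⟨⟨i, a⟩, rfl⟩ := (blockEquiv m h).surjective u
  obtain ⟨⟨j, b⟩, rfl⟩ := (blockEquiv m h).surjective v
  obtain ⟨p, rfl⟩ := σ.symm.surjective i
  obtain ⟨q, rfl⟩ := σ.symm.surjective j
  rw [Equiv.Perm.mul_apply, Equiv.Perm.mul_apply, blockPerm_apply, blockPerm_apply,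
    blockPerm_lt_iff]
  rcases blockPerm_lt_iff.1 huv with hlt | ⟨i, c, d, hx, hy, hlt⟩
  · simp only [Equiv.Perm.mul_apply, Equiv.apply_symm_apply] at hlt
    exact Or.inl hlt
  · obtain rfl : σ.symm p = i := congrArg Sigma.fst hx
    obtain rfl : q = p := σ.symm.injective (congrArg Sigma.fst hy)
    simp only [Sigma.mk.injEq, heq_eq_eq, true_and] at hx hy
    subst hx hy
    exact Or.inr ⟨q, a, b, rfl, rfl, hlt⟩

theorem blockPerm_mul_right (τ' : ∀ i, Equiv.Perm (Fin (m i))) :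
    blockPerm m h σ (fun i => τ i * τ' i) = blockPerm m h σ τ * blockPerm m h 1 τ' := by
  refine perm_ext_of_lt fun u v huv => ?_
  obtain ⟨⟨i, a⟩, rfl⟩ := (blockEquiv m h).surjective u
  obtain ⟨⟨j, b⟩, rfl⟩ := (blockEquiv m h).surjective v
  have e : ∀ (i : Fin l) (a : Fin (m i)), blockPerm m h 1 τ' (blockEquiv m h ⟨i, a⟩) =
      blockEquiv m h ⟨i, τ' i a⟩ := fun i a => blockPerm_apply m h 1 τ' i a
  rw [Equiv.Perm.mul_apply, Equiv.Perm.mul_apply, e, e, blockPerm_lt_iff]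
  rcases blockPerm_lt_iff.1 huv with hlt | ⟨k, c, d, hx, hy, hlt⟩
  · exact Or.inl hlt
  · obtain rfl : i = k := congrArg Sigma.fst hx
    obtain rfl : j = i := congrArg Sigma.fst hy
    simp only [Sigma.mk.injEq, heq_eq_eq, true_and] at hx hy
    subst hx hy
    exact Or.inr ⟨j, _, _, rfl, rfl, hlt⟩

theorem blockPerm_ones (h : ∑ _i : Fin l, ((1 : ℕ+) : ℕ) = l)
    (τ : Fin l → Equiv.Perm (Fin (1 : ℕ+))) : blockPerm (fun _ => 1) h σ τ = σ := by
  ext u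
  obtain ⟨p, rfl⟩ := σ.symm.surjective u
  have := blockPerm_apply (fun _ => 1) h σ τ p 0
  rw [blockEquiv_one, blockEquiv_one] at this
  rw [this, Equiv.apply_symm_apply]

theorem blockPerm_single (h : ∑ _i : Fin (1 : ℕ+), (n : ℕ) = n) (σ : Equiv.Perm (Fin (1 : ℕ+)))
    (τ : Equiv.Perm (Fin n)) : blockPerm (fun _ => n) h σ (fun _ => τ) = τ := by
  ext u
  have := blockPerm_apply (fun _ => n) h σ (fun _ => τ) 0 u
  rw [blockEquiv_single, blockEquiv_single] at this
  rw [this]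

theorem blockPerm_one_one : blockPerm m h 1 (fun _ => 1) = 1 := by
  ext u
  obtain ⟨⟨i, a⟩, rfl⟩ := (blockEquiv m h).surjective u
  exact congrArg Fin.val (blockPerm_apply m h 1 (fun _ => 1) i a)

/-- When the letter in position `r` moves to position zero, so does its block; the shift is the
position where that block begins. -/
theorem blockPerm_add_right (r : Fin l) :
    blockPerm m h (σ.trans (Equiv.subRight r)) τ = (blockPerm m h σ τ).trans
      (Equiv.subRight (blockFirst (fun p => m (σ.symm p)) (sum_symm h σ) r)) := by
  ext u
  obtain ⟨⟨i, a⟩, rfl⟩ := (blockEquiv m h).surjective u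
  obtain ⟨p, rfl⟩ := (σ.trans (Equiv.subRight r)).symm.surjective i
  rw [blockPerm_apply]
  have h2 := blockPerm_apply m h σ τ (p + r) a
  refine congrArg Fin.val ((blockEquiv_add_right (fun p => m (σ.symm p)) (sum_symm h σ) r p
    (τ (σ.symm (p + r)) a)).trans ?_)
  rw [Equiv.trans_apply, Equiv.subRight_apply, ← h2]
  rfl

variable (k : ∀ i, Fin (m i) → ℕ+) (q : Fin l → ℕ+) (hq : ∀ i, ∑ j, (k i j : ℕ) = q i)
  (hN : ∑ i, (q i : ℕ) = N)
  (hN' : ∑ s, (k ((blockEquiv m h).symm s).1 ((blockEquiv m h).symm s).2 : ℕ) = N)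
  (ρ : ∀ i j, Equiv.Perm (Fin (k i j)))

theorem blockPerm_blockPerm_lt {x y : Σ i, Fin (m i)}
    (hxy : blockPerm m h σ τ (blockEquiv m h x) < blockPerm m h σ τ (blockEquiv m h y))
    (a : Fin (k x.1 x.2)) (b : Fin (k y.1 y.2)) :
    blockPerm q hN σ (fun i => blockPerm (k i) (hq i) (τ i) (ρ i))
        (blockEquiv q hN ⟨x.1, blockEquiv (k x.1) (hq x.1) ⟨x.2, a⟩⟩) <
      blockPerm q hN σ (fun i => blockPerm (k i) (hq i) (τ i) (ρ i))
        (blockEquiv q hN ⟨y.1, blockEquiv (k y.1) (hq y.1) ⟨y.2, b⟩⟩) := by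
  rw [blockPerm_lt_iff]
  rcases blockPerm_lt_iff.1 hxy with hlt | ⟨i, c, d, rfl, rfl, hlt⟩
  · exact Or.inl hlt
  · exact Or.inr ⟨i, _, _, rfl, rfl, blockPerm_lt_iff.2 (Or.inl hlt)⟩

theorem blockPerm_assoc :
    blockPerm (fun s => k ((blockEquiv m h).symm s).1 ((blockEquiv m h).symm s).2) hN'
        (blockPerm m h σ τ)
        (fun s => ρ ((blockEquiv m h).symm s).1 ((blockEquiv m h).symm s).2) =
      blockPerm q hN σ fun i => blockPerm (k i) (hq i) (τ i) (ρ i) := by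
  refine perm_ext_of_lt fun u v huv => ?_
  obtain ⟨⟨s, a⟩, rfl⟩ := (blockEquiv _ hN').surjective u
  obtain ⟨⟨t, b⟩, rfl⟩ := (blockEquiv _ hN').surjective v
  rw [blockEquiv_assoc m h k q hq hN hN', blockEquiv_assoc m h k q hq hN hN']
  rcases blockPerm_lt_iff.1 huv with hlt | ⟨i, c, d, hx, hy, hlt⟩
  · refine blockPerm_blockPerm_lt m h σ τ k q hq hN ρ ?_ a b
    rwa [Equiv.apply_symm_apply, Equiv.apply_symm_apply]
  · obtain rfl : s = i := congrArg Sigma.fst hx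
    obtain rfl : t = s := congrArg Sigma.fst hy
    simp only [Sigma.mk.injEq, heq_eq_eq, true_and] at hx hy
    subst hx hy
    exact blockPerm_lt_iff.2 (Or.inr ⟨_, _, _, rfl, rfl,
      blockPerm_lt_iff.2 (Or.inr ⟨_, _, _, rfl, rfl, hlt⟩)⟩)

end BlockPerm

/-! ### Composition and action on disjoint unions indexed by permutations -/

section Sym

/-- The disjoint union of copies of `X n`, indexed by permutations. -/
abbrev Sym (X : ℕ+ → Type) (n : ℕ+) : Type := Σ _σ : Equiv.Perm (Fin n), X n

/-- A family of operations with inputs of arities `m₀, …, m_{l-1}`. -/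
abbrev Composition (X Y : ℕ+ → Type) : Type :=
  ∀ ⦃l n : ℕ+⦄ (m : Fin l → ℕ+), ∑ i, (m i : ℕ) = n → X l → (∀ i, Y (m i)) → X n

variable {X Y : ℕ+ → Type} (ν : Composition X Y) (γ : Composition Y Y)

/-- Arities that are computed in two ways agree only propositionally, so arguments are compared as
pairs of an arity and a point. -/
theorem Composition.congr {l n : ℕ+} {m m' : Fin l → ℕ+} (h : ∑ i, (m i : ℕ) = n)
    (h' : ∑ i, (m' i : ℕ) = n) (x : X l) {y : ∀ i, Y (m i)} {y' : ∀ i, Y (m' i)}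
    (e : ∀ i, (⟨m i, y i⟩ : Σ n, Y n) = ⟨m' i, y' i⟩) : ν m h x y = ν m' h' x y' := by
  obtain rfl : m = m' := funext fun i => congrArg Sigma.fst (e i)
  obtain rfl : y = y' := funext fun i => eq_of_heq (Sigma.mk.inj_iff.1 (e i)).2
  rfl

variable {l n N : ℕ+} (m : Fin l → ℕ+) (h : ∑ i, (m i : ℕ) = n)

/-- The composition on symmetrizations. -/
def symComp (x : Sym X l) (y : ∀ i, Sym Y (m i)) : Sym X n :=
  ⟨blockPerm m h x.1 fun i => (y i).1,
    ν (fun p => m (x.1.symm p)) (sum_symm h x.1) x.2 fun p => (y (x.1.symm p)).2⟩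

/-- The right action on symmetrizations. -/
def symAct (τ : Equiv.Perm (Fin n)) (x : Sym X n) : Sym X n := ⟨x.1 * τ, x.2⟩

/-- Only the indices need an argument: the underlying planar composites are the same by definition.
-/
theorem symComp_symAct_left (σ : Equiv.Perm (Fin l)) (x : Sym X l) (y : ∀ i, Sym Y (m i)) :
    symComp ν m h (symAct σ x) y = symAct (blockPerm m h σ fun _ => 1)
      (symComp ν (fun p => m (σ.symm p)) (sum_symm h σ) x fun p => y (σ.symm p)) :=
  Sigma.ext (blockPerm_mul_left m h σ _ x.1) HEq.rfl

theorem symComp_symAct_right (τ : ∀ i, Equiv.Perm (Fin (m i))) (x : Sym X l)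
    (y : ∀ i, Sym Y (m i)) : symComp ν m h x (fun i => symAct (τ i) (y i)) =
      symAct (blockPerm m h 1 τ) (symComp ν m h x y) :=
  Sigma.ext (blockPerm_mul_right m h x.1 _ τ) HEq.rfl

variable (k : ∀ i, Fin (m i) → ℕ+) (q : Fin l → ℕ+) (hq : ∀ i, ∑ j, (k i j : ℕ) = q i)
  (hN : ∑ i, (q i : ℕ) = N)
  (hN' : ∑ s, (k ((blockEquiv m h).symm s).1 ((blockEquiv m h).symm s).2 : ℕ) = N)

include hq hN in
theorem sum_flat :
    ∑ s, (k ((blockEquiv m h).symm s).1 ((blockEquiv m h).symm s).2 : ℕ) = N := by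
  rw [Equiv.sum_comp (blockEquiv m h).symm fun w => (k w.1 w.2 : ℕ), Fintype.sum_sigma, ← hN]
  exact Finset.sum_congr rfl fun i _ => hq i

-- The indices agree by `blockPerm_assoc`. The points agree by planar associativity, applied to the
-- arities and arguments in the order of their positions rather than of their labels.
variable {ν γ} in
theorem symComp_assoc
    (H : ∀ {l n N : ℕ+} (m : Fin l → ℕ+) (h : ∑ i, (m i : ℕ) = n)
      (k : ∀ i, Fin (m i) → ℕ+) (q : Fin l → ℕ+) (hq : ∀ i, ∑ j, (k i j : ℕ) = q i)
      (hN : ∑ i, (q i : ℕ) = N)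
      (hN' : ∑ s, (k ((blockEquiv m h).symm s).1 ((blockEquiv m h).symm s).2 : ℕ) = N)
      (x : X l) (y : ∀ i, Y (m i)) (z : ∀ i j, Y (k i j)),
      ν (fun s => k ((blockEquiv m h).symm s).1 ((blockEquiv m h).symm s).2) hN'
          (ν m h x y) (fun s => z ((blockEquiv m h).symm s).1 ((blockEquiv m h).symm s).2) =
        ν q hN x fun i => γ (k i) (hq i) (y i) (z i))
    (x : Sym X l) (y : ∀ i, Sym Y (m i)) (z : ∀ i j, Sym Y (k i j)) :
    symComp ν (fun s => k ((blockEquiv m h).symm s).1 ((blockEquiv m h).symm s).2) hN'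
        (symComp ν m h x y)
        (fun s => z ((blockEquiv m h).symm s).1 ((blockEquiv m h).symm s).2) =
      symComp ν q hN x fun i => symComp γ (k i) (hq i) (y i) (z i) := by
  obtain ⟨σ, x⟩ := x
  have e1 := blockPerm_assoc m h σ (fun i => (y i).1) k q hq hN hN' fun i j => (z i j).1
  simp only [symComp]
  rw [Sigma.mk.injEq]
  refine ⟨e1, heq_of_eq ?_⟩
  have hN'' := sum_flat (fun p => m (σ.symm p)) (sum_symm h σ)
    (fun p j => k (σ.symm p) ((y (σ.symm p)).1.symm j)) (fun p => q (σ.symm p))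
    (fun p => sum_symm (hq (σ.symm p)) (y (σ.symm p)).1) (sum_symm hN σ)
  have e2 := H (fun p => m (σ.symm p)) (sum_symm h σ)
    (fun p j => k (σ.symm p) ((y (σ.symm p)).1.symm j)) (fun p => q (σ.symm p))
    (fun p => sum_symm (hq (σ.symm p)) (y (σ.symm p)).1) (sum_symm hN σ) hN'' x
    (fun p => (y (σ.symm p)).2) fun p j => (z (σ.symm p) ((y (σ.symm p)).1.symm j)).2
  refine Eq.trans ?_ e2
  refine Composition.congr ν _ _ _ fun s => ?_
  obtain ⟨⟨p, a⟩, rfl⟩ := (blockEquiv (fun p => m (σ.symm p)) (sum_symm h σ)).surjective s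
  rw [Equiv.symm_apply_apply]
  have e2 : (blockEquiv m h).symm ((blockPerm m h σ fun i => (y i).1).symm
      (blockEquiv (fun p => m (σ.symm p)) (sum_symm h σ) ⟨p, a⟩)) =
      ⟨σ.symm p, (y (σ.symm p)).1.symm a⟩ := by
    rw [blockPerm_symm_apply, Equiv.symm_apply_apply]
  exact congrArg (fun w : Σ i, Fin (m i) => (⟨k w.1 w.2, (z w.1 w.2).2⟩ : Σ n, Y n)) e2

variable [∀ n, TopologicalSpace (X n)] [∀ n, TopologicalSpace (Y n)]

-- The indices of all arguments are locally constant, and while they are fixed the composition is a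
-- single planar operation.
variable {ν} in
theorem continuous_symComp
    (H : ∀ {l n : ℕ+} (m : Fin l → ℕ+) (h : ∑ i, (m i : ℕ) = n),
      Continuous fun p : X l × ∀ i, Y (m i) => ν m h p.1 p.2) :
    Continuous fun p : Sym X l × ∀ i, Sym Y (m i) => symComp ν m h p.1 p.2 := by
  rw [continuous_iff_continuousAt]
  rintro ⟨⟨σ, x⟩, y⟩
  have h1 : ∀ᶠ p : Sym X l × ∀ i, Sym Y (m i) in 𝓝 (⟨σ, x⟩, y), p.1.1 = σ := by
    have : IsOpen (Sigma.fst ⁻¹' {σ} : Set (Sym X l)) := by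
      rw [← range_sigmaMk]
      exact isOpen_range_sigmaMk
    exact (this.preimage continuous_fst).mem_nhds rfl
  have h2 : ∀ᶠ p : Sym X l × ∀ i, Sym Y (m i) in 𝓝 (⟨σ, x⟩, y), ∀ i, (p.2 i).1 = (y i).1 := by
    refine Filter.eventually_all.2 fun i => ?_
    have : IsOpen (Sigma.fst ⁻¹' {(y i).1} : Set (Sym Y (m i))) := by
      rw [← range_sigmaMk]
      exact isOpen_range_sigmaMk
    exact (this.preimage (f := fun p : Sym X l × ∀ i, Sym Y (m i) => p.2 i)
      ((continuous_apply i).comp continuous_snd)).mem_nhds rfl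
  have hsnd : ∀ {Z : ℕ+ → Type} [∀ n, TopologicalSpace (Z n)] {n : ℕ+},
      Continuous fun z : Sym Z n => z.2 := continuous_sigma fun _ => continuous_id
  have h3 : Continuous fun p : Sym X l × ∀ i, Sym Y (m i) =>
      (⟨blockPerm m h σ fun i => (y i).1, ν (fun p => m (σ.symm p)) (sum_symm h σ) p.1.2
        fun i => (p.2 (σ.symm i)).2⟩ : Sym X n) := by
    refine continuous_sigmaMk.comp ((H (fun p => m (σ.symm p)) (sum_symm h σ)).comp
      ((hsnd.comp continuous_fst).prodMk (continuous_pi fun i => ?_)))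
    exact hsnd.comp ((continuous_apply (σ.symm i)).comp continuous_snd)
  refine h3.continuousAt.congr ?_
  filter_upwards [h1, h2] with p hp1 hp2
  obtain ⟨⟨σ', x'⟩, y'⟩ := p
  dsimp only at hp1 hp2
  subst hp1
  simp only [symComp, hp2]

theorem continuous_symAct (τ : Equiv.Perm (Fin n)) : Continuous (symAct (X := X) τ) :=
  continuous_sigma fun σ =>
  continuous_sigmaMk (σ := fun _ : Equiv.Perm (Fin n) => X n) (i := σ * τ)

/-- A subset of one of the copies. -/
def symCell (σ : Equiv.Perm (Fin n)) (S : Set (X n)) : Set (Sym X n) := {x | ∃ t ∈ S, x = ⟨σ, t⟩}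

omit [∀ n, TopologicalSpace (X n)] [∀ n, TopologicalSpace (Y n)] in
theorem bijOn_symComp (σ : Equiv.Perm (Fin l)) (τ : ∀ i, Equiv.Perm (Fin (m i))) {S : Set (X l)}
    {T : ∀ i, Set (Y (m i))} {R : Set (X n)}
    (H : BijOn (fun p : X l × ∀ i, Y (m (σ.symm i)) => ν (fun p => m (σ.symm p)) (sum_symm h σ)
      p.1 p.2) (S ×ˢ univ.pi fun i => T (σ.symm i)) R) :
    BijOn (fun p : Sym X l × ∀ i, Sym Y (m i) => symComp ν m h p.1 p.2)
      (symCell σ S ×ˢ univ.pi fun i => symCell (τ i) (T i)) (symCell (blockPerm m h σ τ) R) := by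
  have key : ∀ p ∈ symCell σ S ×ˢ univ.pi fun i => symCell (τ i) (T i),
      ∃ x ∈ S, ∃ y ∈ univ.pi T, p = (⟨σ, x⟩, fun i => ⟨τ i, y i⟩) := by
    rintro ⟨x, y⟩ ⟨⟨x, hx, rfl⟩, hy⟩
    choose y' h1 h2 using fun i => hy i (mem_univ i)
    exact ⟨x, hx, y', fun i _ => h1 i, Prod.ext rfl (funext h2)⟩
  refine ⟨?_, ?_, ?_⟩
  · intro p hp
    obtain ⟨x, hx, y, hy, rfl⟩ := key p hp
    exact ⟨_, H.mapsTo (x := (x, fun i => y (σ.symm i))) ⟨hx, fun i _ => hy _ (mem_univ _)⟩, rfl⟩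
  · intro p hp p' hp' e
    obtain ⟨x, hx, y, hy, rfl⟩ := key p hp
    obtain ⟨x', hx', y', hy', rfl⟩ := key p' hp'
    have e1 := H.injOn (x₁ := (x, fun i => y (σ.symm i))) ⟨hx, fun i _ => hy _ (mem_univ _)⟩
      (x₂ := (x', fun i => y' (σ.symm i))) ⟨hx', fun i _ => hy' _ (mem_univ _)⟩
      (eq_of_heq (Sigma.mk.inj_iff.1 e).2)
    obtain rfl : x = x' := congrArg Prod.fst e1
    have e2 : ∀ i, y i = y' i := fun i => by
      obtain ⟨p, rfl⟩ := σ.symm.surjective i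
      exact congrFun (congrArg Prod.snd e1) p
    rw [funext e2]
  · rintro _ ⟨z, hz, rfl⟩
    obtain ⟨⟨x, y⟩, ⟨hx, hy⟩, rfl⟩ := H.surjOn hz
    obtain ⟨y, rfl⟩ : ∃ y' : ∀ i, Y (m i), (fun i => y' (σ.symm i)) = y :=
      (Equiv.piCongrLeft (fun i => Y (m i)) σ.symm).symm.surjective y
    refine ⟨(⟨σ, x⟩, fun i => ⟨τ i, y i⟩), ⟨⟨x, hx, rfl⟩, fun i _ => ⟨y i, ?_, rfl⟩⟩, rfl⟩
    obtain ⟨p, rfl⟩ := σ.symm.surjective i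
    exact hy p (mem_univ p)

end Sym

/-! ### The operad and the module defined by planar structures -/

section Operad

instance : Subsingleton (polyK 1) :=
  ⟨fun x y => Subtype.ext (funext fun k => absurd k.2 (by simp))⟩

/-- The underlying operations of a planar operad. -/
def PlanarOperad.op (A : PlanarOperad) :
    Composition (fun n => polyK n) (fun n => polyK n) := fun _ _ m h x y => A.comp m h (x, y)

/-- The underlying operations of a planar module. -/
def PlanarModule.op {A : PlanarOperad} (B : PlanarModule A) :
    Composition (fun n => polyW n) (fun n => polyK n) := fun _ _ m h x y => B.comp m h (x, y)

variable {l n N : ℕ+}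

theorem PlanarOperad.continuous_symComp (A : PlanarOperad) (m : Fin l → ℕ+)
    (h : ∑ i, (m i : ℕ) = n) :
    Continuous fun p : KBar l × ∀ i, KBar (m i) => symComp A.op m h p.1 p.2 :=
  CycloMod.continuous_symComp (X := fun n => polyK n) (Y := fun n => polyK n) (ν := A.op) m h
    fun m h => (A.comp m h).continuous

theorem PlanarModule.continuous_symComp {A : PlanarOperad} (B : PlanarModule A) (m : Fin l → ℕ+)
    (h : ∑ i, (m i : ℕ) = n) : Continuous fun p : Sym (fun n => polyW n) l × ∀ i, KBar (m i) =>
      symComp B.op m h p.1 p.2 :=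
  CycloMod.continuous_symComp (X := fun n => polyW n) (Y := fun n => polyK n) (ν := B.op) m h
    fun m h => (B.comp m h).continuous

theorem symComp_ones {X Y : ℕ+ → Type} {ν : Composition X Y} (h : ∑ _i : Fin l, ((1 : ℕ+) : ℕ) = l)
    (hν : ∀ (x : X l) (y : Fin l → Y 1), ν (fun _ => 1) h x y = x) (x : Sym X l)
    (y : Fin l → Sym Y 1) : symComp ν (fun _ => 1) h x y = x := by
  obtain ⟨σ, x⟩ := x
  simp only [symComp]
  rw [Sigma.mk.injEq]
  exact ⟨blockPerm_ones σ h _, heq_of_eq (hν x _)⟩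

/-- The operad of symmetrized associahedra that is defined by a planar operad. -/
def PlanarOperad.symmetrize (A : PlanarOperad) (e : polyK 1) : TopOperad KBar where
  one := ⟨1, e⟩
  act τ := ⟨symAct (X := fun n => polyK n) τ, continuous_symAct τ⟩
  comp m h := ⟨fun p => symComp A.op m h p.1 p.2, A.continuous_symComp m h⟩
  act_one x := rfl
  act_mul σ τ x := rfl
  one_comp {n} h x := by
    obtain ⟨σ, x⟩ := x
    simp only [ContinuousMap.coe_mk, symComp]
    rw [Sigma.mk.injEq]
    exact ⟨blockPerm_single h _ _, heq_of_eq (A.one_comp h e x)⟩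
  comp_one h x := symComp_ones (X := fun n => polyK n) (Y := fun n => polyK n) (ν := A.op) h
    (A.comp_one h) x _
  assoc m h k q hq hN hN' x y z := symComp_assoc (X := fun n => polyK n)
    (Y := fun n => polyK n) (ν := A.op) (γ := A.op) m h k q hq hN hN' A.assoc x y z
  act_comp m h σ x y := symComp_symAct_left A.op m h σ x y
  comp_act m h τ x y := symComp_symAct_right A.op m h τ x y

theorem PlanarOperad.isCellularOperad (A : PlanarOperad) (e : polyK 1) :
    IsCellularOperad (A.symmetrize e) where
  act_eq _ _ _ := rfl
  comp_cell m h b c := bijOn_symComp A.op m h b.1 (fun i => (c i).1)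
    (T := fun i => faceK (c i).2) (A.bijOn (fun p => m (b.1.symm p)) (sum_symm h b.1) b.2 _)

end Operad

/-! ### The symmetrized cyclohedron as a quotient by rotations -/

section Module

variable {l n N : ℕ+}

/-- The projection on orbits of rotations, which are represented by points of copies of index
`σ` with `σ 0 = 0`. -/
noncomputable def toWBar (x : Sym (fun n => polyW n) n) : WBar n := ⟨toFix x.1, rotW (x.1 0) x.2⟩

/-- The inclusion of the copies of index `σ` with `σ 0 = 0`. -/
def ofWBar (w : WBar n) : Sym (fun n => polyW n) n := ⟨w.1.1, w.2⟩

/-- The rotation of a circle with `n` letters. -/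
noncomputable def rotSym (r : Fin n) (x : Sym (fun n => polyW n) n) : Sym (fun n => polyW n) n :=
  ⟨x.1.trans (Equiv.subRight r), rotW r x.2⟩

/-- Representatives change only by rotations, under which `toWBar` is invariant. So the axioms of a
module on `WBar` follow by projection of those on the union of `n!` copies. -/
theorem ofWBar_toWBar (x : Sym (fun n => polyW n) n) : ofWBar (toWBar x) = rotSym (x.1 0) x := rfl

theorem toFix_coe (σ : PermFix n) : toFix σ.1 = σ := by
  refine Subtype.ext (Equiv.ext fun i => ?_)
  change σ.1 i - σ.1 0 = σ.1 i
  rw [σ.2, sub_zero]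

theorem toFix_subRight (σ : Equiv.Perm (Fin n)) (r : Fin n) :
    toFix (σ.trans (Equiv.subRight r)) = toFix σ := by
  refine Subtype.ext (Equiv.ext fun i => ?_)
  change (σ i - r) - (σ 0 - r) = σ i - σ 0
  rw [sub_sub_sub_cancel_right]

theorem toWBar_ofWBar (w : WBar n) : toWBar (ofWBar w) = w := by
  obtain ⟨σ, x⟩ := w
  simp only [toWBar, ofWBar]
  rw [Sigma.mk.injEq, σ.2, rotW_zero]
  exact ⟨toFix_coe σ, HEq.rfl⟩

theorem toWBar_rotSym (r : Fin n) (x : Sym (fun n => polyW n) n) :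
    toWBar (rotSym r x) = toWBar x := by
  obtain ⟨σ, x⟩ := x
  simp only [toWBar, rotSym]
  rw [Sigma.mk.injEq, rotW_rotW]
  refine ⟨toFix_subRight σ r, heq_of_eq ?_⟩
  change rotW (σ 0 - r + r) x = rotW (σ 0) x
  rw [sub_add_cancel]

theorem continuous_toWBar : Continuous (toWBar (n := n)) :=
  continuous_sigma fun σ => (continuous_sigmaMk (σ := fun _ : PermFix n => polyW n)
    (i := toFix σ)).comp (continuous_rotW (σ 0))

theorem continuous_ofWBar : Continuous (ofWBar (n := n)) :=
  continuous_sigma fun σ =>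
    continuous_sigmaMk (σ := fun _ : Equiv.Perm (Fin n) => polyW n) (i := σ.1)

theorem bijOn_toWBar (σ : Equiv.Perm (Fin n)) (b : CycBracketing n) :
    BijOn toWBar (symCell (X := fun n => polyW n) σ (faceW b)) (cellW (BCBar.mk σ b)) := by
  have h := bijOn_rotW (σ 0) b
  refine ⟨?_, ?_, ?_⟩
  · rintro _ ⟨t, ht, rfl⟩
    exact ⟨rotW (σ 0) t, h.mapsTo ht, rfl⟩
  · rintro _ ⟨t, ht, rfl⟩ _ ⟨t', ht', rfl⟩ e
    simp only [toWBar] at e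
    rw [h.injOn ht ht' (eq_of_heq (Sigma.mk.inj_iff.1 e).2)]
  · rintro _ ⟨t, ht, rfl⟩
    obtain ⟨t, ht', rfl⟩ := h.surjOn ht
    exact ⟨⟨σ, t⟩, ⟨t, ht', rfl⟩, rfl⟩

theorem bijOn_ofWBar (b : BCBar n) :
    BijOn ofWBar (cellW b) (symCell (X := fun n => polyW n) b.1.1 (faceW b.2)) := by
  refine ⟨?_, ?_, ?_⟩
  · rintro _ ⟨t, ht, rfl⟩
    exact ⟨t, ht, rfl⟩
  · rintro _ ⟨t, ht, rfl⟩ _ ⟨t', ht', rfl⟩ e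
    simp only [ofWBar] at e
    rw [eq_of_heq (Sigma.mk.inj_iff.1 e).2]
  · rintro _ ⟨t, ht, rfl⟩
    exact ⟨⟨b.1, t⟩, ⟨t, ht, rfl⟩, rfl⟩

variable {A : PlanarOperad} (B : PlanarModule A)

/-- Rotation of the outer circle rotates the composite, both for the index and for the point. This
is what makes the composition well defined on orbits. -/
theorem PlanarModule.symComp_rotSym (m : Fin l → ℕ+) (h : ∑ i, (m i : ℕ) = n) (r : Fin l)
    (x : Sym (fun n => polyW n) l) (y : ∀ i, KBar (m i)) :
    symComp B.op m h (rotSym r x) y =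
      rotSym (blockFirst (fun p => m (x.1.symm p)) (sum_symm h x.1) r) (symComp B.op m h x y) := by
  obtain ⟨σ, x⟩ := x
  simp only [symComp, rotSym]
  rw [Sigma.mk.injEq]
  exact ⟨blockPerm_add_right m h σ _ r, heq_of_eq (B.rotate_comp (fun p => m (σ.symm p))
    (sum_symm h σ) r x fun p => (y (σ.symm p)).2)⟩

theorem PlanarModule.toWBar_symComp (m : Fin l → ℕ+) (h : ∑ i, (m i : ℕ) = n)
    (x : Sym (fun n => polyW n) l) (y : ∀ i, KBar (m i)) :
    toWBar (symComp B.op m h (ofWBar (toWBar x)) y) = toWBar (symComp B.op m h x y) := by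
  rw [ofWBar_toWBar, B.symComp_rotSym, toWBar_rotSym]

theorem PlanarModule.continuous_toWBar_symComp (m : Fin l → ℕ+) (h : ∑ i, (m i : ℕ) = n) :
    Continuous fun p : WBar l × ∀ i, KBar (m i) => toWBar (symComp B.op m h (ofWBar p.1) p.2) := by
  have h1 : Continuous fun p : WBar l × ∀ i, KBar (m i) =>
      ((ofWBar p.1, p.2) : Sym (fun n => polyW n) l × ∀ i, KBar (m i)) :=
    (continuous_ofWBar.comp continuous_fst).prodMk continuous_snd
  have h2 := (continuous_toWBar.comp (B.continuous_symComp m h)).comp h1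
  exact h2

theorem toWBar_symAct (τ : Equiv.Perm (Fin n)) (x : Sym (fun n => polyW n) n) :
    toWBar (symAct τ (ofWBar (toWBar x))) = toWBar (symAct τ x) :=
  toWBar_rotSym (x.1 0) (symAct τ x)

variable {O : TopOperad KBar}

/-- The right module of symmetrized cyclohedra that is defined by a planar module. -/
noncomputable def PlanarModule.symmetrize
    (hact : ∀ {n : ℕ+} (τ : Equiv.Perm (Fin n)) (x : KBar n), O.act τ x = symAct (X := fun n => polyK n) τ x)
    (hcomp : ∀ {l n : ℕ+} (m : Fin l → ℕ+) (h : ∑ i, (m i : ℕ) = n) (x : KBar l)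
      (y : ∀ i, KBar (m i)), O.comp m h (x, y) = symComp A.op m h x y) : TopModule O WBar where
  act τ := ⟨fun w => toWBar (symAct τ (ofWBar w)),
    continuous_toWBar.comp ((continuous_symAct τ).comp continuous_ofWBar)⟩
  comp m h := ⟨fun p => toWBar (symComp B.op m h (ofWBar p.1) p.2),
    B.continuous_toWBar_symComp m h⟩
  act_one w := toWBar_ofWBar w
  act_mul σ τ w := (toWBar_symAct τ (symAct σ (ofWBar w))).symm
  comp_one h w := by
    simp only [ContinuousMap.coe_mk]
    rw [symComp_ones (X := fun n => polyW n) (Y := fun n => polyK n) (ν := B.op) h (B.comp_one h),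
      toWBar_ofWBar]
  assoc m h k q hq hN hN' x y z := by
    simp only [ContinuousMap.coe_mk]
    rw [B.toWBar_symComp, symComp_assoc (X := fun n => polyW n) (Y := fun n => polyK n) (ν := B.op)
      (γ := A.op) m h k q hq hN hN' B.assoc]
    simp only [hcomp]
  act_comp m h σ x y := by
    simp only [ContinuousMap.coe_mk]
    rw [B.toWBar_symComp, symComp_symAct_left, toWBar_symAct]
  comp_act m h τ x y := by
    simp only [ContinuousMap.coe_mk, hact]
    rw [symComp_symAct_right, toWBar_symAct]

theorem bijOn_toWBar_symAct (τ : Equiv.Perm (Fin n)) (b : BCBar n) :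
    BijOn (fun w => toWBar (symAct τ (ofWBar w))) (cellW b) (cellW (b.act τ)) := by
  have h : BijOn (symAct (X := fun n => polyW n) τ) (symCell b.1.1 (faceW b.2))
      (symCell (b.1.1 * τ) (faceW b.2)) := by
    refine ⟨?_, ?_, ?_⟩
    · rintro _ ⟨t, ht, rfl⟩
      exact ⟨t, ht, rfl⟩
    · rintro _ ⟨t, ht, rfl⟩ _ ⟨t', ht', rfl⟩ e
      simp only [symAct] at e
      rw [eq_of_heq (Sigma.mk.inj_iff.1 e).2]
    · rintro _ ⟨t, ht, rfl⟩
      exact ⟨⟨b.1.1, t⟩, ⟨t, ht, rfl⟩, rfl⟩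
  have h2 := (bijOn_toWBar (b.1.1 * τ) b.2).comp (h.comp (bijOn_ofWBar b))
  exact h2

theorem bijOn_prod_left {α β γ : Type} {f : α → β} {s : Set α} {t : Set β} (h : BijOn f s t)
    (r : Set γ) : BijOn (fun p : α × γ => (f p.1, p.2)) (s ×ˢ r) (t ×ˢ r) := by
  refine ⟨fun p hp => ⟨h.mapsTo hp.1, hp.2⟩, fun p hp q hq e => ?_, ?_⟩
  · rw [Prod.mk.injEq] at e
    exact Prod.ext (h.injOn hp.1 hq.1 e.1) e.2
  · rintro ⟨x, y⟩ ⟨hx, hy⟩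
    obtain ⟨x, hx', rfl⟩ := h.surjOn hx
    exact ⟨(x, y), ⟨hx', hy⟩, rfl⟩

theorem PlanarModule.bijOn_toWBar_symComp (m : Fin l → ℕ+) (h : ∑ i, (m i : ℕ) = n) (b : BCBar l)
    (c : ∀ i, BBar (m i)) :
    BijOn (fun p : WBar l × ∀ i, KBar (m i) => toWBar (symComp B.op m h (ofWBar p.1) p.2))
      (cellW b ×ˢ univ.pi fun i => cellK (c i)) (cellW (b.comp m h c)) := by
  have h1 := bijOn_symComp (X := fun n => polyW n) (Y := fun n => polyK n) B.op m h b.1.1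
    (fun i => (c i).1) (T := fun i => faceK (c i).2)
    (B.bijOn (fun p => m (b.1.1.symm p)) (sum_symm h b.1.1) b.2 fun i => (c (b.1.1.symm i)).2)
  have h2 := bijOn_prod_left (bijOn_ofWBar b) (univ.pi fun i => cellK (c i))
  have h3 := bijOn_toWBar (blockPerm m h b.1.1 fun i => (c i).1)
    (b.2.comp (fun p => m (b.1.1.symm p)) (sum_symm h b.1.1) fun p => (c (b.1.1.symm p)).2)
  have h4 := (h3.comp h1).comp h2
  exact h4

theorem PlanarModule.isCellularModule
    (hact : ∀ {n : ℕ+} (τ : Equiv.Perm (Fin n)) (x : KBar n),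
      O.act τ x = symAct (X := fun n => polyK n) τ x)
    (hcomp : ∀ {l n : ℕ+} (m : Fin l → ℕ+) (h : ∑ i, (m i : ℕ) = n) (x : KBar l)
      (y : ∀ i, KBar (m i)), O.comp m h (x, y) = symComp A.op m h x y) :
    IsCellularModule (B.symmetrize hact hcomp) where
  act_cell := bijOn_toWBar_symAct
  comp_cell := B.bijOn_toWBar_symComp

end Module

/-! ### Facets and coarsest decompositions -/

section Facets

variable {l n N : ℕ+}

theorem blockEquiv_circArity_val {M : ℕ+} (i : Fin M)
    (h : ∑ j, (circArity i n j : ℕ) = N) (a : Fin (circArity i n i)) :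
    (blockEquiv (circArity i n) h ⟨i, a⟩ : ℕ) = i + a := by
  simp only [blockEquiv, Equiv.trans_apply, finCongr_apply, Fin.val_cast, finSigmaFinEquiv_apply]
  congr 1
  have : ∀ k : Fin (i : ℕ), (circArity i n (Fin.castLE i.2.le k) : ℕ) = 1 := by
    intro k
    rw [circArity, if_neg, PNat.one_coe]
    intro e
    have h1 := congrArg Fin.val e
    have h2 := k.2
    simp only [Fin.val_castLE] at h1
    omega
  rw [Finset.sum_congr rfl fun k _ => this k]
  simp

theorem mem_close_top {p : Fin n × Fin n} :
    p ∈ (⊤ : Bracketing n).close.1 ↔ 1 < n ∧ p = (0, ⊤) := by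
  rw [Bracketing.mem_close]
  exact or_iff_left (Finset.notMem_empty p)

theorem circArity_self {M : ℕ+} (i : Fin M) : circArity i n i = n := if_pos rfl

/-- The composite at one place of trivial bracketings has a single bracket. -/
theorem mem_insertBrackets_circArity {M : ℕ+} (i : Fin M) (h : ∑ j, (circArity i n j : ℕ) = N)
    (hn : 1 < n) {p : Fin N × Fin N} :
    p ∈ insertBrackets (circArity i n) h ∅ (fun _ => ⊤) ↔
      (p.1 : ℕ) = i ∧ (p.2 : ℕ) + 1 = i + n := by
  have e1 : (((⊤ : Fin (circArity i n i)) : Fin (circArity i n i)) : ℕ) + 1 = n := by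
    have := (circArity i n i).pos
    rw [Fin.val_top, circArity_self]
    have := n.pos
    omega
  have b1 := blockEquiv_circArity_val i h 0
  have b2 := blockEquiv_circArity_val i h ⊤
  rw [Fin.val_zero] at b1
  rw [mem_insertBrackets]
  constructor
  · rintro (⟨q, hq, -⟩ | ⟨j, q, hq, rfl⟩)
    · exact absurd hq (Finset.notMem_empty q)
    · obtain ⟨hj, rfl⟩ := mem_close_top.1 hq
      obtain rfl : j = i := by
        by_contra hji
        rw [circArity, if_neg hji] at hj
        exact lt_irrefl _ hj
      dsimp only
      rw [b1, b2]
      omega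
  · rintro ⟨h1, h2⟩
    refine Or.inr ⟨i, (0, ⊤), mem_close_top.2 ⟨by rwa [circArity_self], rfl⟩, ?_⟩
    refine Prod.ext (Fin.ext ?_) (Fin.ext ?_)
    · rw [h1, b1, add_zero]
    · rw [b2]
      omega

theorem Bracketing.mem_comp {m : Fin l → ℕ+} {h : ∑ i, (m i : ℕ) = n} {b : Bracketing l}
    {c : ∀ i, Bracketing (m i)} {p : Fin n × Fin n} : p ∈ (b.comp m h c).1 ↔
      p ∈ insertBrackets m h b.1 c ∧ (p.2 : ℕ) - p.1 + 1 < n := Finset.mem_filter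

/-- A bracketing with a bracket is obtained by a composition with fewer inputs. -/
theorem Bracketing.exists_le_comp_top {b : Bracketing n} (hb : b ≠ ⊤) :
    ∃ (l : ℕ+) (m : Fin l → ℕ+) (h : ∑ i, (m i : ℕ) = n), 1 < l ∧ l < n ∧
      b ≤ (⊤ : Bracketing l).comp m h fun _ => ⊤ := by
  obtain ⟨p, hp⟩ : ∃ p, p ∈ b.1 := by
    by_contra hne
    push Not at hne
    exact hb (Bracketing.ext fun p => iff_of_false (hne p) (Finset.notMem_empty p))
  have h1 := (b.2.1 p hp).1
  have h2 := (b.2.1 p hp).2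
  rw [Fin.lt_def] at h1
  have h3 := p.2.2
  obtain ⟨l, hl⟩ : ∃ l : ℕ+, (l : ℕ) = n - ((p.2 : ℕ) - p.1) := ⟨⟨_, by omega⟩, rfl⟩
  obtain ⟨k, hk⟩ : ∃ k : ℕ+, (k : ℕ) = (p.2 : ℕ) - p.1 + 1 := ⟨⟨_, by omega⟩, rfl⟩
  have hN : (n : ℕ) + 1 = l + k := by omega
  refine ⟨l, circArity ⟨p.1, by omega⟩ k, sum_circArity _ hN, ?_, ?_, ?_⟩
  · rw [← PNat.coe_lt_coe, PNat.one_coe]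
    omega
  · rw [← PNat.coe_lt_coe]
    omega
  · intro q hq
    have hk1 : 1 < k := by
      rw [← PNat.coe_lt_coe, PNat.one_coe]
      omega
    obtain ⟨e1, e2⟩ := (mem_insertBrackets_circArity _ _ hk1).1 (Bracketing.mem_comp.1 hq).1
    dsimp only at e1 e2
    rwa [show q = p from Prod.ext (Fin.ext e1) (Fin.ext (by omega))]

end Facets

/-! ### Uniqueness of the coarsest decomposition -/

section Blocks

variable {l l' n : ℕ+}

theorem monotone_blockEquiv_symm (m : Fin l → ℕ+) (h : ∑ i, (m i : ℕ) = n) :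
    Monotone fun u => ((blockEquiv m h).symm u).1 := by
  intro u v huv
  obtain ⟨x, rfl⟩ := (blockEquiv m h).surjective u
  obtain ⟨y, rfl⟩ := (blockEquiv m h).surjective v
  simp only [Equiv.symm_apply_apply]
  by_contra hlt
  exact absurd (blockEquiv_lt_of_lt m h (not_le.1 hlt)) (not_lt.2 huv)

theorem surjective_blockEquiv_symm (m : Fin l → ℕ+) (h : ∑ i, (m i : ℕ) = n) :
    Function.Surjective fun u => ((blockEquiv m h).symm u).1 := fun i =>
  ⟨blockEquiv m h ⟨i, 0⟩, by simp only [Equiv.symm_apply_apply]⟩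

/-- As `l > 1`, the bracket around each block of at least two letters is proper and is recorded; as
the outer bracketing is trivial, every bracket lies in a block. So the blocks can be read off from
the composite. -/
theorem blockEquiv_symm_eq_iff {m : Fin l → ℕ+} {h : ∑ i, (m i : ℕ) = n} (hl : 1 < l)
    (c : ∀ i, Bracketing (m i)) {u v : Fin n} (huv : u ≠ v) :
    ((blockEquiv m h).symm u).1 = ((blockEquiv m h).symm v).1 ↔
      ∃ p ∈ ((⊤ : Bracketing l).comp m h c).1, (p.1 ≤ u ∧ u ≤ p.2) ∧ p.1 ≤ v ∧ v ≤ p.2 := by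
  constructor
  · intro e
    obtain ⟨⟨i, a⟩, rfl⟩ := (blockEquiv m h).surjective u
    obtain ⟨⟨j, b⟩, rfl⟩ := (blockEquiv m h).surjective v
    simp only [Equiv.symm_apply_apply] at e
    subst e
    have hi : (0 : Fin (m i)) < ⊤ := by
      by_contra h0
      have h1 : ∀ a : Fin (m i), a = 0 := fun a =>
        le_antisymm (le_top.trans (not_lt.1 h0)) (Fin.zero_le a)
      rw [h1 a, h1 b] at huv
      exact huv rfl
    have hlt := (blockEquiv_lt_iff_snd m h).2 hi
    have hle : ∀ {a b : Fin (m i)}, a ≤ b → blockEquiv m h ⟨i, a⟩ ≤ blockEquiv m h ⟨i, b⟩ :=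
      fun {a b} hab => not_lt.1 fun h' => absurd ((blockEquiv_lt_iff_snd m h).1 h') (not_lt.2 hab)
    refine ⟨(blockEquiv m h ⟨i, 0⟩, blockEquiv m h ⟨i, ⊤⟩), Bracketing.mem_comp.2 ⟨?_, ?_⟩,
      ⟨hle (Fin.zero_le a), hle le_top⟩, hle (Fin.zero_le b), hle le_top⟩
    · exact mem_insertBrackets.2 (Or.inr ⟨i, (0, ⊤),
        Bracketing.mem_close.2 (Or.inl ⟨zero_lt_top_iff.1 hi, rfl⟩), rfl⟩)
    · refine (proper_of_compatible_outer hlt.ne (Or.inr (Or.inl (gaps_subset_outer hlt))) ?_).2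
      intro e
      have e1 : blockEquiv m h ⟨i, 0⟩ = blockEquiv m h ⟨0, 0⟩ :=
        (congrArg Prod.fst e).trans (blockFirst_zero m h).symm
      have e2 : blockEquiv m h ⟨i, ⊤⟩ = blockEquiv m h ⟨⊤, ⊤⟩ :=
        (congrArg Prod.snd e).trans (blockLast_top m h).symm
      have e3 : i = 0 := congrArg Sigma.fst ((blockEquiv m h).injective e1)
      have e4 : i = ⊤ := congrArg Sigma.fst ((blockEquiv m h).injective e2)
      exact (zero_lt_top_iff.2 hl).ne (e3.symm.trans e4)
  · rintro ⟨p, hp, hu, hv⟩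
    rcases mem_insertBrackets.1 (Bracketing.mem_comp.1 hp).1 with ⟨q, hq, -⟩ | ⟨i, q, hq, rfl⟩
    · exact absurd hq (Finset.notMem_empty q)
    · have key : ∀ w, blockEquiv m h ⟨i, q.1⟩ ≤ w → w ≤ blockEquiv m h ⟨i, q.2⟩ →
          ((blockEquiv m h).symm w).1 = i := by
        intro w h1 h2
        have h3 := monotone_blockEquiv_symm m h h1
        have h4 := monotone_blockEquiv_symm m h h2
        simp only [Equiv.symm_apply_apply] at h3 h4
        exact le_antisymm h4 h3
      rw [key u hu.1 hu.2, key v hv.1 hv.2]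

theorem strictMono_of_fibers {N L L' : ℕ} {π : Fin N → Fin L} {π' : Fin N → Fin L'}
    (hπ : Monotone π) (hπ' : Monotone π') (h : ∀ u v, π' u = π' v → π u = π v)
    {r : Fin L → Fin N} (hr : ∀ i, π (r i) = i) : StrictMono fun i => π' (r i) := by
  intro i j hij
  have h1 : r i ≤ r j := by
    by_contra h1
    have := hπ (not_le.1 h1).le
    rw [hr, hr] at this
    exact absurd hij (not_lt.2 this)
  refine lt_of_le_of_ne (hπ' h1) fun e => ?_
  have := h _ _ e
  rw [hr, hr] at this
  exact hij.ne this

/-- Monotone surjections with the same fibers are equal. -/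
theorem eq_of_fibers {N L L' : ℕ} {π : Fin N → Fin L} {π' : Fin N → Fin L'}
    (hπ : Monotone π) (hπ' : Monotone π') (hs : Function.Surjective π)
    (hs' : Function.Surjective π') (h : ∀ u v, π u = π v ↔ π' u = π' v) :
    L = L' ∧ ∀ u, (π u : ℕ) = π' u := by
  -- A section of one map followed by the other map is strictly increasing, in both directions.
  -- Hence the targets have equal size and these composites are identities.
  choose r hr using hs
  choose r' hr' using hs'
  have s1 := strictMono_of_fibers hπ hπ' (fun u v => (h u v).2) hr
  have s2 := strictMono_of_fibers hπ' hπ (fun u v => (h u v).1) hr'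
  have e1 := Fintype.card_le_of_injective _ s1.injective
  have e2 := Fintype.card_le_of_injective _ s2.injective
  rw [Fintype.card_fin, Fintype.card_fin] at e1 e2
  obtain rfl := le_antisymm e1 e2
  refine ⟨rfl, fun u => ?_⟩
  have e3 := strictMono_eq_self s1 (π u)
  have e4 : π' (r (π u)) = π' u := (h _ _).1 (hr _)
  rw [← e4]
  exact congrArg Fin.val e3.symm

theorem card_block (m : Fin l → ℕ+) (h : ∑ i, (m i : ℕ) = n) (i : Fin l) :
    (m i : ℕ) = Nat.card {u : Fin n // ((blockEquiv m h).symm u).1 = i} := by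
  have e : {u : Fin n // ((blockEquiv m h).symm u).1 = i} ≃ Fin (m i) :=
    ((blockEquiv m h).symm.subtypeEquiv fun _ => Iff.rfl).trans (Equiv.sigmaSubtype i)
  rw [Nat.card_congr e, Nat.card_eq_fintype_card, Fintype.card_fin]

/-- The coarsest decomposition of a bracketing is unique. -/
theorem eq_of_top_comp_eq {m : Fin l → ℕ+} {h : ∑ i, (m i : ℕ) = n} {m' : Fin l' → ℕ+}
    {h' : ∑ i, (m' i : ℕ) = n} (hl : 1 < l) (hl' : 1 < l') {c : ∀ i, Bracketing (m i)}
    {c' : ∀ i, Bracketing (m' i)}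
    (e : (⊤ : Bracketing l).comp m h c = (⊤ : Bracketing l').comp m' h' c') :
    (⟨l, m⟩ : Σ l : ℕ+, Fin l → ℕ+) = ⟨l', m'⟩ := by
  have key := eq_of_fibers (monotone_blockEquiv_symm m h) (monotone_blockEquiv_symm m' h')
    (surjective_blockEquiv_symm m h) (surjective_blockEquiv_symm m' h') fun u v => by
      by_cases huv : u = v
      · rw [huv]
        exact iff_of_true rfl rfl
      · rw [blockEquiv_symm_eq_iff hl c huv, blockEquiv_symm_eq_iff hl' c' huv, e]
  obtain rfl := PNat.eq key.1
  congr 1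
  funext i
  refine PNat.eq ?_
  rw [card_block m h, card_block m' h']
  have : ∀ u, ((blockEquiv m h).symm u).1 = ((blockEquiv m' h').symm u).1 := fun u =>
    Fin.ext (key.2 u)
  simp only [this]

end Blocks

/-! ### Comparison of planar operads -/

/-- A function on a quotient of a compact space is continuous if its composition with the projection
is. -/
theorem continuousOn_range_of_comp {K X Z : Type} [TopologicalSpace K] [CompactSpace K]
    [TopologicalSpace X] [T2Space X] [TopologicalSpace Z] {c : K → X} {φ : X → Z}
    (hc : Continuous c) (hφ : Continuous (φ ∘ c)) : ContinuousOn φ (range c) := by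
  rw [continuousOn_iff_isClosed]
  intro t ht
  refine ⟨c '' ((φ ∘ c) ⁻¹' t), hc.isClosedMap _ (ht.preimage hφ), ?_⟩
  ext x
  constructor
  · rintro ⟨hx, ⟨k, rfl⟩⟩
    exact ⟨⟨k, hx, rfl⟩, ⟨k, rfl⟩⟩
  · rintro ⟨⟨k, hk, rfl⟩, hx⟩
    exact ⟨hk, hx⟩

/-- A bijection of the boundary of a ball extends to the ball, radially. -/
theorem IsCellMap.exists_extension {X : Type} [TopologicalSpace X] [T2Space X] {d : ℕ}
    {χ : (Fin d → ℝ) → X} {I : Set X} (hχ : IsCellMap χ univ I) {φ : X → X}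
    (hc : ContinuousOn φ Iᶜ) (hb : BijOn φ Iᶜ Iᶜ) :
    ∃ f : X → X, Continuous f ∧ Function.Bijective f ∧ EqOn f φ Iᶜ := by
  have h0 : ∀ x, ∃ v, ‖v‖ ≤ 1 ∧ χ v = x := fun x => by
    obtain ⟨v, hv, rfl⟩ := hχ.image_closedBall.symm ▸ mem_univ x
    exact ⟨v, mem_closedBall_zero_iff.1 hv, rfl⟩
  choose ρ hρ hχρ using h0
  have hinj : ∀ {v w}, ‖v‖ ≤ 1 → ‖w‖ ≤ 1 → χ v = χ w → v = w := fun hv hw e =>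
    hχ.injOn (mem_closedBall_zero_iff.2 hv) (mem_closedBall_zero_iff.2 hw) e
  have hρχ : ∀ v, ‖v‖ ≤ 1 → ρ (χ v) = v := fun v hv => hinj (hρ _) hv (hχρ _)
  have hρc : Continuous ρ := continuousOn_univ.1
    (hχ.continuousOn_inv fun v hv => hρχ v (mem_closedBall_zero_iff.1 hv))
  have hI : ∀ x, x ∈ Iᶜ ↔ ‖ρ x‖ = 1 := by
    intro x
    rw [mem_compl_iff, ← hχ.image_ball]
    constructor
    · intro hx
      by_contra hne
      exact hx ⟨ρ x, mem_ball_zero_iff.2 (lt_of_le_of_ne (hρ x) hne), hχρ x⟩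
    · rintro hx ⟨v, hv, rfl⟩
      rw [mem_ball_zero_iff] at hv
      rw [hρχ v hv.le] at hx
      exact hv.ne hx
  have hIχ : ∀ u, ‖u‖ = 1 → χ u ∈ Iᶜ := fun u hu => by rw [hI, hρχ u hu.le, hu]
  set G : (Fin d → ℝ) → (Fin d → ℝ) := fun u => ρ (φ (χ u)) with hG
  have hGn : ∀ u, ‖u‖ = 1 → ‖G u‖ = 1 := fun u hu => (hI _).1 (hb.mapsTo (hIχ u hu))
  have hGc : ContinuousOn G {u | ‖u‖ = 1} :=
    hρc.comp_continuousOn (hc.comp (hχ.continuousOn.mono fun u hu =>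
      mem_closedBall_zero_iff.2 (le_of_eq hu)) fun u hu => hIχ u hu)
  have hGinj : ∀ u v, ‖u‖ = 1 → ‖v‖ = 1 → G u = G v → u = v := by
    intro u v hu hv e
    have e1 : φ (χ u) = φ (χ v) := by rw [← hχρ (φ (χ u)), ← hχρ (φ (χ v))]; exact congrArg χ e
    exact hinj hu.le hv.le (hb.injOn (hIχ u hu) (hIχ v hv) e1)
  have hGsurj : ∀ w, ‖w‖ = 1 → ∃ u, ‖u‖ = 1 ∧ G u = w := by
    intro w hw
    obtain ⟨x, hx, e⟩ := hb.surjOn (hIχ w hw)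
    refine ⟨ρ x, (hI x).1 hx, ?_⟩
    rw [hG]
    dsimp only
    rw [hχρ, e, hρχ w hw.le]
  -- The cone over the boundary map `G`. It preserves the norm, which gives continuity at the
  -- origin; the value of `G` that enters there is irrelevant, being multiplied by zero.
  set F : (Fin d → ℝ) → (Fin d → ℝ) := fun v => ‖v‖ • G (‖v‖⁻¹ • v) with hF
  have hunit : ∀ v : Fin d → ℝ, v ≠ 0 → ‖‖v‖⁻¹ • v‖ = 1 := fun v hv => by
    rw [norm_smul, norm_inv, norm_norm, inv_mul_cancel₀ (norm_ne_zero_iff.2 hv)]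
  have hFn : ∀ v, ‖F v‖ = ‖v‖ := by
    intro v
    by_cases hv : v = 0
    · simp [hF, hv]
    · rw [hF]
      dsimp only
      rw [norm_smul, norm_norm, hGn _ (hunit v hv), mul_one]
  have hFc : Continuous F := by
    rw [continuous_iff_continuousAt]
    intro v
    by_cases hv : v = 0
    · subst hv
      have h1 : F 0 = 0 := norm_eq_zero.1 (by rw [hFn, norm_zero])
      rw [ContinuousAt, h1, tendsto_zero_iff_norm_tendsto_zero]
      simp only [hFn]
      exact tendsto_norm_zero
    · have h1 : ContinuousOn F {0}ᶜ := by
        refine continuous_norm.continuousOn.smul (hGc.comp ?_ fun w hw => hunit w hw)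
        exact (continuous_norm.continuousOn.inv₀ fun w hw => norm_ne_zero_iff.2 hw).smul
          continuousOn_id
      exact h1.continuousAt (isOpen_compl_singleton.mem_nhds hv)
  have hFinj : Function.Injective F := by
    intro v w e
    have e1 : ‖v‖ = ‖w‖ := by rw [← hFn v, e, hFn]
    by_cases hv : v = 0
    · rw [hv, norm_zero] at e1
      rw [hv, norm_eq_zero.1 e1.symm]
    · have hv' : ‖v‖ ≠ 0 := norm_ne_zero_iff.2 hv
      have hw : w ≠ 0 := norm_ne_zero_iff.1 (e1 ▸ hv')
      simp only [hF] at e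
      rw [← e1] at e
      have e2 := hGinj _ _ (hunit v hv) (by rw [e1]; exact hunit w hw)
        (smul_right_injective _ hv' e)
      exact smul_right_injective _ (inv_ne_zero hv') e2
  have hFsurj : ∀ w, ∃ v, F v = w := by
    intro w
    by_cases hw : w = 0
    · exact ⟨0, norm_eq_zero.1 (by rw [hFn, norm_zero]) |>.trans hw.symm⟩
    · have hw' : ‖w‖ ≠ 0 := norm_ne_zero_iff.2 hw
      obtain ⟨u, hu, e⟩ := hGsurj _ (hunit w hw)
      have e1 : ‖‖w‖ • u‖ = ‖w‖ := by rw [norm_smul, norm_norm, hu, mul_one]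
      refine ⟨‖w‖ • u, ?_⟩
      rw [hF]
      dsimp only
      rw [e1, inv_smul_smul₀ hw', e, smul_inv_smul₀ hw']
  refine ⟨fun x => χ (F (ρ x)), ?_, ⟨fun x y e => ?_, fun x => ?_⟩, fun x hx => ?_⟩
  · refine hχ.continuousOn.comp_continuous (hFc.comp hρc) fun x => ?_
    rw [mem_closedBall_zero_iff, hFn]
    exact hρ x
  · have e1 := hFinj (hinj (by rw [hFn]; exact hρ x) (by rw [hFn]; exact hρ y) e)
    rw [← hχρ x, e1, hχρ]
  · obtain ⟨v, hv⟩ := hFsurj (ρ x)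
    refine ⟨χ v, ?_⟩
    dsimp only
    rw [hρχ v (by rw [← hFn, hv]; exact hρ x), hv, hχρ]
  · rw [hI] at hx
    simp only [hF, hG, hx, inv_one, one_smul, hχρ]

instance (n : ℕ+) : CompactSpace (polyK n) := by
  obtain ⟨χ, hχ⟩ := exists_cellMap_faceK (⊤ : Bracketing n) rfl
  rw [← isCompact_univ_iff, ← eq_univ_of_forall fun t => mem_faceK_iff.2 (le_top (a := carrierK t)),
    ← hχ.image_closedBall]
  exact (isCompact_closedBall _ _).image_of_continuousOn hχ.continuousOn

/-! ### The inductive comparison of two planar operads -/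

namespace PlanarOperad

variable (A : PlanarOperad) {l n N : ℕ+}

theorem faceK_top : faceK (⊤ : Bracketing n) = univ :=
  eq_univ_of_forall fun _ => mem_faceK_iff.2 le_top

theorem op_injective {m : Fin l → ℕ+} {h : ∑ i, (m i : ℕ) = n} {x x' : polyK l}
    {y y' : ∀ i, polyK (m i)} (e : A.op m h x y = A.op m h x' y') : x = x' ∧ y = y' := by
  have hinj := (A.bijOn m h ⊤ fun _ => ⊤).injOn
  simp only [faceK_top] at hinj
  have := hinj (x₁ := (x, y)) ⟨mem_univ _, fun _ _ => mem_univ _⟩ (x₂ := (x', y'))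
    ⟨mem_univ _, fun _ _ => mem_univ _⟩ e
  exact ⟨congrArg Prod.fst this, congrArg Prod.snd this⟩

theorem op_mem_faceK {m : Fin l → ℕ+} {h : ∑ i, (m i : ℕ) = n} {x : polyK l}
    {y : ∀ i, polyK (m i)} {b : Bracketing l} {c : ∀ i, Bracketing (m i)} (hx : x ∈ faceK b)
    (hy : ∀ i, y i ∈ faceK (c i)) : A.op m h x y ∈ faceK (b.comp m h c) :=
  (A.bijOn m h b c).mapsTo (x := (x, y)) ⟨hx, fun i _ => hy i⟩

theorem exists_op_eq {m : Fin l → ℕ+} {h : ∑ i, (m i : ℕ) = n} {b : Bracketing l}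
    {c : ∀ i, Bracketing (m i)} {t : polyK n} (ht : t ∈ faceK (b.comp m h c)) :
    ∃ x ∈ faceK b, ∃ y, (∀ i, y i ∈ faceK (c i)) ∧ A.op m h x y = t := by
  obtain ⟨⟨x, y⟩, ⟨hx, hy⟩, rfl⟩ := (A.bijOn m h b c).surjOn ht
  exact ⟨x, hx, y, fun i => hy i (mem_univ i), rfl⟩

/-- If the composite were in a smaller cell, that cell would again be indexed by a composite, and by
injectivity the arguments would lie in correspondingly smaller cells. -/
theorem carrierK_op (m : Fin l → ℕ+) (h : ∑ i, (m i : ℕ) = n) (x : polyK l)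
    (y : ∀ i, polyK (m i)) :
    carrierK (A.op m h x y) = (carrierK x).comp m h fun i => carrierK (y i) := by
  have h1 : carrierK (A.op m h x y) ≤ (carrierK x).comp m h fun i => carrierK (y i) :=
    mem_faceK_iff.1 (A.op_mem_faceK (mem_faceK_iff.2 le_rfl) fun i => mem_faceK_iff.2 le_rfl)
  refine le_antisymm h1 ?_
  obtain ⟨b, c, e, -, -⟩ := Bracketing.exists_eq_comp m h h1
  obtain ⟨x', hx', y', hy', e'⟩ := A.exists_op_eq (t := A.op m h x y) (m := m) (h := h) (b := b)
    (c := c) (mem_faceK_iff.2 e.le)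
  obtain ⟨rfl, rfl⟩ := A.op_injective e'
  rw [e, Bracketing.comp_le_comp]
  exact ⟨mem_faceK_iff.1 hx', fun i => mem_faceK_iff.1 (hy' i)⟩

/-- Associativity, for the composition of a composite. -/
theorem op_op {l₀ : ℕ+} (m₀ : Fin l₀ → ℕ+) (h₀ : ∑ i, (m₀ i : ℕ) = l) (m : Fin l → ℕ+)
    (h : ∑ i, (m i : ℕ) = n) (q : Fin l₀ → ℕ+)
    (hq : ∀ i, ∑ j, (m (blockEquiv m₀ h₀ ⟨i, j⟩) : ℕ) = q i) (hN : ∑ i, (q i : ℕ) = n)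
    (x : polyK l₀) (w : ∀ i, polyK (m₀ i)) (y : ∀ i, polyK (m i)) :
    A.op m h (A.op m₀ h₀ x w) y = A.op q hN x fun i => A.op (fun j => m (blockEquiv m₀ h₀ ⟨i, j⟩))
      (hq i) (w i) fun j => y (blockEquiv m₀ h₀ ⟨i, j⟩) := by
  have hN' := sum_flat m₀ h₀ (fun i j => m (blockEquiv m₀ h₀ ⟨i, j⟩)) q hq hN
  refine Eq.trans ?_ (A.assoc m₀ h₀ (fun i j => m (blockEquiv m₀ h₀ ⟨i, j⟩)) q hq hN hN' x w
    fun i j => y (blockEquiv m₀ h₀ ⟨i, j⟩))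
  refine Composition.congr A.op _ _ _ fun s => ?_
  exact congrArg (fun s => (⟨m s, y s⟩ : Σ n, polyK n)) ((blockEquiv m₀ h₀).apply_symm_apply s).symm

theorem exists_sums {l₀ : ℕ+} (m₀ : Fin l₀ → ℕ+) (h₀ : ∑ i, (m₀ i : ℕ) = l) (m : Fin l → ℕ+)
    (h : ∑ i, (m i : ℕ) = n) : ∃ q : Fin l₀ → ℕ+,
      (∀ i, ∑ j, (m (blockEquiv m₀ h₀ ⟨i, j⟩) : ℕ) = q i) ∧ ∑ i, (q i : ℕ) = n := by
  refine ⟨fun i => ⟨∑ j, (m (blockEquiv m₀ h₀ ⟨i, j⟩) : ℕ),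
    Finset.sum_pos (fun j _ => (m _).pos) ⟨0, Finset.mem_univ _⟩⟩, fun i => rfl, ?_⟩
  rw [← h, ← Equiv.sum_comp (blockEquiv m₀ h₀) fun s => (m s : ℕ), Fintype.sum_sigma]
  rfl

theorem lt_of_one_lt {m : Fin l → ℕ+} (h : ∑ i, (m i : ℕ) = n) (hl : 1 < l) (i : Fin l) :
    m i < n := by
  rw [← PNat.coe_lt_coe, ← h]
  obtain ⟨j, hj⟩ : ∃ j, j ≠ i := by
    by_contra hne
    push Not at hne
    exact (zero_lt_top_iff.2 hl).ne ((hne 0).trans (hne ⊤).symm)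
  have h1 := Finset.add_le_sum (f := fun i => (m i : ℕ)) (s := Finset.univ)
    (fun i _ => Nat.zero_le _) (Finset.mem_univ i) (Finset.mem_univ j) hj.symm
  have h2 := (m j).pos
  omega

theorem le_of_sum {m : Fin l → ℕ+} (h : ∑ i, (m i : ℕ) = n) : l ≤ n := by
  rw [← PNat.coe_le_coe, ← h]
  calc (l : ℕ) = ∑ _i : Fin l, 1 := by simp
    _ ≤ _ := Finset.sum_le_sum fun i _ => (m i).pos

theorem nonempty_polyK : Nonempty (polyK n) :=
  ⟨(chartK n).pt ⟨fun _ => ⊤, fun _ _ _ => le_rfl⟩⟩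

/-- The existence of decompositions with an interior point in the first place. -/
theorem exists_coarsest (hn : 1 < n) (t : polyK n) :
    ∃ (l : ℕ+) (m : Fin l → ℕ+) (h : ∑ i, (m i : ℕ) = n) (x : polyK l) (y : ∀ i, polyK (m i)),
      1 < l ∧ carrierK x = ⊤ ∧ A.op m h x y = t := by
  induction n using PNat.strongInductionOn with
  | _ n ih =>
    by_cases ht : carrierK t = ⊤
    · exact ⟨n, fun _ => 1, by simp, t, fun _ => nonempty_polyK.some, hn, ht, A.comp_one _ _ _⟩
    -- A boundary point is a composite with fewer inputs. The coarsest decomposition of its first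
    -- argument, which exists by induction, is regrouped by associativity.
    · obtain ⟨l, m, h, hl, hln, hle⟩ := Bracketing.exists_le_comp_top ht
      obtain ⟨x, -, y, -, rfl⟩ := A.exists_op_eq (mem_faceK_iff.2 hle)
      obtain ⟨l₀, m₀, h₀, x₀, w, hl₀, hx₀, rfl⟩ := ih l hln hl x
      obtain ⟨q, hq, hN⟩ := exists_sums m₀ h₀ m h
      exact ⟨l₀, q, hN, x₀, _, hl₀, hx₀, (A.op_op m₀ h₀ m h q hq hN x₀ w y).symm⟩

variable (A' : PlanarOperad) (g : ∀ k : ℕ+, polyK k → polyK k)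

/-- The compatibility of a family of maps with compositions of arity `k`. -/
def Preserves (k : ℕ+) : Prop :=
  ∀ (l : ℕ+) (m : Fin l → ℕ+) (h : ∑ i, (m i : ℕ) = k) (x : polyK l) (y : ∀ i, polyK (m i)),
    g k (A.op m h x y) = A'.op m h (g l x) fun i => g (m i) (y i)

/-- The relation between the boundary points that correspond to each other. -/
def Related (t s : polyK n) : Prop :=
  ∃ (l : ℕ+) (m : Fin l → ℕ+) (h : ∑ i, (m i : ℕ) = n) (x : polyK l) (y : ∀ i, polyK (m i)),
    1 < l ∧ carrierK x = ⊤ ∧ A.op m h x y = t ∧ A'.op m h (g l x) (fun i => g (m i) (y i)) = s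

-- The carrier of `t` is a composite with trivial outer bracketing, so it determines `l` and `m`;
-- injectivity of the composition then determines the arguments.
variable {A A' g} in
theorem Related.eq {t s s' : polyK n} (h : Related A A' g t s) (h' : Related A A' g t s') :
    s = s' := by
  obtain ⟨l, m, h, x, y, hl, hx, rfl, rfl⟩ := h
  obtain ⟨l', m', h', x', y', hl', hx', e, rfl⟩ := h'
  have e1 := congrArg carrierK e
  rw [carrierK_op, carrierK_op, hx, hx'] at e1
  have e2 := eq_of_top_comp_eq hl' hl e1
  obtain rfl : l' = l := congrArg Sigma.fst e2
  obtain rfl : m' = m := eq_of_heq (Sigma.mk.inj_iff.1 e2).2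
  obtain ⟨rfl, rfl⟩ := A.op_injective e
  rfl

/-- The coarsest decomposition of `x`, regrouped, is the coarsest decomposition of the composite.
The two candidates for the image agree because `g` preserves compositions of the arities `l` and `q
i`, which are less than `n`. -/
theorem related_op (hg : ∀ k < n, Preserves A A' g k) {m : Fin l → ℕ+}
    (h : ∑ i, (m i : ℕ) = n) (hl : 1 < l) (hln : l < n) (x : polyK l) (y : ∀ i, polyK (m i)) :
    Related A A' g (A.op m h x y) (A'.op m h (g l x) fun i => g (m i) (y i)) := by
  obtain ⟨l₀, m₀, h₀, x₀, w, hl₀, hx₀, rfl⟩ := A.exists_coarsest hl x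
  obtain ⟨q, hq, hN⟩ := exists_sums m₀ h₀ m h
  refine ⟨l₀, q, hN, x₀, _, hl₀, hx₀, (A.op_op m₀ h₀ m h q hq hN x₀ w y).symm, ?_⟩
  rw [hg l hln, A'.op_op m₀ h₀ m h q hq hN]
  congr 1
  funext i
  exact hg (q i) (lt_of_one_lt hN hl₀ i) _ _ _ _ _

open Classical in
/-- The map of the boundary of the associahedron that is determined by maps in lower arities. -/
noncomputable def boundaryMap (t : polyK n) : polyK n :=
  if h : ∃ s, Related A A' g t s then h.choose else t

theorem boundaryMap_op (hg : ∀ k < n, Preserves A A' g k) {m : Fin l → ℕ+}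
    (h : ∑ i, (m i : ℕ) = n) (hl : 1 < l) (hln : l < n) (x : polyK l) (y : ∀ i, polyK (m i)) :
    boundaryMap A A' g (A.op m h x y) = A'.op m h (g l x) fun i => g (m i) (y i) := by
  have h1 := related_op A A' g hg h hl hln x y
  have h2 : ∃ s, Related A A' g (A.op m h x y) s := ⟨_, h1⟩
  rw [boundaryMap, dif_pos h2]
  exact h2.choose_spec.eq h1


/-- The properties of a family of maps that are established by induction. -/
structure IsComparison (n : ℕ+) : Prop where
  continuous : Continuous (g n)
  bijOn : ∀ b : Bracketing n, BijOn (g n) (faceK b) (faceK b)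
  preserves : Preserves A A' g n

/-! ### The map on the boundary and its extension -/

section Boundary

variable (hg : ∀ k < n, IsComparison A A' g k)

include hg

/-- A proper face is the image of a product of faces under a composition of lower arities, and in
these terms the boundary map is a product of the bijections given by induction. -/
theorem bijOn_boundaryMap {b : Bracketing n} (hb : b ≠ ⊤) :
    BijOn (boundaryMap A A' g) (faceK b) (faceK b) := by
  obtain ⟨l, m, h, hl, hln, hle⟩ := Bracketing.exists_le_comp_top hb
  obtain ⟨b, c, rfl, -, -⟩ := Bracketing.exists_eq_comp m h hle
  have key := boundaryMap_op A A' g (fun k hk => (hg k hk).preserves) h hl hln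
  have hm := lt_of_one_lt h hl
  have b1 := (hg l hln).bijOn b
  have b2 := fun i => (hg (m i) (hm i)).bijOn (c i)
  refine ⟨fun t ht => ?_, fun t ht t' ht' e => ?_, fun s hs => ?_⟩
  · obtain ⟨x, hx, y, hy, rfl⟩ := A.exists_op_eq ht
    rw [key]
    exact A'.op_mem_faceK (b1.mapsTo hx) fun i => (b2 i).mapsTo (hy i)
  · obtain ⟨x, hx, y, hy, rfl⟩ := A.exists_op_eq ht
    obtain ⟨x', hx', y', hy', rfl⟩ := A.exists_op_eq ht'
    rw [key, key] at e
    obtain ⟨e1, e2⟩ := A'.op_injective e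
    rw [b1.injOn hx hx' e1, funext fun i => (b2 i).injOn (hy i) (hy' i) (congrFun e2 i)]
  · obtain ⟨x, hx, y, hy, rfl⟩ := A'.exists_op_eq hs
    obtain ⟨x', hx', rfl⟩ := b1.surjOn hx
    choose y' hy' e using fun i => (b2 i).surjOn (hy i)
    refine ⟨_, A.op_mem_faceK hx' hy', ?_⟩
    rw [key]
    simp only [e]

/-- The image is in the face of `t`, so its carrier is not larger. If it were smaller, surjectivity
onto the smaller face and injectivity on the larger one would put `t` in the smaller face. -/
theorem carrierK_boundaryMap {t : polyK n} (ht : carrierK t ≠ ⊤) :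
    carrierK (boundaryMap A A' g t) = carrierK t := by
  have h1 := (bijOn_boundaryMap A A' g hg ht).mapsTo (mem_faceK_iff.2 le_rfl)
  have h2 := mem_faceK_iff.1 h1
  have h3 : carrierK (boundaryMap A A' g t) ≠ ⊤ := fun e => ht (top_le_iff.1 (e ▸ h2))
  obtain ⟨t', ht', e⟩ := (bijOn_boundaryMap A A' g hg h3).surjOn (mem_faceK_iff.2 le_rfl)
  have h4 := (bijOn_boundaryMap A A' g hg ht).injOn
    (mem_faceK_iff.2 ((mem_faceK_iff.1 ht').trans h2)) (mem_faceK_iff.2 le_rfl) e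
  rw [h4] at ht'
  exact le_antisymm h2 (mem_faceK_iff.1 ht')

theorem bijOn_boundaryMap_boundary :
    BijOn (boundaryMap A A' g) {t : polyK n | carrierK t ≠ ⊤} {t | carrierK t ≠ ⊤} := by
  refine ⟨fun t ht => ?_, fun t ht t' ht' e => ?_, fun s hs => ?_⟩
  · change carrierK _ ≠ ⊤
    rwa [carrierK_boundaryMap A A' g hg ht]
  · have h1 := congrArg carrierK e
    rw [carrierK_boundaryMap A A' g hg ht, carrierK_boundaryMap A A' g hg ht'] at h1
    exact (bijOn_boundaryMap A A' g hg ht).injOn (mem_faceK_iff.2 le_rfl)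
      (mem_faceK_iff.2 h1.ge) e
  · obtain ⟨t, ht, rfl⟩ := (bijOn_boundaryMap A A' g hg hs).surjOn (mem_faceK_iff.2 le_rfl)
    exact ⟨t, fun e => hs (top_le_iff.1 (e ▸ mem_faceK_iff.1 ht)), rfl⟩

/-- Each proper face is contained in the range of a composition map, which is a quotient map from a
compact space onto its range. There the boundary map comes from continuous maps of lower arities,
and finitely many closed faces cover the boundary. -/
theorem continuousOn_boundaryMap :
    ContinuousOn (boundaryMap A A' g) {t : polyK n | carrierK t ≠ ⊤} := by
  have h1 : ∀ b : {b : Bracketing n // b ≠ ⊤},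
      ContinuousOn (boundaryMap A A' g) (faceK b.1) := by
    rintro ⟨b, hb⟩
    obtain ⟨l, m, h, hl, hln, hle⟩ := Bracketing.exists_le_comp_top hb
    have key := boundaryMap_op A A' g (fun k hk => (hg k hk).preserves) h hl hln
    have hm := lt_of_one_lt h hl
    refine ContinuousOn.mono (s := range (A.comp m h)) (continuousOn_range_of_comp
      (A.comp m h).continuous ?_) fun t ht => ?_
    · have h2 : Continuous fun p : polyK l × ∀ i, polyK (m i) =>
          (g l p.1, fun i => g (m i) (p.2 i)) :=
        ((hg l hln).continuous.comp continuous_fst).prodMk (continuous_pi fun i =>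
          (hg (m i) (hm i)).continuous.comp ((continuous_apply i).comp continuous_snd))
      have h3 := (A'.comp m h).continuous.comp h2
      exact h3.congr fun p => (key p.1 p.2).symm
    · obtain ⟨x, -, y, -, rfl⟩ :=
        A.exists_op_eq (mem_faceK_iff.2 ((mem_faceK_iff.1 ht).trans hle))
      exact ⟨(x, y), rfl⟩
  have h2 := (locallyFinite_of_finite fun b : {b : Bracketing n // b ≠ ⊤} => faceK b.1)
    |>.continuousOn_iUnion (fun b => isClosed_faceK b.1) h1
  exact h2.mono fun t ht => mem_iUnion.2 ⟨⟨carrierK t, ht⟩, mem_faceK_iff.2 le_rfl⟩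

theorem exists_comparison_step : ∃ f : polyK n → polyK n, Continuous f ∧
    (∀ b : Bracketing n, BijOn f (faceK b) (faceK b)) ∧
    ∀ (l : ℕ+) (m : Fin l → ℕ+) (h : ∑ i, (m i : ℕ) = n) (x : polyK l) (y : ∀ i, polyK (m i)),
      1 < l → l < n → f (A.op m h x y) = A'.op m h (g l x) fun i => g (m i) (y i) := by
  obtain ⟨χ, hχ⟩ := exists_cellMap_faceK (⊤ : Bracketing n) rfl
  rw [faceK_top] at hχ
  obtain ⟨f, h1, h2, h3⟩ := hχ.exists_extension (continuousOn_boundaryMap A A' g hg)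
    (bijOn_boundaryMap_boundary A A' g hg)
  have h4 : ∀ t : polyK n, carrierK t ≠ ⊤ → f t = boundaryMap A A' g t := fun t ht => h3 ht
  refine ⟨f, h1, fun b => ?_, fun l m h x y hl hln => ?_⟩
  · by_cases hb : b = ⊤
    · rw [hb, faceK_top]
      exact bijOn_univ.2 h2
    · exact (bijOn_boundaryMap A A' g hg hb).congr fun t ht =>
        (h4 t fun e => hb (top_le_iff.1 (e ▸ mem_faceK_iff.1 ht))).symm
  · rw [h4, boundaryMap_op A A' g (fun k hk => (hg k hk).preserves) h hl hln]
    rw [carrierK_op]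
    intro e
    -- A composite with `1 < l < n` is a boundary point: otherwise the trivial bracketing would have
    -- coarsest decompositions into `l` blocks and into `n` blocks.
    have e1 : (carrierK x).comp m h (fun i => carrierK (y i)) ≤ (⊤ : Bracketing l).comp m h
      fun i => ⊤ := (Bracketing.comp_le_comp m h).2 ⟨le_top, fun i => le_top⟩
    rw [e, top_le_iff] at e1
    have e2 : (⊤ : Bracketing n).comp (fun _ => 1) (by simp) (fun _ => ⊤) = (⊤ : Bracketing n) :=
      Bracketing.comp_one _ _ _
    have e3 := congrArg Sigma.fst (eq_of_top_comp_eq hl (hl.trans hln) (e1.trans e2.symm))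
    exact hln.ne e3

end Boundary

/-- The cases `l = 1` and `l = n` of compatibility hold for any family of maps, by the unit laws.
The recursion only has to treat `1 < l < n`. -/
theorem op_of_eq_one {m : Fin l → ℕ+} (h : ∑ i, (m i : ℕ) = n) (hl : l = 1) (x : polyK l)
    (y : ∀ i, polyK (m i)) (g : ∀ k : ℕ+, polyK k → polyK k) :
    g n (A.op m h x y) = A'.op m h (g l x) fun i => g (m i) (y i) := by
  subst hl
  obtain rfl : m = fun _ => n := funext fun i => PNat.eq (by
    rw [← h, eq_of_fin_one i 0]
    exact (Fin.sum_univ_one fun i => (m i : ℕ)).symm)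
  have hy : y = fun _ => y 0 := funext fun i => by rw [eq_of_fin_one i 0]
  rw [hy, op, op, A.one_comp, A'.one_comp]

theorem op_of_eq {m : Fin l → ℕ+} (h : ∑ i, (m i : ℕ) = n) (hl : l = n) (x : polyK l)
    (y : ∀ i, polyK (m i)) (g : ∀ k : ℕ+, polyK k → polyK k) :
    g n (A.op m h x y) = A'.op m h (g l x) fun i => g (m i) (y i) := by
  subst hl
  obtain rfl : m = fun _ => 1 := by
    have h1 : ∑ _i : Fin l, 1 = ∑ i, (m i : ℕ) := by rw [h]; simp
    have h2 := (Finset.sum_eq_sum_iff_of_le fun i _ => (m i).pos).1 h1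
    exact funext fun i => PNat.eq (h2 i (Finset.mem_univ i)).symm
  rw [op, op, A.comp_one, A'.comp_one]

/-- Any two planar operads are isomorphic by maps that preserve the faces. -/
theorem exists_isComparison : ∃ g : ∀ k : ℕ+, polyK k → polyK k, ∀ n, IsComparison A A' g n := by
  let Q : ∀ n : ℕ+, (∀ k : ℕ+, k < n → polyK k → polyK k) → (polyK n → polyK n) → Prop :=
    fun n r f => Continuous f ∧ (∀ b : Bracketing n, BijOn f (faceK b) (faceK b)) ∧
      ∀ (l : ℕ+) (m : Fin l → ℕ+) (h : ∑ i, (m i : ℕ) = n) (x : polyK l) (y : ∀ i, polyK (m i))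
        (hl : 1 < l) (hln : l < n), f (A.op m h x y) =
          A'.op m h (r l hln x) fun i => r (m i) (lt_of_one_lt h hl i) (y i)
  have hne : ∀ n : ℕ+, Nonempty (polyK n → polyK n) := fun n => ⟨id⟩
  -- Well-founded recursion on the arity. The choice is arbitrary where no suitable map exists; the
  -- induction below shows that one always does.
  let g : ∀ k : ℕ+, polyK k → polyK k := wellFounded_lt.fix fun n r => Classical.epsilon (Q n r)
  have hfix : ∀ n, g n = Classical.epsilon (Q n fun k _ => g k) := fun n =>
    wellFounded_lt.fix_eq (fun n r => Classical.epsilon (Q n r)) n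
  refine ⟨g, fun n => ?_⟩
  induction n using PNat.strongInductionOn with
  | _ n ih =>
    have hQ : Q n (fun k _ => g k) (g n) := by
      rw [hfix n]
      refine Classical.epsilon_spec (p := Q n fun k _ => g k) ?_
      obtain ⟨f, h1, h2, h3⟩ := exists_comparison_step A A' g ih
      exact ⟨f, h1, h2, fun l m h x y hl hln => h3 l m h x y hl hln⟩
    refine ⟨hQ.1, hQ.2.1, fun l m h x y => ?_⟩
    by_cases h1 : l = 1
    · exact op_of_eq_one A A' h h1 x y g
    by_cases h2 : l = n
    · exact op_of_eq A A' h h2 x y g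
    · exact hQ.2.2 l m h x y (lt_of_le_of_ne one_le (Ne.symm h1))
        (lt_of_le_of_ne (le_of_sum h) h2)

end PlanarOperad

/-! ### The module over an arbitrary cellular operad -/

section Planar

variable {O : TopOperad KBar} (hO : IsCellularOperad O) {l n N : ℕ+}

include hO

/-- The cell of the trivial bracketing is a whole component, so preservation of cells says in which
component a composite lies. -/
theorem IsCellularOperad.comp_fst (m : Fin l → ℕ+) (h : ∑ i, (m i : ℕ) = n) (x : KBar l)
    (y : ∀ i, KBar (m i)) : (O.comp m h (x, y)).1 = blockPerm m h x.1 fun i => (y i).1 := by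
  obtain ⟨t, -, e⟩ := (hO.comp_cell m h ⟨x.1, ⊤⟩ fun i => ⟨(y i).1, ⊤⟩).mapsTo (x := (x, y))
    ⟨⟨x.2, mem_faceK_iff.2 le_top, rfl⟩, fun i _ => ⟨(y i).2, mem_faceK_iff.2 le_top, rfl⟩⟩
  rw [e]
  rfl

theorem IsCellularOperad.comp_ones (m : Fin l → ℕ+) (h : ∑ i, (m i : ℕ) = n) (x : polyK l)
    (y : ∀ i, polyK (m i)) : O.comp m h (⟨1, x⟩, fun i => ⟨1, y i⟩) =
      ⟨1, (O.comp m h (⟨1, x⟩, fun i => ⟨1, y i⟩)).2⟩ :=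
  Sigma.ext ((hO.comp_fst m h _ _).trans (blockPerm_one_one m h)) HEq.rfl

omit hO in
theorem subsingleton_KBar_one : Subsingleton (KBar 1) :=
  ⟨fun _ _ => Sigma.ext (Equiv.ext fun _ => eq_of_fin_one _ _)
    (heq_of_eq (Subsingleton.elim (α := polyK 1) _ _))⟩

omit hO in
theorem continuous_KBar_snd : Continuous fun x : KBar n => x.2 :=
  continuous_sigma fun _ => continuous_id

/-- The restriction of a cellular operad structure to the components of the identities. -/
def IsCellularOperad.planar : PlanarOperad where
  comp m h := ⟨fun p => (O.comp m h (⟨1, p.1⟩, fun i => ⟨1, p.2 i⟩)).2, by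
    refine continuous_KBar_snd.comp ((O.comp m h).continuous.comp (Continuous.prodMk ?_ ?_))
    · exact (continuous_sigmaMk (σ := fun _ : Equiv.Perm _ => polyK _)).comp continuous_fst
    · exact continuous_pi fun i => (continuous_sigmaMk (σ := fun _ : Equiv.Perm _ => polyK _)).comp
        ((continuous_apply i).comp continuous_snd)⟩
  bijOn {l n} m h b c := by
    have h1 := hO.comp_cell m h ⟨1, b⟩ fun i => ⟨1, c i⟩
    have hmem : ∀ x ∈ faceK b, ∀ y ∈ univ.pi fun i => faceK (c i),
        ((⟨1, x⟩, fun i => ⟨1, y i⟩) : KBar l × ∀ i, KBar (m i)) ∈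
          cellK ⟨1, b⟩ ×ˢ univ.pi fun i => cellK ⟨1, c i⟩ := fun x hx y hy =>
      ⟨⟨x, hx, rfl⟩, fun i _ => ⟨y i, hy i (mem_univ i), rfl⟩⟩
    refine ⟨?_, ?_, ?_⟩
    · rintro ⟨x, y⟩ ⟨hx, hy⟩
      obtain ⟨t, ht, e⟩ := h1.mapsTo (hmem x hx y hy)
      simp only [ContinuousMap.coe_mk]
      rw [e]
      exact ht
    · rintro ⟨x, y⟩ ⟨hx, hy⟩ ⟨x', y'⟩ ⟨hx', hy'⟩ e
      simp only [ContinuousMap.coe_mk] at e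
      have e1 := h1.injOn (hmem x hx y hy) (hmem x' hx' y' hy') (by
        rw [hO.comp_ones m h x y, e, ← hO.comp_ones m h x' y'])
      rw [Prod.mk.injEq] at e1
      refine Prod.ext (eq_of_heq (Sigma.mk.inj_iff.1 e1.1).2) (funext fun i => ?_)
      exact eq_of_heq (Sigma.mk.inj_iff.1 (congrFun e1.2 i)).2
    · intro t ht
      obtain ⟨⟨x, y⟩, ⟨⟨x, hx, rfl⟩, hy⟩, e⟩ := h1.surjOn (show
        (⟨blockPerm m h 1 fun _ => 1, t⟩ : KBar n) ∈ _ from ⟨t, ht, rfl⟩)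
      choose y' hy' e' using fun i => hy i (mem_univ i)
      obtain rfl : y = fun i => ⟨1, y' i⟩ := funext e'
      refine ⟨(x, y'), ⟨hx, fun i _ => hy' i⟩, ?_⟩
      simp only [ContinuousMap.coe_mk]
      rw [e]
  one_comp h x y := by
    have h1 := O.one_comp h ⟨1, y⟩
    rw [subsingleton_KBar_one.elim O.one ⟨1, x⟩] at h1
    simp only [ContinuousMap.coe_mk]
    rw [h1]
  comp_one h x y := by
    have h1 := O.comp_one h ⟨1, x⟩
    have h2 : (fun _ => O.one) = fun i => (⟨1, y i⟩ : KBar 1) :=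
      funext fun i => subsingleton_KBar_one.elim _ _
    rw [h2] at h1
    simp only [ContinuousMap.coe_mk]
    rw [h1]
  assoc m h k q hq hN hN' x y z := by
    have h1 := O.assoc m h k q hq hN hN' ⟨1, x⟩ (fun i => ⟨1, y i⟩) fun i j => ⟨1, z i j⟩
    simp only [ContinuousMap.coe_mk]
    rw [← hO.comp_ones, h1]
    congr 3
    funext i
    exact hO.comp_ones _ _ _ _

theorem IsCellularOperad.act_eq_symAct (τ : Equiv.Perm (Fin n)) (x : KBar n) :
    O.act τ x = symAct (X := fun n => polyK n) τ x := hO.act_eq x.1 τ x.2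

/-- Every point is a translate of a point in the component of the identity, so the equivariance
axioms express any composition by its planar part. -/
theorem IsCellularOperad.comp_eq_symComp (m : Fin l → ℕ+) (h : ∑ i, (m i : ℕ) = n) (x : KBar l)
    (y : ∀ i, KBar (m i)) : O.comp m h (x, y) = symComp hO.planar.op m h x y := by
  obtain ⟨σ, x⟩ := x
  have e1 : (⟨σ, x⟩ : KBar l) = O.act σ ⟨1, x⟩ := by rw [hO.act_eq, one_mul]
  have e2 : y = fun i => O.act (y i).1 ⟨1, (y i).2⟩ := funext fun i => by
    rw [hO.act_eq, one_mul]
  conv_lhs => rw [e1, e2, O.comp_act, O.act_comp, hO.comp_ones, hO.act_eq, hO.act_eq, one_mul,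
    ← blockPerm_mul_right]
  rfl

end Planar

/-! ### The cyclohedra as a module over an arbitrary planar operad -/

section Pullback

variable {A : PlanarOperad} {g : ∀ k : ℕ+, polyK k → polyK k}
  (hg : ∀ n, PlanarOperad.IsComparison A standardOperad g n)

/-- The structure of a module that is obtained by a comparison with the standard operad. -/
noncomputable def pullbackModule : PlanarModule A where
  comp {l _} m h := ⟨fun p => compW m h p.1 fun i => g (m i) (p.2 i), by
    have h0 : Continuous fun p : polyW l × ∀ i, polyK (m i) => (p.1, fun i => g (m i) (p.2 i)) :=
      continuous_fst.prodMk (continuous_pi fun i =>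
        (hg (m i)).continuous.comp ((continuous_apply i).comp continuous_snd))
    have h1 := (continuous_compW m h).comp h0
    exact h1⟩
  bijOn {l n} m h b c := by
    have h1 : BijOn (fun p : polyW l × ∀ i, polyK (m i) => (p.1, fun i => g (m i) (p.2 i)))
        (faceW b ×ˢ univ.pi fun i => faceK (c i)) (faceW b ×ˢ univ.pi fun i => faceK (c i)) := by
      refine ⟨?_, ?_, ?_⟩
      · rintro ⟨x, y⟩ ⟨hx, hy⟩
        exact ⟨hx, fun i hi => ((hg (m i)).bijOn (c i)).mapsTo (hy i hi)⟩
      · rintro ⟨x, y⟩ ⟨hx, hy⟩ ⟨x', y'⟩ ⟨hx', hy'⟩ e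
        rw [Prod.mk.injEq] at e
        exact Prod.ext e.1 (funext fun i => ((hg (m i)).bijOn (c i)).injOn (hy i (mem_univ i))
          (hy' i (mem_univ i)) (congrFun e.2 i))
      · rintro ⟨x, y⟩ ⟨hx, hy⟩
        choose y' hy' e using fun i => ((hg (m i)).bijOn (c i)).surjOn (hy i (mem_univ i))
        exact ⟨(x, y'), ⟨hx, fun i _ => hy' i⟩, Prod.ext rfl (funext e)⟩
    have h2 := (bijOn_compW m h b c).comp h1
    exact h2
  comp_one h x y := compW_one h x _
  assoc m h k q hq hN hN' x y z := by
    refine (compW_assoc m h k q hq hN hN' x (fun i => g (m i) (y i))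
      fun i j => g (k i j) (z i j)).trans ?_
    exact congrArg (compW q hN x) (funext fun i =>
      ((hg (q i)).preserves (m i) (k i) (hq i) (y i) (z i)).symm)
  rotate_comp m h r x y := rotW_compW m h r x fun i => g (m i) (y i)

end Pullback

/-! ### Partial compositions and facets -/

section Circ

variable {m n N : ℕ+}

theorem comp_circArity_eq_single (i : Fin m) (hN : (N : ℕ) + 1 = m + n) {a b : Fin N} (hab : a ≠ b)
    (ha : (a : ℕ) = i) (hb : (b : ℕ) = i + n - 1) :
    (⊤ : CycBracketing m).comp (circArity i n) (sum_circArity i hN) (fun _ => ⊤) =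
      CycBracketing.single (a, b) hab := by
  have hn : 1 < n := by
    rw [← PNat.coe_lt_coe, PNat.one_coe]
    by_contra h
    exact hab (Fin.ext (by have := n.pos; omega))
  refine CycBracketing.ext fun p =>
    (mem_insertBrackets_circArity i (sum_circArity i hN) hn).trans ?_
  change _ ↔ p ∈ ({(a, b)} : Finset (Fin N × Fin N))
  rw [Finset.mem_singleton, Prod.ext_iff, Fin.ext_iff, Fin.ext_iff]
  dsimp only
  have := n.pos
  omega

theorem cast_fst_eq_one {a b : ℕ+} (e : a = b) (x : KBar a) :
    (cast (congrArg KBar e) x).1 = 1 ↔ x.1 = 1 := by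
  subst e
  rfl

theorem mem_cellK_one_top {x : KBar n} : x ∈ cellK (⟨1, ⊤⟩ : BBar n) ↔ x.1 = 1 := by
  constructor
  · rintro ⟨t, -, rfl⟩
    rfl
  · intro e
    exact ⟨x.2, mem_faceK_iff.2 le_top, Sigma.ext e HEq.rfl⟩

/-- At each place other than `i` the argument ranges over `KBar 1`, which is a point. At the place
`i` the arity equals `n` only propositionally, whence the casts. -/
theorem bijOn_circArgs (e : KBar 1) (i : Fin m) :
    BijOn (fun x : polyW m × polyK n => (((⟨⟨1, rfl⟩, x.1⟩, circArgs e i (⟨1, x.2⟩ : KBar n))) :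
        WBar m × ∀ j, KBar (circArity i n j))) univ
      (cellW (⟨⟨1, rfl⟩, ⊤⟩ : BCBar m) ×ˢ univ.pi fun j => cellK (⟨1, ⊤⟩ : BBar (circArity i n j))) := by
  have hone : ∀ j, j ≠ i → ∀ x y : KBar (circArity i n j), x = y := by
    intro j hj
    have h1 : circArity i n j = 1 := if_neg hj
    rw [h1]
    exact subsingleton_KBar_one.elim
  have hself : ∀ p : KBar n, circArgs e i p i = cast (congrArg KBar (circArity_self i).symm) p :=
    fun p => dif_pos rfl
  refine ⟨?_, ?_, ?_⟩
  · rintro ⟨x, t⟩ -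
    refine ⟨⟨x, mem_faceW_iff.2 le_top, rfl⟩, fun j _ => mem_cellK_one_top.2 ?_⟩
    by_cases hj : j = i
    · subst hj
      dsimp only
      rw [hself, cast_fst_eq_one (circArity_self j).symm]
    · exact congrArg Sigma.fst (hone j hj _ ⟨1, PlanarOperad.nonempty_polyK.some⟩)
  · rintro ⟨x, t⟩ - ⟨x', t'⟩ - h
    rw [Prod.mk.injEq] at h
    have h2 := congrFun h.2 i
    dsimp only at h2
    rw [hself, hself, cast_inj] at h2
    exact Prod.ext (eq_of_heq (Sigma.mk.inj_iff.1 h.1).2) (eq_of_heq (Sigma.mk.inj_iff.1 h2).2)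
  · rintro ⟨x, y⟩ ⟨⟨x, hx, rfl⟩, hy⟩
    have h1 := mem_cellK_one_top.1 (hy i (mem_univ i))
    rw [← cast_fst_eq_one (circArity_self i)] at h1
    refine ⟨(x, (cast (congrArg KBar (circArity_self i)) (y i)).2), mem_univ _,
      Prod.ext rfl (funext fun j => ?_)⟩
    by_cases hj : j = i
    · subst hj
      dsimp only
      rw [hself]
      have h2 : (⟨1, (cast (congrArg KBar (circArity_self j)) (y j)).2⟩ : KBar n) =
          cast (congrArg KBar (circArity_self j)) (y j) := Sigma.ext h1.symm HEq.rfl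
      rw [h2, cast_cast, cast_eq]
    · exact hone j hj _ _

theorem BCBar.mk_one (b : CycBracketing n) : BCBar.mk 1 b = ⟨⟨1, rfl⟩, b⟩ := by
  unfold BCBar.mk
  rw [Sigma.mk.injEq]
  exact ⟨toFix_coe ⟨1, rfl⟩, heq_of_eq b.rotate_zero⟩

/-- The cells of trivial bracketings are whole components. Their composite has a single bracket,
since only the inserted string of length `n` has at least two letters. -/
theorem IsCellularModule.circIsFacet {O : TopOperad KBar} {M : TopModule O WBar}
    (hM : IsCellularModule M) : CircIsFacet M := by
  intro m n N i hN a b hab ha hb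
  have h1 := hM.comp_cell (circArity i n) (sum_circArity i hN) ⟨⟨1, rfl⟩, ⊤⟩ fun _ => ⟨1, ⊤⟩
  have e : BCBar.comp (circArity i n) (sum_circArity i hN) ⟨⟨1, rfl⟩, ⊤⟩ (fun _ => ⟨1, ⊤⟩) =
      ⟨⟨1, rfl⟩, CycBracketing.single (a, b) hab⟩ := by
    rw [← comp_circArity_eq_single i hN hab ha hb]
    exact (congrArg (fun σ => BCBar.mk σ _)
      (blockPerm_one_one (circArity i n) (sum_circArity i hN))).trans (BCBar.mk_one _)
  rw [e] at h1
  refine ⟨h1.comp (bijOn_circArgs O.one i), ?_⟩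
  have h2 : dimW (⟨⟨1, rfl⟩, CycBracketing.single (a, b) hab⟩ : BCBar N) = (N : ℕ) - 1 - 1 := by
    rw [dimW]
    rfl
  have h3 : (a : ℕ) ≠ b := fun h => hab (Fin.ext h)
  have := a.2
  have := b.2
  omega

end Circ

theorem exists_cellular_module {O : TopOperad KBar} (hO : IsCellularOperad O) :
    ∃ M : TopModule O WBar, IsCellularModule M := by
  obtain ⟨g, hg⟩ := PlanarOperad.exists_isComparison hO.planar standardOperad
  exact ⟨_, (pullbackModule hg).isCellularModule hO.act_eq_symAct hO.comp_eq_symComp⟩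

/-! ### Homology in degree zero and the homology of disjoint unions of convex sets -/

section VertexClass

open CategoryTheory Limits HomologicalComplex Simplicial

variable {C : Type*} [Category* C] [HasCoproducts.{0} C] [Preadditive C] [CategoryWithHomology C]

/-- The class of a vertex of a simplicial set in degree zero homology. -/
noncomputable def vertexHom {K : SSet.{0}} (R : C) (x : K _⦋0⦌) : R ⟶ K.homology R 0 :=
  (K.chainComplex R).liftCycles (k := K.ιChainComplex x) 0 (by simp) (by simp) ≫
    (K.chainComplex R).homologyπ 0

theorem vertexHom_homology₀Iso {K : SSet.{0}} (R : C) (x : K _⦋0⦌) :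
    vertexHom R x ≫ (K.homology₀Iso R).hom = Sigma.ι (fun _ : K.π₀ => R) (.mk x) := by
  rw [vertexHom, Category.assoc, SSet.liftCycles_ιChainComplex_homologyπ_homology₀Iso_hom]

theorem vertexHom_homologyMap {K L : SSet.{0}} (R : C) (x : K _⦋0⦌) (f : K ⟶ L) :
    vertexHom R x ≫ SSet.homologyMap f R 0 = vertexHom R (f.app _ x) := by
  rw [vertexHom, Category.assoc, SSet.homologyMap, homologyπ_naturality, ← Category.assoc,
    liftCycles_comp_cyclesMap, vertexHom]
  simp only [SSet.ι_chainComplexMap_f]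

theorem vertexHom_homology₀ε {K : SSet.{0}} (R : C) (x : K _⦋0⦌) :
    vertexHom R x ≫ K.homology₀ε R = 𝟙 R := by
  rw [vertexHom, Category.assoc, SSet.liftCycles_ιChainComplex_homologyπ_homology₀ε]

end VertexClass

/-! ### Classes of points, and degree zero homology as a free module -/

section PointClass

open CategoryTheory Limits Simplicial
variable (k : Type u) [Field k] {X Y : Type} [TopologicalSpace X] [TopologicalSpace Y]

/-- For the one-point space the vertex class is a section of the augmentation, which is an
isomorphism; the general case follows by naturality. -/
theorem ptClass_eq (x : X) : ptClass k x =
    (vertexHom (ModuleCat.of k k) (TopCat.toSSetObj₀Equiv (X := TopCat.of X) |>.symm x)).hom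
      (1 : k) := by
  have h1 : inv (TopCat.singularHomology₀ε (TopCat.of Unit) (ModuleCat.of k k)) = 
      vertexHom (ModuleCat.of k k) (TopCat.toSSetObj₀Equiv (X := TopCat.of Unit) |>.symm ()) := by
    refine IsIso.inv_eq_of_inv_hom_id ?_
    exact vertexHom_homology₀ε _ _
  have h2 := vertexHom_homologyMap (ModuleCat.of k k)
    (TopCat.toSSetObj₀Equiv (X := TopCat.of Unit) |>.symm ())
    (TopCat.toSSet.map (TopCat.ofHom (ContinuousMap.const Unit x)))
  unfold ptClass
  rw [h1]
  have h3 := congrArg (fun f => f.hom (1 : k)) h2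
  exact h3

theorem map_ptClass (f : C(X, Y)) (x : X) :
    Homology.map k 0 f (ptClass k x) = ptClass k (f x) := by
  rw [ptClass_eq, ptClass_eq]
  have h2 := vertexHom_homologyMap (ModuleCat.of k k)
    (TopCat.toSSetObj₀Equiv (X := TopCat.of X) |>.symm x)
    (TopCat.toSSet.map (TopCat.ofHom f))
  exact congrArg (fun f => f.hom (1 : k)) h2

/-- The coproduct of copies of `k`. -/
noncomputable def coproductEquiv (S : Type) :
    (∐ fun _ : S => ModuleCat.of k k : ModuleCat.{u} k) ≅ ModuleCat.of k (S →₀ k) where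
  hom := Sigma.desc fun s => ModuleCat.ofHom (Finsupp.lsingle s)
  inv := ModuleCat.ofHom (Finsupp.lsum k fun s => (Sigma.ι (fun _ : S => ModuleCat.of k k) s).hom)
  hom_inv_id := by
    refine Sigma.hom_ext _ _ fun s => ?_
    rw [← Category.assoc, Sigma.ι_desc]
    ext
    simp
  inv_hom_id := by
    ext s
    simp

/-- `H₀(X)` is free on any set that indexes the path components of `X`. -/
theorem exists_homologyZero_equiv {S : Type} (p : X → S) (hp : Function.Surjective p)
    (hj : ∀ x y, p x = p y ↔ Joined x y) :
    ∃ φ : Homology k 0 X ≃ₗ[k] (S →₀ k), ∀ x, φ (ptClass k x) = Finsupp.single (p x) 1 := by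
  let q : ((TopCat.toSSet.obj (TopCat.of X)).π₀) ≃ S := 
    (TopCat.zerothHomotopyEquiv (X := TopCat.of X)).symm.trans
      (Equiv.ofBijective (Quotient.lift p fun x y h => (hj x y).2 h) (by
        constructor
        · rintro ⟨x⟩ ⟨y⟩ e
          exact Quotient.sound ((hj x y).1 e)
        · intro s
          obtain ⟨x, rfl⟩ := hp s
          exact ⟨Quotient.mk _ x, rfl⟩))
  refine ⟨(((TopCat.toSSet.obj (TopCat.of X)).homology₀Iso (ModuleCat.of k k)).trans
    (coproductEquiv k _)).toLinearEquiv.trans (Finsupp.domLCongr q), fun x => ?_⟩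
  have h1 := vertexHom_homology₀Iso (ModuleCat.of k k) 
    (TopCat.toSSetObj₀Equiv (X := TopCat.of X) |>.symm x)
  have h2 := congrArg (fun f => f.hom (1 : k)) (congrArg (fun f => f ≫ (coproductEquiv k _).hom) h1)
  rw [ptClass_eq]
  have h3 := congrArg (Finsupp.domLCongr (M := k) (R := k) q) h2
  refine h3.trans ?_
  have h4 := congrArg (fun f => f.hom (1 : k)) (Sigma.ι_desc (fun s => ModuleCat.ofHom
    (Finsupp.lsingle (R := k) (M := k) s)) (SSet.π₀.mk
      ((TopCat.toSSetObj₀Equiv (X := TopCat.of X)).symm x)))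
  refine (congrArg (Finsupp.domLCongr (M := k) (R := k) q) h4).trans ?_
  exact Finsupp.domLCongr_single _ _ _

/-- The identity of the homology of `X` factors through that of a discrete space, which vanishes in
nonzero degrees. -/
theorem subsingleton_homology {S : Type} [TopologicalSpace S] [DiscreteTopology S] (f : C(X, S))
    (g : C(S, X)) (hgf : (g.comp f).Homotopic (.id X)) {i : ℕ} (hi : i ≠ 0) :
    Subsingleton (Homology k i X) := by
  have h1 : Subsingleton (Homology k i S) := ModuleCat.subsingleton_of_isZero
    (AlgebraicTopology.isZero_singularHomologyFunctor_of_totallyDisconnectedSpace _ _ _ _ hi)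
  obtain ⟨F⟩ := hgf
  have h2 := TopCat.Homotopy.congr_homologyMap_singularChainComplexFunctor (X := TopCat.of X)
    (Y := TopCat.of X) (f := TopCat.ofHom (g.comp f)) (g := TopCat.ofHom (.id X)) F
    (ModuleCat.of k k) i
  have h3 : Homology.map k i (g.comp f) = Homology.map k i (.id X) :=
    congrArg ModuleCat.Hom.hom h2
  have h4 : Homology.map k i (g.comp f) = Homology.map k i g ∘ₗ Homology.map k i f :=
    congrArg ModuleCat.Hom.hom (((AlgebraicTopology.singularHomologyFunctor (ModuleCat.{u} k) i).obj
      (ModuleCat.of k k)).map_comp (TopCat.ofHom f) (TopCat.ofHom g))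
  have h5 : Homology.map k i (.id X) = LinearMap.id :=
    congrArg ModuleCat.Hom.hom (((AlgebraicTopology.singularHomologyFunctor (ModuleCat.{u} k) i).obj
      (ModuleCat.of k k)).map_id (TopCat.of X))
  have h6 : ∀ a : Homology k i X, Homology.map k i g (Homology.map k i f a) = a := fun a => by
    rw [← LinearMap.comp_apply, ← h4, h3, h5, LinearMap.id_apply]
  refine ⟨fun a b => ?_⟩
  rw [← h6 a, ← h6 b, Subsingleton.elim (Homology.map k i f a)]
theorem ptClass_eq_of_joined {x y : X} (h : Joined x y) : ptClass k x = ptClass k y := by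
  obtain ⟨φ, hφ⟩ := exists_homologyZero_equiv k (ZerothHomotopy.mk (X := X)) Quotient.mk_surjective
    fun x y => Quotient.eq
  refine φ.injective ?_
  rw [hφ, hφ, ZerothHomotopy.sound h.some]

/-- `H₀(X)` is free on the path components, with classes of points as a basis. -/
theorem homologyZero_hom_ext {V : Type*} [AddCommGroup V] [Module k V]
    {f g : Homology k 0 X →ₗ[k] V} (h : ∀ x, f (ptClass k x) = g (ptClass k x)) : f = g := by
  obtain ⟨φ, hφ⟩ := exists_homologyZero_equiv k (ZerothHomotopy.mk (X := X)) Quotient.mk_surjective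
    fun x y => Quotient.eq
  have h1 : f ∘ₗ φ.symm.toLinearMap = g ∘ₗ φ.symm.toLinearMap := by
    refine Finsupp.lhom_ext' fun s => LinearMap.ext_ring ?_
    obtain ⟨x, rfl⟩ := Quotient.mk_surjective s
    have h2 : φ.symm (Finsupp.single (ZerothHomotopy.mk x) 1) = ptClass k x := by
      rw [← hφ, LinearEquiv.symm_apply_apply]
    exact (congrArg f h2).trans ((h x).trans (congrArg g h2).symm)
  ext a
  simpa using LinearMap.congr_fun h1 (φ a)

theorem multilinearOfBasis_single {l : ℕ} (m : Fin l → ℕ+) {V : Type u} [AddCommGroup V]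
    [Module k V] (f : (∀ i, Equiv.Perm (Fin (m i))) → V) (τ : ∀ i, Equiv.Perm (Fin (m i))) :
    multilinearOfBasis k m f (fun i => Finsupp.single (τ i) 1) = f τ := by
  rw [multilinearOfBasis, sum_apply, Finset.sum_eq_single τ]
  · simp
  · intro τ' _ hne
    obtain ⟨i, hi⟩ := Function.ne_iff.1 hne
    have h1 : ∏ j, (Finsupp.single (τ j) (1 : k)) (τ' j) = 0 :=
      Finset.prod_eq_zero (Finset.mem_univ i) (Finsupp.single_eq_of_ne hi)
    simp [h1]
  · simp

theorem map_multilinearOfBasis {l : ℕ} (m : Fin l → ℕ+) {V W : Type u} [AddCommGroup V]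
    [Module k V] [AddCommGroup W] [Module k W] (L : V →ₗ[k] W)
    (f : (∀ i, Equiv.Perm (Fin (m i))) → V) (c : ∀ i, Ass k (m i)) :
    L (multilinearOfBasis k m f c) = multilinearOfBasis k m (fun τ => L (f τ)) c := by
  simp [multilinearOfBasis, map_sum]

/-- `E` is defined on basis elements by points chosen in the components; another choice gives joined
points and so the same classes. The second assertion expresses linear maps after `E` by their values
on chosen points, in the form in which `Ass.comp` and `Cycl.comp` are defined. -/
theorem exists_exteriorProduct {l : ℕ} (m : Fin l → ℕ+) {S : Type} {p : X → S}
    (φ : Homology k 0 X ≃ₗ[k] (S →₀ k)) (hφ : ∀ x, φ (ptClass k x) = Finsupp.single (p x) 1)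
    (hp : ∀ x y, p x = p y → Joined x y) {x₀ : S → X} (hx₀ : ∀ s, p (x₀ s) = s)
    {Y : Fin l → Type} [∀ i, TopologicalSpace (Y i)] {q : ∀ i, Y i → Equiv.Perm (Fin (m i))}
    (χ : ∀ i, Homology k 0 (Y i) ≃ₗ[k] Ass k (m i))
    (hχ : ∀ i y, χ i (ptClass k y) = Finsupp.single (q i y) 1)
    (hq : ∀ i x y, q i x = q i y → Joined x y) {y₀ : ∀ i, Equiv.Perm (Fin (m i)) → Y i}
    (hy₀ : ∀ i τ, q i (y₀ i τ) = τ) :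
    ∃ E, IsExteriorProduct k (X := X) (Y := Y) E ∧ ∀ (V : Type u) [AddCommGroup V] [Module k V]
      (L : Homology k 0 (X × ∀ i, Y i) →ₗ[k] V) (a : Homology k 0 X) (c : ∀ i, Homology k 0 (Y i)),
      L (E a c) = Finsupp.lift _ k _ (fun s => multilinearOfBasis k m fun τ =>
        L (ptClass k (x₀ s, fun i => y₀ i (τ i)))) (φ a) (fun i => χ i (c i)) := by
  let E₀ : (S →₀ k) →ₗ[k] MultilinearMap k (fun i => Ass k (m i)) (Homology k 0 (X × ∀ i, Y i)) :=
    Finsupp.lift _ k _ fun s => multilinearOfBasis k m fun τ =>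
      ptClass k (x₀ s, fun i => y₀ i (τ i))
  refine ⟨MultilinearMap.compLinearMapₗ (fun i => (χ i).toLinearMap) ∘ₗ E₀ ∘ₗ φ.toLinearMap,
    fun x y => ?_, fun V _ _ L a c => ?_⟩
  · have h1 : (fun i => χ i (ptClass k (y i))) = fun i => Finsupp.single (q i (y i)) 1 :=
      funext fun i => hχ i _
    change E₀ (φ (ptClass k x)) (fun i => χ i (ptClass k (y i))) = _
    rw [h1, hφ]
    simp only [E₀, Finsupp.lift_apply, Finsupp.sum_single_index, zero_smul, one_smul,
      multilinearOfBasis_single]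
    refine ptClass_eq_of_joined k ⟨(hp _ _ (hx₀ _)).some.prod (Path.pi fun i => ?_)⟩
    exact (hq i _ _ (hy₀ i _)).some
  · change L (E₀ (φ a) fun i => χ i (c i)) = _
    simp only [E₀, Finsupp.lift_apply, Finsupp.sum, sum_apply,
      smul_apply, map_sum, map_smul, map_multilinearOfBasis]

end PointClass

/-! ### Homology of disjoint unions of copies of a convex set -/

section Convex

variable {S ι : Type} {s : Set (ι → ℝ)} (hs : Convex ℝ s)

include hs in
theorem joined_of_fst_eq {x y : Σ _ : S, s} (h : x.1 = y.1) : Joined x y := by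
  obtain ⟨i, x⟩ := x
  obtain ⟨j, y⟩ := y
  obtain rfl : i = j := h
  have h1 : PathConnectedSpace s := isPathConnected_iff_pathConnectedSpace.1
    (hs.isPathConnected ⟨x, x.2⟩)
  exact ⟨(PathConnectedSpace.joined x y).some.map continuous_sigmaMk⟩

theorem fst_eq_of_joined {x y : Σ _ : S, s} (h : Joined x y) : x.1 = y.1 := by
  obtain ⟨γ⟩ := h
  let _ : TopologicalSpace S := ⊥
  have _ : DiscreteTopology S := ⟨rfl⟩
  have h1 : Continuous fun x : Σ _ : S, s => x.1 := continuous_sigma fun _ => continuous_const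
  have h2 := PreconnectedSpace.constant inferInstance (h1.comp γ.continuous) (x := 0) (y := 1)
  simpa using h2

include hs

theorem exists_homologyZero_equiv_sigma (c : s) (k : Type u) [Field k] :
    ∃ φ : Homology k 0 (Σ _ : S, s) ≃ₗ[k] (S →₀ k),
      ∀ x, φ (ptClass k x) = Finsupp.single x.1 1 :=
  exists_homologyZero_equiv k _ (fun i => ⟨⟨i, c⟩, rfl⟩) fun _ _ =>
    ⟨joined_of_fst_eq hs, fst_eq_of_joined⟩

/-- All copies are contracted simultaneously, so the union is homotopy equivalent to its discrete
set of indices. -/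
theorem subsingleton_homology_sigma (hne : s.Nonempty) (k : Type u) [Field k] {i : ℕ} (hi : i ≠ 0) :
    Subsingleton (Homology k i (Σ _ : S, s)) := by
  let _ : TopologicalSpace S := ⊥
  have _ : DiscreteTopology S := ⟨rfl⟩
  have h1 : ContractibleSpace s := hs.contractibleSpace hne
  obtain ⟨c, ⟨F⟩⟩ := (contractible_iff_id_nullhomotopic s).1 h1
  refine subsingleton_homology k (S := S) ⟨fun x => x.1, continuous_sigma fun _ => continuous_const⟩
    ⟨fun i => ⟨i, c⟩, continuous_of_discreteTopology⟩ ?_ hi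
  symm
  refine ⟨⟨⟨fun p => ⟨p.2.1, F (p.1, p.2.2)⟩, ?_⟩, fun x => ?_, fun x => ?_⟩⟩
  · rw [← ((Homeomorph.prodComm _ _).trans Homeomorph.sigmaProdDistrib).symm.comp_continuous_iff']
    refine continuous_sigma fun i => ?_
    exact continuous_sigmaMk.comp (F.continuous.comp (continuous_snd.prodMk continuous_fst))
  · exact Sigma.ext rfl (heq_of_eq (F.map_zero_left x.2))
  · exact Sigma.ext rfl (heq_of_eq (F.map_one_left x.2))

end Convex

theorem convex_polyK (n : ℕ+) : Convex ℝ (polyK n) := by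
  intro x hx y hy a c ha hc hac
  constructor
  · intro hn
    simp only [Pi.add_apply, Pi.smul_apply, smul_eq_mul, Finset.sum_add_distrib, ← Finset.mul_sum,
      hx.1 hn, hy.1 hn]
    rw [← add_mul, hac, one_mul]
  · intro p hp hp'
    simp only [Pi.add_apply, Pi.smul_apply, smul_eq_mul, Finset.sum_add_distrib, ← Finset.mul_sum]
    have h1 := mul_le_mul_of_nonneg_left (hx.2 p hp hp') ha
    have h2 := mul_le_mul_of_nonneg_left (hy.2 p hp hp') hc
    have h3 : (3 : ℝ) ^ ((p.2 : ℕ) - p.1) = a * 3 ^ ((p.2 : ℕ) - p.1) + c * 3 ^ ((p.2 : ℕ) - p.1) := by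
      rw [← add_mul, hac, one_mul]
    linarith

/-! ### Identification with `Ass` and `Cycl` -/

section Cycl

variable {O : TopOperad KBar} {M : TopModule O WBar} {l n : ℕ+}

theorem IsCellularModule.comp_fst (hM : IsCellularModule M) (m : Fin l → ℕ+)
    (h : ∑ i, (m i : ℕ) = n) (x : WBar l) (y : ∀ i, KBar (m i)) :
    (M.comp m h (x, y)).1 = toFix (blockPerm m h x.1.1 fun i => (y i).1) := by
  obtain ⟨t, -, e⟩ := (hM.comp_cell m h ⟨x.1, ⊤⟩ fun i => ⟨(y i).1, ⊤⟩).mapsTo (x := (x, y))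
    ⟨⟨x.2, mem_faceW_iff.2 le_top, rfl⟩, fun i _ => ⟨(y i).2, mem_faceK_iff.2 le_top, rfl⟩⟩
  rw [e]
  rfl

theorem IsCellularModule.act_fst (hM : IsCellularModule M) (τ : Equiv.Perm (Fin n)) (x : WBar n) :
    (M.act τ x).1 = toFix (x.1.1 * τ) := by
  obtain ⟨t, -, e⟩ := (hM.act_cell τ ⟨x.1, ⊤⟩).mapsTo (x := x)
    ⟨x.2, mem_faceW_iff.2 le_top, rfl⟩
  rw [e]
  rfl

/-- It suffices to compare the maps on classes of points, where only the index of the component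
matters; for actions and composites it is given by cellularity. -/
theorem IsCellularModule.homologyIsCycl (hM : IsCellularModule M) (hO : IsCellularOperad O)
    (k : Type u) [Field k] : HomologyIsCycl k O M := by
  let cK : ∀ n, polyK n := fun n => PlanarOperad.nonempty_polyK.some
  let cW : ∀ n, polyW n := fun n => centerW ⊤
  choose φ hφ using fun n : ℕ+ => exists_homologyZero_equiv_sigma (S := Equiv.Perm (Fin n))
    (convex_polyK n) (cK n) k
  choose ψ hψ using fun n : ℕ+ => exists_homologyZero_equiv_sigma (S := PermFix n)
    convex_polyW (cW n) k
  refine ⟨fun n i hi => ⟨subsingleton_homology_sigma (convex_polyK n) ⟨_, (cK n).2⟩ k hi,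
    subsingleton_homology_sigma convex_polyW ⟨_, (cW n).2⟩ k hi⟩, φ, ψ, hφ, hψ, ?_, ?_, ?_, ?_, ?_⟩
  · rw [hφ, subsingleton_KBar_one.elim O.one ⟨1, cK 1⟩]
  · intro n τ a
    have h1 : (φ n).toLinearMap ∘ₗ Homology.map k 0 (O.act τ) =
        Ass.act k τ ∘ₗ (φ n).toLinearMap := by
      refine homologyZero_hom_ext k fun x => ?_
      change φ n (Homology.map k 0 (O.act τ) (ptClass k x)) = Ass.act k τ (φ n (ptClass k x))
      rw [map_ptClass, hφ, hφ, hO.act_eq_symAct]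
      exact (Finsupp.mapDomain_single (f := fun σ => σ * τ) (b := (1 : k))).symm
    exact LinearMap.congr_fun h1 a
  · intro n τ a
    have h1 : (ψ n).toLinearMap ∘ₗ Homology.map k 0 (M.act τ) =
        Cycl.act k τ ∘ₗ (ψ n).toLinearMap := by
      refine homologyZero_hom_ext k fun x => ?_
      change ψ n (Homology.map k 0 (M.act τ) (ptClass k x)) = Cycl.act k τ (ψ n (ptClass k x))
      rw [map_ptClass, hψ, hψ, hM.act_fst]
      exact (Finsupp.mapDomain_single (f := fun σ : PermFix n => toFix (σ.1 * τ))
        (b := (1 : k))).symm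
    exact LinearMap.congr_fun h1 a
  · intro l n m h
    obtain ⟨E, hE, hE'⟩ := exists_exteriorProduct k m (φ l) (hφ l)
      (fun _ _ => joined_of_fst_eq (convex_polyK l)) (x₀ := fun σ => ⟨σ, cK l⟩) (fun _ => rfl)
      (fun i => φ (m i)) (fun i => hφ (m i)) (fun i _ _ => joined_of_fst_eq (convex_polyK (m i)))
      (y₀ := fun i τ => ⟨τ, cK (m i)⟩) (fun _ _ => rfl)
    refine ⟨E, hE, fun a c => ?_⟩
    refine (hE' _ ((φ n).toLinearMap ∘ₗ Homology.map k 0 (O.comp m h)) a c).trans ?_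
    simp only [LinearMap.comp_apply, LinearEquiv.coe_coe, map_ptClass, hφ, hO.comp_fst]
    rfl
  · intro l n m h
    obtain ⟨E, hE, hE'⟩ := exists_exteriorProduct k m (ψ l) (hψ l)
      (fun _ _ => joined_of_fst_eq convex_polyW) (x₀ := fun σ => ⟨σ, cW l⟩) (fun _ => rfl)
      (fun i => φ (m i)) (fun i => hφ (m i)) (fun i _ _ => joined_of_fst_eq (convex_polyK (m i)))
      (y₀ := fun i τ => ⟨τ, cK (m i)⟩) (fun _ _ => rfl)
    refine ⟨E, hE, fun a c => ?_⟩
    refine (hE' _ ((ψ n).toLinearMap ∘ₗ Homology.map k 0 (M.comp m h)) a c).trans ?_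
    simp only [LinearMap.comp_apply, LinearEquiv.coe_coe, map_ptClass, hψ, hM.comp_fst]
    rfl

end Cycl

end CycloMod

theorem theorem2p1 :
    (∀ n : ℕ+, IsRegularCellComplex (dimK (n := n)) (cellK (n := n))) ∧
    (∀ n : ℕ+, IsRegularCellComplex (dimW (n := n)) (cellW (n := n))) ∧
    (∃ O : TopOperad KBar, IsCellularOperad O) ∧
    ∀ O : TopOperad KBar, IsCellularOperad O →
      ∃ M : TopModule O WBar, IsCellularModule M ∧ CircIsFacet M ∧
        ∀ (k : Type u) [Field k], HomologyIsCycl k O M := by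
  refine ⟨isRegularCellComplex_KBar, isRegularCellComplex_WBar,
    ⟨standardOperad.symmetrize PlanarOperad.nonempty_polyK.some,
      standardOperad.isCellularOperad _⟩, fun O hO => ?_⟩
  obtain ⟨M, hM⟩ := exists_cellular_module hO
  exact ⟨M, hM, hM.circIsFacet, fun k _ => hM.homologyIsCycl hO k⟩
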